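/- **Setup.** Let $\delta=2^{-n}$, $R_0=2^{m_0}$, $R_i:=2^iR_0$. For $R=R_i$ and $0\le j\le n=\log_2(1/\delta)$ let $r_j$ be the largest power of two with $r_j\le R^{2^j\delta}$ (so $r_n=R$). Let $\mathcal D_{\rho}$ denote the half-open dyadic squares of side $\rho$ in the plane; $\lambda Q$, $\lambda T$ denote dilations from the center. For each $j$ divide $S^1$ into $r_j$ equal half-open arcs ("$r_j^{-1}$-caps"); the caps $\theta$ of level $j=n-1$ are called $R^{-1/2}$-caps, and $e_\theta$ is the center of $\theta$. *Wave packets.* For each $i\ge1$ and each $R_i^{-1/2}$-cap $\theta$, let $\psi_{i,\theta}\ge 0$ be smooth, supported in a rectangle $\{A^{-1}R_i\le \xi\cdot e_\theta\le AR_i,\ |\xi\cdot e_\theta^\perp|\le AR_i^{1/2}\}$, with all derivatives of the function rescaled by $R_i$ along $e_\theta$ and $R_i^{1/2}$ along $e_\theta^\perp$ bounded uniformly in $i,\theta$; let $\psi_0\ge0$ be smooth, supported in $\{|\xi|\le AR_0\}$; and assume $\psi_0+\sum_{i\ge1}\sum_\theta\psi_{i,\theta}=1$. Let $\mathbb T_{i,\theta}$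 be a finite family, of overlap at most $A$, of $R_i^{-1/2+\delta}\times L$ tubes $T$ parallel to $e_\theta$, centered at points $u\,e_\theta^\perp$, $|u|\le A$, where $L>4$ is a fixed length (so each tube crosses the ball $B_2$ of radius $2$), with smooth $\eta_T\ge0$ supported in $T$, $\sum_{T\in\mathbb T_{i,\theta}}\eta_T=1$ on $B_2$, all derivatives of $\eta_T$ rescaled by $1$ along $e_\theta$ and $R_i^{-1/2+\delta}$ along $e_\theta^\perp$ being bounded uniformly in $i,\theta,T$. Let $\mathbb T_i=\bigcup_\theta\mathbb T_{i,\theta}$, $M_0\mu=(\psi_0\hat\mu)^\vee$ and $M_T\mu=\eta_T(\psi_{i,\theta}\hat\mu)^\vee$ for $T\in\mathbb T_{i,\theta}$. *Good part.* Let $\mu,\nu$ be measures and $t$ a real number. Fix $i\ge 1$, $R=R_i$. For $0\le j\le n-1$, an $r_j^{-1}$-cap $\theta_j$ is *bad* for $Q_j\in\mathcal D_{r_j/R}$ if $$\nu_{R^{2(j+2)\delta^2}Q_{j+1}}\big(R^\delta T\big)>R^{10\delta}\,(r_j/r_{j+1})^{\min\{t,1\}},$$ where $Q_{j+1}\in\mathcal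 D_{r_{j+1}/R}$ contains $Q_j$, $T$ is the $r_j/R\times r_{j+1}/R$ tube centered at the center of $Q_j$ whose direction is the center of $\theta_j$, and $\nu_Q=\nu(Q)^{-1}\nu|_Q$ (no cap is bad if $\nu(R^{2(j+2)\delta^2}Q_{j+1})=0$). For $Q\in\mathcal D_{r_0/R}$ let $\mathbb T_{i,Q}$ be the set of $T\in\mathbb T_{i,\theta}$, $\theta$ any $R^{-1/2}$-cap, with $2T\cap Q\ne\emptyset$ such that, for some $0\le j\le n-1$, $e_\theta$ lies in an $r_j^{-1}$-cap that is bad for the cube of $\mathcal D_{r_j/R}$ containing $Q$. Put $$\mu_{good,i,Q}=\sum_{T\in\mathbb T_i\setminus\mathbb T_{i,Q}}M_T\mu,\qquad \mu_{good,y}=M_0\mu+\sum_{i\ge1}\mu_{good,i,Q_i(y)},$$ where $Q_i(y)\in\mathcal D_{r_0/R_i}$ (with $r_0$ taken for $R=R_i$) is the cube containing $y$ and the sum over $i$ is taken in the sense of distributions. **Proposition 4.1.** Let $s>1$ and $t>2-s$. There is $\delta_0=\delta_0(s,t)>0$ such that the following holds for all $\delta=2^{-n}\le\delta_0$, all $R_0=2^{m_0}$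 ($m_0\in\mathbb N$) and all choices of wave packets as above. Let $\mu,\nu$ be Borel probability measures on the plane with disjoint supports contained in the closed unit ball, such that $I_s(\mu)=\iint|x-y|^{-s}d\mu(x)d\mu(y)<\infty$, $\nu$ is Frostman of dimension $t$ (i.e. $\nu(B(x,r))\le Cr^t$ for some $C$ and all $x$, $r>0$), and the upper Minkowski dimension of $\operatorname{supp}\nu$ is less than $t+\delta^2$. Then, with $d^y(x)=|x-y|$, for $\nu$-a.e. $y$ the pushforward $d^y_*(\mu_{good,y})$ (the limit, as distributions on $\mathbb R$ tested against Schwartz functions, of the pushforwards of the partial sums of $\mu_{good,y}$) is given by a function on $\mathbb R$, which can be chosen jointly measurable in $y$ and the real variable, and $$\int\big\|d^y_*(\mu_{good,y})\big\|_{L^2(\mathbb R)}^2\,d\nu(y)<\infty.$$ -/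

import Mathlib

open MeasureTheory Filter Topology
open scoped ENNReal NNReal SchwartzMap ContDiff FourierTransform

noncomputable section

namespace PinnedDistance

/-- The Euclidean plane. -/
abbrev Plane : Type := EuclideanSpace ℝ (Fin 2)

/-! ### Energies and dimensions -/

/-- The `s`-dimensional energy `I_s(μ) = ∬ |x - y|^{-s} dμ(x) dμ(y)`. It takes values in `[0, ∞]`,
and the kernel is `∞` on the diagonal when `s > 0`. -/
def energy (s : ℝ) (μ : Measure Plane) : ℝ≥0∞ :=
  ∫⁻ x, ∫⁻ y, (edist x y) ^ (-s) ∂μ ∂μ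

/-- `ν` is Frostman of dimension `t`: `ν(B(x,r)) ≲ r^t` for all `x` and all `r > 0`. -/
def IsFrostman (t : ℝ) (ν : Measure Plane) : Prop :=
  ∃ C : ℝ, ∀ (x : Plane) (r : ℝ), 0 < r → ν (Metric.ball x r) ≤ ENNReal.ofReal (C * r ^ t)

/-- The upper Minkowski dimension `limsup_{r → 0+} log N(E, r) / log (1 / r)`, where `N(E, r)` is
the smallest number of `r`-balls needed to cover `E`. -/
def upperMinkowskiDim (E : Set Plane) : EReal :=
  limsup (fun r : ℝ≥0 =>
    ENNReal.log ((Metric.externalCoveringNumber r E : ℕ∞) : ℝ≥0∞) /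
      ((Real.log (1 / (r : ℝ)) : ℝ) : EReal)) (𝓝[>] (0 : ℝ≥0))

/-! ### Cubes, tubes and caps -/

/-- Index of the dyadic cube of side `2 ^ (-p)` that contains `x`. -/
def cubeIndex (p : ℕ) (x : Plane) : Fin 2 → ℤ := fun l => ⌊(2 : ℝ) ^ p * x l⌋

/-- Center of the half-open dyadic cube `∏ₗ [k l 2 ^ (-p), (k l + 1) 2 ^ (-p))`. -/
def cubeCenter (p : ℕ) (k : Fin 2 → ℤ) : Plane :=
  WithLp.toLp 2 (fun l => ((k l : ℝ) + 1 / 2) / (2 : ℝ) ^ p)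

/-- The dilation `lam Q`, from its center, of the half-open dyadic cube `Q` of side `2 ^ (-p)` and
index `k`; the cube itself is `dilatedCube 1 p k`. -/
def dilatedCube (lam : ℝ) (p : ℕ) (k : Fin 2 → ℤ) : Set Plane :=
  {x | ∀ l, cubeCenter p k l - lam / 2 / (2 : ℝ) ^ p ≤ x l ∧
    x l < cubeCenter p k l + lam / 2 / (2 : ℝ) ^ p}

/-- Rotation by a right angle. -/
def perp (e : Plane) : Plane := !₂[-(e 1), e 0]

/-- The `w × L` tube centered at `c` whose long axis (of length `L`) has the direction of the unit
vector `e`. Its dilation by `lam` from its center is `tube c e (lam * w) (lam * L)`. -/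
def tube (c e : Plane) (w L : ℝ) : Set Plane :=
  {x | |inner ℝ (x - c) e| ≤ L / 2 ∧ |inner ℝ (x - c) (perp e)| ≤ w / 2}

/-- The point of the unit circle at angle `φ`. -/
def circlePoint (φ : ℝ) : Plane := !₂[Real.cos φ, Real.sin φ]

/-- The unit circle is divided into `2 ^ a` equal half-open arcs; this is the `m`-th one. -/
def cap (a : ℕ) (m : Fin (2 ^ a)) : Set Plane :=
  circlePoint '' Set.Ico (2 * Real.pi * (m : ℝ) / 2 ^ a) (2 * Real.pi * ((m : ℝ) + 1) / 2 ^ a)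

/-- The center of the `m`-th arc. -/
def capDir (a : ℕ) (m : Fin (2 ^ a)) : Plane :=
  circlePoint (2 * Real.pi * ((m : ℝ) + 1 / 2) / 2 ^ a)

/-! ### Scales

Throughout `δ = 2 ^ (-n)` and `R = 2 ^ ℓ`. -/

/-- `δ = 2 ^ (-n)`. -/
def dlt (n : ℕ) : ℝ := (2 : ℝ)⁻¹ ^ n

/-- `R ^ x` for `R = 2 ^ ℓ`. -/
def Rpow (ℓ : ℕ) (x : ℝ) : ℝ := ((2 : ℝ) ^ ℓ) ^ x

/-- The exponent of the dyadic number `r_j`, the largest power of two (with integer exponent) not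
exceeding `R ^ (2 ^ j δ)`, for `j = 0, …, n = log₂ (1 / δ)`. -/
def scaleExp (n ℓ j : ℕ) : ℕ := ℓ * 2 ^ j / 2 ^ n

/-- The dyadic number `r_j ≈ R ^ (2 ^ j δ)`; in particular `r_n = R`. -/
def scale (n ℓ j : ℕ) : ℝ := (2 : ℝ) ^ scaleExp n ℓ j

/-- The cubes of `𝒟_{r_j / R}` are the dyadic cubes of side `r_j / R = 2 ^ (-cubeExp n ℓ j)`. -/
def cubeExp (n ℓ j : ℕ) : ℕ := ℓ - scaleExp n ℓ j

/-- `R ^ (-1/2)`-caps: the arcs of the level `j = n - 1 = log₂ (1 / δ) - 1`. -/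
abbrev FineCap (n ℓ : ℕ) : Type := Fin (2 ^ scaleExp n ℓ (n - 1))

/-- The direction (center) of a fine cap. -/
def fineDir {n ℓ : ℕ} (θ : FineCap n ℓ) : Plane := capDir (scaleExp n ℓ (n - 1)) θ

/-! ### Bad caps -/

/-- The `r_j⁻¹`-cap `m` is bad for the cube `Q_j ∈ 𝒟_{r_j / R}` of index `k`: with `T` the
`r_j / R × r_{j+1} / R` tube centered at the center of `Q_j` in the direction of the cap, and
`Q_{j+1} ∈ 𝒟_{r_{j+1} / R}` the cube that contains `Q_j`,
`ν_{R^{2(j+2)δ²} Q_{j+1}} (R^δ T) > R^{10δ} (r_j / r_{j+1}) ^ min(t, 1)`.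
Here `ν_Q = ν(Q)⁻¹ ν|_Q`, which is the zero measure when `ν(Q) = 0`. -/
def IsBadCap (ν : Measure Plane) (t : ℝ) (n ℓ j : ℕ) (k : Fin 2 → ℤ)
    (m : Fin (2 ^ scaleExp n ℓ j)) : Prop :=
  ENNReal.ofReal (Rpow ℓ (10 * dlt n) * (scale n ℓ j / scale n ℓ (j + 1)) ^ (min t 1)) <
    ProbabilityTheory.cond ν
      (dilatedCube (Rpow ℓ (2 * ((j : ℝ) + 2) * dlt n ^ 2)) (cubeExp n ℓ (j + 1))
        (cubeIndex (cubeExp n ℓ (j + 1)) (cubeCenter (cubeExp n ℓ j) k)))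
      (tube (cubeCenter (cubeExp n ℓ j) k) (capDir (scaleExp n ℓ j) m)
        (Rpow ℓ (dlt n) * (scale n ℓ j / 2 ^ ℓ))
        (Rpow ℓ (dlt n) * (scale n ℓ (j + 1) / 2 ^ ℓ)))

/-- For a cube `Q ∈ 𝒟_{r_0 / R}` of index `k`, the direction of the fine cap `θ` lies in an
`r_j⁻¹`-cap that is bad for the cube of `𝒟_{r_j / R}` containing `Q`. -/
def InBadCap (ν : Measure Plane) (t : ℝ) (n ℓ j : ℕ) (k : Fin 2 → ℤ) (θ : FineCap n ℓ) : Prop :=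
  ∃ m : Fin (2 ^ scaleExp n ℓ j),
    IsBadCap ν t n ℓ j (cubeIndex (cubeExp n ℓ j) (cubeCenter (cubeExp n ℓ 0) k)) m ∧
      fineDir θ ∈ cap (scaleExp n ℓ j) m

/-! ### Wave packets -/

/-- `f` is a smooth function adapted to rectangles of dimensions `a` along `e` and `b` along
`perp e`: after rescaling such a rectangle to a unit square, all derivatives of order `k` are
bounded by `K k`. -/
def IsAdapted (K : ℕ → ℝ) (e : Plane) (a b : ℝ) (f : Plane → ℝ) : Prop :=
  ContDiff ℝ ∞ f ∧
    ∀ (k : ℕ) (p : Plane),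
      ‖iteratedFDeriv ℝ k (fun q : Plane => f ((a * q 0) • e + (b * q 1) • perp e)) p‖ ≤ K k

/-- A choice of the frequency partition `1 = ψ₀ + ∑_{i ≥ 1} ∑_θ ψ_{i,θ}` and, for every `(i, θ)`, of
a cover by tubes `T ∈ 𝕋_{i,θ}` with a subordinate partition of unity `η_T`, where `R₀ = 2 ^ m₀`,
`R_i = 2 ^ i R₀ = 2 ^ (m₀ + i)`, `δ = 2 ^ (-n)` and `θ` runs through the `R_i ^ (-1/2)`-caps. Only
the indices `i ≥ 1` matter. The tubes of `𝕋_{i,θ}` are `R_i ^ (-1/2 + δ) × len` rectangles parallel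
to `θ` and centered on the line through the origin orthogonal to `θ`; they are indexed by the
coordinate `u` of their center on this line. Every tube has length `len > 4`, so that it crosses
the ball of radius `2`. -/
structure WavePackets (m₀ n : ℕ) where
  /-- Constant in the comparisons of sizes and bound for the overlap. -/
  A : ℝ
  one_le_A : 1 ≤ A
  /-- Constants in the derivative bounds. -/
  K : ℕ → ℝ
  /-- The common length of all tubes. -/
  len : ℝ
  four_lt_len : 4 < len
  ψ₀ : Plane → ℝ
  ψ : (i : ℕ) → FineCap n (m₀ + i) → Plane → ℝ
  tubes : (i : ℕ) → FineCap n (m₀ + i) → Finset ℝ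
  η : (i : ℕ) → FineCap n (m₀ + i) → ℝ → Plane → ℝ
  ψ₀_smooth : ContDiff ℝ ∞ ψ₀
  ψ₀_nonneg : ∀ ξ, 0 ≤ ψ₀ ξ
  ψ₀_support : Function.support ψ₀ ⊆ Metric.closedBall 0 (A * 2 ^ m₀)
  ψ_adapted : ∀ i, 1 ≤ i → ∀ θ,
    IsAdapted K (fineDir θ) (2 ^ (m₀ + i)) (Rpow (m₀ + i) (1 / 2)) (ψ i θ)
  ψ_nonneg : ∀ i, 1 ≤ i → ∀ θ ξ, 0 ≤ ψ i θ ξ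
  ψ_support : ∀ i, 1 ≤ i → ∀ θ, Function.support (ψ i θ) ⊆
    {ξ | A⁻¹ * 2 ^ (m₀ + i) ≤ inner ℝ ξ (fineDir θ) ∧ inner ℝ ξ (fineDir θ) ≤ A * 2 ^ (m₀ + i) ∧
      |inner ℝ ξ (perp (fineDir θ))| ≤ A * Rpow (m₀ + i) (1 / 2)}
  ψ_sum : ∀ ξ, HasSum (fun i : ℕ => ∑ θ, ψ (i + 1) θ ξ) (1 - ψ₀ ξ)
  tubes_bounded : ∀ i, 1 ≤ i → ∀ θ, ∀ u ∈ tubes i θ, |u| ≤ A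
  tubes_overlap : ∀ i, 1 ≤ i → ∀ θ (x : Plane),
    (Set.ncard {u : ℝ | u ∈ tubes i θ ∧ x ∈ tube (u • perp (fineDir θ)) (fineDir θ)
      (Rpow (m₀ + i) (-(1 / 2) + dlt n)) len} : ℝ) ≤ A
  η_adapted : ∀ i, 1 ≤ i → ∀ θ, ∀ u ∈ tubes i θ,
    IsAdapted K (fineDir θ) 1 (Rpow (m₀ + i) (-(1 / 2) + dlt n)) (η i θ u)
  η_nonneg : ∀ i, 1 ≤ i → ∀ θ, ∀ u ∈ tubes i θ, ∀ x, 0 ≤ η i θ u x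
  η_support : ∀ i, 1 ≤ i → ∀ θ, ∀ u ∈ tubes i θ, Function.support (η i θ u) ⊆
    tube (u • perp (fineDir θ)) (fineDir θ) (Rpow (m₀ + i) (-(1 / 2) + dlt n)) len
  η_sum : ∀ i, 1 ≤ i → ∀ θ, ∀ x ∈ Metric.closedBall (0 : Plane) 2, ∑ u ∈ tubes i θ, η i θ u x = 1

/-- The Fourier transform `μ̂(ξ) = ∫ e^{-2πi x·ξ} dμ(x)` of a measure. -/
def fourierMeasure (μ : Measure Plane) (ξ : Plane) : ℂ :=
  ∫ x, (Real.fourierChar (-(inner ℝ x ξ)) : ℂ) ∂μ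

namespace WavePackets

variable {m₀ n : ℕ} (W : WavePackets m₀ n)

/-- `M₀ μ = (ψ₀ μ̂)^∨`. -/
def M₀ (μ : Measure Plane) : Plane → ℂ :=
  𝓕⁻ (fun ξ : Plane => (W.ψ₀ ξ : ℂ) * fourierMeasure μ ξ)

/-- `M_T μ = η_T (ψ_{i,θ} μ̂)^∨` for the tube `T ∈ 𝕋_{i,θ}` of index `u`. -/
def M (μ : Measure Plane) (i : ℕ) (θ : FineCap n (m₀ + i)) (u : ℝ) (x : Plane) : ℂ :=
  (W.η i θ u x : ℂ) * 𝓕⁻ (fun ξ : Plane => (W.ψ i θ ξ : ℂ) * fourierMeasure μ ξ) x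

/-- The tube `T ∈ 𝕋_{i,θ}` of index `u` belongs to `𝕋_{i,Q}`, where `Q ∈ 𝒟_{r_0 / R_i}` has index
`k`: for some `0 ≤ j ≤ log₂ (1 / δ) - 1`, `2T` meets `Q` and `θ` lies in an `r_j⁻¹`-cap bad for
`Q`. -/
def IsRemoved (ν : Measure Plane) (t : ℝ) (i : ℕ) (k : Fin 2 → ℤ)
    (θ : FineCap n (m₀ + i)) (u : ℝ) : Prop :=
  ∃ j, j < n ∧
    (tube (u • perp (fineDir θ)) (fineDir θ)
      (2 * Rpow (m₀ + i) (-(1 / 2) + dlt n)) (2 * W.len) ∩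
        dilatedCube 1 (cubeExp n (m₀ + i) 0) k).Nonempty ∧
    InBadCap ν t n (m₀ + i) j k θ

open Classical in
/-- `μ_{good,i,Q} = ∑_{T ∈ 𝕋_i ∖ 𝕋_{i,Q}} M_T μ`, where `Q ∈ 𝒟_{r_0 / R_i}` has index `k`. -/
def goodAt (μ ν : Measure Plane) (t : ℝ) (i : ℕ) (k : Fin 2 → ℤ) (x : Plane) : ℂ :=
  ∑ θ : FineCap n (m₀ + i),
    ∑ u ∈ (W.tubes i θ).filter (fun u => ¬ W.IsRemoved ν t i k θ u), W.M μ i θ u x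

/-- The partial sums `M₀ μ + ∑_{1 ≤ i ≤ N} μ_{good,i,Q(y)}` of the series that defines
`μ_{good,y}`; in the `i`-th summand `Q(y) ∈ 𝒟_{r_0 / R_i}` is the cube containing `y`. -/
def goodPartialSum (μ ν : Measure Plane) (t : ℝ) (N : ℕ) (y x : Plane) : ℂ :=
  W.M₀ μ x +
    ∑ i ∈ Finset.Icc 1 N, W.goodAt μ ν t i (cubeIndex (cubeExp n (m₀ + i) 0) y) x

end WavePackets

/-- For a sequence of functions `f N` on the plane, whose limit as `N → ∞` is taken in the sense of
distributions, and `d^y(x) = |x - y|`: the pushforward `d^y_*(lim f N)` is (the distribution given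
by) the function `g` on the line. -/
def IsPushforwardDensity (f : ℕ → Plane → ℂ) (y : Plane) (g : ℝ → ℂ) : Prop :=
  ∀ φ : 𝓢(ℝ, ℂ), Tendsto (fun N => ∫ x, φ (dist x y) * f N x) atTop (𝓝 (∫ r, φ r * g r))

end PinnedDistance

end

open PinnedDistance

/-!
For `r > 0` the pushforward of a function `F` under `x ↦ |x - y|` has the density
`r ∫ F (y + r ω) dω` (`radialDensity`, `integral_comp_dist_mul`), so the proof is a mean square
estimate for the circular averages around `y` of the good part of `μ` at each scale `R = R_i`. The
bound obtained is `R ^ (2 - s - min (t, 1) + 20 (n + 1) δ)`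
(`exists_lintegral_goodDensity_sq_le`). Since `s > 1` and `t > 2 - s`, the exponent is negative as
soon as `δ = 2 ^ (-n)` is small, and the scales are then summed as a geometric series
(`lintegral_sq_tsum_lt_top`, `exists_pushforward_density`).

At a single scale, the good part may be replaced by the sum of the full pieces `(ψ_{i,θ} μ̂)^∨` over
the caps `θ` that are good, at all levels, for the cube of `y`
(`eventually_norm_integral_circle_goodAt_sub_le`). Indeed all tubes of a good cap are kept, and they
resolve the unit on `B_2`, outside of which the pieces are negligible. The tubes kept for a bad cap
do not contain `y` in their double; on the part of a circle around `y` in such a tube the wave packet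
oscillates with a nonvanishing phase derivative, and its circular average is negligible
(`eventually_norm_integral_tube_le`).

Let `b` be the Fourier transform of the resulting sum. The average over the rotations around `y` is,
by Plancherel's identity, turned into an integral over the frequencies `ξ` of
`|∫ b (ζ) e (y · ζ) dσ_ξ (ζ)|²`, where `σ_ξ` is the arc length of the circle through `ξ`
(`lintegral_circle_average`). For a fixed circle of radius about `R` this is the square of an
extension operator, restricted to the caps that are good for the cube of the point. Its integral
with respect to `ν` is smaller than the integral of `|b|²` over the circle by the factor
`R ^ (-min (t, 1))`, up to small powers of `R` (`eventually_lintegral_good_le`). This is the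
multiscale part of the argument. Two sums over pairs of a cube, weighted by its `ν` measure, and
a cap alternate in it: `tubeSum`, of integrals over tubes of width `ρ_j = r_j / R` and length
`ρ_{j+1}`, and `ballSum`, of integrals over balls of radius about `ρ_{j+1}`.

* From tubes to balls (`tubeSum_le_ballSum`), the weight of all cubes of level `j` whose tubes pass
  through one point of a ball is at most the `ν` measure of a tube. As the cap is not bad, this is
  at most `(r_j / r_{j+1}) ^ min (t, 1)` times the measure of the cube of level `j + 1`. These factors
  multiply to the gain.
* From balls to tubes (`exists_ballSum_le_tubeSum`), the pieces of the caps of level `j + 1` in one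
  cap of level `j` are almost orthogonal on a ball of radius `ρ_{j+1}`
  (`exists_local_orthogonality`), and each of them is essentially constant on tubes of width
  `ρ_{j+1}` and length `ρ_{j+2}`, because an arc of length `1 / ρ_{j+1}` lies in the dual rectangle
  (`exists_locally_constant`). Averaging over these tubes costs `ρ_{j+1} / ρ_{j+2}`, and these costs
  telescope.

Finally, integrating over the circles leaves the mass of `|μ̂|²` in a ball of radius about `R`, which
is at most `R ^ (2 - s) I_s(μ)` up to a constant (`exists_lintegral_fourierMeasure_le`).
-/

noncomputable section

namespace PinnedDistance

/-! ### Plancherel's identity -/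

/-- The inverse Fourier integral of an integrable and square integrable function is (a.e.) its
inverse Fourier transform in the `L²` sense: both define the same tempered distribution. -/
theorem fourierInv_toLp_ae_eq {f : Plane → ℂ} (hf : Integrable f) (hf2 : MemLp f 2) :
    (𝓕⁻ (hf2.toLp f) : Lp ℂ 2 (volume : Measure Plane)) =ᵐ[volume] 𝓕⁻ f := by
  have hcont : Continuous (𝓕⁻ f) := by
    have : (𝓕⁻ f : Plane → ℂ) = fun x => 𝓕 f (-x) := by
      ext x; rw [Real.fourierInv_eq_fourier_neg]
    rw [this]
    exact (VectorFourier.fourierIntegral_continuous Real.continuous_fourierChar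
      (innerSL ℝ).continuous₂ hf).comp continuous_neg
  apply ae_eq_of_integral_contDiff_smul_eq
  · exact (Lp.memLp _).locallyIntegrable (by norm_num)
  · exact hcont.locallyIntegrable
  · intro g g_smooth g_cpt
    have hg₁ : HasCompactSupport (Complex.ofRealCLM ∘ g) := g_cpt.comp_left rfl
    have hg₂ : ContDiff ℝ ∞ (Complex.ofRealCLM ∘ g) := by fun_prop
    set φ : 𝓢(Plane, ℂ) := hg₁.toSchwartzMap hg₂ with hφ
    have h1 := congrArg (fun T => T φ) (Lp.fourierInv_toTemperedDistribution_eq (hf2.toLp f))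
    simp only [TemperedDistribution.fourierInv_apply, Lp.toTemperedDistribution_apply] at h1
    have h2 : ∀ x, g x • (𝓕⁻ (hf2.toLp f) : Lp ℂ 2 (volume : Measure Plane)) x
        = φ x • (𝓕⁻ (hf2.toLp f) : Lp ℂ 2 (volume : Measure Plane)) x := by
      intro x; simp [hφ]
    have h3 : ∀ x, g x • (𝓕⁻ f) x = φ x • (𝓕⁻ f) x := by
      intro x; simp [hφ]
    simp_rw [h2, h3]
    rw [← h1]
    have h4 : ∫ x, (𝓕⁻ φ : 𝓢(Plane, ℂ)) x • (hf2.toLp f) x = ∫ x, (𝓕⁻ φ : 𝓢(Plane, ℂ)) x • f x := by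
      apply integral_congr_ae
      filter_upwards [hf2.coeFn_toLp] with x hx
      rw [hx]
    rw [h4]
    have h5 := VectorFourier.integral_fourierIntegral_smul_eq_flip (μ := volume) (ν := volume)
      (L := -(innerₗ Plane)) (e := Real.fourierChar) (f := φ) (g := f)
      Real.continuous_fourierChar (by
        have : Continuous fun p : Plane × Plane => -(inner ℝ p.1 p.2) := by fun_prop
        exact this) φ.integrable hf
    have h6 : ∀ (h : Plane → ℂ) x,
        VectorFourier.fourierIntegral Real.fourierChar volume (-(innerₗ Plane)) h x = 𝓕⁻ h x := by
      intro h x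
      rw [VectorFourier.fourierIntegral, Real.fourierInv_eq]
      simp
    have h7 : ∀ (h : Plane → ℂ) x,
        VectorFourier.fourierIntegral Real.fourierChar volume (-(innerₗ Plane)).flip h x
          = 𝓕⁻ h x := by
      intro h x
      rw [VectorFourier.fourierIntegral, Real.fourierInv_eq]
      simp [real_inner_comm]
    simp_rw [h6, h7] at h5
    rw [← h5]
    simp [SchwartzMap.fourierInv_coe]

theorem lintegral_enorm_sq_fourierInv {f : Plane → ℂ} (hf : Integrable f) (hf2 : MemLp f 2) :
    ∫⁻ x, ‖𝓕⁻ f x‖ₑ ^ 2 = ∫⁻ x, ‖f x‖ₑ ^ 2 := by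
  have key : eLpNorm (𝓕⁻ f) 2 volume = eLpNorm f 2 volume := by
    rw [← eLpNorm_congr_ae (fourierInv_toLp_ae_eq hf hf2), ← eLpNorm_congr_ae hf2.coeFn_toLp]
    have h := (Lp.fourierTransformₗᵢ Plane ℂ).symm.norm_map (hf2.toLp f)
    have h' : ‖(𝓕⁻ (hf2.toLp f) : Lp ℂ 2 (volume : Measure Plane))‖ = ‖hf2.toLp f‖ := h
    rw [Lp.norm_def, Lp.norm_def] at h'
    exact (ENNReal.toReal_eq_toReal_iff' (Lp.eLpNorm_ne_top _) (Lp.eLpNorm_ne_top _)).1 h'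
  have e : ∀ g : Plane → ℂ, ∫⁻ x, ‖g x‖ₑ ^ 2 = eLpNorm g 2 volume ^ 2 := by
    intro g
    have := eLpNorm_nnreal_pow_eq_lintegral (f := g) (μ := volume) (p := 2) (by norm_num)
    simpa using this.symm
  rw [e, e, key]

/-! ### Orthonormal frames of the plane -/

theorem inner_eq (x y : Plane) : inner ℝ x y = x 0 * y 0 + x 1 * y 1 := by
  simp [PiLp.inner_apply, Fin.sum_univ_two, mul_comm]

theorem norm_sq_eq (x : Plane) : ‖x‖ ^ 2 = x 0 ^ 2 + x 1 ^ 2 := by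
  simp [EuclideanSpace.norm_sq_eq, Fin.sum_univ_two]

@[simp] theorem perp_zero (e : Plane) : perp e 0 = -(e 1) := by simp [perp]
@[simp] theorem perp_one (e : Plane) : perp e 1 = e 0 := by simp [perp]
@[simp] theorem circlePoint_zero (a : ℝ) : circlePoint a 0 = Real.cos a := by simp [circlePoint]
@[simp] theorem circlePoint_one (a : ℝ) : circlePoint a 1 = Real.sin a := by simp [circlePoint]

@[simp] theorem norm_circlePoint (a : ℝ) : ‖circlePoint a‖ = 1 := by
  have := norm_sq_eq (circlePoint a)
  simp only [circlePoint_zero, circlePoint_one, Real.cos_sq_add_sin_sq] at this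
  nlinarith [norm_nonneg (circlePoint a)]

@[simp] theorem norm_perp (e : Plane) : ‖perp e‖ = ‖e‖ := by
  have h1 := norm_sq_eq (perp e)
  have h2 := norm_sq_eq e
  simp only [perp_zero, perp_one] at h1
  rw [← sq_eq_sq₀ (norm_nonneg _) (norm_nonneg _), h1, h2]; ring

theorem norm_sq_eq_inner {e : Plane} (he : ‖e‖ = 1) (x : Plane) :
    ‖x‖ ^ 2 = inner ℝ x e ^ 2 + inner ℝ x (perp e) ^ 2 := by
  have h := norm_sq_eq e
  rw [he] at h
  rw [inner_eq, inner_eq, norm_sq_eq, perp_zero, perp_one]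
  linear_combination (x 0 ^ 2 + x 1 ^ 2) * h

theorem continuous_perp : Continuous perp := by
  unfold perp; fun_prop

theorem continuous_circlePoint : Continuous circlePoint := by
  unfold circlePoint; fun_prop

/-- The linear map `q ↦ (a q₀) e + (b q₁) e^⊥`. -/
def frameMap (e : Plane) (a b : ℝ) : Plane →ₗ[ℝ] Plane where
  toFun q := (a * q 0) • e + (b * q 1) • perp e
  map_add' p q := by simp only [PiLp.add_apply]; module
  map_smul' c q := by simp only [PiLp.smul_apply, smul_eq_mul, RingHom.id_apply]; module

theorem frameMap_apply (e : Plane) (a b : ℝ) (q : Plane) :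
    frameMap e a b q = (a * q 0) • e + (b * q 1) • perp e := rfl

theorem inner_frameMap (e : Plane) (a b : ℝ) (q x : Plane) :
    inner ℝ (frameMap e a b q) x = a * q 0 * inner ℝ e x + b * q 1 * inner ℝ (perp e) x := by
  rw [frameMap_apply, inner_add_left, inner_smul_left, inner_smul_left]; simp

theorem inner_perp_self (e : Plane) : inner ℝ e (perp e) = 0 := by
  rw [inner_eq]; simp; ring

theorem inner_frameMap_self {e : Plane} (he : ‖e‖ = 1) (a b : ℝ) (q : Plane) :
    inner ℝ (frameMap e a b q) e = a * q 0 := by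
  rw [inner_frameMap, real_inner_self_eq_norm_sq, he, real_inner_comm, inner_perp_self]; ring

theorem inner_frameMap_perp {e : Plane} (he : ‖e‖ = 1) (a b : ℝ) (q : Plane) :
    inner ℝ (frameMap e a b q) (perp e) = b * q 1 := by
  rw [inner_frameMap, real_inner_self_eq_norm_sq, norm_perp, he, inner_perp_self]; ring

theorem det_frameMap {e : Plane} (he : ‖e‖ = 1) (a b : ℝ) :
    LinearMap.det (frameMap e a b) = a * b := by
  have h := norm_sq_eq e
  rw [he] at h
  rw [← LinearMap.det_toMatrix (EuclideanSpace.basisFun (Fin 2) ℝ).toBasis, Matrix.det_fin_two]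
  simp only [LinearMap.toMatrix_apply, frameMap_apply]
  simp
  linear_combination (-a * b) * h

theorem continuous_frameMap (e : Plane) (a b : ℝ) : Continuous (frameMap e a b) :=
  (frameMap e a b).continuous_of_finiteDimensional

theorem map_frameMap_volume {e : Plane} (he : ‖e‖ = 1) {a b : ℝ} (ha : 0 < a) (hb : 0 < b) :
    Measure.map (frameMap e a b) volume = ENNReal.ofReal ((a * b)⁻¹) • volume := by
  have := Measure.map_linearMap_addHaar_eq_smul_addHaar (volume : Measure Plane)
    (f := frameMap e a b) (by rw [det_frameMap he]; positivity)
  rw [this, det_frameMap he, abs_of_pos (by positivity)]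

theorem frameMap_injective {e : Plane} (he : ‖e‖ = 1) {a b : ℝ} (ha : 0 < a) (hb : 0 < b) :
    Function.Injective (frameMap e a b) := by
  intro p q h
  have h0 := congrArg (fun x => inner ℝ x e) h
  have h1 := congrArg (fun x => inner ℝ x (perp e)) h
  simp only [inner_frameMap_self he] at h0
  simp only [inner_frameMap_perp he] at h1
  ext l
  fin_cases l
  · exact mul_left_cancel₀ ha.ne' h0
  · exact mul_left_cancel₀ hb.ne' h1

theorem measurableEmbedding_frameMap {e : Plane} (he : ‖e‖ = 1) {a b : ℝ} (ha : 0 < a)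
    (hb : 0 < b) : MeasurableEmbedding (frameMap e a b) :=
  (continuous_frameMap e a b).measurableEmbedding (frameMap_injective he ha hb)

theorem lintegral_frameMap {e : Plane} (he : ‖e‖ = 1) {a b : ℝ} (ha : 0 < a) (hb : 0 < b)
    (f : Plane → ℝ≥0∞) :
    ∫⁻ q, f (frameMap e a b q) = ENNReal.ofReal ((a * b)⁻¹) * ∫⁻ x, f x := by
  rw [← (measurableEmbedding_frameMap he ha hb).lintegral_map, map_frameMap_volume he ha hb,
    lintegral_smul_measure, smul_eq_mul]

theorem integral_frameMap {e : Plane} (he : ‖e‖ = 1) {a b : ℝ} (ha : 0 < a) (hb : 0 < b)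
    (f : Plane → ℂ) :
    ∫ q, f (frameMap e a b q) = ((a * b)⁻¹ : ℝ) • ∫ x, f x := by
  rw [← (measurableEmbedding_frameMap he ha hb).integral_map, map_frameMap_volume he ha hb,
    integral_smul_measure, ENNReal.toReal_ofReal (by positivity)]

/-- The frame map in the orthonormal frame `(e, e^⊥)` inverts the frame coordinates. -/
theorem frameMap_inner {e : Plane} (he : ‖e‖ = 1) (x : Plane) :
    inner ℝ x e • e + inner ℝ x (perp e) • perp e = x := by
  have h := norm_sq_eq e
  rw [he] at h
  ext l
  fin_cases l
  · simp [inner_eq]; linear_combination (-(x 0)) * h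
  · simp [inner_eq]; linear_combination (-(x 1)) * h

theorem inner_eq_frame {e : Plane} (he : ‖e‖ = 1) (x y : Plane) :
    inner ℝ x y = inner ℝ x e * inner ℝ y e + inner ℝ x (perp e) * inner ℝ y (perp e) := by
  nth_rewrite 1 [← frameMap_inner he x]
  rw [inner_add_left, inner_smul_left, inner_smul_left, real_inner_comm y e,
    real_inner_comm y (perp e)]
  simp

/-! ### Rotations and polar coordinates -/

/-- Rotation by the angle `α`. -/
def rot (α : ℝ) (x : Plane) : Plane := frameMap (circlePoint α) 1 1 x

theorem rot_zero' (α : ℝ) (x : Plane) : rot α x 0 = Real.cos α * x 0 - Real.sin α * x 1 := by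
  simp [rot, frameMap_apply]; ring

theorem rot_one' (α : ℝ) (x : Plane) : rot α x 1 = Real.sin α * x 0 + Real.cos α * x 1 := by
  simp [rot, frameMap_apply]; ring

theorem measurePreserving_rot (α : ℝ) : MeasurePreserving (rot α) volume volume := by
  refine ⟨(continuous_frameMap _ _ _).measurable, ?_⟩
  have := map_frameMap_volume (norm_circlePoint α) (a := 1) (b := 1) one_pos one_pos
  simp only [mul_one, inv_one, ENNReal.ofReal_one, one_smul] at this
  exact this

theorem measurableEmbedding_rot (α : ℝ) : MeasurableEmbedding (rot α) :=
  measurableEmbedding_frameMap (norm_circlePoint α) one_pos one_pos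

theorem continuous_rot : Continuous (Function.uncurry rot) := by
  have : (Function.uncurry rot) = fun p : ℝ × Plane =>
      (1 * p.2 0) • circlePoint p.1 + (1 * p.2 1) • perp (circlePoint p.1) := by
    ext p; rfl
  rw [this]
  have := continuous_circlePoint
  have := continuous_perp
  fun_prop

@[simp] theorem norm_rot (α : ℝ) (x : Plane) : ‖rot α x‖ = ‖x‖ := by
  rw [← sq_eq_sq₀ (norm_nonneg _) (norm_nonneg _), norm_sq_eq, norm_sq_eq, rot_zero', rot_one']
  linear_combination (x 0 ^ 2 + x 1 ^ 2) * Real.cos_sq_add_sin_sq α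

theorem rot_smul_circlePoint (α β r : ℝ) :
    rot α (r • circlePoint β) = r • circlePoint (α + β) := by
  ext l
  fin_cases l
  · change rot α (r • circlePoint β) 0 = (r • circlePoint (α + β)) 0
    simp [rot_zero', Real.cos_add]; ring
  · change rot α (r • circlePoint β) 1 = (r • circlePoint (α + β)) 1
    simp [rot_one', Real.sin_add]; ring

theorem measurePreserving_toPlane :
    MeasurePreserving (fun p : ℝ × ℝ => (!₂[p.1, p.2] : Plane)) volume volume := by
  have h1 := (volume_preserving_finTwoArrow ℝ).symm
  have h2 := PiLp.volume_preserving_toLp (Fin 2)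
  have := h2.comp h1
  convert! this using 1

theorem measurableEmbedding_toPlane :
    MeasurableEmbedding (fun p : ℝ × ℝ => (!₂[p.1, p.2] : Plane)) := by
  have h1 := (MeasurableEquiv.finTwoArrow (α := ℝ)).symm.measurableEmbedding
  have h2 := (MeasurableEquiv.toLp 2 (Fin 2 → ℝ)).measurableEmbedding
  have := h2.comp h1
  convert! this using 1

theorem toPlane_polarCoord_symm (p : ℝ × ℝ) :
    (!₂[(polarCoord.symm p).1, (polarCoord.symm p).2] : Plane) = p.1 • circlePoint p.2 := by
  ext l; fin_cases l <;> simp [circlePoint]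

theorem lintegral_polar (f : Plane → ℝ≥0∞) :
    ∫⁻ x, f x = ∫⁻ p in Set.Ioi (0 : ℝ) ×ˢ Set.Ioo (-Real.pi) Real.pi,
      ENNReal.ofReal p.1 * f (p.1 • circlePoint p.2) := by
  rw [← measurePreserving_toPlane.lintegral_comp_emb measurableEmbedding_toPlane,
    ← lintegral_comp_polarCoord_symm]
  simp only [toPlane_polarCoord_symm, smul_eq_mul]
  rfl

theorem integral_polar (f : Plane → ℂ) :
    ∫ x, f x = ∫ p in Set.Ioi (0 : ℝ) ×ˢ Set.Ioo (-Real.pi) Real.pi,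
      p.1 • f (p.1 • circlePoint p.2) := by
  rw [← measurePreserving_toPlane.integral_comp measurableEmbedding_toPlane,
    ← integral_comp_polarCoord_symm]
  simp only [toPlane_polarCoord_symm]
  rfl

/-! ### The extension operator -/

/-- The extension operator `E f(y) = ∫ f(ζ) e^{2πi y·ζ} dσ(ζ)` of a measure `σ` in frequency
space. -/
def extOp (σ : Measure Plane) (f : Plane → ℂ) (y : Plane) : ℂ :=
  ∫ ζ, f ζ * (Real.fourierChar (inner ℝ y ζ) : ℂ) ∂σ

theorem continuous_fourierChar_coe : Continuous (fun x : ℝ => (Real.fourierChar x : ℂ)) :=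
  continuous_induced_dom.comp Real.continuous_fourierChar

@[simp] theorem norm_fourierChar_coe (x : ℝ) : ‖(Real.fourierChar x : ℂ)‖ = 1 :=
  Circle.norm_coe _

@[simp] theorem enorm_fourierChar_coe (x : ℝ) : ‖(Real.fourierChar x : ℂ)‖ₑ = 1 := by
  rw [← ofReal_norm, norm_fourierChar_coe, ENNReal.ofReal_one]

theorem fourierChar_add_coe (x y : ℝ) :
    (Real.fourierChar (x + y) : ℂ) = Real.fourierChar x * Real.fourierChar y := by
  rw [AddChar.map_add_eq_mul]; rfl

theorem integrable_mul_fourierChar {α : Type*} [MeasurableSpace α] {μ : Measure α} {f : α → ℂ}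
    (hf : Integrable f μ) {g : α → ℝ} (hg : AEStronglyMeasurable g μ) :
    Integrable (fun x => f x * (Real.fourierChar (g x) : ℂ)) μ := by
  refine hf.mul_bdd (c := 1) ?_ ?_
  · exact continuous_fourierChar_coe.comp_aestronglyMeasurable hg
  · exact Eventually.of_forall fun x => (norm_fourierChar_coe _).le

theorem norm_extOp_le (σ : Measure Plane) (f : Plane → ℂ) (y : Plane) :
    ‖extOp σ f y‖ ≤ ∫ ζ, ‖f ζ‖ ∂σ := by
  refine (norm_integral_le_integral_norm _).trans (le_of_eq ?_)
  simp

theorem continuous_extOp {σ : Measure Plane} {f : Plane → ℂ} (hf : Integrable f σ) :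
    Continuous (extOp σ f) := by
  refine continuous_of_dominated (bound := fun ζ => ‖f ζ‖) ?_ ?_ hf.norm ?_
  · intro y
    exact (integrable_mul_fourierChar hf (by fun_prop)).aestronglyMeasurable
  · intro y; exact Eventually.of_forall fun ζ => by simp
  · refine Eventually.of_forall fun ζ => ?_
    exact continuous_const.mul (continuous_fourierChar_coe.comp (by fun_prop))

theorem extOp_finset_sum {ι : Type*} {σ : Measure Plane} (s : Finset ι) {f : ι → Plane → ℂ}
    (hf : ∀ i ∈ s, Integrable (f i) σ) (y : Plane) :
    extOp σ (fun ζ => ∑ i ∈ s, f i ζ) y = ∑ i ∈ s, extOp σ (f i) y := by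
  simp only [extOp, Finset.sum_mul]
  exact integral_finsetSum _ fun i hi => integrable_mul_fourierChar (hf i hi) (by fun_prop)

theorem sq_lintegral_mul_le {α : Type*} [MeasurableSpace α] {μ : Measure α} {w g : α → ℝ≥0∞}
    (hw : AEMeasurable w μ) (hg : AEMeasurable g μ) :
    (∫⁻ x, w x * g x ∂μ) ^ 2 ≤ (∫⁻ x, w x ∂μ) * ∫⁻ x, w x * g x ^ 2 ∂μ := by
  have h := ENNReal.lintegral_mul_le_Lp_mul_Lq μ Real.HolderConjugate.two_two
    (hw.pow_const (1 / 2 : ℝ)) ((hw.pow_const (1 / 2 : ℝ)).mul hg)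
  have e1 : ∀ x, ((fun x => w x ^ (1 / 2 : ℝ)) * ((fun x => w x ^ (1 / 2 : ℝ)) * g)) x
      = w x * g x := by
    intro x
    simp only [Pi.mul_apply]
    rw [← mul_assoc, ← ENNReal.rpow_add_of_nonneg _ _ (by norm_num) (by norm_num)]
    norm_num
  have e2 : ∀ x, (w x ^ (1 / 2 : ℝ)) ^ (2 : ℝ) = w x := by
    intro x; rw [← ENNReal.rpow_mul]; norm_num
  have e3 : ∀ x, ((fun x => w x ^ (1 / 2 : ℝ)) * g) x ^ (2 : ℝ) = w x * g x ^ 2 := by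
    intro x
    simp only [Pi.mul_apply]
    rw [ENNReal.mul_rpow_of_nonneg _ _ (by norm_num), e2]; norm_num
  simp_rw [e1, e2, e3] at h
  calc _ ≤ _ := pow_le_pow_left' h 2
    _ = _ := by
      rw [mul_pow, ← ENNReal.rpow_natCast, ← ENNReal.rpow_natCast, ← ENNReal.rpow_mul,
        ← ENNReal.rpow_mul]
      norm_num

/-- Schwartz functions have rapidly decaying integrals outside of large balls. -/
theorem SchwartzMap.exists_lintegral_tail_le (Φ : 𝓢(Plane, ℂ)) (N : ℕ) :
    ∃ C : ℝ, 0 ≤ C ∧ ∀ X : ℝ, 1 ≤ X →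
      ∫⁻ q in {q : Plane | X < ‖q‖}, ‖Φ q‖ₑ ≤ ENNReal.ofReal (C / X ^ N) := by
  have hi := Φ.integrable_pow_mul (μ := volume) N
  refine ⟨∫ q, ‖q‖ ^ N * ‖Φ q‖, integral_nonneg fun q => by positivity, fun X hX => ?_⟩
  have hX0 : 0 < X := by linarith
  rw [← integral_div, ofReal_integral_eq_lintegral_ofReal]
  · refine (lintegral_mono_ae ?_).trans (setLIntegral_le_lintegral {q : Plane | X < ‖q‖} _)
    refine (ae_restrict_mem (measurableSet_lt measurable_const measurable_norm)).mono
      fun q hq => ?_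
    rw [← ofReal_norm]
    apply ENNReal.ofReal_le_ofReal
    rw [le_div_iff₀ (by positivity), mul_comm]
    have : X ^ N ≤ ‖q‖ ^ N := pow_le_pow_left₀ hX0.le (le_of_lt hq) N
    gcongr
  · exact hi.div_const _
  · exact Eventually.of_forall fun q => by positivity

/-! #### Reproducing formula and the locally constant property -/

theorem exists_schwartz_fourier_eq_one :
    ∃ Φ : 𝓢(Plane, ℂ), ∀ v : Plane, ‖v‖ ≤ 2 → 𝓕 (Φ : Plane → ℂ) v = 1 := by
  let χ : ContDiffBump (0 : Plane) := ⟨2, 3, by norm_num, by norm_num⟩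
  have hg₁ : HasCompactSupport (Complex.ofRealCLM ∘ χ) := χ.hasCompactSupport.comp_left rfl
  have hg₂ : ContDiff ℝ ∞ (Complex.ofRealCLM ∘ χ) := Complex.ofRealCLM.contDiff.comp χ.contDiff
  refine ⟨𝓕⁻ (hg₁.toSchwartzMap hg₂), fun v hv => ?_⟩
  rw [← SchwartzMap.fourier_coe, FourierTransform.fourier_fourierInv_eq]
  have : χ v = 1 := χ.one_of_mem_closedBall (by simpa [χ] using hv)
  simp [this]

/-- The reproducing formula: a function with frequencies in an `a × b` rectangle around `lam e` is
reproduced by convolution with a modulated bump at the dual scale. -/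
theorem extOp_reproduce {Φ : 𝓢(Plane, ℂ)} (hΦ : ∀ v : Plane, ‖v‖ ≤ 2 → 𝓕 (Φ : Plane → ℂ) v = 1)
    {σ : Measure Plane} [IsFiniteMeasure σ] {f : Plane → ℂ} (hf : Integrable f σ) {e : Plane}
    {lam a b : ℝ} (ha : 0 < a) (hb : 0 < b)
    (hsupp : ∀ᵐ ζ ∂σ, f ζ ≠ 0 → |inner ℝ ζ e - lam| ≤ a ∧ |inner ℝ ζ (perp e)| ≤ b) (y : Plane) :
    extOp σ f y = ∫ q, (Φ q * Real.fourierChar (lam * q 0 / a)) *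
      extOp σ f (y - frameMap e a⁻¹ b⁻¹ q) := by
  have step : ∀ q ζ : Plane, (Φ q * (Real.fourierChar (lam * q 0 / a) : ℂ)) *
      (f ζ * (Real.fourierChar (inner ℝ (y - frameMap e a⁻¹ b⁻¹ q) ζ) : ℂ)) =
      (f ζ * (Real.fourierChar (inner ℝ y ζ) : ℂ)) * ((Real.fourierChar (-(inner ℝ q
        (!₂[(inner ℝ ζ e - lam) / a, inner ℝ ζ (perp e) / b] : Plane))) : ℂ) * Φ q) := by
    intro q ζ
    rw [show Φ q * (Real.fourierChar (lam * q 0 / a) : ℂ) *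
      (f ζ * (Real.fourierChar (inner ℝ (y - frameMap e a⁻¹ b⁻¹ q) ζ) : ℂ)) = Φ q * f ζ *
      ((Real.fourierChar (lam * q 0 / a) : ℂ) *
        (Real.fourierChar (inner ℝ (y - frameMap e a⁻¹ b⁻¹ q) ζ) : ℂ)) by ring,
      ← fourierChar_add_coe]
    rw [mul_assoc (f ζ), mul_comm _ (Φ q), mul_left_comm _ (Φ q), mul_assoc (Φ q),
      mul_left_comm (f ζ), ← fourierChar_add_coe]
    congr 4
    rw [inner_sub_left, inner_frameMap, inner_eq q]
    simp only [Matrix.cons_val_zero, Matrix.cons_val_one]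
    rw [real_inner_comm e ζ, real_inner_comm (perp e) ζ]
    field_simp
    ring
  have hint : Integrable (fun p : Plane × Plane => Φ p.1 * f p.2) (volume.prod σ) :=
    Φ.integrable.mul_prod hf
  simp_rw [extOp, ← integral_const_mul]
  simp_rw [step]
  rw [integral_integral_swap]
  · apply integral_congr_ae
    filter_upwards [hsupp] with ζ hζ
    rw [integral_const_mul]
    by_cases h0 : f ζ = 0
    · simp [h0]
    · obtain ⟨h1, h2⟩ := hζ h0
      have h3 := hΦ (!₂[(inner ℝ ζ e - lam) / a, inner ℝ ζ (perp e) / b] : Plane) (by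
        have hx : |(inner ℝ ζ e - lam) / a| ≤ 1 := by
          rw [abs_div, abs_of_pos ha, div_le_one ha]; exact h1
        have hy : |inner ℝ ζ (perp e) / b| ≤ 1 := by
          rw [abs_div, abs_of_pos hb, div_le_one hb]; exact h2
        have := norm_sq_eq (!₂[(inner ℝ ζ e - lam) / a, inner ℝ ζ (perp e) / b] : Plane)
        simp only [Matrix.cons_val_zero, Matrix.cons_val_one] at this
        have hx2 := (sq_le_one_iff_abs_le_one _).2 hx
        have hy2 := (sq_le_one_iff_abs_le_one _).2 hy
        nlinarith [norm_nonneg (!₂[(inner ℝ ζ e - lam) / a, inner ℝ ζ (perp e) / b] : Plane)])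
      rw [Real.fourier_eq] at h3
      simp only [Circle.smul_def, smul_eq_mul] at h3
      rw [h3, mul_one]
  · have h1 := integrable_mul_fourierChar hint (g := fun p : Plane × Plane => inner ℝ y p.2 +
      -(inner ℝ p.1 (!₂[(inner ℝ p.2 e - lam) / a, inner ℝ p.2 (perp e) / b] : Plane)))
      (by apply Continuous.aestronglyMeasurable; fun_prop)
    refine h1.congr (Eventually.of_forall fun p => ?_)
    simp only [Function.uncurry, fourierChar_add_coe]
    ring

theorem measurableSet_tube (c e : Plane) (w L : ℝ) : MeasurableSet (tube c e w L) := by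
  have h1 : Continuous fun x : Plane => |inner ℝ (x - c) e| := by fun_prop
  have h2 : Continuous fun x : Plane => |inner ℝ (x - c) (perp e)| := by fun_prop
  exact ((isClosed_le h1 continuous_const).inter (isClosed_le h2 continuous_const)).measurableSet

/-- The locally constant property: if `f` has its frequencies in an `a × b` rectangle, then
`|E f(y)|²` is controlled by its average over the dual `b⁻¹ × a⁻¹` tube around `y`, up to a rapidly
decaying tail. -/
theorem exists_locally_constant :
    ∃ C : ℝ, 0 ≤ C ∧ ∀ N : ℕ, ∃ D : ℝ, 0 ≤ D ∧
      ∀ (σ : Measure Plane) [IsFiniteMeasure σ] (f : Plane → ℂ), Integrable f σ →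
      ∀ (e : Plane), ‖e‖ = 1 → ∀ (lam a b X M : ℝ), 0 < a → 0 < b → 1 ≤ X →
      (∫ ζ, ‖f ζ‖ ∂σ) ≤ M →
      (∀ᵐ ζ ∂σ, f ζ ≠ 0 → |inner ℝ ζ e - lam| ≤ a ∧ |inner ℝ ζ (perp e)| ≤ b) → ∀ y : Plane,
      ‖extOp σ f y‖ₑ ^ 2 ≤ ENNReal.ofReal (C * (a * b)) *
        (∫⁻ z in tube y e (2 * (X / b)) (2 * (X / a)), ‖extOp σ f z‖ₑ ^ 2) +
          ENNReal.ofReal (D * M ^ 2 / X ^ N) := by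
  obtain ⟨Φ, hΦ⟩ := exists_schwartz_fourier_eq_one
  obtain ⟨B, hB0, hB⟩ : ∃ B : ℝ, 0 ≤ B ∧ ∀ q, ‖Φ q‖ ≤ B := by
    obtain ⟨B, hB⟩ := Φ.decay 0 0
    exact ⟨B, hB.1.le, fun q => by simpa using hB.2 q⟩
  set I : ℝ := ∫ q, ‖Φ q‖ with hI
  have hI0 : 0 ≤ I := integral_nonneg fun q => norm_nonneg _
  have hIe : ∫⁻ q, ‖Φ q‖ₑ = ENNReal.ofReal I := by
    rw [hI, ofReal_integral_norm_eq_lintegral_enorm Φ.integrable]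
  refine ⟨I * B, by positivity, fun N => ?_⟩
  obtain ⟨D, hD0, hD⟩ := SchwartzMap.exists_lintegral_tail_le Φ N
  refine ⟨I * D, by positivity, ?_⟩
  intro σ _ f hf e he lam a b X M ha hb hX hM hsupp y
  have hcont := continuous_extOp hf
  have hM0 : 0 ≤ M := le_trans (integral_nonneg fun _ => norm_nonneg _) hM
  set g : Plane → ℝ≥0∞ := fun q => ‖extOp σ f (y - frameMap e a⁻¹ b⁻¹ q)‖ₑ with hg
  have hgm : Measurable g := by
    have : Continuous fun q => extOp σ f (y - frameMap e a⁻¹ b⁻¹ q) :=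
      hcont.comp (continuous_const.sub (continuous_frameMap _ _ _))
    exact this.enorm.measurable
  have hΦm : Measurable fun q => ‖Φ q‖ₑ := Φ.continuous.enorm.measurable
  -- By the reproducing formula `|E f (y)| ≤ ∫ |Φ| g`, and the Cauchy–Schwarz inequality with the
  -- weight `|Φ|` leaves `∫ |Φ| g ^ 2`. The part of it in the square `S` becomes, in the frame of the
  -- rectangle, the integral over the dual tube; the rest is a tail of `Φ`.
  have h1 : ‖extOp σ f y‖ₑ ≤ ∫⁻ q, ‖Φ q‖ₑ * g q := by
    rw [extOp_reproduce hΦ hf ha hb hsupp y]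
    refine (enorm_integral_le_lintegral_enorm _).trans (le_of_eq ?_)
    refine lintegral_congr fun q => ?_
    simp only [enorm_mul, hg, enorm_fourierChar_coe, mul_one]
  set S : Set Plane := {q | |q 0| ≤ X ∧ |q 1| ≤ X} with hS
  have hSm : MeasurableSet S := by
    have h1 : Continuous fun x : Plane => |x 0| := by fun_prop
    have h2 : Continuous fun x : Plane => |x 1| := by fun_prop
    exact ((isClosed_le h1 continuous_const).inter (isClosed_le h2 continuous_const)).measurableSet
  have h2 : ∫⁻ q, ‖Φ q‖ₑ * g q ^ 2 ≤ ENNReal.ofReal B * (∫⁻ q in S, g q ^ 2) +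
      ENNReal.ofReal (D / X ^ N) * ENNReal.ofReal (M ^ 2) := by
    rw [← lintegral_add_compl _ hSm]
    gcongr
    · rw [← lintegral_const_mul _ (hgm.pow_const 2)]
      refine lintegral_mono fun q => ?_
      gcongr
      rw [← ofReal_norm]
      exact ENNReal.ofReal_le_ofReal (hB q)
    · calc ∫⁻ q in Sᶜ, ‖Φ q‖ₑ * g q ^ 2
          ≤ ∫⁻ q in Sᶜ, ‖Φ q‖ₑ * ENNReal.ofReal (M ^ 2) := by
            refine lintegral_mono fun q => ?_
            gcongr
            rw [hg, ENNReal.ofReal_pow hM0]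
            simp only
            rw [← ofReal_norm]
            gcongr
            exact (norm_extOp_le _ _ _).trans hM
        _ = (∫⁻ q in Sᶜ, ‖Φ q‖ₑ) * ENNReal.ofReal (M ^ 2) := lintegral_mul_const _ hΦm
        _ ≤ _ := by
            gcongr
            refine (lintegral_mono_set ?_).trans (hD X hX)
            intro q hq
            simp only [hS, Set.mem_compl_iff, Set.mem_ofPred_eq, not_and_or, not_le] at hq
            have hn := norm_sq_eq q
            rcases hq with hq | hq
            · have : |q 0| ≤ ‖q‖ := by
                apply abs_le_of_sq_le_sq _ (norm_nonneg _); nlinarith [sq_nonneg (q 1)]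
              exact lt_of_lt_of_le hq this
            · have : |q 1| ≤ ‖q‖ := by
                apply abs_le_of_sq_le_sq _ (norm_nonneg _); nlinarith [sq_nonneg (q 0)]
              exact lt_of_lt_of_le hq this
  have h3 : ∫⁻ q in S, g q ^ 2 = ENNReal.ofReal (a * b) *
      ∫⁻ z in tube y e (2 * (X / b)) (2 * (X / a)), ‖extOp σ f z‖ₑ ^ 2 := by
    have h4 : ∫⁻ q in S, g q ^ 2 = ∫⁻ q, (fun x => (tube y e (2 * (X / b)) (2 * (X / a))).indicator
        (fun z => ‖extOp σ f z‖ₑ ^ 2) (y - x)) (frameMap e a⁻¹ b⁻¹ q) := by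
      rw [← lintegral_indicator hSm]
      refine lintegral_congr fun q => ?_
      have hiff : q ∈ S ↔ (y - frameMap e a⁻¹ b⁻¹ q) ∈ tube y e (2 * (X / b)) (2 * (X / a)) := by
        simp only [hS, tube, Set.mem_ofPred_eq, sub_sub_cancel_left, inner_neg_left, abs_neg,
          inner_frameMap_self he, inner_frameMap_perp he, abs_mul, abs_inv, abs_of_pos ha,
          abs_of_pos hb, mul_div_cancel_left₀ _ (two_ne_zero' ℝ)]
        rw [inv_mul_le_iff₀ ha, inv_mul_le_iff₀ hb, mul_div_cancel₀ _ ha.ne',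
          mul_div_cancel₀ _ hb.ne']
      by_cases hq : q ∈ S
      · simp only [Set.indicator_of_mem hq, Set.indicator_of_mem (hiff.1 hq), hg]
      · simp only [Set.indicator_of_notMem hq, Set.indicator_of_notMem (hiff.not.1 hq)]
    rw [h4, lintegral_frameMap he (inv_pos.2 ha) (inv_pos.2 hb)
      (fun x => (tube y e (2 * (X / b)) (2 * (X / a))).indicator
        (fun z => ‖extOp σ f z‖ₑ ^ 2) (y - x)),
      lintegral_sub_left_eq_self (fun x => (tube y e (2 * (X / b)) (2 * (X / a))).indicator
        (fun z => ‖extOp σ f z‖ₑ ^ 2) x),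
      lintegral_indicator (measurableSet_tube _ _ _ _)]
    congr 2
    field_simp
  calc ‖extOp σ f y‖ₑ ^ 2 ≤ (∫⁻ q, ‖Φ q‖ₑ * g q) ^ 2 := by gcongr
    _ ≤ _ := sq_lintegral_mul_le hΦm.aemeasurable hgm.aemeasurable
    _ ≤ _ := mul_le_mul_right h2 _
    _ = _ := by
      rw [hIe, h3, mul_add]
      congr 1
      · rw [← mul_assoc, ← mul_assoc, ← ENNReal.ofReal_mul hI0,
          ← ENNReal.ofReal_mul (by positivity)]
      · rw [← mul_assoc, ← ENNReal.ofReal_mul hI0, ← ENNReal.ofReal_mul (by positivity)]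
        congr 1
        ring

/-! ### Local orthogonality -/

/-- A smooth bump `χ` supported in the ball of radius `1 / 8`, whose inverse Fourier transform is
bounded below on the unit ball. -/
theorem exists_window :
    ∃ (χ : 𝓢(Plane, ℂ)) (κ : ℝ), 0 < κ ∧ (∀ v, ‖χ v‖ ≤ 1) ∧ (∀ v, 1 / 8 ≤ ‖v‖ → χ v = 0) ∧
      ∀ x : Plane, ‖x‖ ≤ 1 → κ ≤ ‖𝓕⁻ (χ : Plane → ℂ) x‖ := by
  let χ : ContDiffBump (0 : Plane) := ⟨1 / 16, 1 / 8, by norm_num, by norm_num⟩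
  have hg₁ : HasCompactSupport (Complex.ofRealCLM ∘ χ) := χ.hasCompactSupport.comp_left rfl
  have hg₂ : ContDiff ℝ ∞ (Complex.ofRealCLM ∘ χ) := Complex.ofRealCLM.contDiff.comp χ.contDiff
  have hz : ∀ v : Plane, 1 / 8 ≤ ‖v‖ → χ v = 0 := fun v hv =>
    χ.zero_of_le_dist (by simpa [χ] using hv)
  have hint : Integrable (fun v => χ v) (volume : Measure Plane) := χ.integrable
  have hcoe : ∀ v, (hg₁.toSchwartzMap hg₂) v = ((χ v : ℝ) : ℂ) := fun v => by simp
  refine ⟨hg₁.toSchwartzMap hg₂, (1 / 2) * ∫ v, χ v, ?_, ?_, ?_, ?_⟩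
  · have := χ.integral_pos (μ := (volume : Measure Plane))
    positivity
  · intro v
    simp [abs_of_nonneg (χ.nonneg' v), χ.le_one]
  · intro v hv
    simp [hz v hv]
  · intro x hx
    refine le_trans ?_ (Complex.re_le_norm _)
    rw [Real.fourierInv_eq]
    have h1 : (∫ v, Real.fourierChar (inner ℝ v x) • (hg₁.toSchwartzMap hg₂) v : ℂ).re =
        ∫ v, χ v * Real.cos (2 * Real.pi * inner ℝ v x) := by
      rw [← RCLike.re_eq_complex_re, ← integral_re]
      · refine integral_congr_ae (Eventually.of_forall fun v => ?_)
        simp only [Circle.smul_def, Real.fourierChar_apply, smul_eq_mul,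
          hcoe, RCLike.re_eq_complex_re, Complex.re_mul_ofReal, Complex.exp_ofReal_mul_I_re]
        ring
      · have := integrable_mul_fourierChar (hg₁.toSchwartzMap hg₂).integrable (μ := volume)
          (g := fun v : Plane => inner ℝ v x) (by fun_prop)
        refine this.congr (Eventually.of_forall fun v => ?_)
        simp only [Circle.smul_def, smul_eq_mul, mul_comm]
    rw [h1, ← integral_const_mul]
    refine integral_mono (hint.const_mul _) ?_ fun v => ?_
    · refine hint.mul_bdd (c := 1) (by fun_prop) (Eventually.of_forall fun v => ?_)
      exact Real.abs_cos_le_one _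
    · by_cases hv : 1 / 8 ≤ ‖v‖
      · simp [hz v hv]
      · push Not at hv
        have h2 : |inner ℝ v x| ≤ 1 / 8 :=
          (abs_real_inner_le_norm v x).trans (by nlinarith [norm_nonneg x, norm_nonneg v])
        have h3 : 1 / 2 ≤ Real.cos (2 * Real.pi * inner ℝ v x) := by
          rw [← Real.cos_pi_div_three, ← Real.cos_abs (2 * Real.pi * inner ℝ v x)]
          apply Real.cos_le_cos_of_nonneg_of_le_pi (abs_nonneg _)
          · linarith [Real.pi_pos]
          · rw [abs_mul, abs_of_pos (by positivity : 0 < 2 * Real.pi)]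
            nlinarith [Real.pi_pos]
        rw [mul_comm]
        exact mul_le_mul_of_nonneg_left h3 (χ.nonneg' v)

/-- The mollification of the measure `f σ` at scale `ρ⁻¹`, modulated by the point `c`. Its inverse
Fourier transform is `E f` times a bump adapted to the ball of radius `ρ` around `c`. -/
def mollify (χ : 𝓢(Plane, ℂ)) (σ : Measure Plane) (c : Plane) (ρ : ℝ) (f : Plane → ℂ)
    (η : Plane) : ℂ :=
  ∫ ζ, f ζ * ((ρ ^ 2 : ℝ) * χ (ρ • (η - ζ)) * Real.fourierChar (-(inner ℝ c (η - ζ)))) ∂σ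

section mollify

variable {χ : 𝓢(Plane, ℂ)} {σ : Measure Plane} {c : Plane} {ρ : ℝ}
  {f : Plane → ℂ}

theorem integral_smul_plane (hρ : 0 < ρ) (F : Plane → ℂ) :
    ∫ v, (ρ ^ 2 : ℝ) * F (ρ • v) = ∫ v, F v := by
  rw [integral_const_mul, Measure.integral_comp_smul]
  simp only [finrank_euclideanSpace, Fintype.card_fin, Complex.real_smul]
  rw [← mul_assoc, ← Complex.ofReal_mul, abs_of_pos (by positivity), mul_inv_cancel₀ (by positivity)]
  simp

theorem lintegral_smul_plane (hρ : 0 < ρ) (F : Plane → ℝ≥0∞) :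
    ENNReal.ofReal (ρ ^ 2) * ∫⁻ v, F (ρ • v) = ∫⁻ v, F v := by
  have h := Measure.map_addHaar_smul (volume : Measure Plane) hρ.ne'
  have h2 := (Homeomorph.smulOfNeZero ρ hρ.ne').measurableEmbedding.lintegral_map
    (μ := (volume : Measure Plane)) F
  have h3 : (⇑(Homeomorph.smulOfNeZero ρ hρ.ne') : Plane → Plane) = (ρ • ·) := rfl
  rw [h3, h, lintegral_smul_measure] at h2
  simp only [finrank_euclideanSpace, Fintype.card_fin, smul_eq_mul] at h2
  rw [← h2, ← mul_assoc, ← ENNReal.ofReal_mul (by positivity), abs_of_pos (by positivity),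
    mul_inv_cancel₀ (by positivity), ENNReal.ofReal_one, one_mul]

theorem integrable_mollify_kernel [IsFiniteMeasure σ] (hf : Integrable f σ) (hρ : 0 < ρ) :
    Integrable (fun p : Plane × Plane => f p.2 * ((ρ ^ 2 : ℝ) * χ (ρ • (p.1 - p.2)) *
      Real.fourierChar (-(inner ℝ c (p.1 - p.2))))) (volume.prod σ) := by
  have hχ : Integrable (fun v : Plane => (ρ ^ 2 : ℝ) * χ (ρ • v)) volume :=
    (χ.integrable.comp_smul hρ.ne').const_mul _
  have h1 : Integrable (fun p : Plane × Plane => f p.2 * ((ρ ^ 2 : ℝ) * χ (ρ • p.1)))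
      (volume.prod σ) := by
    have := hχ.mul_prod hf
    refine this.congr (Eventually.of_forall fun p => ?_)
    simp only; ring
  have hmp : MeasurePreserving (fun p : Plane × Plane => (p.1 - p.2, p.2)) (volume.prod σ)
      (volume.prod σ) := by
    have h2 : MeasurePreserving (fun p : Plane × Plane => (p.1, p.2 - p.1)) (σ.prod volume)
        (σ.prod volume) :=
      (MeasurePreserving.id σ).skew_product (g := fun x y => y - x) (by fun_prop)
        (Eventually.of_forall fun x => (measurePreserving_sub_right volume x).map_eq)
    exact (Measure.measurePreserving_swap.comp (h2.comp Measure.measurePreserving_swap))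
  have h3 := hmp.integrable_comp_of_integrable h1
  have h4 := integrable_mul_fourierChar h3
    (g := fun p : Plane × Plane => -(inner ℝ c (p.1 - p.2))) (by fun_prop)
  refine h4.congr (Eventually.of_forall fun p => ?_)
  simp only [Function.comp]; ring

theorem fourierInv_mollify [IsFiniteMeasure σ] (hf : Integrable f σ) (hρ : 0 < ρ) (x : Plane) :
    𝓕⁻ (mollify χ σ c ρ f) x = extOp σ f x * 𝓕⁻ (χ : Plane → ℂ) (ρ⁻¹ • (x - c)) := by
  rw [Real.fourierInv_eq]
  simp only [Circle.smul_def, smul_eq_mul, mollify, ← integral_const_mul]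
  rw [integral_integral_swap]
  · rw [extOp, ← integral_mul_const]
    refine integral_congr_ae (Eventually.of_forall fun ζ => ?_)
    simp only
    rw [← integral_add_right_eq_self (fun η => (Real.fourierChar (inner ℝ η x) : ℂ) * (f ζ *
      ((ρ ^ 2 : ℝ) * χ (ρ • (η - ζ)) * Real.fourierChar (-(inner ℝ c (η - ζ)))))) ζ,
      Real.fourierInv_eq, ← integral_smul_plane hρ
        (fun v => Real.fourierChar (inner ℝ v (ρ⁻¹ • (x - c))) • χ v), ← integral_const_mul]
    refine integral_congr_ae (Eventually.of_forall fun v => ?_)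
    simp only [add_sub_cancel_right, Circle.smul_def, smul_eq_mul]
    have h1 : (Real.fourierChar (inner ℝ (v + ζ) x) : ℂ) * Real.fourierChar (-(inner ℝ c v)) =
        Real.fourierChar (inner ℝ x ζ) * Real.fourierChar (inner ℝ (ρ • v) (ρ⁻¹ • (x - c))) := by
      rw [← fourierChar_add_coe, ← fourierChar_add_coe]
      congr 2
      rw [inner_smul_left, inner_smul_right, inner_add_left, inner_sub_right, real_inner_comm x ζ,
        real_inner_comm c v]
      simp only [conj_trivial]
      field_simp
      ring
    linear_combination (f ζ * (ρ ^ 2 : ℝ) * χ (ρ • v)) * h1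
  · have := integrable_mul_fourierChar (integrable_mollify_kernel (χ := χ) (c := c) hf hρ)
      (g := fun p : Plane × Plane => inner ℝ p.1 x) (by fun_prop)
    refine this.congr (Eventually.of_forall fun p => ?_)
    simp only [Function.uncurry]; ring

theorem norm_mollify_le (hχ : ∀ v, ‖χ v‖ ≤ 1) (hf : Integrable f σ) (η : Plane) :
    ‖mollify χ σ c ρ f η‖ ≤ ρ ^ 2 * ∫ ζ, ‖f ζ‖ ∂σ := by
  rw [← integral_const_mul]
  refine norm_integral_le_of_norm_le (hf.norm.const_mul _) (Eventually.of_forall fun ζ => ?_)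
  rw [norm_mul, norm_mul, norm_mul, norm_fourierChar_coe, mul_one, mul_comm, Complex.norm_real,
    Real.norm_of_nonneg (by positivity)]
  have := hχ (ρ • (η - ζ))
  gcongr
  exact mul_le_of_le_one_right (by positivity) this

theorem integrable_mollify [IsFiniteMeasure σ] (hf : Integrable f σ) (hρ : 0 < ρ) :
    Integrable (mollify χ σ c ρ f) volume :=
  (integrable_mollify_kernel (χ := χ) (c := c) hf hρ).integral_prod_left

theorem memLp_two_of_integrable_of_bound {g : Plane → ℂ} (hg : Integrable g) {B : ℝ}
    (hB : ∀ x, ‖g x‖ ≤ B) : MemLp g 2 := by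
  rw [memLp_two_iff_integrable_sq_norm hg.aestronglyMeasurable]
  refine (hg.norm.const_mul B).mono' (by have := hg.aestronglyMeasurable; fun_prop)
    (Eventually.of_forall fun x => ?_)
  rw [Real.norm_of_nonneg (by positivity), sq]
  exact mul_le_mul_of_nonneg_right (hB x) (norm_nonneg _)

theorem lintegral_mollify [IsFiniteMeasure σ] (hχ : ∀ v, ‖χ v‖ ≤ 1) (hf : Integrable f σ) (hρ : 0 < ρ) :
    ∫⁻ x, (‖extOp σ f x‖ₑ * ‖𝓕⁻ (χ : Plane → ℂ) (ρ⁻¹ • (x - c))‖ₑ) ^ 2 =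
      ∫⁻ η, ‖mollify χ σ c ρ f η‖ₑ ^ 2 := by
  rw [← lintegral_enorm_sq_fourierInv (integrable_mollify hf hρ)
    (memLp_two_of_integrable_of_bound (integrable_mollify hf hρ) (norm_mollify_le hχ hf))]
  refine lintegral_congr fun x => ?_
  rw [fourierInv_mollify hf hρ, enorm_mul]

theorem exists_of_mollify_ne_zero (hχ : ∀ v, 1 / 8 ≤ ‖v‖ → χ v = 0) (hρ : 0 < ρ) {η : Plane}
    (h : mollify χ σ c ρ f η ≠ 0) : ∃ ζ, f ζ ≠ 0 ∧ ‖η - ζ‖ < 1 / (8 * ρ) := by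
  by_contra! hne
  apply h
  rw [mollify]
  convert integral_zero Plane ℂ with ζ
  by_cases h0 : f ζ = 0
  · simp [h0]
  · rw [hχ]
    · simp
    · rw [norm_smul, Real.norm_of_nonneg hρ.le]
      have := hne ζ h0
      rw [div_le_iff₀ (by positivity)] at this ⊢
      nlinarith

theorem extOp_le_of_window {κ : ℝ} (hκ : 0 < κ)
    (hχκ : ∀ x : Plane, ‖x‖ ≤ 1 → κ ≤ ‖𝓕⁻ (χ : Plane → ℂ) x‖) (hρ : 0 < ρ) (F : Plane → ℝ≥0∞) :
    ∫⁻ x in Metric.closedBall c ρ, F x ^ 2 ≤ ENNReal.ofReal (κ⁻¹ ^ 2) *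
      ∫⁻ x, (F x * ‖𝓕⁻ (χ : Plane → ℂ) (ρ⁻¹ • (x - c))‖ₑ) ^ 2 := by
  rw [← lintegral_const_mul' _ _ ENNReal.ofReal_ne_top]
  refine (setLIntegral_mono' Metric.isClosed_closedBall.measurableSet fun x hx => ?_).trans
    (setLIntegral_le_lintegral _ _)
  have h1 : κ ≤ ‖𝓕⁻ (χ : Plane → ℂ) (ρ⁻¹ • (x - c))‖ := by
    apply hχκ
    rw [norm_smul, norm_inv, Real.norm_of_nonneg hρ.le, inv_mul_le_one₀ hρ, ← dist_eq_norm]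
    exact hx
  rw [ENNReal.ofReal_pow (by positivity), ← mul_pow]
  gcongr
  have h2 : 1 ≤ ENNReal.ofReal κ⁻¹ * ‖𝓕⁻ (χ : Plane → ℂ) (ρ⁻¹ • (x - c))‖ₑ := by
    rw [← ofReal_norm, ← ENNReal.ofReal_mul (by positivity), ENNReal.one_le_ofReal]
    rw [inv_mul_eq_div, one_le_div hκ]; exact h1
  calc F x = F x * 1 := (mul_one _).symm
    _ ≤ F x * (ENNReal.ofReal κ⁻¹ * ‖𝓕⁻ (χ : Plane → ℂ) (ρ⁻¹ • (x - c))‖ₑ) := by gcongr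
    _ = _ := by ring

end mollify

/-- The Cauchy–Schwarz inequality for a sum with at most `K` nonzero terms. -/
theorem enorm_sum_sq_le {ι : Type*} [DecidableEq ι] (s : Finset ι) (g : ι → ℂ) {K : ℕ}
    (hK : (s.filter fun i => g i ≠ 0).card ≤ K) :
    ‖∑ i ∈ s, g i‖ₑ ^ 2 ≤ K * ∑ i ∈ s, ‖g i‖ₑ ^ 2 := by
  have h1 : ∑ i ∈ s, g i = ∑ i ∈ s.filter fun i => g i ≠ 0, g i :=
    (Finset.sum_filter_ne_zero s).symm
  rw [h1]
  calc ‖∑ i ∈ s.filter (fun i => g i ≠ 0), g i‖ₑ ^ 2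
      ≤ (∑ i ∈ s.filter (fun i => g i ≠ 0), ‖g i‖ₑ) ^ 2 := by gcongr; exact enorm_sum_le _ _
    _ ≤ ((s.filter fun i => g i ≠ 0).card : ℝ≥0∞) *
        ∑ i ∈ s.filter (fun i => g i ≠ 0), ‖g i‖ₑ ^ 2 := by
        have := ENNReal.inner_le_Lp_mul_Lq (s.filter fun i => g i ≠ 0) (fun _ => (1 : ℝ≥0∞))
          (fun i => ‖g i‖ₑ) Real.HolderConjugate.two_two
        have h2 := pow_le_pow_left' this 2
        simp only [one_mul, ENNReal.one_rpow, Finset.sum_const, nsmul_eq_mul, mul_one] at h2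
        refine h2.trans (le_of_eq ?_)
        rw [mul_pow, ← ENNReal.rpow_natCast, ← ENNReal.rpow_natCast, ← ENNReal.rpow_mul,
          ← ENNReal.rpow_mul]
        norm_num
    _ ≤ _ := by
        gcongr
        exact Finset.filter_subset _ _

/-- Local orthogonality: on a ball of radius `ρ`, functions `E f_i` with essentially `1 / ρ`
separated frequencies are almost orthogonal, up to a rapidly decaying tail. -/
theorem exists_local_orthogonality :
    ∃ C : ℝ, 0 ≤ C ∧ ∀ N : ℕ, ∃ D : ℝ, 0 ≤ D ∧
      ∀ (σ : Measure Plane) [IsFiniteMeasure σ] (ι : Type) [Fintype ι] [DecidableEq ι]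
        (f : ι → Plane → ℂ), (∀ i, Integrable (f i) σ) →
      ∀ (c : Plane) (ρ X M : ℝ) (K : ℕ), 0 < ρ → 1 ≤ X → (∀ i, (∫ ζ, ‖f i ζ‖ ∂σ) ≤ M) →
      (∀ i, Set.ncard {j | ∃ ζ ζ', f i ζ ≠ 0 ∧ f j ζ' ≠ 0 ∧ ‖ζ - ζ'‖ ≤ 1 / ρ} ≤ K) →
      ∫⁻ x in Metric.closedBall c ρ, ‖∑ i, extOp σ (f i) x‖ₑ ^ 2 ≤ ENNReal.ofReal C * K *
        ∑ i, ((∫⁻ x in Metric.closedBall c (X * ρ), ‖extOp σ (f i) x‖ₑ ^ 2) +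
          ENNReal.ofReal (D * ρ ^ 2 * M ^ 2 / X ^ N)) := by
  obtain ⟨χ, κ, hκ, hχ1, hχ0, hχκ⟩ := exists_window
  set Φ : 𝓢(Plane, ℂ) := 𝓕⁻ χ with hΦ
  have hΦχ : ∀ x, 𝓕⁻ (χ : Plane → ℂ) x = Φ x := by
    intro x; rw [hΦ, SchwartzMap.fourierInv_coe]
  obtain ⟨B, hB0, hB⟩ : ∃ B : ℝ, 0 < B ∧ ∀ q, ‖Φ q‖ ≤ B := by
    obtain ⟨B, hB⟩ := Φ.decay 0 0
    exact ⟨B, hB.1, fun q => by simpa using hB.2 q⟩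
  refine ⟨κ⁻¹ ^ 2 * B ^ 2, by positivity, fun N => ?_⟩
  obtain ⟨D, hD0, hD⟩ := SchwartzMap.exists_lintegral_tail_le Φ N
  refine ⟨D / B, by positivity, ?_⟩
  intro σ _ ι _ _ f hf c ρ X M K hρ hX hM hK
  have hX0 : 0 < X := by linarith
  have hmol : ∀ x, mollify χ σ c ρ (fun ζ => ∑ i, f i ζ) x = ∑ i, mollify χ σ c ρ (f i) x := by
    intro η
    simp only [mollify, Finset.sum_mul]
    refine integral_finsetSum _ fun i _ => ?_
    have := integrable_mul_fourierChar (hf i) (g := fun ζ => -(inner ℝ c (η - ζ))) (by fun_prop)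
    have h2 := this.mul_bdd (c := ρ ^ 2) (g := fun ζ => (ρ ^ 2 : ℝ) * χ (ρ • (η - ζ)))
      (by
        apply Continuous.aestronglyMeasurable
        exact continuous_const.mul (χ.continuous.comp (by fun_prop)))
      (Eventually.of_forall fun ζ => by
        rw [norm_mul, Complex.norm_real, Real.norm_of_nonneg (by positivity)]
        exact mul_le_of_le_one_right (by positivity) (hχ1 _))
    refine h2.congr (Eventually.of_forall fun ζ => ?_)
    simp only; ring
  have hmeas : ∀ i, AEMeasurable (fun η => ‖mollify χ σ c ρ (f i) η‖ₑ ^ 2) volume := fun i =>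
    ((integrable_mollify (hf i) hρ).aestronglyMeasurable.enorm).pow_const 2
  -- On the ball, `E f_i` may be multiplied by a window adapted to it. This mollifies the frequency
  -- side at the scale `1 / ρ`: the support of the `i`-th piece grows by `1 / (8 ρ)`, so that at most
  -- `K` of the pieces are nonzero at any given point.
  have h1 : ∫⁻ x in Metric.closedBall c ρ, ‖∑ i, extOp σ (f i) x‖ₑ ^ 2 ≤
      ENNReal.ofReal (κ⁻¹ ^ 2) * (K * ∑ i, ∫⁻ η, ‖mollify χ σ c ρ (f i) η‖ₑ ^ 2) := by
    have h2 := extOp_le_of_window (c := c) hκ hχκ hρ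
      (fun x => ‖extOp σ (fun ζ => ∑ i, f i ζ) x‖ₑ)
    rw [lintegral_mollify hχ1 (integrable_finsetSum _ fun i _ => hf i) hρ] at h2
    simp_rw [extOp_finset_sum Finset.univ (fun i _ => hf i)] at h2
    refine h2.trans ?_
    gcongr
    rw [← lintegral_finsetSum' _ fun i _ => hmeas i, ← lintegral_const_mul' _ _ (by simp)]
    refine lintegral_mono fun η => ?_
    simp only
    rw [hmol]
    apply enorm_sum_sq_le
    by_cases hemp : (Finset.univ.filter fun i => mollify χ σ c ρ (f i) η ≠ 0).Nonempty
    · obtain ⟨i0, hi0⟩ := hemp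
      simp only [Finset.mem_filter, Finset.mem_univ, true_and] at hi0
      obtain ⟨ζ, hζ, hζη⟩ := exists_of_mollify_ne_zero hχ0 hρ hi0
      refine le_trans ?_ (hK i0)
      rw [← Set.ncard_coe_finset]
      refine Set.ncard_le_ncard (fun j hj => ?_) (Set.toFinite _)
      simp only [Finset.coe_filter, Finset.mem_univ, true_and, Set.mem_ofPred_eq] at hj ⊢
      obtain ⟨ζ', hζ', hζη'⟩ := exists_of_mollify_ne_zero hχ0 hρ hj
      refine ⟨ζ, ζ', hζ, hζ', ?_⟩
      have h5 : ‖ζ - ζ'‖ ≤ ‖η - ζ‖ + ‖η - ζ'‖ := by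
        have : ζ - ζ' = (η - ζ') - (η - ζ) := by abel
        rw [this, add_comm]; exact norm_sub_le _ _
      have h6 : 1 / (8 * ρ) + 1 / (8 * ρ) ≤ 1 / ρ := by
        have : 1 / (8 * ρ) + 1 / (8 * ρ) = (1 / 4) * (1 / ρ) := by field_simp; norm_num
        rw [this]
        have : 0 < 1 / ρ := by positivity
        linarith
      linarith
    · rw [Finset.not_nonempty_iff_eq_empty.1 hemp]; simp
  -- Undoing the Fourier transform, the window is bounded on the dilated ball and decays rapidly
  -- outside of it.
  have h3 : ∀ i, ∫⁻ η, ‖mollify χ σ c ρ (f i) η‖ₑ ^ 2 ≤ ENNReal.ofReal (B ^ 2) *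
      ((∫⁻ x in Metric.closedBall c (X * ρ), ‖extOp σ (f i) x‖ₑ ^ 2) +
          ENNReal.ofReal (D / B * ρ ^ 2 * M ^ 2 / X ^ N)) := by
    intro i
    have hM0 : 0 ≤ M := le_trans (integral_nonneg fun _ => norm_nonneg _) (hM i)
    rw [← lintegral_mollify hχ1 (hf i) hρ,
      ← lintegral_add_compl _ (Metric.isClosed_closedBall (x := c) (ε := X * ρ)).measurableSet,
      mul_add]
    gcongr
    · rw [← lintegral_const_mul' _ _ ENNReal.ofReal_ne_top]
      refine lintegral_mono fun x => ?_
      simp only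
      rw [mul_pow, mul_comm, ENNReal.ofReal_pow hB0.le, hΦχ]
      gcongr
      rw [← ofReal_norm]
      exact ENNReal.ofReal_le_ofReal (hB _)
    · calc ∫⁻ x in (Metric.closedBall c (X * ρ))ᶜ,
            (‖extOp σ (f i) x‖ₑ * ‖𝓕⁻ (χ : Plane → ℂ) (ρ⁻¹ • (x - c))‖ₑ) ^ 2
          ≤ ∫⁻ x in (Metric.closedBall c (X * ρ))ᶜ,
              ENNReal.ofReal (M ^ 2 * B) * ‖Φ (ρ⁻¹ • (x - c))‖ₑ := by
            refine lintegral_mono fun x => ?_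
            simp only
            rw [mul_pow, hΦχ, sq ‖Φ _‖ₑ, ENNReal.ofReal_mul (by positivity), ← mul_assoc,
              ENNReal.ofReal_pow hM0]
            gcongr
            · rw [← ofReal_norm]
              exact ENNReal.ofReal_le_ofReal ((norm_extOp_le _ _ _).trans (hM i))
            · rw [← ofReal_norm]
              exact ENNReal.ofReal_le_ofReal (hB _)
        _ = ENNReal.ofReal (M ^ 2 * B) * ∫⁻ x,
              (fun v => Set.indicator {q : Plane | X < ‖q‖} (fun q => ‖Φ q‖ₑ) (ρ⁻¹ • v)) (x - c) := by
            rw [lintegral_const_mul' _ _ ENNReal.ofReal_ne_top,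
              ← lintegral_indicator Metric.isClosed_closedBall.measurableSet.compl]
            congr 1
            refine lintegral_congr fun x => ?_
            have hiff : x ∈ (Metric.closedBall c (X * ρ))ᶜ ↔
                ρ⁻¹ • (x - c) ∈ {q : Plane | X < ‖q‖} := by
              simp only [Set.mem_compl_iff, Metric.mem_closedBall, not_le, Set.mem_ofPred_eq,
                norm_smul, norm_inv, Real.norm_of_nonneg hρ.le, dist_eq_norm]
              rw [inv_mul_eq_div, lt_div_iff₀ hρ]
            by_cases hx : x ∈ (Metric.closedBall c (X * ρ))ᶜ
            · simp only [Set.indicator_of_mem hx, Set.indicator_of_mem (hiff.1 hx)]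
            · simp only [Set.indicator_of_notMem hx, Set.indicator_of_notMem (hiff.not.1 hx)]
        _ = ENNReal.ofReal (M ^ 2 * B) * (ENNReal.ofReal (ρ ^ 2) *
              ∫⁻ q in {q : Plane | X < ‖q‖}, ‖Φ q‖ₑ) := by
            rw [lintegral_sub_right_eq_self
              (fun v => Set.indicator {q : Plane | X < ‖q‖} (fun q => ‖Φ q‖ₑ) (ρ⁻¹ • v)),
              ← lintegral_indicator (measurableSet_lt measurable_const measurable_norm),
              ← lintegral_smul_plane (inv_pos.2 hρ)
                (Set.indicator {q : Plane | X < ‖q‖} (fun q => ‖Φ q‖ₑ)), ← mul_assoc (ENNReal.ofReal (ρ ^ 2)),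
              ← ENNReal.ofReal_mul (by positivity), inv_pow, mul_inv_cancel₀ (by positivity),
              ENNReal.ofReal_one, one_mul]
        _ ≤ ENNReal.ofReal (M ^ 2 * B) * (ENNReal.ofReal (ρ ^ 2) *
              ENNReal.ofReal (D / X ^ N)) := by gcongr; exact hD X hX
        _ = _ := by
            rw [← ENNReal.ofReal_mul (by positivity), ← ENNReal.ofReal_mul (by positivity),
              ← ENNReal.ofReal_mul (by positivity)]
            congr 1
            field_simp
  refine h1.trans ?_
  rw [ENNReal.ofReal_mul (by positivity), mul_assoc, mul_assoc]
  gcongr ENNReal.ofReal (κ⁻¹ ^ 2) * ?_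
  rw [← mul_assoc, mul_comm (ENNReal.ofReal (B ^ 2)), mul_assoc, Finset.mul_sum (a := ENNReal.ofReal (B ^ 2))]
  gcongr with i
  exact h3 i

/-- The local `L²` bound for the extension operator of a measure which is one-dimensional at scale
`1 / ρ`. -/
theorem exists_trace_bound :
    ∃ C : ℝ, 0 ≤ C ∧ ∀ (σ : Measure Plane) [IsFiniteMeasure σ] (f : Plane → ℂ), Measurable f →
      (∃ B, ∀ ζ, ‖f ζ‖ ≤ B) → ∀ (c : Plane) (ρ s : ℝ), 0 < ρ →
      (∀ η, σ (Metric.closedBall η (1 / ρ)) ≤ ENNReal.ofReal s) →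
      ∫⁻ x in Metric.closedBall c ρ, ‖extOp σ f x‖ₑ ^ 2 ≤
        ENNReal.ofReal (C * ρ ^ 2 * s) * ∫⁻ ζ, ‖f ζ‖ₑ ^ 2 ∂σ := by
  obtain ⟨χ, κ, hκ, hχ1, hχ0, hχκ⟩ := exists_window
  set I : ℝ := ∫ q, ‖χ q‖ with hI
  have hI0 : 0 ≤ I := integral_nonneg fun q => norm_nonneg _
  have hIe : ∫⁻ q, ‖χ q‖ₑ = ENNReal.ofReal I := by
    rw [hI, ofReal_integral_norm_eq_lintegral_enorm χ.integrable]
  refine ⟨κ⁻¹ ^ 2 * I, by positivity, ?_⟩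
  intro σ _ f hfm ⟨B, hB⟩ c ρ s hρ hs
  have hf : Integrable f σ := Integrable.of_bound hfm.aestronglyMeasurable B
    (Eventually.of_forall hB)
  have h1 := extOp_le_of_window (c := c) hκ hχκ hρ (fun x => ‖extOp σ f x‖ₑ)
  rw [lintegral_mollify hχ1 hf hρ] at h1
  refine h1.trans ?_
  have hw : ∀ η : Plane, Measurable fun ζ => ‖χ (ρ • (η - ζ))‖ₑ := fun η =>
    (χ.continuous.comp (by fun_prop : Continuous fun ζ => ρ • (η - ζ))).enorm.measurable
  -- Schur's test for the mollification: its kernel has mass at most `ρ ^ 2 s` with respect to `σ`,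
  -- by the bound on the measure of balls, and mass `I` with respect to Lebesgue measure.
  have h2 : ∀ η, ‖mollify χ σ c ρ f η‖ₑ ^ 2 ≤ ENNReal.ofReal (ρ ^ 2) * ENNReal.ofReal (ρ ^ 2) *
      (ENNReal.ofReal s * ∫⁻ ζ, ‖χ (ρ • (η - ζ))‖ₑ * ‖f ζ‖ₑ ^ 2 ∂σ) := by
    intro η
    have h3 : ‖mollify χ σ c ρ f η‖ₑ ≤
        ENNReal.ofReal (ρ ^ 2) * ∫⁻ ζ, ‖χ (ρ • (η - ζ))‖ₑ * ‖f ζ‖ₑ ∂σ := by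
      rw [← lintegral_const_mul' _ _ ENNReal.ofReal_ne_top]
      refine (enorm_integral_le_lintegral_enorm _).trans (le_of_eq (lintegral_congr fun ζ => ?_))
      simp only [enorm_mul, enorm_fourierChar_coe, mul_one]
      rw [← ofReal_norm ((ρ ^ 2 : ℝ) : ℂ), Complex.norm_real, Real.norm_of_nonneg (by positivity)]
      ring
    calc _ ≤ _ := pow_le_pow_left' h3 2
      _ = ENNReal.ofReal (ρ ^ 2) * ENNReal.ofReal (ρ ^ 2) *
          (∫⁻ ζ, ‖χ (ρ • (η - ζ))‖ₑ * ‖f ζ‖ₑ ∂σ) ^ 2 := by ring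
      _ ≤ _ := by
        gcongr
        refine (sq_lintegral_mul_le (hw η).aemeasurable hfm.enorm.aemeasurable).trans ?_
        gcongr
        calc ∫⁻ ζ, ‖χ (ρ • (η - ζ))‖ₑ ∂σ
            ≤ ∫⁻ ζ, (Metric.closedBall η (1 / ρ)).indicator 1 ζ ∂σ := by
              refine lintegral_mono fun ζ => ?_
              by_cases hζ : ζ ∈ Metric.closedBall η (1 / ρ)
              · rw [Set.indicator_of_mem hζ, Pi.one_apply, ← ofReal_norm, ENNReal.ofReal_le_one]
                exact hχ1 _
              · rw [hχ0]
                · simp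
                · rw [norm_smul, Real.norm_of_nonneg hρ.le]
                  simp only [Metric.mem_closedBall, not_le, dist_eq_norm] at hζ
                  rw [norm_sub_rev, div_lt_iff₀ hρ] at hζ
                  linarith
          _ ≤ _ := by
              rw [lintegral_indicator_one Metric.isClosed_closedBall.measurableSet]
              exact hs η
  have h4 : ENNReal.ofReal (ρ ^ 2) * ∫⁻ η, ∫⁻ ζ, ‖χ (ρ • (η - ζ))‖ₑ * ‖f ζ‖ₑ ^ 2 ∂σ =
      ENNReal.ofReal I * ∫⁻ ζ, ‖f ζ‖ₑ ^ 2 ∂σ := by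
    rw [lintegral_lintegral_swap, ← lintegral_const_mul' _ _ ENNReal.ofReal_ne_top,
      ← lintegral_const_mul' _ _ ENNReal.ofReal_ne_top]
    · refine lintegral_congr fun ζ => ?_
      rw [lintegral_mul_const]
      · rw [← mul_assoc, lintegral_sub_right_eq_self (fun v => ‖χ (ρ • v)‖ₑ) ζ,
          lintegral_smul_plane hρ (fun v => ‖χ v‖ₑ), hIe]
      · exact (χ.continuous.comp (by fun_prop : Continuous fun η => ρ • (η - ζ))).enorm.measurable
    · apply Measurable.aemeasurable
      exact Measurable.mul (f := fun p : Plane × Plane => ‖χ (ρ • (p.1 - p.2))‖ₑ)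
        (χ.continuous.comp
          (by fun_prop : Continuous fun p : Plane × Plane => ρ • (p.1 - p.2))).enorm.measurable
        ((hfm.comp measurable_snd).enorm.pow_const 2)
  calc ENNReal.ofReal (κ⁻¹ ^ 2) * ∫⁻ η, ‖mollify χ σ c ρ f η‖ₑ ^ 2
      ≤ ENNReal.ofReal (κ⁻¹ ^ 2) * ∫⁻ η, ENNReal.ofReal (ρ ^ 2) * ENNReal.ofReal (ρ ^ 2) *
      (ENNReal.ofReal s * ∫⁻ ζ, ‖χ (ρ • (η - ζ))‖ₑ * ‖f ζ‖ₑ ^ 2 ∂σ) := by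
        gcongr with η
        exact h2 η
    _ = ENNReal.ofReal (κ⁻¹ ^ 2) * ENNReal.ofReal (ρ ^ 2) * ENNReal.ofReal s *
        (ENNReal.ofReal (ρ ^ 2) * ∫⁻ η, ∫⁻ ζ, ‖χ (ρ • (η - ζ))‖ₑ * ‖f ζ‖ₑ ^ 2 ∂σ) := by
        rw [lintegral_const_mul' _ _ (by finiteness), lintegral_const_mul' _ _ (by finiteness)]
        ring
    _ = _ := by
        rw [h4, ← mul_assoc, ← ENNReal.ofReal_mul (by positivity)]
        rw [mul_assoc (ENNReal.ofReal (κ⁻¹ ^ 2 * ρ ^ 2)), mul_comm (ENNReal.ofReal s),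
          ← mul_assoc, ← ENNReal.ofReal_mul (by positivity), ← ENNReal.ofReal_mul (by positivity)]
        congr 2
        ring

/-! ### Scales -/

theorem scaleExp_mono (n ℓ : ℕ) {i j : ℕ} (h : i ≤ j) : scaleExp n ℓ i ≤ scaleExp n ℓ j := by
  unfold scaleExp
  gcongr
  norm_num

theorem scaleExp_self (n ℓ : ℕ) : scaleExp n ℓ n = ℓ := by
  unfold scaleExp
  exact Nat.mul_div_cancel _ (by positivity)

theorem scaleExp_le (n ℓ : ℕ) {j : ℕ} (h : j ≤ n) : scaleExp n ℓ j ≤ ℓ :=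
  (scaleExp_mono n ℓ h).trans (scaleExp_self n ℓ).le

theorem scaleExp_succ_le (n ℓ j : ℕ) : scaleExp n ℓ (j + 1) ≤ 2 * scaleExp n ℓ j + 1 := by
  unfold scaleExp
  have h1 : 0 < 2 ^ n := by positivity
  have h2 := Nat.div_add_mod (ℓ * 2 ^ j) (2 ^ n)
  have h3 := Nat.mod_lt (ℓ * 2 ^ j) h1
  rw [Nat.div_le_iff_le_mul_add_pred h1]
  rw [pow_succ]
  generalize ℓ * 2 ^ j / 2 ^ n = q at *
  generalize ℓ * 2 ^ j % 2 ^ n = r at *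
  rw [← mul_assoc, ← h2]
  generalize 2 ^ n = m at *
  have : m * (2 * q + 1) = m * q * 2 + m := by ring
  omega

/-- The side `ρ_j = r_j / R` of the cubes of level `j`. -/
def side (n ℓ j : ℕ) : ℝ := scale n ℓ j / 2 ^ ℓ

theorem side_pos (n ℓ j : ℕ) : 0 < side n ℓ j := by unfold side scale; positivity

theorem scale_pos (n ℓ j : ℕ) : 0 < scale n ℓ j := by unfold scale; positivity

theorem scale_mono (n ℓ : ℕ) {i j : ℕ} (h : i ≤ j) : scale n ℓ i ≤ scale n ℓ j :=
  pow_le_pow_right₀ (by norm_num) (scaleExp_mono n ℓ h)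

theorem side_mono (n ℓ : ℕ) {i j : ℕ} (h : i ≤ j) : side n ℓ i ≤ side n ℓ j :=
  div_le_div_of_nonneg_right (scale_mono n ℓ h) (by positivity)

theorem side_eq (n ℓ : ℕ) {j : ℕ} (h : j ≤ n) : side n ℓ j = ((2 : ℝ) ^ cubeExp n ℓ j)⁻¹ := by
  unfold side scale cubeExp
  have := scaleExp_le n ℓ h
  rw [div_eq_iff (by positivity), eq_inv_mul_iff_mul_eq₀ (by positivity), ← pow_add]
  congr 1; omega

theorem cubeExp_anti (n ℓ : ℕ) {i j : ℕ} (h : i ≤ j) : cubeExp n ℓ j ≤ cubeExp n ℓ i := by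
  unfold cubeExp
  have := scaleExp_mono n ℓ h
  omega

theorem side_self (n ℓ : ℕ) : side n ℓ n = 1 := by
  rw [side, scale, scaleExp_self, div_self (by positivity)]

theorem one_le_scale (n ℓ j : ℕ) : 1 ≤ scale n ℓ j := one_le_pow₀ (by norm_num)

theorem scale_succ_le (n ℓ j : ℕ) : scale n ℓ (j + 1) ≤ 2 * scale n ℓ j ^ 2 := by
  unfold scale
  calc (2 : ℝ) ^ scaleExp n ℓ (j + 1) ≤ 2 ^ (2 * scaleExp n ℓ j + 1) :=
        pow_le_pow_right₀ (by norm_num) (scaleExp_succ_le n ℓ j)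
    _ = _ := by rw [pow_succ, pow_mul']; ring

theorem side_le_one (n ℓ : ℕ) {j : ℕ} (h : j ≤ n) : side n ℓ j ≤ 1 :=
  (side_mono n ℓ h).trans (side_self n ℓ).le

/-! ### Dyadic cubes -/

theorem mem_dilatedCube_cubeIndex (p : ℕ) (x : Plane) : x ∈ dilatedCube 1 p (cubeIndex p x) := by
  intro l
  have h1 := Int.floor_le ((2 : ℝ) ^ p * x l)
  have h2 := Int.lt_floor_add_one ((2 : ℝ) ^ p * x l)
  have hp : (0 : ℝ) < 2 ^ p := by positivity
  simp only [cubeCenter, cubeIndex]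
  rw [← sub_div, ← add_div, div_le_iff₀ hp, lt_div_iff₀ hp]
  constructor <;> linarith

theorem abs_sub_cubeCenter_le {lam : ℝ} {p : ℕ} {k : Fin 2 → ℤ} {x : Plane}
    (hx : x ∈ dilatedCube lam p k) (l : Fin 2) :
    |x l - cubeCenter p k l| ≤ lam / 2 * ((2 : ℝ) ^ p)⁻¹ := by
  have := hx l
  rw [div_eq_mul_inv] at this
  rw [abs_le]
  constructor <;> linarith [this.1, this.2]

theorem cubeIndex_cubeCenter {p q : ℕ} (h : p ≤ q) (y : Plane) :
    cubeIndex p (cubeCenter q (cubeIndex q y)) = cubeIndex p y := by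
  obtain ⟨d, rfl⟩ := Nat.exists_eq_add_of_le h
  funext l
  simp only [cubeIndex, cubeCenter]
  set x := (2 : ℝ) ^ p * y l with hx
  have h1 : (2 : ℝ) ^ (p + d) * y l = 2 ^ d * x := by rw [hx, pow_add]; ring
  rw [h1]
  have hd : (0 : ℝ) < 2 ^ d := by positivity
  have h2 : (2 : ℝ) ^ p * (((⌊2 ^ d * x⌋ : ℝ) + 1 / 2) / 2 ^ (p + d)) =
      ((⌊2 ^ d * x⌋ : ℝ) + 1 / 2) / 2 ^ d := by
    rw [pow_add]; field_simp
  rw [h2, Int.floor_eq_iff, le_div_iff₀ hd, div_lt_iff₀ hd]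
  have h3 : (2 ^ d * ⌊x⌋ : ℤ) ≤ ⌊2 ^ d * x⌋ := by
    rw [Int.le_floor]
    push_cast
    exact mul_le_mul_of_nonneg_left (Int.floor_le x) hd.le
  have h4 : ⌊2 ^ d * x⌋ < (2 ^ d * (⌊x⌋ + 1) : ℤ) := by
    rw [Int.floor_lt]
    push_cast
    exact mul_lt_mul_of_pos_left (Int.lt_floor_add_one x) hd
  have h3' : ((2 : ℝ) ^ d * ⌊x⌋) ≤ ⌊2 ^ d * x⌋ := by exact_mod_cast h3
  have h4' : (⌊2 ^ d * x⌋ : ℝ) + 1 ≤ 2 ^ d * (⌊x⌋ + 1) := by exact_mod_cast h4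
  constructor <;> linarith

theorem cubeIndex_cubeCenter_self (p : ℕ) (k : Fin 2 → ℤ) :
    cubeIndex p (cubeCenter p k) = k := by
  funext l
  simp only [cubeIndex, cubeCenter]
  rw [mul_div_cancel₀ _ (by positivity), Int.floor_eq_iff]
  constructor <;> linarith

theorem measurable_cubeIndex (p : ℕ) : Measurable (cubeIndex p) := by
  unfold cubeIndex
  fun_prop

theorem measurableSet_dilatedCube (lam : ℝ) (p : ℕ) (k : Fin 2 → ℤ) :
    MeasurableSet (dilatedCube lam p k) := by
  unfold dilatedCube
  have : ∀ l : Fin 2, Measurable fun x : Plane => x l := fun l => by fun_prop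
  have h : {x : Plane | ∀ l, cubeCenter p k l - lam / 2 / (2 : ℝ) ^ p ≤ x l ∧
      x l < cubeCenter p k l + lam / 2 / (2 : ℝ) ^ p} = ⋂ l, {x : Plane |
      cubeCenter p k l - lam / 2 / (2 : ℝ) ^ p ≤ x l ∧
      x l < cubeCenter p k l + lam / 2 / (2 : ℝ) ^ p} := by
    ext x; simp
  rw [h]
  refine MeasurableSet.iInter fun l => ?_
  exact (measurableSet_le measurable_const (this l)).inter
    (measurableSet_lt (this l) measurable_const)

theorem tsum_indicator_dilatedCube_le {lam : ℝ} (hlam : 0 ≤ lam) (p : ℕ) (x : Plane) :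
    ∑' k, (dilatedCube lam p k).indicator (1 : Plane → ℝ≥0∞) x ≤
      ENNReal.ofReal ((lam + 1) ^ 2) := by
  set s : Finset (Fin 2 → ℤ) := Fintype.piFinset fun l =>
    Finset.Icc ⌈(2 : ℝ) ^ p * x l - 1 / 2 - lam / 2⌉ ⌊(2 : ℝ) ^ p * x l - 1 / 2 + lam / 2⌋ with hs
  have hmem : ∀ k, k ∉ s → (dilatedCube lam p k).indicator (1 : Plane → ℝ≥0∞) x = 0 := by
    intro k hk
    apply Set.indicator_of_notMem
    contrapose! hk
    rw [hs, Fintype.mem_piFinset]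
    intro l
    have := hk l
    have hp : (0 : ℝ) < 2 ^ p := by positivity
    simp only [cubeCenter] at this
    rw [← sub_div, ← add_div, div_le_iff₀ hp, lt_div_iff₀ hp] at this
    rw [Finset.mem_Icc, Int.ceil_le, Int.le_floor]
    constructor <;> linarith [this.1, this.2]
  rw [tsum_eq_sum (s := s) fun k hk => hmem k hk]
  calc ∑ k ∈ s, (dilatedCube lam p k).indicator (1 : Plane → ℝ≥0∞) x ≤ ∑ k ∈ s, 1 := by
        gcongr with k
        exact Set.indicator_le_self' (fun _ _ => zero_le) x
    _ = (s.card : ℝ≥0∞) := by simp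
    _ = ENNReal.ofReal (s.card : ℝ) := by simp
    _ ≤ _ := by
      apply ENNReal.ofReal_le_ofReal
      rw [hs, Fintype.card_piFinset, Fin.prod_univ_two, sq]
      push_cast
      have hc : ∀ l : Fin 2, ((Finset.Icc ⌈(2 : ℝ) ^ p * x l - 1 / 2 - lam / 2⌉
          ⌊(2 : ℝ) ^ p * x l - 1 / 2 + lam / 2⌋).card : ℝ) ≤ lam + 1 := by
        intro l
        rw [Int.card_Icc]
        have h1 := Int.floor_le ((2 : ℝ) ^ p * x l - 1 / 2 + lam / 2)
        have h2 := Int.le_ceil ((2 : ℝ) ^ p * x l - 1 / 2 - lam / 2)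
        set u := ⌊(2 : ℝ) ^ p * x l - 1 / 2 + lam / 2⌋
        set v := ⌈(2 : ℝ) ^ p * x l - 1 / 2 - lam / 2⌉
        by_cases h : 0 ≤ u + 1 - v
        · have : ((u + 1 - v).toNat : ℝ) = (u : ℝ) + 1 - v := by
            have := Int.toNat_of_nonneg h
            exact_mod_cast congrArg (fun z : ℤ => (z : ℝ)) this
          rw [this]; linarith
        · rw [Int.toNat_of_nonpos (by omega)]; push_cast; linarith
      exact mul_le_mul (hc 0) (hc 1) (by positivity) (by positivity)

/-- The bounded overlap of dilated cubes, in measure. -/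
theorem tsum_measure_dilatedCube_le (ν : Measure Plane) {lam : ℝ} (hlam : 0 ≤ lam) (p : ℕ)
    (S : Set (Fin 2 → ℤ)) {W : Set Plane}
    (hS : ∀ k ∈ S, dilatedCube lam p k ⊆ W) :
    ∑' k, S.indicator (fun k => ν (dilatedCube lam p k)) k ≤
      ENNReal.ofReal ((lam + 1) ^ 2) * ν W := by
  have h1 : ∀ k, S.indicator (fun k => ν (dilatedCube lam p k)) k ≤
      ∫⁻ x in W, (dilatedCube lam p k).indicator 1 x ∂ν := by
    intro k
    by_cases hk : k ∈ S
    · rw [Set.indicator_of_mem hk, lintegral_indicator_one (measurableSet_dilatedCube _ _ _),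
        Measure.restrict_apply (measurableSet_dilatedCube _ _ _),
        Set.inter_eq_left.2 (hS k hk)]
    · rw [Set.indicator_of_notMem hk]; exact zero_le
  calc _ ≤ ∑' k, ∫⁻ x in W, (dilatedCube lam p k).indicator 1 x ∂ν := ENNReal.tsum_le_tsum h1
    _ = ∫⁻ x in W, ∑' k, (dilatedCube lam p k).indicator 1 x ∂ν := by
      rw [lintegral_tsum]
      intro k
      exact (measurable_one.indicator (measurableSet_dilatedCube _ _ _)).aemeasurable
    _ ≤ ∫⁻ x in W, ENNReal.ofReal ((lam + 1) ^ 2) ∂ν := by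
      gcongr with x
      exact tsum_indicator_dilatedCube_le hlam p x
    _ = _ := by rw [setLIntegral_const]

/-! ### Caps -/

theorem norm_circlePoint_sub (α β : ℝ) :
    ‖circlePoint α - circlePoint β‖ = 2 * |Real.sin ((α - β) / 2)| := by
  rw [← sq_eq_sq₀ (norm_nonneg _) (by positivity), norm_sq_eq, mul_pow, sq_abs]
  simp only [PiLp.sub_apply, circlePoint_zero, circlePoint_one]
  have h1 : Real.sin ((α - β) / 2) ^ 2 = (1 - Real.cos (α - β)) / 2 := by
    rw [Real.sin_sq_eq_half_sub]; ring_nf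
  rw [h1, Real.cos_sub]
  linear_combination Real.cos_sq_add_sin_sq α + Real.cos_sq_add_sin_sq β

theorem norm_circlePoint_sub_le (α β : ℝ) : ‖circlePoint α - circlePoint β‖ ≤ |α - β| := by
  rw [norm_circlePoint_sub]
  have := Real.abs_sin_le_abs (x := (α - β) / 2)
  rw [abs_div, abs_of_pos (two_pos : (0 : ℝ) < 2)] at this
  linarith

theorem circlePoint_injOn {α β : ℝ} (hα : α ∈ Set.Ico 0 (2 * Real.pi))
    (hβ : β ∈ Set.Ico 0 (2 * Real.pi)) (h : circlePoint α = circlePoint β) : α = β := by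
  have h1 := norm_circlePoint_sub α β
  rw [h, sub_self, norm_zero] at h1
  have h2 : Real.sin ((α - β) / 2) = 0 := by
    rw [← abs_eq_zero]; linarith
  have h3 := (Real.sin_eq_zero_iff_of_lt_of_lt (by linarith [hα.1, hβ.2]) (by linarith [hα.2, hβ.1])).1 h2
  linarith

/-- The cap of level `a` containing the center of the `m`-th cap of the finer level `b`. -/
def capParent (a b : ℕ) (m : Fin (2 ^ b)) : Fin (2 ^ a) :=
  ⟨(m / 2 ^ (b - a)) % 2 ^ a, Nat.mod_lt _ (by positivity)⟩

theorem capParent_val {a b : ℕ} (h : a ≤ b) (m : Fin (2 ^ b)) :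
    (capParent a b m : ℕ) = m / 2 ^ (b - a) := by
  apply Nat.mod_eq_of_lt
  rw [Nat.div_lt_iff_lt_mul (by positivity), ← pow_add, Nat.add_sub_cancel' h]
  exact m.2

theorem capParent_capParent {a b c : ℕ} (hab : a ≤ b) (hbc : b ≤ c) (m : Fin (2 ^ c)) :
    capParent a b (capParent b c m) = capParent a c m := by
  apply Fin.ext
  rw [capParent_val hab, capParent_val hbc, capParent_val (hab.trans hbc), Nat.div_div_eq_div_mul,
    ← pow_add]
  congr 2; omega

theorem capParent_self (a : ℕ) (m : Fin (2 ^ a)) : capParent a a m = m := by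
  apply Fin.ext
  rw [capParent_val le_rfl]; simp

theorem capParent_spec {a b : ℕ} (h : a ≤ b) (m : Fin (2 ^ b)) :
    ((capParent a b m : ℕ) : ℝ) / 2 ^ a ≤ ((m : ℝ) + 1 / 2) / 2 ^ b ∧
      ((m : ℝ) + 1 / 2) / 2 ^ b < (((capParent a b m : ℕ) : ℝ) + 1) / 2 ^ a := by
  obtain ⟨d, rfl⟩ := Nat.exists_eq_add_of_le h
  rw [capParent_val h, Nat.add_sub_cancel_left]
  have h1 := Nat.div_add_mod (m : ℕ) (2 ^ d)
  have h2 := Nat.mod_lt (m : ℕ) (show 0 < 2 ^ d by positivity)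
  set q := (m : ℕ) / 2 ^ d
  have h3 : (2 : ℝ) ^ d * q ≤ m := by
    have : 2 ^ d * q ≤ (m : ℕ) := by omega
    exact_mod_cast this
  have h4 : (m : ℝ) + 1 ≤ 2 ^ d * q + 2 ^ d := by
    have : (m : ℕ) + 1 ≤ 2 ^ d * q + 2 ^ d := by omega
    exact_mod_cast this
  have hpow : (2 : ℝ) ^ (a + d) = 2 ^ a * 2 ^ d := pow_add _ _ _
  rw [hpow, div_le_div_iff₀ (by positivity) (by positivity),
    div_lt_div_iff₀ (by positivity) (by positivity)]
  have ha : (0 : ℝ) < 2 ^ a := by positivity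
  constructor <;> nlinarith

theorem capDir_mem_cap_iff {a b : ℕ} (h : a ≤ b) (m : Fin (2 ^ b)) (m' : Fin (2 ^ a)) :
    capDir b m ∈ cap a m' ↔ m' = capParent a b m := by
  have hspec := capParent_spec h m
  have hπ := Real.pi_pos
  have ha : (0 : ℝ) < 2 ^ a := by positivity
  have hb : (0 : ℝ) < 2 ^ b := by positivity
  constructor
  · rintro ⟨α, ⟨hα1, hα2⟩, hα⟩
    have hm' : ((m' : ℕ) : ℝ) + 1 ≤ 2 ^ a := by exact_mod_cast m'.2
    have hm : ((m : ℕ) : ℝ) + 1 ≤ 2 ^ b := by exact_mod_cast m.2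
    have hα' : α = 2 * Real.pi * ((m : ℝ) + 1 / 2) / 2 ^ b := by
      refine circlePoint_injOn ⟨le_trans (by positivity) hα1, hα2.trans_le ?_⟩
        ⟨by positivity, ?_⟩ hα
      · rw [div_le_iff₀ ha]; nlinarith
      · rw [div_lt_iff₀ hb]; nlinarith
    rw [hα', mul_div_assoc, mul_div_assoc] at hα1 hα2
    have h1 := le_of_mul_le_mul_left hα1 (by positivity)
    have h2 := lt_of_mul_lt_mul_left hα2 (by positivity)
    have h3 := lt_of_le_of_lt h1 hspec.2
    have h4 := lt_of_le_of_lt hspec.1 h2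
    rw [div_lt_div_iff_of_pos_right ha] at h3 h4
    have h3' : (m' : ℕ) < (capParent a b m : ℕ) + 1 := by exact_mod_cast h3
    have h4' : (capParent a b m : ℕ) < (m' : ℕ) + 1 := by exact_mod_cast h4
    apply Fin.ext; omega
  · rintro rfl
    refine ⟨_, ⟨?_, ?_⟩, rfl⟩
    · rw [mul_div_assoc, mul_div_assoc]
      exact mul_le_mul_of_nonneg_left hspec.1 (by positivity)
    · rw [mul_div_assoc, mul_div_assoc]
      exact mul_lt_mul_of_pos_left hspec.2 (by positivity)

@[simp] theorem norm_capDir (a : ℕ) (m : Fin (2 ^ a)) : ‖capDir a m‖ = 1 := norm_circlePoint _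

theorem norm_capDir_sub_capParent_le {a b : ℕ} (h : a ≤ b) (m : Fin (2 ^ b)) :
    ‖capDir b m - capDir a (capParent a b m)‖ ≤ 4 / 2 ^ a := by
  refine (norm_circlePoint_sub_le _ _).trans ?_
  have hspec := capParent_spec h m
  have hπ := Real.pi_pos
  have hπ4 := Real.pi_le_four
  have ha : (0 : ℝ) < 2 ^ a := by positivity
  have h1 : |((m : ℝ) + 1 / 2) / 2 ^ b - (((capParent a b m : ℕ) : ℝ) + 1 / 2) / 2 ^ a| ≤
      (1 / 2) / 2 ^ a := by
    have h5 := hspec.1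
    have h6 := hspec.2
    rw [add_div (((capParent a b m : ℕ) : ℝ))] at h6
    rw [add_div (((capParent a b m : ℕ) : ℝ))]
    have h7 : (1 : ℝ) / 2 ^ a = 1 / 2 / 2 ^ a + 1 / 2 / 2 ^ a := by ring
    rw [abs_le]
    constructor <;> linarith
  rw [mul_div_assoc, mul_div_assoc, ← mul_sub, abs_mul, abs_of_pos (by positivity)]
  calc 2 * Real.pi * _ ≤ 2 * Real.pi * ((1 / 2) / 2 ^ a) := by gcongr
    _ = Real.pi / 2 ^ a := by ring
    _ ≤ _ := by gcongr

theorem two_mul_min_le_abs_sin {x : ℝ} (hx : |x| < 1) :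
    2 * min |x| (1 - |x|) ≤ |Real.sin (Real.pi * x)| := by
  have hπ := Real.pi_pos
  have h1 : |Real.sin (Real.pi * x)| = Real.sin (Real.pi * |x|) := by
    rcases abs_cases x with ⟨h, h'⟩ | ⟨h, h'⟩
    · rw [h] at hx ⊢
      exact abs_of_nonneg (Real.sin_nonneg_of_nonneg_of_le_pi (by positivity) (by nlinarith))
    · rw [h] at hx ⊢
      rw [mul_neg, Real.sin_neg]
      apply abs_of_nonpos
      have := Real.sin_nonneg_of_nonneg_of_le_pi (x := Real.pi * -x) (by nlinarith) (by nlinarith)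
      rw [mul_neg, Real.sin_neg] at this
      linarith
  rw [h1]
  have hx0 := abs_nonneg x
  rcases le_total |x| (1 / 2) with h | h
  · have h2 := Real.mul_le_sin (x := Real.pi * |x|) (by positivity) (by nlinarith)
    have h3 : 2 / Real.pi * (Real.pi * |x|) = 2 * |x| := by field_simp
    rw [h3] at h2
    exact le_trans (by gcongr; exact min_le_left _ _) h2
  · have h2 := Real.mul_le_sin (x := Real.pi * (1 - |x|)) (by nlinarith) (by nlinarith)
    have h3 : 2 / Real.pi * (Real.pi * (1 - |x|)) = 2 * (1 - |x|) := by field_simp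
    have h4 : Real.pi * (1 - |x|) = Real.pi - Real.pi * |x| := by ring
    rw [h3, h4, Real.sin_pi_sub] at h2
    exact le_trans (by gcongr; exact min_le_right _ _) h2

/-- Only boundedly many caps of a given level are within a bounded multiple of their length. -/
theorem ncard_near_caps_le (c a : ℕ) (m : Fin (2 ^ a)) :
    Set.ncard {m' : Fin (2 ^ a) | ‖capDir a m - capDir a m'‖ ≤ c / 2 ^ a} ≤ 3 * (2 * c + 1) := by
  set P : ℤ := 2 ^ a with hP
  set s : Finset ℤ := Finset.Icc (-(c : ℤ)) c ∪ Finset.Icc (P - c) (P + c) ∪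
    Finset.Icc (-P - c) (-P + c) with hs
  have hcard : s.card ≤ 3 * (2 * c + 1) := by
    refine (Finset.card_union_le _ _).trans ?_
    have := Finset.card_union_le (Finset.Icc (-(c : ℤ)) c) (Finset.Icc (P - c) (P + c))
    simp only [Int.card_Icc] at this ⊢
    omega
  refine le_trans ?_ hcard
  rw [← Set.ncard_coe_finset]
  refine Set.ncard_le_ncard_of_injOn (fun m' => ((m : ℕ) : ℤ) - ((m' : ℕ) : ℤ)) ?_ ?_
    (Finset.finite_toSet _)
  · intro m' hm'
    have ha : (0 : ℝ) < 2 ^ a := by positivity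
    set d : ℤ := ((m : ℕ) : ℤ) - ((m' : ℕ) : ℤ) with hd
    simp only [Set.mem_ofPred_eq, capDir, norm_circlePoint_sub] at hm'
    have h1 : (2 * Real.pi * ((m : ℝ) + 1 / 2) / 2 ^ a -
        2 * Real.pi * ((m' : ℝ) + 1 / 2) / 2 ^ a) / 2 = Real.pi * ((d : ℝ) / 2 ^ a) := by
      rw [hd]; push_cast; field_simp; ring
    rw [h1] at hm'
    have hdlt : |(d : ℝ)| < 2 ^ a := by
      have h2 : ((m : ℕ) : ℤ) < P := by rw [hP]; exact_mod_cast m.2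
      have h3 : ((m' : ℕ) : ℤ) < P := by rw [hP]; exact_mod_cast m'.2
      have : |d| < P := by rw [abs_lt]; omega
      rw [hP] at this
      exact_mod_cast this
    have h4 := two_mul_min_le_abs_sin (x := (d : ℝ) / 2 ^ a) (by
      rw [abs_div, abs_of_pos ha, div_lt_one ha]; exact hdlt)
    rw [abs_div, abs_of_pos ha] at h4
    have h5 : 4 * min (|(d : ℝ)| / 2 ^ a) (1 - |(d : ℝ)| / 2 ^ a) ≤ c / 2 ^ a := by linarith
    have h6 : |(d : ℝ)| ≤ c ∨ (2 : ℝ) ^ a - |(d : ℝ)| ≤ c := by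
      have hc0 : (0 : ℝ) ≤ c := by positivity
      rcases min_choice (|(d : ℝ)| / 2 ^ a) (1 - |(d : ℝ)| / 2 ^ a) with h | h
      · left
        rw [h, ← mul_div_assoc, div_le_div_iff_of_pos_right ha] at h5
        linarith [abs_nonneg (d : ℝ)]
      · right
        rw [h, one_sub_div ha.ne', ← mul_div_assoc, div_le_div_iff_of_pos_right ha] at h5
        linarith
    have h7 : |d| ≤ (c : ℤ) ∨ P - |d| ≤ (c : ℤ) := by
      rw [hP]
      rcases h6 with h | h
      · left; exact_mod_cast h
      · right; exact_mod_cast h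
    have hdlt' : |d| < P := by rw [hP]; exact_mod_cast hdlt
    simp only [hs, Finset.coe_union, Finset.coe_Icc, Set.mem_union, Set.mem_Icc]
    change ((-(c : ℤ) ≤ d ∧ d ≤ c) ∨ (P - c ≤ d ∧ d ≤ P + c)) ∨ (-P - c ≤ d ∧ d ≤ -P + c)
    rcases abs_cases d with ⟨h, h'⟩ | ⟨h, h'⟩ <;> rw [h] at h7 hdlt' <;> omega
  · intro m1 _ m2 _ h
    simp only at h
    apply Fin.ext; omega

/-! ### Good directions at all scales -/

/-- The cap of level `j` that contains the direction of the fine cap `θ`. -/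
def anc {n ℓ : ℕ} (j : ℕ) (θ : FineCap n ℓ) : Fin (2 ^ scaleExp n ℓ j) :=
  capParent (scaleExp n ℓ j) (scaleExp n ℓ (n - 1)) θ

/-- The index of the cube of level `j + 1` that contains the cube of level `j` and index `k`. -/
def parentCube (n ℓ j : ℕ) (k : Fin 2 → ℤ) : Fin 2 → ℤ :=
  cubeIndex (cubeExp n ℓ (j + 1)) (cubeCenter (cubeExp n ℓ j) k)

/-- The fine cap `θ` is good for the cube of level `j` and index `k`: at every level `i ≥ j`, the
cap containing `θ` is not bad for the cube containing the given one. -/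
def IsGood (ν : Measure Plane) (t : ℝ) (n ℓ j : ℕ) (k : Fin 2 → ℤ) (θ : FineCap n ℓ) : Prop :=
  ∀ i, j ≤ i → i < n → ¬ IsBadCap ν t n ℓ i
    (cubeIndex (cubeExp n ℓ i) (cubeCenter (cubeExp n ℓ j) k)) (anc i θ)

theorem isGood_zero_iff (ν : Measure Plane) (t : ℝ) (n ℓ : ℕ) (k : Fin 2 → ℤ) (θ : FineCap n ℓ) :
    IsGood ν t n ℓ 0 k θ ↔ ¬ ∃ j, j < n ∧ InBadCap ν t n ℓ j k θ := by
  simp only [IsGood, InBadCap, not_exists, not_and]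
  have key : ∀ i, i < n → ∀ m, fineDir θ ∈ cap (scaleExp n ℓ i) m ↔ m = anc i θ := fun i hi m =>
    capDir_mem_cap_iff (scaleExp_mono n ℓ (by omega)) θ m
  constructor
  · intro h i hi m hm hθ
    rw [(key i hi m).1 hθ] at hm
    exact h i (Nat.zero_le _) hi hm
  · intro h i _ hi hbad
    exact h i hi _ hbad ((key i hi _).2 rfl)

theorem isGood_succ_iff {ν : Measure Plane} {t : ℝ} {n ℓ j : ℕ} (hj : j < n) (k : Fin 2 → ℤ)
    (θ : FineCap n ℓ) : IsGood ν t n ℓ j k θ ↔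
      ¬ IsBadCap ν t n ℓ j k (anc j θ) ∧ IsGood ν t n ℓ (j + 1) (parentCube n ℓ j k) θ := by
  have hnest : ∀ i, j + 1 ≤ i → cubeIndex (cubeExp n ℓ i) (cubeCenter (cubeExp n ℓ (j + 1))
      (parentCube n ℓ j k)) = cubeIndex (cubeExp n ℓ i) (cubeCenter (cubeExp n ℓ j) k) :=
    fun i hi => cubeIndex_cubeCenter (cubeExp_anti n ℓ hi) _
  constructor
  · intro h
    refine ⟨?_, fun i hji hi => ?_⟩
    · have := h j le_rfl hj
      rwa [cubeIndex_cubeCenter_self] at this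
    · rw [hnest i hji]; exact h i (by omega) hi
  · rintro ⟨h1, h2⟩ i hji hi
    rcases hji.eq_or_lt with rfl | hlt
    · rwa [cubeIndex_cubeCenter_self]
    · rw [← hnest i hlt]; exact h2 i hlt hi

section parts

variable (ν : Measure Plane) (t : ℝ) {n ℓ : ℕ} (f : FineCap n ℓ → Plane → ℂ)

open Classical in
/-- The part of `∑_θ f_θ` coming from the fine caps in the `r_j⁻¹`-cap `τ` that are good for the
cube of level `i` and index `k`. -/
def goodPart (i j : ℕ) (τ : Fin (2 ^ scaleExp n ℓ j)) (k : Fin 2 → ℤ) (ζ : Plane) : ℂ :=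
  ∑ θ, if anc j θ = τ ∧ IsGood ν t n ℓ i k θ then f θ ζ else 0

open Classical in
theorem goodPart_self {j : ℕ} (hj : j < n) (τ : Fin (2 ^ scaleExp n ℓ j)) (k : Fin 2 → ℤ) :
    goodPart ν t f j j τ k = if IsBadCap ν t n ℓ j k τ then 0 else
      goodPart ν t f (j + 1) j τ (parentCube n ℓ j k) := by
  funext ζ
  split_ifs with hbad
  · refine Finset.sum_eq_zero fun θ _ => if_neg ?_
    rintro ⟨rfl, h⟩
    exact ((isGood_succ_iff hj k θ).1 h).1 hbad
  · refine Finset.sum_congr rfl fun θ _ => ?_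
    congr 1
    apply propext
    refine and_congr_right fun h => ?_
    rw [isGood_succ_iff hj, h]
    simp [hbad]

theorem anc_anc {i j : ℕ} (hij : i ≤ j) (hj : j < n) (θ : FineCap n ℓ) :
    capParent (scaleExp n ℓ i) (scaleExp n ℓ j) (anc j θ) = anc i θ :=
  capParent_capParent (scaleExp_mono n ℓ hij) (scaleExp_mono n ℓ (by omega)) θ

theorem goodPart_eq_sum {j : ℕ} (hj : j + 1 < n) (τ : Fin (2 ^ scaleExp n ℓ j)) (k : Fin 2 → ℤ)
    (ζ : Plane) : goodPart ν t f (j + 1) j τ k ζ = ∑ τ' : Fin (2 ^ scaleExp n ℓ (j + 1)),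
      if capParent (scaleExp n ℓ j) (scaleExp n ℓ (j + 1)) τ' = τ then
        goodPart ν t f (j + 1) (j + 1) τ' k ζ else 0 := by
  classical
  have h1 : ∀ τ' : Fin (2 ^ scaleExp n ℓ (j + 1)),
      (if capParent (scaleExp n ℓ j) (scaleExp n ℓ (j + 1)) τ' = τ then
        goodPart ν t f (j + 1) (j + 1) τ' k ζ else 0) =
      ∑ θ, if anc (j + 1) θ = τ' then (if anc j θ = τ ∧ IsGood ν t n ℓ (j + 1) k θ then
        f θ ζ else 0) else 0 := by
    intro τ'
    split_ifs with h
    · refine Finset.sum_congr rfl fun θ _ => ?_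
      by_cases h1 : anc (j + 1) θ = τ'
      · have h2 : anc j θ = τ := by rw [← anc_anc (Nat.le_succ j) hj, h1, h]
        simp [h1, h2]
      · simp [h1]
    · symm
      refine Finset.sum_eq_zero fun θ _ => ?_
      split_ifs with h1 h2
      · exact absurd (by rw [← h1, anc_anc (Nat.le_succ j) hj]; exact h2.1) h
      · rfl
      · rfl
  simp_rw [h1]
  rw [Finset.sum_comm]
  simp only [goodPart, Finset.sum_ite_eq, Finset.mem_univ, if_true]

theorem goodPart_top (θ : FineCap n ℓ) (k : Fin 2 → ℤ) :
    goodPart ν t f n (n - 1) θ k = f θ := by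
  classical
  funext ζ
  have h1 : ∀ θ' : FineCap n ℓ, anc (n - 1) θ' = θ' := fun θ' => capParent_self _ _
  have h2 : ∀ θ', IsGood ν t n ℓ n k θ' := fun θ' i h1 h2 => absurd h2 (by omega)
  simp [goodPart, h1, h2]

open Classical in
theorem sum_good_eq (k : Fin 2 → ℤ) (ζ : Plane) :
    ∑ θ, (if IsGood ν t n ℓ 0 k θ then f θ ζ else 0) =
      ∑ τ : Fin (2 ^ scaleExp n ℓ 0), goodPart ν t f 0 0 τ k ζ := by
  simp only [goodPart]
  rw [Finset.sum_comm]
  refine Finset.sum_congr rfl fun θ _ => ?_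
  by_cases h : IsGood ν t n ℓ 0 k θ <;> simp [h]

theorem norm_goodPart_le (i j : ℕ) (τ : Fin (2 ^ scaleExp n ℓ j)) (k : Fin 2 → ℤ) (ζ : Plane) :
    ‖goodPart ν t f i j τ k ζ‖ ≤ ∑ θ, ‖f θ ζ‖ := by
  refine (norm_sum_le _ _).trans (Finset.sum_le_sum fun θ _ => ?_)
  split_ifs <;> simp

theorem exists_of_goodPart_ne_zero {i j : ℕ} {τ : Fin (2 ^ scaleExp n ℓ j)} {k : Fin 2 → ℤ}
    {ζ : Plane} (h : goodPart ν t f i j τ k ζ ≠ 0) : ∃ θ, anc j θ = τ ∧ f θ ζ ≠ 0 := by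
  obtain ⟨θ, _, hθ⟩ := Finset.exists_ne_zero_of_sum_ne_zero h
  split_ifs at hθ with h1
  · exact ⟨θ, h1.1, hθ⟩
  · exact absurd rfl hθ

theorem measurable_goodPart (hf : ∀ θ, Measurable (f θ)) (i j : ℕ)
    (τ : Fin (2 ^ scaleExp n ℓ j)) (k : Fin 2 → ℤ) : Measurable (goodPart ν t f i j τ k) := by
  refine Finset.measurable_sum _ fun θ _ => ?_
  split_ifs
  · exact hf θ
  · exact measurable_const

end parts

/-! ### Frequency pieces on a circle -/

/-- The data of the multiscale estimate at the scale `R = 2 ^ ℓ`: the functions `f_θ`, bounded by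
`1` in total, live on the circle of radius `lam`, comparable to `R`, and each of them near the
direction of the fine cap `θ`, within the multiple `A` of the length `R / r_{n-1}` (about `R ^ (1/2)`)
of an arc of the fine level. The measure `σ` has bounded mass and is one-dimensional, as is the arc
length of the circle divided by its radius. -/
structure IsFreqData (A : ℝ) (n ℓ : ℕ) (σ : Measure Plane) (lam : ℝ)
    (f : FineCap n ℓ → Plane → ℂ) : Prop where
  univ_le : σ Set.univ ≤ ENNReal.ofReal A
  le_lam : A⁻¹ * 2 ^ ℓ ≤ lam
  lam_le : lam ≤ A * 2 ^ ℓ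
  ball_le : ∀ (η : Plane) (s : ℝ), 0 < s →
    σ (Metric.closedBall η s) ≤ ENNReal.ofReal (A * s / 2 ^ ℓ)
  measurable : ∀ θ, Measurable (f θ)
  sum_le : ∀ ζ, ∑ θ, ‖f θ ζ‖ ≤ 1
  norm_eq : ∀ θ ζ, f θ ζ ≠ 0 → ‖ζ‖ = lam
  near : ∀ θ ζ, f θ ζ ≠ 0 → ‖ζ - lam • fineDir θ‖ ≤ A * (side n ℓ (n - 1))⁻¹

namespace IsFreqData

variable {A : ℝ} {n ℓ : ℕ} {σ : Measure Plane} {lam : ℝ} {f : FineCap n ℓ → Plane → ℂ}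

theorem isFiniteMeasure (h : IsFreqData A n ℓ σ lam f) : IsFiniteMeasure σ :=
  ⟨h.univ_le.trans_lt ENNReal.ofReal_lt_top⟩

theorem norm_goodPart_le_one (h : IsFreqData A n ℓ σ lam f) (ν : Measure Plane) (t : ℝ) (i j : ℕ)
    (τ : Fin (2 ^ scaleExp n ℓ j)) (k : Fin 2 → ℤ) (ζ : Plane) :
    ‖goodPart ν t f i j τ k ζ‖ ≤ 1 :=
  (norm_goodPart_le ν t f i j τ k ζ).trans (h.sum_le ζ)

theorem integrable_goodPart (h : IsFreqData A n ℓ σ lam f) (ν : Measure Plane) (t : ℝ) (i j : ℕ)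
    (τ : Fin (2 ^ scaleExp n ℓ j)) (k : Fin 2 → ℤ) :
    Integrable (goodPart ν t f i j τ k) σ := by
  have := h.isFiniteMeasure
  exact Integrable.of_bound (measurable_goodPart ν t f h.measurable i j τ k).aestronglyMeasurable 1
    (Eventually.of_forall (h.norm_goodPart_le_one ν t i j τ k))

theorem integral_norm_goodPart_le (h : IsFreqData A n ℓ σ lam f) (hA : 1 ≤ A) (ν : Measure Plane)
    (t : ℝ) (i j : ℕ) (τ : Fin (2 ^ scaleExp n ℓ j)) (k : Fin 2 → ℤ) :
    ∫ ζ, ‖goodPart ν t f i j τ k ζ‖ ∂σ ≤ A := by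
  have := h.isFiniteMeasure
  calc ∫ ζ, ‖goodPart ν t f i j τ k ζ‖ ∂σ ≤ ∫ _, (1 : ℝ) ∂σ :=
        integral_mono (h.integrable_goodPart ν t i j τ k).norm (integrable_const _)
          (h.norm_goodPart_le_one ν t i j τ k)
    _ = (σ Set.univ).toReal := by simp [Measure.real]
    _ ≤ A := ENNReal.toReal_le_of_le_ofReal (by linarith) h.univ_le

theorem lam_pos (h : IsFreqData A n ℓ σ lam f) (hA : 1 ≤ A) : 0 < lam :=
  lt_of_lt_of_le (by positivity) h.le_lam

theorem near_cap (h : IsFreqData A n ℓ σ lam f) (hA : 1 ≤ A) {ν : Measure Plane} {t : ℝ} {i j : ℕ}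
    (hj : j < n) {τ : Fin (2 ^ scaleExp n ℓ j)} {k : Fin 2 → ℤ} {ζ : Plane}
    (hζ : goodPart ν t f i j τ k ζ ≠ 0) :
    ‖ζ‖ = lam ∧ ‖ζ - lam • capDir (scaleExp n ℓ j) τ‖ ≤ 5 * A * (side n ℓ j)⁻¹ := by
  obtain ⟨θ, rfl, hθ⟩ := exists_of_goodPart_ne_zero ν t f hζ
  refine ⟨h.norm_eq θ ζ hθ, ?_⟩
  have hl := h.lam_pos hA
  have hj' : j ≤ n - 1 := by omega
  have h1 := h.near θ ζ hθ
  have h2 := norm_capDir_sub_capParent_le (scaleExp_mono n ℓ hj') θ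
  have h3 : (side n ℓ (n - 1))⁻¹ ≤ (side n ℓ j)⁻¹ :=
    inv_anti₀ (side_pos n ℓ j) (side_mono n ℓ hj')
  have h4 : lam * (4 / 2 ^ scaleExp n ℓ j) ≤ 4 * A * (side n ℓ j)⁻¹ := by
    rw [side, scale, inv_div]
    calc lam * (4 / 2 ^ scaleExp n ℓ j) ≤ (A * 2 ^ ℓ) * (4 / 2 ^ scaleExp n ℓ j) := by
          gcongr; exact h.lam_le
      _ = _ := by ring
  calc ‖ζ - lam • capDir (scaleExp n ℓ j) (anc j θ)‖
      = ‖(ζ - lam • fineDir θ) + lam • (fineDir θ - capDir (scaleExp n ℓ j) (anc j θ))‖ := by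
        congr 1; module
    _ ≤ ‖ζ - lam • fineDir θ‖ + lam * ‖fineDir θ - capDir (scaleExp n ℓ j) (anc j θ)‖ := by
        refine (norm_add_le _ _).trans ?_
        rw [norm_smul, Real.norm_of_nonneg hl.le]
    _ ≤ A * (side n ℓ j)⁻¹ + lam * (4 / 2 ^ scaleExp n ℓ j) := by
        gcongr
        · exact h1.trans (by gcongr)
        · exact h2
    _ ≤ _ := by linarith

/-- The part of the circle in a cap of level `j` lies in a rectangle whose sides are, up to constants,
the inverses of the length and the width of the tubes of this level: an arc of length `l = R / r_j` deviates from its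
tangent by `l ^ 2 / R`, which is at most `2 R / r_{j+1}` as `r_{j+1} ≤ 2 r_j ^ 2`. -/
theorem rectangle (h : IsFreqData A n ℓ σ lam f) (hA : 1 ≤ A) {ν : Measure Plane} {t : ℝ}
    {i j : ℕ} (hj : j < n) {τ : Fin (2 ^ scaleExp n ℓ j)} {k : Fin 2 → ℤ} {ζ : Plane}
    (hζ : goodPart ν t f i j τ k ζ ≠ 0) :
    |inner ℝ ζ (capDir (scaleExp n ℓ j) τ) - lam| ≤ 25 * A ^ 3 * (side n ℓ (j + 1))⁻¹ ∧
      |inner ℝ ζ (perp (capDir (scaleExp n ℓ j) τ))| ≤ 25 * A ^ 3 * (side n ℓ j)⁻¹ := by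
  obtain ⟨h1, h2⟩ := h.near_cap hA hj hζ
  set e := capDir (scaleExp n ℓ j) τ with he
  have hen : ‖e‖ = 1 := norm_capDir _ _
  have hl := h.lam_pos hA
  have hs := side_pos n ℓ j
  have hs' := side_pos n ℓ (j + 1)
  have h3 : ‖ζ - lam • e‖ ^ 2 = 2 * lam * (lam - inner ℝ ζ e) := by
    rw [norm_sub_sq_real, norm_smul, hen, inner_smul_right, h1, Real.norm_of_nonneg hl.le]
    ring
  have h4 : inner ℝ (ζ - lam • e) (perp e) = inner ℝ ζ (perp e) := by
    rw [inner_sub_left, inner_smul_left, inner_perp_self]; simp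
  constructor
  · have h5 : inner ℝ ζ e ≤ lam := by
      have := real_inner_le_norm ζ e
      rwa [hen, h1, mul_one] at this
    rw [abs_sub_comm, abs_of_nonneg (by linarith)]
    have h6 : 2 * lam * (lam - inner ℝ ζ e) ≤ (5 * A * (side n ℓ j)⁻¹) ^ 2 := by
      rw [← h3]; gcongr
    have h7 : 2 * (A⁻¹ * 2 ^ ℓ) * (lam - inner ℝ ζ e) ≤ (5 * A * (side n ℓ j)⁻¹) ^ 2 := by
      refine le_trans ?_ h6
      have := h.le_lam
      have : 0 ≤ lam - inner ℝ ζ e := by linarith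
      gcongr
    have hsc := scale_succ_le n ℓ j
    have hp := scale_pos n ℓ j
    have hp' := scale_pos n ℓ (j + 1)
    simp only [side, inv_div] at h7 ⊢
    have h8 : lam - inner ℝ ζ e ≤ 25 / 2 * A ^ 3 * (2 ^ ℓ / scale n ℓ j ^ 2) := by
      have : 2 * (A⁻¹ * 2 ^ ℓ) * (25 / 2 * A ^ 3 * (2 ^ ℓ / scale n ℓ j ^ 2)) =
          (5 * A * (2 ^ ℓ / scale n ℓ j)) ^ 2 := by
        field_simp; ring
      rw [← this] at h7
      exact le_of_mul_le_mul_left h7 (by positivity)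
    refine h8.trans ?_
    have h9 : (2 : ℝ) ^ ℓ / scale n ℓ j ^ 2 ≤ 2 * (2 ^ ℓ / scale n ℓ (j + 1)) := by
      rw [← mul_div_assoc, div_le_div_iff₀ (by positivity) hp']
      have : (0 : ℝ) < 2 ^ ℓ := by positivity
      nlinarith
    calc 25 / 2 * A ^ 3 * (2 ^ ℓ / scale n ℓ j ^ 2)
        ≤ 25 / 2 * A ^ 3 * (2 * (2 ^ ℓ / scale n ℓ (j + 1))) := by gcongr
      _ = _ := by ring
  · rw [← h4]
    refine (abs_real_inner_le_norm _ _).trans ?_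
    rw [norm_perp, hen, mul_one]
    refine h2.trans ?_
    have : A ≤ A ^ 3 := le_self_pow₀ hA (by norm_num)
    exact mul_le_mul_of_nonneg_right (by nlinarith) (by positivity)

end IsFreqData

theorem tube_mono {c e : Plane} {w w' L L' : ℝ} (hw : w ≤ w') (hL : L ≤ L') :
    tube c e w L ⊆ tube c e w' L' := by
  rintro x ⟨h1, h2⟩
  exact ⟨h1.trans (by linarith), h2.trans (by linarith)⟩

/-- The locally constant property for the pieces of level `j`. -/
theorem exists_locally_constant_goodPart (A : ℝ) (hA : 1 ≤ A) :
    ∃ C : ℝ, 0 ≤ C ∧ ∀ N : ℕ, ∃ D : ℝ, 0 ≤ D ∧ ∀ (n ℓ : ℕ) (σ : Measure Plane) (lam : ℝ)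
      (f : FineCap n ℓ → Plane → ℂ), IsFreqData A n ℓ σ lam f → ∀ (ν : Measure Plane) (t : ℝ)
      (i j : ℕ), j < n → ∀ (τ : Fin (2 ^ scaleExp n ℓ j)) (k : Fin 2 → ℤ) (X : ℝ), 1 ≤ X →
      ∀ y : Plane, ‖extOp σ (goodPart ν t f i j τ k) y‖ₑ ^ 2 ≤
        ENNReal.ofReal (C * (side n ℓ j * side n ℓ (j + 1))⁻¹) *
          (∫⁻ z in tube y (capDir (scaleExp n ℓ j) τ) (2 * (X * side n ℓ j))
            (2 * (X * side n ℓ (j + 1))), ‖extOp σ (goodPart ν t f i j τ k) z‖ₑ ^ 2) +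
          ENNReal.ofReal (D / X ^ N) := by
  obtain ⟨C, hC, hmain⟩ := exists_locally_constant
  refine ⟨C * (25 * A ^ 3) ^ 2, by positivity, fun N => ?_⟩
  obtain ⟨D, hD, hmain⟩ := hmain N
  refine ⟨D * A ^ 2, by positivity, ?_⟩
  intro n ℓ σ lam f h ν t i j hj τ k X hX y
  have := h.isFiniteMeasure
  have hs := side_pos n ℓ j
  have hs' := side_pos n ℓ (j + 1)
  have h1 := hmain σ _ (h.integrable_goodPart ν t i j τ k) (capDir (scaleExp n ℓ j) τ)
    (norm_capDir _ _) lam (25 * A ^ 3 * (side n ℓ (j + 1))⁻¹) (25 * A ^ 3 * (side n ℓ j)⁻¹) X A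
    (by positivity) (by positivity) hX (h.integral_norm_goodPart_le hA ν t i j τ k)
    (Eventually.of_forall fun ζ hζ => h.rectangle hA hj hζ) y
  refine h1.trans ?_
  have hA3 : 1 ≤ 25 * A ^ 3 := by nlinarith [one_le_pow₀ hA (n := 3)]
  have hX0 : 0 ≤ X := by linarith
  have hc : ∀ s : ℝ, 0 < s → X / (25 * A ^ 3 * s⁻¹) ≤ X * s := by
    intro s hs
    rw [div_le_iff₀ (by positivity)]
    calc X = X * s * (1 * s⁻¹) := by field_simp
      _ ≤ _ := by gcongr
  refine add_le_add (mul_le_mul' (ENNReal.ofReal_le_ofReal (le_of_eq ?_)) (lintegral_mono_set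
    (tube_mono (by gcongr; exact hc _ hs) (by gcongr; exact hc _ hs')))) le_rfl
  rw [mul_inv]; ring

/-- Local orthogonality of the pieces of level `j` on balls of radius at least `ρ_j`. -/
theorem exists_local_orthogonality_goodPart (A : ℝ) (hA : 1 ≤ A) :
    ∃ C : ℝ, 0 ≤ C ∧ ∀ N : ℕ, ∃ D : ℝ, 0 ≤ D ∧ ∀ (n ℓ : ℕ) (σ : Measure Plane) (lam : ℝ)
      (f : FineCap n ℓ → Plane → ℂ), IsFreqData A n ℓ σ lam f → ∀ (ν : Measure Plane) (t : ℝ)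
      (i j : ℕ), j < n → ∀ (s : Finset (Fin (2 ^ scaleExp n ℓ j))) (k : Fin 2 → ℤ) (c : Plane)
      (ρ X : ℝ), side n ℓ j ≤ ρ → 1 ≤ X →
      ∫⁻ x in Metric.closedBall c ρ, ‖∑ τ ∈ s, extOp σ (goodPart ν t f i j τ k) x‖ₑ ^ 2 ≤
        ENNReal.ofReal C * ∑ τ ∈ s, ((∫⁻ x in Metric.closedBall c (X * ρ),
          ‖extOp σ (goodPart ν t f i j τ k) x‖ₑ ^ 2) +
          ENNReal.ofReal (D * ρ ^ 2 / X ^ N)) := by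
  obtain ⟨C, hC, hmain⟩ := exists_local_orthogonality
  set c0 : ℕ := ⌈11 * A ^ 2⌉₊ with hc0
  refine ⟨C * (3 * (2 * c0 + 1) : ℕ), by positivity, fun N => ?_⟩
  obtain ⟨D, hD, hmain⟩ := hmain N
  refine ⟨D * A ^ 2, by positivity, ?_⟩
  intro n ℓ σ lam f h ν t i j hj s k c ρ X hρ hX
  have := h.isFiniteMeasure
  have hs := side_pos n ℓ j
  have hρ0 : 0 < ρ := lt_of_lt_of_le hs hρ
  have hl := h.lam_pos hA
  have hsum : ∀ F : Fin (2 ^ scaleExp n ℓ j) → ℂ, ∑ τ ∈ s, F τ = ∑ τ : s, F τ := fun F =>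
    (Finset.sum_coe_sort s F).symm
  have hsum' : ∀ F : Fin (2 ^ scaleExp n ℓ j) → ℝ≥0∞, ∑ τ ∈ s, F τ = ∑ τ : s, F τ := fun F =>
    (Finset.sum_coe_sort s F).symm
  have h1 := hmain σ s (fun τ => goodPart ν t f i j τ k)
    (fun τ => h.integrable_goodPart ν t i j τ k) c ρ X A (3 * (2 * c0 + 1)) hρ0 hX
    (fun τ => h.integral_norm_goodPart_le hA ν t i j τ k) (by
      intro τ
      refine le_trans ?_ (ncard_near_caps_le c0 (scaleExp n ℓ j) τ)
      refine Set.ncard_le_ncard_of_injOn (fun τ' : s => (τ' : Fin (2 ^ scaleExp n ℓ j))) ?_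
        (fun a _ b _ hab => Subtype.ext hab) (Set.toFinite _)
      rintro τ' ⟨ζ, ζ', hζ, hζ', hd⟩
      have h2 := (h.near_cap hA hj hζ).2
      have h3 := (h.near_cap hA hj hζ').2
      have h4 : 1 / ρ ≤ A * (side n ℓ j)⁻¹ := by
        rw [one_div]
        calc ρ⁻¹ ≤ (side n ℓ j)⁻¹ := inv_anti₀ hs hρ
          _ ≤ _ := le_mul_of_one_le_left (by positivity) hA
      set e := capDir (scaleExp n ℓ j) τ
      set e' := capDir (scaleExp n ℓ j) τ'
      have h5 : lam * ‖e - e'‖ ≤ 11 * A * (side n ℓ j)⁻¹ := by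
        calc lam * ‖e - e'‖ = ‖lam • (e - e')‖ := by
              rw [norm_smul, Real.norm_of_nonneg hl.le]
          _ = ‖(ζ' - lam • e') - (ζ - lam • e) + (ζ - ζ')‖ := by congr 1; module
          _ ≤ ‖ζ' - lam • e'‖ + ‖ζ - lam • e‖ + ‖ζ - ζ'‖ :=
              (norm_add_le _ _).trans (by gcongr; exact norm_sub_le _ _)
          _ ≤ _ := by linarith
      have h6 : A⁻¹ * 2 ^ ℓ * ‖e - e'‖ ≤ 11 * A * (side n ℓ j)⁻¹ :=
        le_trans (by gcongr; exact h.le_lam) h5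
      change ‖e - e'‖ ≤ c0 / 2 ^ scaleExp n ℓ j
      have h7 : ‖e - e'‖ ≤ 11 * A ^ 2 / 2 ^ scaleExp n ℓ j := by
        rw [side, scale, inv_div] at h6
        have h8 : A⁻¹ * 2 ^ ℓ * (11 * A ^ 2 / 2 ^ scaleExp n ℓ j) =
            11 * A * (2 ^ ℓ / 2 ^ scaleExp n ℓ j) := by field_simp
        rw [← h8] at h6
        exact le_of_mul_le_mul_left h6 (by positivity)
      exact h7.trans (by gcongr; exact Nat.le_ceil _))
  simp_rw [hsum, hsum']
  refine h1.trans ?_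
  rw [ENNReal.ofReal_mul hC, ENNReal.ofReal_natCast]
  rw [mul_right_comm D]

/-! ### From tubes to balls: the use of the bad caps -/

theorem norm_le_of_abs_le {x : Plane} {b : ℝ} (hb : ∀ l, |x l| ≤ b) : ‖x‖ ≤ 2 * b := by
  have h0 := hb 0
  have h1 := hb 1
  have hb0 : 0 ≤ b := (abs_nonneg _).trans h0
  have h := norm_sq_eq x
  have h2 : x 0 ^ 2 ≤ b ^ 2 := sq_le_sq' (abs_le.1 h0).1 (abs_le.1 h0).2
  have h3 : x 1 ^ 2 ≤ b ^ 2 := sq_le_sq' (abs_le.1 h1).1 (abs_le.1 h1).2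
  nlinarith [norm_nonneg x]

theorem abs_inner_le {x e : Plane} (he : ‖e‖ = 1) : |inner ℝ x e| ≤ ‖x‖ := by
  have := abs_real_inner_le_norm x e
  rwa [he, mul_one] at this

theorem norm_le_of_mem_tube {c e x : Plane} (he : ‖e‖ = 1) {w L : ℝ}
    (hx : x ∈ tube c e (2 * w) (2 * L)) : ‖x - c‖ ≤ w + L := by
  obtain ⟨h1, h2⟩ := hx
  have h := norm_sq_eq_inner he (x - c)
  rw [mul_div_cancel_left₀ _ (two_ne_zero' ℝ)] at h1 h2
  have h3 := abs_nonneg (inner ℝ (x - c) e)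
  have h4 := abs_nonneg (inner ℝ (x - c) (perp e))
  rw [← sq_abs (inner ℝ (x - c) e), ← sq_abs (inner ℝ (x - c) (perp e))] at h
  nlinarith [norm_nonneg (x - c)]

/-- The factor `R ^ (2 (j + 1) δ²)` by which the cubes of level `j` are dilated. At level `j + 1` it is
the dilation in the definition of the bad caps of level `j`. It grows with the level, so that a
dilated cube lies in its dilated parent (`dilatedCube_subset_parent`). -/
def dil (n ℓ j : ℕ) : ℝ := Rpow ℓ (2 * ((j : ℝ) + 1) * dlt n ^ 2)

theorem dlt_pos (n : ℕ) : 0 < dlt n := by unfold dlt; positivity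

theorem Rpow_pos (ℓ : ℕ) (x : ℝ) : 0 < Rpow ℓ x := by unfold Rpow; positivity

theorem Rpow_mono (ℓ : ℕ) {x y : ℝ} (h : x ≤ y) : Rpow ℓ x ≤ Rpow ℓ y :=
  Real.rpow_le_rpow_of_exponent_le (one_le_pow₀ (by norm_num)) h

theorem Rpow_zero (ℓ : ℕ) : Rpow ℓ 0 = 1 := Real.rpow_zero _

theorem Rpow_one (ℓ : ℕ) : Rpow ℓ 1 = 2 ^ ℓ := Real.rpow_one _

theorem Rpow_add (ℓ : ℕ) (x y : ℝ) : Rpow ℓ (x + y) = Rpow ℓ x * Rpow ℓ y :=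
  Real.rpow_add (by positivity) _ _

theorem Rpow_neg (ℓ : ℕ) (x : ℝ) : Rpow ℓ (-x) = (Rpow ℓ x)⁻¹ :=
  Real.rpow_neg (by positivity) _

theorem Rpow_mul_nat (ℓ : ℕ) (x : ℝ) (N : ℕ) : Rpow ℓ (x * N) = Rpow ℓ x ^ N := by
  rw [Rpow, Rpow, Real.rpow_mul (by positivity), Real.rpow_natCast]

theorem one_le_Rpow (ℓ : ℕ) {x : ℝ} (h : 0 ≤ x) : 1 ≤ Rpow ℓ x := by
  rw [← Rpow_zero ℓ]; exact Rpow_mono ℓ h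

theorem one_le_dil (n ℓ j : ℕ) : 1 ≤ dil n ℓ j :=
  one_le_Rpow ℓ (by positivity)

theorem dil_le_dil_succ (n ℓ j : ℕ) : dil n ℓ j ≤ dil n ℓ (j + 1) := by
  apply Rpow_mono
  push_cast
  gcongr
  linarith

theorem abs_cubeCenter_sub_le {n ℓ j : ℕ} (hj : j < n) (k : Fin 2 → ℤ) (l : Fin 2) :
    |cubeCenter (cubeExp n ℓ j) k l - cubeCenter (cubeExp n ℓ (j + 1)) (parentCube n ℓ j k) l| ≤
      (side n ℓ (j + 1) - side n ℓ j) / 2 := by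
  rw [side_eq n ℓ hj, side_eq n ℓ hj.le]
  simp only [parentCube, cubeIndex, cubeCenter]
  have hle := cubeExp_anti n ℓ (Nat.le_succ j)
  rw [Nat.succ_eq_add_one] at hle
  obtain ⟨d, hd⟩ := Nat.exists_eq_add_of_le hle
  rw [hd]
  set p := cubeExp n ℓ (j + 1)
  have h2 : (2 : ℝ) ^ p * (((k l : ℝ) + 1 / 2) / 2 ^ (p + d)) = ((k l : ℝ) + 1 / 2) / 2 ^ d := by
    rw [pow_add]; field_simp
  rw [h2]
  set m := ⌊((k l : ℝ) + 1 / 2) / 2 ^ d⌋ with hm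
  have hd0 : (0 : ℝ) < 2 ^ d := by positivity
  have h3 := Int.floor_le (((k l : ℝ) + 1 / 2) / 2 ^ d)
  have h4 := Int.lt_floor_add_one (((k l : ℝ) + 1 / 2) / 2 ^ d)
  rw [← hm, le_div_iff₀ hd0] at h3
  rw [← hm, div_lt_iff₀ hd0] at h4
  have h5 : m * 2 ^ d < k l + 1 := by
    have : ((m * 2 ^ d : ℤ) : ℝ) < ((k l + 1 : ℤ) : ℝ) := by push_cast; linarith
    exact_mod_cast this
  have h6 : k l < (m + 1) * 2 ^ d := by
    have : ((k l : ℤ) : ℝ) < (((m + 1) * 2 ^ d : ℤ) : ℝ) := by push_cast; linarith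
    exact_mod_cast this
  have h5' : (m : ℝ) * 2 ^ d ≤ k l := by exact_mod_cast Int.lt_add_one_iff.1 h5
  have h6' : (k l : ℝ) + 1 ≤ (m + 1) * 2 ^ d := by exact_mod_cast h6
  have e1 : ((k l : ℝ) + 1 / 2) / 2 ^ (p + d) - ((m : ℝ) + 1 / 2) / 2 ^ p =
      ((k l : ℝ) + 1 / 2 - ((m : ℝ) + 1 / 2) * 2 ^ d) / 2 ^ (p + d) := by
    rw [pow_add]; field_simp
  have e2 : (((2 : ℝ) ^ p)⁻¹ - (2 ^ (p + d))⁻¹) / 2 = ((2 ^ d - 1) / 2) / 2 ^ (p + d) := by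
    rw [pow_add]; field_simp
  rw [e1, e2, abs_div, abs_of_pos (by positivity : (0 : ℝ) < 2 ^ (p + d))]
  gcongr
  rw [abs_le]
  constructor <;> linarith

theorem dilatedCube_subset_parent {n ℓ j : ℕ} (hj : j < n) (k : Fin 2 → ℤ) :
    dilatedCube (dil n ℓ j) (cubeExp n ℓ j) k ⊆
      dilatedCube (dil n ℓ (j + 1)) (cubeExp n ℓ (j + 1)) (parentCube n ℓ j k) := by
  intro x hx l
  have h1 := hx l
  have h2 := abs_le.1 (abs_cubeCenter_sub_le (ℓ := ℓ) hj k l)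
  rw [div_eq_mul_inv, ← side_eq n ℓ hj.le] at h1
  rw [div_eq_mul_inv, ← side_eq n ℓ hj]
  have h3 := dil_le_dil_succ n ℓ j
  have h4 := one_le_dil n ℓ j
  have h5 := side_mono n ℓ (Nat.le_succ j)
  have h6 := side_pos n ℓ j
  have h7 : (dil n ℓ j - 1) * side n ℓ j ≤ (dil n ℓ (j + 1) - 1) * side n ℓ (j + 1) :=
    mul_le_mul (by linarith) h5 h6.le (by linarith)
  constructor <;> nlinarith [h1.1, h1.2, h2.1, h2.2]

theorem norm_sub_cubeCenter_le {n ℓ j : ℕ} (hj : j ≤ n) {lam : ℝ} {k : Fin 2 → ℤ} {x : Plane}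
    (hx : x ∈ dilatedCube lam (cubeExp n ℓ j) k) :
    ‖x - cubeCenter (cubeExp n ℓ j) k‖ ≤ lam * side n ℓ j := by
  have := norm_le_of_abs_le (x := x - cubeCenter (cubeExp n ℓ j) k)
    (b := lam / 2 * side n ℓ j) fun l => by
      rw [side_eq n ℓ hj]; exact abs_sub_cubeCenter_le hx l
  linarith

/-- If a cap is not bad for a collection of cubes of level `j` contained in one cube of level
`j + 1`, the total measure of those whose tubes meet at a point is small. -/
theorem tsum_measure_cubes_le (ν : Measure Plane) [IsFiniteMeasure ν] (t : ℝ) {n ℓ j : ℕ}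
    (hj : j < n) {Y : ℝ} (hY : 0 ≤ Y) (hYd : dil n ℓ j + 2 * Y ≤ Rpow ℓ (dlt n) / 2)
    (τ : Fin (2 ^ scaleExp n ℓ j)) (k' : Fin 2 → ℤ) (z : Plane) :
    ∑' k, {k | parentCube n ℓ j k = k' ∧ ¬ IsBadCap ν t n ℓ j k τ ∧
      z ∈ tube (cubeCenter (cubeExp n ℓ j) k) (capDir (scaleExp n ℓ j) τ) (2 * (Y * side n ℓ j))
        (2 * (Y * side n ℓ (j + 1)))}.indicator
          (fun k => ν (dilatedCube (dil n ℓ j) (cubeExp n ℓ j) k)) k ≤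
      (Metric.closedBall (cubeCenter (cubeExp n ℓ (j + 1)) k')
        ((2 * Y + 1) * side n ℓ (j + 1))).indicator (fun _ =>
        ENNReal.ofReal ((dil n ℓ j + 1) ^ 2) * (ENNReal.ofReal (Rpow ℓ (10 * dlt n) *
          (scale n ℓ j / scale n ℓ (j + 1)) ^ (min t 1)) *
          ν (dilatedCube (dil n ℓ (j + 1)) (cubeExp n ℓ (j + 1)) k'))) z := by
  set e := capDir (scaleExp n ℓ j) τ with he
  have hen : ‖e‖ = 1 := norm_capDir _ _
  have hpn : ‖perp e‖ = 1 := by rw [norm_perp, hen]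
  have hs := side_pos n ℓ j
  have hs' := side_mono n ℓ (Nat.le_succ j)
  rw [Nat.succ_eq_add_one] at hs'
  set S : Set (Fin 2 → ℤ) := {k | parentCube n ℓ j k = k' ∧ ¬ IsBadCap ν t n ℓ j k τ ∧
      z ∈ tube (cubeCenter (cubeExp n ℓ j) k) e (2 * (Y * side n ℓ j))
        (2 * (Y * side n ℓ (j + 1)))} with hS
  -- If the tubes of the cubes in question meet at `z`, all of these cubes lie in the tube
  -- `R ^ δ T` of any one `k₀` among them. The cap is not bad for `k₀`, which bounds the measure of
  -- the part of this tube in the dilated parent.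
  rcases S.eq_empty_or_nonempty with hemp | ⟨k₀, hk₀⟩
  · simp [hemp]
  obtain ⟨hpar, hnb, hz⟩ := hk₀
  have hzball : z ∈ Metric.closedBall (cubeCenter (cubeExp n ℓ (j + 1)) k')
      ((2 * Y + 1) * side n ℓ (j + 1)) := by
    rw [Metric.mem_closedBall, dist_eq_norm]
    have h1 := norm_le_of_mem_tube hen hz
    have h2 := norm_le_of_abs_le (x := cubeCenter (cubeExp n ℓ j) k₀ -
      cubeCenter (cubeExp n ℓ (j + 1)) (parentCube n ℓ j k₀)) (abs_cubeCenter_sub_le hj k₀)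
    rw [hpar] at h2
    calc ‖z - cubeCenter (cubeExp n ℓ (j + 1)) k'‖
        = ‖(z - cubeCenter (cubeExp n ℓ j) k₀) + (cubeCenter (cubeExp n ℓ j) k₀ -
          cubeCenter (cubeExp n ℓ (j + 1)) k')‖ := by congr 1; abel
      _ ≤ _ := norm_add_le _ _
      _ ≤ _ := by nlinarith
  rw [Set.indicator_of_mem hzball]
  set D' := dilatedCube (dil n ℓ (j + 1)) (cubeExp n ℓ (j + 1)) k' with hD'
  set T := tube (cubeCenter (cubeExp n ℓ j) k₀) e (Rpow ℓ (dlt n) * (scale n ℓ j / 2 ^ ℓ))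
    (Rpow ℓ (dlt n) * (scale n ℓ (j + 1) / 2 ^ ℓ)) with hT
  refine (tsum_measure_dilatedCube_le ν (by linarith [one_le_dil n ℓ j]) (cubeExp n ℓ j) S
    (W := D' ∩ T) ?_).trans ?_
  · rintro k ⟨hk1, -, hk3⟩
    refine Set.subset_inter ?_ ?_
    · rw [hD', ← hk1]; exact dilatedCube_subset_parent hj k
    · intro y hy
      have h1 := norm_sub_cubeCenter_le hj.le hy
      obtain ⟨h2, h3⟩ := hk3
      obtain ⟨h4, h5⟩ := hz
      rw [mul_div_cancel_left₀ _ (two_ne_zero' ℝ)] at h2 h3 h4 h5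
      have hdec : ∀ v : Plane, inner ℝ (y - cubeCenter (cubeExp n ℓ j) k₀) v =
          inner ℝ (y - cubeCenter (cubeExp n ℓ j) k) v - inner ℝ (z - cubeCenter (cubeExp n ℓ j) k) v
            + inner ℝ (z - cubeCenter (cubeExp n ℓ j) k₀) v := by
        intro v; simp only [inner_sub_left]; ring
      have htri : ∀ a b c : ℝ, |a - b + c| ≤ |a| + |b| + |c| := fun a b c =>
        (abs_add_le _ _).trans (by gcongr; exact abs_sub _ _)
      have hdil0 : 0 ≤ dil n ℓ j := by linarith [one_le_dil n ℓ j]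
      constructor
      · rw [hdec]
        refine (htri _ _ _).trans ?_
        have := (abs_inner_le (x := y - cubeCenter (cubeExp n ℓ j) k) hen).trans h1
        change _ ≤ Rpow ℓ (dlt n) * side n ℓ (j + 1) / 2
        have h6 : dil n ℓ j * side n ℓ j ≤ dil n ℓ j * side n ℓ (j + 1) := by gcongr
        have h7 : (dil n ℓ j + 2 * Y) * side n ℓ (j + 1) ≤ Rpow ℓ (dlt n) / 2 * side n ℓ (j + 1) := by
          gcongr
          exact (side_pos n ℓ (j + 1)).le
        linarith
      · rw [hdec]
        refine (htri _ _ _).trans ?_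
        have := (abs_inner_le (x := y - cubeCenter (cubeExp n ℓ j) k) hpn).trans h1
        change _ ≤ Rpow ℓ (dlt n) * side n ℓ j / 2
        have h7 : (dil n ℓ j + 2 * Y) * side n ℓ j ≤ Rpow ℓ (dlt n) / 2 * side n ℓ j := by
          gcongr
        linarith
  · gcongr ENNReal.ofReal ((dil n ℓ j + 1) ^ 2) * ?_
    rw [IsBadCap, not_lt] at hnb
    have hdil : Rpow ℓ (2 * ((j : ℝ) + 2) * dlt n ^ 2) = dil n ℓ (j + 1) := by
      rw [dil]; congr 1; push_cast; ring
    change ProbabilityTheory.cond ν (dilatedCube (Rpow ℓ (2 * ((j : ℝ) + 2) * dlt n ^ 2))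
      (cubeExp n ℓ (j + 1)) (parentCube n ℓ j k₀)) T ≤ _ at hnb
    rw [hdil, hpar, ← hD'] at hnb
    have hDm : MeasurableSet D' := measurableSet_dilatedCube _ _ _
    -- This holds also if the dilated parent is a null set, where the conditional measure is zero.
    rw [← ProbabilityTheory.cond_mul_eq_inter hDm]
    gcongr

section sums

variable (ν : Measure Plane) (t : ℝ) {n ℓ : ℕ} (σ : Measure Plane) (f : FineCap n ℓ → Plane → ℂ)

open Classical in
/-- The sum over the cubes of level `j`, weighted by `ν`, and over their good caps, of the integrals
of `|E g|²` over the tubes of the pair, `g` being the good part of the cap. -/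
def tubeSum (Y : ℝ) (j : ℕ) : ℝ≥0∞ :=
  ∑' k, ν (dilatedCube (dil n ℓ j) (cubeExp n ℓ j) k) * ∑ τ : Fin (2 ^ scaleExp n ℓ j),
    if IsBadCap ν t n ℓ j k τ then 0 else
      ∫⁻ z in tube (cubeCenter (cubeExp n ℓ j) k) (capDir (scaleExp n ℓ j) τ)
        (2 * (Y * side n ℓ j)) (2 * (Y * side n ℓ (j + 1))),
          ‖extOp σ (goodPart ν t f (j + 1) j τ (parentCube n ℓ j k)) z‖ₑ ^ 2

/-- The sum over the cubes of level `j + 1`, weighted by `ν`, and over the caps of level `j`, of the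
integrals of `|E g|²` over balls around the cubes. -/
def ballSum (P : ℝ) (j : ℕ) : ℝ≥0∞ :=
  ∑' k, ν (dilatedCube (dil n ℓ (j + 1)) (cubeExp n ℓ (j + 1)) k) *
    ∑ τ : Fin (2 ^ scaleExp n ℓ j),
      ∫⁻ z in Metric.closedBall (cubeCenter (cubeExp n ℓ (j + 1)) k) (P * side n ℓ (j + 1)),
        ‖extOp σ (goodPart ν t f (j + 1) j τ k) z‖ₑ ^ 2

/-- Passing from tubes to balls gains the factor that defines the bad caps. -/
theorem tubeSum_le_ballSum [IsFiniteMeasure ν] {j : ℕ} (hj : j < n) {Y : ℝ} (hY : 0 ≤ Y)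
    (hYd : dil n ℓ j + 2 * Y ≤ Rpow ℓ (dlt n) / 2)
    (hf : ∀ τ k, Integrable (goodPart ν t f (j + 1) j τ k) σ) :
    tubeSum ν t σ f Y j ≤ ENNReal.ofReal ((dil n ℓ j + 1) ^ 2 * (Rpow ℓ (10 * dlt n) *
      (scale n ℓ j / scale n ℓ (j + 1)) ^ (min t 1))) * ballSum ν t σ f (2 * Y + 1) j := by
  classical
  set g : Fin (2 ^ scaleExp n ℓ j) → (Fin 2 → ℤ) → Plane → ℝ≥0∞ := fun τ k' z =>
    ‖extOp σ (goodPart ν t f (j + 1) j τ k') z‖ₑ ^ 2 with hg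
  have hgm : ∀ τ k', Measurable (g τ k') := fun τ k' =>
    (continuous_extOp (hf τ k')).enorm.measurable.pow_const 2
  set D : (Fin 2 → ℤ) → ℝ≥0∞ := fun k => ν (dilatedCube (dil n ℓ j) (cubeExp n ℓ j) k) with hD
  set T : (Fin 2 → ℤ) → Fin (2 ^ scaleExp n ℓ j) → Set Plane := fun k τ =>
    tube (cubeCenter (cubeExp n ℓ j) k) (capDir (scaleExp n ℓ j) τ)
        (2 * (Y * side n ℓ j)) (2 * (Y * side n ℓ (j + 1))) with hT
  set S : Fin (2 ^ scaleExp n ℓ j) → (Fin 2 → ℤ) → Plane → Set (Fin 2 → ℤ) := fun τ k' z =>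
    {k | parentCube n ℓ j k = k' ∧ ¬ IsBadCap ν t n ℓ j k τ ∧ z ∈ T k τ} with hS
  have key : ∀ k τ, D k * (if IsBadCap ν t n ℓ j k τ then 0 else
      ∫⁻ z in T k τ, g τ (parentCube n ℓ j k) z) =
      ∑' k', ∫⁻ z, g τ k' z * (S τ k' z).indicator D k := by
    intro k τ
    rw [tsum_eq_single (parentCube n ℓ j k)]
    · split_ifs with hb
      · symm
        rw [mul_zero, lintegral_eq_zero_iff' ?_]
        · refine Eventually.of_forall fun z => ?_
          simp [hS, hb]
        · have : (fun z => g τ (parentCube n ℓ j k) z * (S τ (parentCube n ℓ j k) z).indicator D k)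
              = fun _ => 0 := by
            funext z; simp [hS, hb]
          rw [this]; exact aemeasurable_const
      · rw [← lintegral_indicator (measurableSet_tube _ _ _ _),
          ← lintegral_const_mul' _ _ (measure_ne_top _ _)]
        refine lintegral_congr fun z => ?_
        by_cases hz : z ∈ T k τ
        · rw [Set.indicator_of_mem hz, Set.indicator_of_mem (show k ∈ S τ _ z from ⟨rfl, hb, hz⟩),
            mul_comm]
        · rw [Set.indicator_of_notMem hz, Set.indicator_of_notMem, mul_zero, mul_zero]
          exact fun h => hz h.2.2
    · intro k' hk'
      have : ∀ z, g τ k' z * (S τ k' z).indicator D k = 0 := by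
        intro z
        rw [Set.indicator_of_notMem, mul_zero]
        exact fun h => hk' h.1.symm
      simp [this]
  have hmeas : ∀ τ k' k, AEMeasurable (fun z => g τ k' z * (S τ k' z).indicator D k) volume := by
    intro τ k' k
    have : (fun z => (S τ k' z).indicator D k) = Set.indicator (T k τ) (fun _ =>
        if parentCube n ℓ j k = k' ∧ ¬ IsBadCap ν t n ℓ j k τ then D k else 0) := by
      funext z
      by_cases hz : z ∈ T k τ
      · rw [Set.indicator_of_mem hz]
        by_cases h : parentCube n ℓ j k = k' ∧ ¬ IsBadCap ν t n ℓ j k τ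
        · rw [if_pos h, Set.indicator_of_mem]; exact ⟨h.1, h.2, hz⟩
        · rw [if_neg h, Set.indicator_of_notMem]; exact fun h' => h ⟨h'.1, h'.2.1⟩
      · rw [Set.indicator_of_notMem hz, Set.indicator_of_notMem]
        exact fun h => hz h.2.2
    exact ((hgm τ k').mul (by
      rw [this]; exact measurable_const.indicator (measurableSet_tube _ _ _ _))).aemeasurable
  set K : (Fin 2 → ℤ) → ℝ≥0∞ := fun k' => ENNReal.ofReal ((dil n ℓ j + 1) ^ 2) *
    (ENNReal.ofReal (Rpow ℓ (10 * dlt n) * (scale n ℓ j / scale n ℓ (j + 1)) ^ (min t 1)) *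
          ν (dilatedCube (dil n ℓ (j + 1)) (cubeExp n ℓ (j + 1)) k')) with hK
  have hpt : ∀ τ k', ∑' k, ∫⁻ z, g τ k' z * (S τ k' z).indicator D k ≤
      K k' * ∫⁻ z in Metric.closedBall (cubeCenter (cubeExp n ℓ (j + 1)) k')
        ((2 * Y + 1) * side n ℓ (j + 1)), g τ k' z := by
    intro τ k'
    rw [← lintegral_tsum (hmeas τ k')]
    simp_rw [ENNReal.tsum_mul_left]
    rw [← lintegral_indicator Metric.isClosed_closedBall.measurableSet,
      ← lintegral_const_mul' _ _ (by rw [hK]; finiteness)]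
    refine lintegral_mono fun z => ?_
    have h1 := tsum_measure_cubes_le ν t hj hY hYd τ k' z
    simp only
    refine (mul_le_mul_right h1 _).trans (le_of_eq ?_)
    by_cases hz : z ∈ Metric.closedBall (cubeCenter (cubeExp n ℓ (j + 1)) k')
        ((2 * Y + 1) * side n ℓ (j + 1))
    · rw [Set.indicator_of_mem hz, Set.indicator_of_mem hz, mul_comm]
    · rw [Set.indicator_of_notMem hz, Set.indicator_of_notMem hz, mul_zero, mul_zero]
  calc tubeSum ν t σ f Y j = ∑' k, ∑' τ, ∑' k', ∫⁻ z, g τ k' z * (S τ k' z).indicator D k := by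
        rw [tubeSum]
        refine tsum_congr fun k => ?_
        rw [Finset.mul_sum, tsum_fintype]
        exact Finset.sum_congr rfl fun τ _ => key k τ
    _ = ∑' k', ∑' τ, ∑' k, ∫⁻ z, g τ k' z * (S τ k' z).indicator D k := by
        rw [ENNReal.tsum_comm, ENNReal.tsum_comm (α := Fin 2 → ℤ)
          (β := Fin (2 ^ scaleExp n ℓ j))]
        exact tsum_congr fun τ => ENNReal.tsum_comm
    _ ≤ ∑' k', ∑' τ, K k' * ∫⁻ z in Metric.closedBall (cubeCenter (cubeExp n ℓ (j + 1)) k')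
        ((2 * Y + 1) * side n ℓ (j + 1)), g τ k' z :=
        ENNReal.tsum_le_tsum fun k' => ENNReal.tsum_le_tsum fun τ => hpt τ k'
    _ = _ := by
        rw [ballSum, ← ENNReal.tsum_mul_left]
        refine tsum_congr fun k' => ?_
        rw [ENNReal.tsum_mul_left, tsum_fintype, hK,
          ENNReal.ofReal_mul (p := (dil n ℓ j + 1) ^ 2) (by positivity)]
        simp only [hg]
        ring

end sums

/-! ### From balls to tubes: local orthogonality and local constancy -/

theorem volume_closedBall_le (c : Plane) {r : ℝ} (hr : 0 ≤ r) :
    volume (Metric.closedBall c r) ≤ ENNReal.ofReal (4 * r ^ 2) := by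
  rw [EuclideanSpace.volume_closedBall_fin_two, ← ENNReal.ofReal_pow hr]
  rw [← ENNReal.ofReal_mul (by positivity)]
  apply ENNReal.ofReal_le_ofReal
  nlinarith [Real.pi_le_four, sq_nonneg r]

theorem tube_subset_tube {c x e : Plane} (he : ‖e‖ = 1) {w L w' L' d : ℝ} (hx : ‖x - c‖ ≤ d)
    (hw : w + d ≤ w') (hL : L + d ≤ L') : tube x e (2 * w) (2 * L) ⊆ tube c e (2 * w') (2 * L') := by
  have hp : ‖perp e‖ = 1 := by rw [norm_perp, he]
  rintro z ⟨h1, h2⟩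
  rw [mul_div_cancel_left₀ _ (two_ne_zero' ℝ)] at h1 h2
  have hdec : ∀ v : Plane, inner ℝ (z - c) v = inner ℝ (z - x) v + inner ℝ (x - c) v := by
    intro v; simp only [inner_sub_left]; ring
  constructor
  · rw [mul_div_cancel_left₀ _ (two_ne_zero' ℝ), hdec]
    exact (abs_add_le _ _).trans (by linarith [abs_inner_le (x := x - c) he])
  · rw [mul_div_cancel_left₀ _ (two_ne_zero' ℝ), hdec]
    exact (abs_add_le _ _).trans (by linarith [abs_inner_le (x := x - c) hp])

/-- Local constancy integrated over a ball of radius `Q ρ_j`: the piece of a cap of level `j` has its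
square integral over the ball controlled by that over the tube with the same center, at the cost of
the ratio of the width and the length of the tube. -/
theorem exists_ball_le_tube (A : ℝ) (hA : 1 ≤ A) :
    ∃ C : ℝ, 0 ≤ C ∧ ∀ N : ℕ, ∃ D : ℝ, 0 ≤ D ∧ ∀ (n ℓ : ℕ) (σ : Measure Plane) (lam : ℝ)
      (f : FineCap n ℓ → Plane → ℂ), IsFreqData A n ℓ σ lam f → ∀ (ν : Measure Plane) (t : ℝ)
      (i j : ℕ), j < n → ∀ (τ : Fin (2 ^ scaleExp n ℓ j)) (k : Fin 2 → ℤ) (c : Plane)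
      (X Q Y : ℝ), 1 ≤ X → 0 ≤ Q → Q + X ≤ Y →
      ∫⁻ x in Metric.closedBall c (Q * side n ℓ j), ‖extOp σ (goodPart ν t f i j τ k) x‖ₑ ^ 2 ≤
        ENNReal.ofReal (C * Q ^ 2 * (side n ℓ j / side n ℓ (j + 1))) *
          (∫⁻ z in tube c (capDir (scaleExp n ℓ j) τ) (2 * (Y * side n ℓ j))
            (2 * (Y * side n ℓ (j + 1))), ‖extOp σ (goodPart ν t f i j τ k) z‖ₑ ^ 2) +
          ENNReal.ofReal (D * Q ^ 2 / X ^ N) := by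
  obtain ⟨C, hC, hmain⟩ := exists_locally_constant_goodPart A hA
  refine ⟨4 * C, by positivity, fun N => ?_⟩
  obtain ⟨D, hD, hmain⟩ := hmain N
  refine ⟨4 * D, by positivity, ?_⟩
  intro n ℓ σ lam f h ν t i j hj τ k c X Q Y hX hQ hY
  have hs := side_pos n ℓ j
  have hs' := side_pos n ℓ (j + 1)
  have hss := side_mono n ℓ (Nat.le_succ j)
  rw [Nat.succ_eq_add_one] at hss
  set e := capDir (scaleExp n ℓ j) τ
  have he : ‖e‖ = 1 := norm_capDir _ _
  set I := ∫⁻ z in tube c e (2 * (Y * side n ℓ j)) (2 * (Y * side n ℓ (j + 1))),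
    ‖extOp σ (goodPart ν t f i j τ k) z‖ₑ ^ 2 with hI
  calc ∫⁻ x in Metric.closedBall c (Q * side n ℓ j), ‖extOp σ (goodPart ν t f i j τ k) x‖ₑ ^ 2
      ≤ ∫⁻ x in Metric.closedBall c (Q * side n ℓ j),
        (ENNReal.ofReal (C * (side n ℓ j * side n ℓ (j + 1))⁻¹) * I +
          ENNReal.ofReal (D / X ^ N)) := by
        refine setLIntegral_mono' Metric.isClosed_closedBall.measurableSet fun x hx => ?_
        refine (hmain n ℓ σ lam f h ν t i j hj τ k X hX x).trans ?_
        gcongr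
        refine lintegral_mono_set (tube_subset_tube he (d := Q * side n ℓ j) ?_ ?_ ?_)
        · rwa [← dist_eq_norm]
        · nlinarith
        · nlinarith
    _ = (ENNReal.ofReal (C * (side n ℓ j * side n ℓ (j + 1))⁻¹) * I +
          ENNReal.ofReal (D / X ^ N)) * volume (Metric.closedBall c (Q * side n ℓ j)) := by
        rw [setLIntegral_const]
    _ ≤ (ENNReal.ofReal (C * (side n ℓ j * side n ℓ (j + 1))⁻¹) * I +
          ENNReal.ofReal (D / X ^ N)) * ENNReal.ofReal (4 * (Q * side n ℓ j) ^ 2) := by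
        gcongr
        exact volume_closedBall_le c (by positivity)
    _ ≤ _ := by
        rw [add_mul, mul_right_comm, ← ENNReal.ofReal_mul (by positivity),
          ← ENNReal.ofReal_mul (by positivity)]
        refine add_le_add (le_of_eq ?_) (ENNReal.ofReal_le_ofReal ?_)
        · congr 2; field_simp
        · have h1 : side n ℓ j ^ 2 ≤ 1 := pow_le_one₀ hs.le (side_le_one n ℓ hj.le)
          calc D / X ^ N * (4 * (Q * side n ℓ j) ^ 2)
              = 4 * D * Q ^ 2 / X ^ N * side n ℓ j ^ 2 := by ring
            _ ≤ 4 * D * Q ^ 2 / X ^ N * 1 := by gcongr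
            _ = _ := mul_one _

theorem extOp_zero (σ : Measure Plane) (y : Plane) : extOp σ 0 y = 0 := by
  simp [extOp]

theorem scale_le (n ℓ : ℕ) {j : ℕ} (hj : j ≤ n) : scale n ℓ j ≤ 2 ^ ℓ :=
  pow_le_pow_right₀ (by norm_num) (scaleExp_le n ℓ hj)

theorem tsum_measure_le (ν : Measure Plane) [IsProbabilityMeasure ν] (n ℓ j : ℕ) :
    ∑' k, ν (dilatedCube (dil n ℓ j) (cubeExp n ℓ j) k) ≤
      ENNReal.ofReal ((dil n ℓ j + 1) ^ 2) := by
  have := tsum_measure_dilatedCube_le ν (lam := dil n ℓ j) (by linarith [one_le_dil n ℓ j])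
    (cubeExp n ℓ j) Set.univ (W := Set.univ) (fun _ _ => Set.subset_univ _)
  simpa using this

/-- From balls to tubes: the piece of a cap of level `j` is split into those of its caps of level
`j + 1`, which are almost orthogonal on the ball. The bad ones among them do not occur, and local
constancy applies to the others. -/
theorem exists_ballSum_le_tubeSum (A : ℝ) (hA : 1 ≤ A) :
    ∃ C : ℝ, 0 ≤ C ∧ ∀ N : ℕ, ∃ D : ℝ, 0 ≤ D ∧ ∀ (n ℓ : ℕ) (σ : Measure Plane) (lam : ℝ)
      (f : FineCap n ℓ → Plane → ℂ), IsFreqData A n ℓ σ lam f → ∀ (ν : Measure Plane)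
      [IsProbabilityMeasure ν] (t : ℝ) (j : ℕ), j + 1 < n → ∀ (X P Y : ℝ), 1 ≤ X → 1 ≤ P →
      X * P + X ≤ Y →
      ballSum ν t σ f P j ≤
        ENNReal.ofReal (C * (X * P) ^ 2 * (side n ℓ (j + 1) / side n ℓ (j + 2))) *
          tubeSum ν t σ f Y (j + 1) +
          ENNReal.ofReal ((dil n ℓ (j + 1) + 1) ^ 2 * 2 ^ ℓ * D * (X * P) ^ 2 / X ^ N) := by
  classical
  obtain ⟨C, hC, hmain⟩ := exists_ball_le_tube A hA
  obtain ⟨C', hC', hmain'⟩ := exists_local_orthogonality_goodPart A hA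
  refine ⟨C' * C, by positivity, fun N => ?_⟩
  obtain ⟨D, hD, hmain⟩ := hmain N
  obtain ⟨D', hD', hmain'⟩ := hmain' N
  refine ⟨C' * (D' + D), by positivity, ?_⟩
  intro n ℓ σ lam f h ν _ t j hj X P Y hX hP hY
  have hs1 := side_pos n ℓ (j + 1)
  set c : (Fin 2 → ℤ) → Plane := fun k => cubeCenter (cubeExp n ℓ (j + 1)) k with hc
  set w : (Fin 2 → ℤ) → ℝ≥0∞ :=
    fun k => ν (dilatedCube (dil n ℓ (j + 1)) (cubeExp n ℓ (j + 1)) k) with hw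
  set B : (Fin 2 → ℤ) → Fin (2 ^ scaleExp n ℓ (j + 1)) → ℝ≥0∞ := fun k τ' =>
    if IsBadCap ν t n ℓ (j + 1) k τ' then 0 else
      ∫⁻ z in tube (c k) (capDir (scaleExp n ℓ (j + 1)) τ')
        (2 * (Y * side n ℓ (j + 1))) (2 * (Y * side n ℓ (j + 1 + 1))),
          ‖extOp σ (goodPart ν t f (j + 1 + 1) (j + 1) τ' (parentCube n ℓ (j + 1) k)) z‖ₑ ^ 2 with hB
  set a := C * (X * P) ^ 2 * (side n ℓ (j + 1) / side n ℓ (j + 2)) with ha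
  set E := (D' + D) * (X * P) ^ 2 / X ^ N with hE
  have hside2 := side_pos n ℓ (j + 2)
  have hX0 : 0 < X := by linarith
  have hP0 : 0 < P := by linarith
  have step1 : ∀ k, ∑ τ : Fin (2 ^ scaleExp n ℓ j),
      ∫⁻ z in Metric.closedBall (c k) (P * side n ℓ (j + 1)),
        ‖extOp σ (goodPart ν t f (j + 1) j τ k) z‖ₑ ^ 2 ≤
      ENNReal.ofReal C' * ∑ τ', (ENNReal.ofReal a * B k τ' + ENNReal.ofReal E) := by
    intro k
    have h1 : ∀ τ : Fin (2 ^ scaleExp n ℓ j),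
        ∫⁻ z in Metric.closedBall (c k) (P * side n ℓ (j + 1)),
          ‖extOp σ (goodPart ν t f (j + 1) j τ k) z‖ₑ ^ 2 ≤ ENNReal.ofReal C' *
        ∑ τ' ∈ Finset.univ.filter fun τ' : Fin (2 ^ scaleExp n ℓ (j + 1)) =>
          capParent (scaleExp n ℓ j) (scaleExp n ℓ (j + 1)) τ' = τ,
          (ENNReal.ofReal a * B k τ' + ENNReal.ofReal E) := by
      intro τ
      have h2 : goodPart ν t f (j + 1) j τ k = fun ζ =>
          ∑ τ' ∈ Finset.univ.filter fun τ' : Fin (2 ^ scaleExp n ℓ (j + 1)) =>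
            capParent (scaleExp n ℓ j) (scaleExp n ℓ (j + 1)) τ' = τ,
            goodPart ν t f (j + 1) (j + 1) τ' k ζ := by
        funext ζ
        rw [goodPart_eq_sum ν t f hj, Finset.sum_filter]
      have h3 : ∀ z, extOp σ (goodPart ν t f (j + 1) j τ k) z =
          ∑ τ' ∈ Finset.univ.filter fun τ' : Fin (2 ^ scaleExp n ℓ (j + 1)) =>
            capParent (scaleExp n ℓ j) (scaleExp n ℓ (j + 1)) τ' = τ,
            extOp σ (goodPart ν t f (j + 1) (j + 1) τ' k) z := by
        intro z
        rw [h2]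
        exact extOp_finset_sum _ (fun τ' _ => h.integrable_goodPart ν t _ _ τ' k) z
      simp_rw [h3]
      refine (hmain' n ℓ σ lam f h ν t (j + 1) (j + 1) hj _ k (c k) (P * side n ℓ (j + 1)) X
        (by nlinarith) hX).trans ?_
      refine mul_le_mul_right (Finset.sum_le_sum fun τ' _ => ?_) _
      have h4 : D' * (P * side n ℓ (j + 1)) ^ 2 / X ^ N ≤ D' * (X * P) ^ 2 / X ^ N := by
        have : P * side n ℓ (j + 1) ≤ X * P := by
          rw [mul_comm X]
          exact mul_le_mul_of_nonneg_left ((side_le_one n ℓ hj.le).trans hX) hP0.le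
        gcongr
      by_cases hb : IsBadCap ν t n ℓ (j + 1) k τ'
      · rw [goodPart_self ν t f hj, if_pos hb]
        simp only [extOp_zero, enorm_zero, ne_eq, OfNat.ofNat_ne_zero, not_false_eq_true, zero_pow,
          lintegral_zero, zero_add, hB, if_pos hb, mul_zero]
        apply ENNReal.ofReal_le_ofReal
        refine h4.trans ?_
        rw [hE]
        gcongr
        linarith
      · rw [goodPart_self ν t f hj, if_neg hb]
        have h5 := hmain n ℓ σ lam f h ν t (j + 1 + 1) (j + 1) hj τ' (parentCube n ℓ (j + 1) k)
          (c k) X (X * P) Y hX (by positivity) hY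
        rw [← mul_assoc X P]
        calc _ ≤ _ := add_le_add h5 (ENNReal.ofReal_le_ofReal h4)
          _ = _ := by
            rw [add_assoc, ← ENNReal.ofReal_add (by positivity) (by positivity)]
            simp only [hB, if_neg hb]
            congr 2
            rw [hE]; ring
    refine (Finset.sum_le_sum fun τ _ => h1 τ).trans (le_of_eq ?_)
    rw [← Finset.mul_sum, Finset.sum_fiberwise]
  have hcard : ((Finset.univ : Finset (Fin (2 ^ scaleExp n ℓ (j + 1)))).card : ℝ≥0∞) ≤
      ENNReal.ofReal (2 ^ ℓ) := by
    rw [Finset.card_univ, Fintype.card_fin, ← ENNReal.ofReal_natCast]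
    apply ENNReal.ofReal_le_ofReal
    push_cast
    exact scale_le n ℓ hj.le
  calc ballSum ν t σ f P j ≤ ∑' k, w k * (ENNReal.ofReal C' *
        ∑ τ', (ENNReal.ofReal a * B k τ' + ENNReal.ofReal E)) :=
        ENNReal.tsum_le_tsum fun k => mul_le_mul_right (step1 k) _
    _ ≤ ∑' k, (ENNReal.ofReal (C' * a) * (w k * ∑ τ', B k τ') +
          w k * ENNReal.ofReal (2 ^ ℓ * (C' * E))) := by
        refine ENNReal.tsum_le_tsum fun k => ?_
        rw [Finset.sum_add_distrib, ← Finset.mul_sum, Finset.sum_const, nsmul_eq_mul, mul_add,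
          mul_add, ENNReal.ofReal_mul hC']
        refine add_le_add (le_of_eq (by ring)) ?_
        gcongr
        rw [ENNReal.ofReal_mul (by positivity), ENNReal.ofReal_mul hC', mul_left_comm]
        gcongr
    _ = ENNReal.ofReal (C' * a) * tubeSum ν t σ f Y (j + 1) +
          (∑' k, w k) * ENNReal.ofReal (2 ^ ℓ * (C' * E)) := by
        rw [ENNReal.tsum_add, ENNReal.tsum_mul_left, ENNReal.tsum_mul_right]
        rfl
    _ ≤ _ := by
        refine add_le_add (le_of_eq ?_) ((mul_le_mul_left (tsum_measure_le ν n ℓ (j + 1)) _).trans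
          (le_of_eq ?_))
        · congr 2; rw [ha]; ring
        · rw [← ENNReal.ofReal_mul (by positivity)]
          congr 1; rw [hE]; ring

theorem lintegral_comp_cubeIndex (ν : Measure Plane) (p : ℕ) (H : (Fin 2 → ℤ) → ℝ≥0∞) :
    ∫⁻ y, H (cubeIndex p y) ∂ν = ∑' k, H k * ν (cubeIndex p ⁻¹' {k}) := by
  rw [← lintegral_map (measurable_of_countable H) (measurable_cubeIndex p),
    lintegral_countable']
  refine tsum_congr fun k => ?_
  rw [Measure.map_apply (measurable_cubeIndex p) (measurableSet_singleton k)]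

open Classical in
/-- At the smallest cubes: there are only `r_0 ≤ R ^ δ` caps, so that the Cauchy–Schwarz inequality
over them loses little, and each of them is treated by local constancy. -/
theorem exists_lintegral_le_tubeSum (A : ℝ) (hA : 1 ≤ A) :
    ∃ C : ℝ, 0 ≤ C ∧ ∀ N : ℕ, ∃ D : ℝ, 0 ≤ D ∧ ∀ (n ℓ : ℕ) (σ : Measure Plane) (lam : ℝ)
      (f : FineCap n ℓ → Plane → ℂ), IsFreqData A n ℓ σ lam f → ∀ (ν : Measure Plane)
      [IsProbabilityMeasure ν] (t : ℝ), 0 < n → ∀ (X Y : ℝ), 1 ≤ X → X + 1 ≤ Y →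
      ∫⁻ y, ‖∑ θ, if IsGood ν t n ℓ 0 (cubeIndex (cubeExp n ℓ 0) y) θ then extOp σ (f θ) y
        else 0‖ₑ ^ 2 ∂ν ≤
        ENNReal.ofReal (C * scale n ℓ 0 * (side n ℓ 0 * side n ℓ 1)⁻¹) * tubeSum ν t σ f Y 0 +
          ENNReal.ofReal (scale n ℓ 0 ^ 2 * D / X ^ N) := by
  obtain ⟨C, hC, hmain⟩ := exists_locally_constant_goodPart A hA
  refine ⟨C, by positivity, fun N => ?_⟩
  obtain ⟨D, hD, hmain⟩ := hmain N
  refine ⟨D, by positivity, ?_⟩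
  intro n ℓ σ lam f h ν _ t hn X Y hX hY
  have := h.isFiniteMeasure
  have hs := side_pos n ℓ 0
  have hs' := side_pos n ℓ 1
  have hsc := scale_pos n ℓ 0
  have hss : side n ℓ 0 ≤ side n ℓ 1 := side_mono n ℓ (Nat.zero_le 1)
  have hX0 : 0 < X := by linarith
  set a := C * (side n ℓ 0 * side n ℓ 1)⁻¹ with ha
  set B : (Fin 2 → ℤ) → Fin (2 ^ scaleExp n ℓ 0) → ℝ≥0∞ := fun k τ =>
    if IsBadCap ν t n ℓ 0 k τ then 0 else
      ∫⁻ z in tube (cubeCenter (cubeExp n ℓ 0) k) (capDir (scaleExp n ℓ 0) τ)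
        (2 * (Y * side n ℓ 0)) (2 * (Y * side n ℓ (0 + 1))),
          ‖extOp σ (goodPart ν t f (0 + 1) 0 τ (parentCube n ℓ 0 k)) z‖ₑ ^ 2 with hB
  have hint : ∀ θ, Integrable (f θ) σ := fun θ =>
    Integrable.of_bound (h.measurable θ).aestronglyMeasurable 1 (Eventually.of_forall fun ζ =>
      (Finset.single_le_sum (f := fun θ => ‖f θ ζ‖) (fun i _ => norm_nonneg _)
        (Finset.mem_univ θ)).trans (h.sum_le ζ))
  have hcard : ((Finset.univ : Finset (Fin (2 ^ scaleExp n ℓ 0))).card : ℝ≥0∞) =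
      ENNReal.ofReal (scale n ℓ 0) := by
    rw [Finset.card_univ, Fintype.card_fin, ← ENNReal.ofReal_natCast]
    push_cast
    rfl
  have hpt : ∀ y, ‖∑ θ, if IsGood ν t n ℓ 0 (cubeIndex (cubeExp n ℓ 0) y) θ then extOp σ (f θ) y
        else 0‖ₑ ^ 2 ≤ (fun k => ENNReal.ofReal (scale n ℓ 0) *
          (ENNReal.ofReal a * ∑ τ, B k τ + ENNReal.ofReal (scale n ℓ 0) *
            ENNReal.ofReal (D / X ^ N))) (cubeIndex (cubeExp n ℓ 0) y) := by
    intro y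
    set k := cubeIndex (cubeExp n ℓ 0) y with hk
    have h1 : (∑ θ, if IsGood ν t n ℓ 0 k θ then extOp σ (f θ) y else 0) =
        ∑ τ : Fin (2 ^ scaleExp n ℓ 0), extOp σ (goodPart ν t f 0 0 τ k) y := by
      rw [← extOp_finset_sum _ (fun τ _ => h.integrable_goodPart ν t 0 0 τ k)]
      simp_rw [← sum_good_eq]
      rw [extOp_finset_sum]
      · refine Finset.sum_congr rfl fun θ _ => ?_
        split_ifs
        · rfl
        · exact (extOp_zero σ y).symm
      · intro θ _
        split_ifs
        · exact hint θ
        · exact integrable_zero _ _ _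
    rw [h1]
    refine (enorm_sum_sq_le _ _ (Finset.card_filter_le _ _)).trans ?_
    simp only
    rw [hcard]
    gcongr
    calc ∑ τ, ‖extOp σ (goodPart ν t f 0 0 τ k) y‖ₑ ^ 2
        ≤ ∑ τ, (ENNReal.ofReal a * B k τ + ENNReal.ofReal (D / X ^ N)) := by
          gcongr with τ
          rw [goodPart_self ν t f hn]
          split_ifs with hb
          · simp [extOp_zero]
          · refine (hmain n ℓ σ lam f h ν t (0 + 1) 0 hn τ (parentCube n ℓ 0 k) X hX y).trans ?_
            simp only [hB, if_neg hb]
            gcongr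
            refine tube_subset_tube (norm_capDir _ _) (d := side n ℓ 0) ?_ ?_ ?_
            · have := norm_sub_cubeCenter_le hn.le (mem_dilatedCube_cubeIndex (cubeExp n ℓ 0) y)
              rwa [one_mul] at this
            · nlinarith
            · rw [zero_add]; nlinarith
      _ = _ := by
          rw [Finset.sum_add_distrib, ← Finset.mul_sum, Finset.sum_const, nsmul_eq_mul, hcard]
  refine (lintegral_mono hpt).trans ((lintegral_comp_cubeIndex ν (cubeExp n ℓ 0) fun k =>
    ENNReal.ofReal (scale n ℓ 0) * (ENNReal.ofReal a * ∑ τ, B k τ +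
      ENNReal.ofReal (scale n ℓ 0) * ENNReal.ofReal (D / X ^ N))).le.trans ?_)
  have hsub : ∀ k, cubeIndex (cubeExp n ℓ 0) ⁻¹' {k} ⊆
      dilatedCube (dil n ℓ 0) (cubeExp n ℓ 0) k := by
    rintro k y hy
    have hy' : cubeIndex (cubeExp n ℓ 0) y = k := hy
    have h1 := mem_dilatedCube_cubeIndex (cubeExp n ℓ 0) y
    rw [hy'] at h1
    intro l
    have h2 := h1 l
    have h3 : (1 : ℝ) / 2 / 2 ^ cubeExp n ℓ 0 ≤ dil n ℓ 0 / 2 / 2 ^ cubeExp n ℓ 0 := by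
      gcongr; exact one_le_dil n ℓ 0
    constructor <;> linarith [h2.1, h2.2]
  have htot : ∑' k, ν (cubeIndex (cubeExp n ℓ 0) ⁻¹' {k}) = 1 := by
    have := lintegral_comp_cubeIndex ν (cubeExp n ℓ 0) (fun _ => 1)
    simpa using this.symm
  calc _ ≤ ∑' k, (ENNReal.ofReal (C * scale n ℓ 0 * (side n ℓ 0 * side n ℓ 1)⁻¹) *
        (ν (dilatedCube (dil n ℓ 0) (cubeExp n ℓ 0) k) * ∑ τ, B k τ) +
        ENNReal.ofReal (scale n ℓ 0 ^ 2 * D / X ^ N) * ν (cubeIndex (cubeExp n ℓ 0) ⁻¹' {k})) := by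
        refine ENNReal.tsum_le_tsum fun k => ?_
        rw [mul_add, add_mul]
        refine add_le_add ?_ ?_
        · rw [← mul_assoc, ← ENNReal.ofReal_mul hsc.le, mul_assoc, mul_comm (∑ τ, B k τ)]
          have : scale n ℓ 0 * a = C * scale n ℓ 0 * (side n ℓ 0 * side n ℓ 1)⁻¹ := by
            rw [ha]; ring
          rw [this]
          gcongr
          exact hsub k
        · rw [← mul_assoc, ← ENNReal.ofReal_mul hsc.le, ← ENNReal.ofReal_mul (by positivity)]
          gcongr
          apply le_of_eq; ring
    _ = _ := by
        rw [ENNReal.tsum_add, ENNReal.tsum_mul_left, ENNReal.tsum_mul_left, htot, mul_one]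
        rfl

/-- At the unit cubes: the pieces of the single fine caps are estimated on balls of radius about `1` by
the local `L²` bound, with a factor `1 / R` from the measure of arcs of length `1`. -/
theorem exists_ballSum_le_integral (A : ℝ) (hA : 1 ≤ A) :
    ∃ C : ℝ, 0 ≤ C ∧ ∀ (m ℓ : ℕ) (σ : Measure Plane) (lam : ℝ)
      (f : FineCap (m + 1) ℓ → Plane → ℂ), IsFreqData A (m + 1) ℓ σ lam f → ∀ (ν : Measure Plane)
      [IsProbabilityMeasure ν] (t : ℝ) (P : ℝ), 1 ≤ P →
      ballSum ν t σ f P m ≤ ENNReal.ofReal (C * (dil (m + 1) ℓ (m + 1) + 1) ^ 2 * P / 2 ^ ℓ) *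
        ∑ θ, ∫⁻ ζ, ‖f θ ζ‖ₑ ^ 2 ∂σ := by
  obtain ⟨C, hC, hmain⟩ := exists_trace_bound
  refine ⟨C * A, by positivity, ?_⟩
  intro m ℓ σ lam f h ν _ t P hP
  have := h.isFiniteMeasure
  have hP0 : 0 < P := by linarith
  have h1 : ∀ (k : Fin 2 → ℤ) (τ : Fin (2 ^ scaleExp (m + 1) ℓ m)),
      ∫⁻ z in Metric.closedBall (cubeCenter (cubeExp (m + 1) ℓ (m + 1)) k)
        (P * side (m + 1) ℓ (m + 1)), ‖extOp σ (goodPart ν t f (m + 1) m τ k) z‖ₑ ^ 2 ≤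
      ENNReal.ofReal (C * A * P / 2 ^ ℓ) * ∫⁻ ζ, ‖f τ ζ‖ₑ ^ 2 ∂σ := by
    intro k τ
    have h2 : goodPart ν t f (m + 1) m τ k = f τ := goodPart_top ν t f τ k
    rw [h2, side_self, mul_one]
    refine (hmain σ (f τ) (h.measurable τ) ⟨1, fun ζ => ?_⟩ _ P (A * (1 / P) / 2 ^ ℓ) hP0
      (fun η => h.ball_le η (1 / P) (by positivity))).trans (le_of_eq ?_)
    · exact (Finset.single_le_sum (f := fun θ => ‖f θ ζ‖) (fun i _ => norm_nonneg _)
        (Finset.mem_univ τ)).trans (h.sum_le ζ)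
    · congr 2; field_simp
  calc ballSum ν t σ f P m ≤ ∑' k, ν (dilatedCube (dil (m + 1) ℓ (m + 1))
        (cubeExp (m + 1) ℓ (m + 1)) k) *
          ∑ τ : Fin (2 ^ scaleExp (m + 1) ℓ m), ENNReal.ofReal (C * A * P / 2 ^ ℓ) *
            ∫⁻ ζ, ‖f τ ζ‖ₑ ^ 2 ∂σ := by
        refine ENNReal.tsum_le_tsum fun k => ?_
        gcongr with τ
        exact h1 k τ
    _ ≤ ENNReal.ofReal ((dil (m + 1) ℓ (m + 1) + 1) ^ 2) *
          ∑ τ : Fin (2 ^ scaleExp (m + 1) ℓ m), ENNReal.ofReal (C * A * P / 2 ^ ℓ) *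
            ∫⁻ ζ, ‖f τ ζ‖ₑ ^ 2 ∂σ := by
        rw [ENNReal.tsum_mul_right]
        gcongr
        exact tsum_measure_le ν (m + 1) ℓ (m + 1)
    _ = _ := by
        rw [← Finset.mul_sum, ← mul_assoc, ← ENNReal.ofReal_mul (by positivity)]
        congr 2
        ring

/-! ### The multiscale estimate -/

theorem tendsto_Rpow {ε : ℝ} (hε : 0 < ε) : Tendsto (fun ℓ => Rpow ℓ ε) atTop atTop :=
  (tendsto_rpow_atTop hε).comp (tendsto_pow_atTop_atTop_of_one_lt (by norm_num))

theorem dlt_le_one (n : ℕ) : dlt n ≤ 1 := pow_le_one₀ (by norm_num) (by norm_num)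

theorem scale_zero_le (n ℓ : ℕ) : scale n ℓ 0 ≤ Rpow ℓ (dlt n) := by
  unfold scale scaleExp Rpow dlt
  rw [← Real.rpow_natCast, ← Real.rpow_natCast, ← Real.rpow_mul (by norm_num)]
  apply Real.rpow_le_rpow_of_exponent_le (by norm_num)
  refine Nat.cast_div_le.trans (le_of_eq ?_)
  push_cast
  rw [inv_pow]; ring

theorem dil_le {n : ℕ} (hn : 5 ≤ n) (ℓ : ℕ) {j : ℕ} (hj : j ≤ n) :
    dil n ℓ j ≤ Rpow ℓ (dlt n / 2) := by
  apply Rpow_mono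
  have h1 : 4 * ((n : ℝ) + 1) ≤ 2 ^ n := by
    have : 4 * (n + 1) ≤ 2 ^ n := by
      induction n, hn using Nat.le_induction with
      | base => norm_num
      | succ m hm ih =>
        by_cases h : j ≤ m
        · have := ih h; rw [pow_succ]; omega
        · have := Nat.lt_two_pow_self (n := m)
          have h3 : ∀ m, 5 ≤ m → 4 * (m + 1) ≤ 2 ^ m := by
            intro m hm
            induction m, hm using Nat.le_induction with
            | base => norm_num
            | succ m hm ih => rw [pow_succ]; omega
          exact h3 _ (by omega)
    exact_mod_cast this
  have h2 : (2 : ℝ) ^ n * dlt n = 1 := by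
    unfold dlt; rw [inv_pow]; exact mul_inv_cancel₀ (by positivity)
  have h3 := dlt_pos n
  have h4 : (j : ℝ) ≤ n := by exact_mod_cast hj
  have h5 : 4 * ((j : ℝ) + 1) * dlt n ≤ 1 := by
    rw [← h2]; gcongr; linarith
  nlinarith

/-- The bookkeeping of a chain of estimates with multiplicative losses at most `Λ` and additive
errors at most `E`. -/
theorem chain_estimate {L : ℝ≥0∞} {u : ℕ → ℝ≥0∞} {n : ℕ} {Λ E : ℝ} {G α β e : ℕ → ℝ}
    (hΛ : 1 ≤ Λ) (hE : 0 ≤ E) (hG : ∀ j, 0 ≤ G j) (hα : ∀ j, 0 ≤ α j)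
    (h0 : L ≤ ENNReal.ofReal (Λ * G 0) * u 0 + ENNReal.ofReal E)
    (hu : ∀ j, j + 1 < n → u j ≤ ENNReal.ofReal (α j) *
      (ENNReal.ofReal (β j) * u (j + 1) + ENNReal.ofReal (e j)))
    (hβ : ∀ j, j + 1 < n → G j * α j * β j ≤ Λ * G (j + 1))
    (he : ∀ j, j + 1 < n → G j * α j * e j ≤ E) (j : ℕ) (hj : j < n) :
    L ≤ ENNReal.ofReal (Λ ^ (j + 1) * G j) * u j +
      ENNReal.ofReal ((j + 1) * Λ ^ (j + 1) * E) := by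
  induction j with
  | zero =>
    refine h0.trans ?_
    simp only [zero_add, pow_one, Nat.cast_zero, one_mul]
    gcongr
    nlinarith
  | succ j ih =>
    have hΛ0 : 0 ≤ Λ := by linarith
    have hp : 0 ≤ Λ ^ (j + 1) := by positivity
    have := hG j
    have := hα j
    refine (ih (by omega)).trans ?_
    calc _ ≤ ENNReal.ofReal (Λ ^ (j + 1) * G j) * (ENNReal.ofReal (α j) *
          (ENNReal.ofReal (β j) * u (j + 1) + ENNReal.ofReal (e j))) +
          ENNReal.ofReal ((j + 1) * Λ ^ (j + 1) * E) := by gcongr; exact hu j hj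
      _ = ENNReal.ofReal (Λ ^ (j + 1) * (G j * α j * β j)) * u (j + 1) +
          (ENNReal.ofReal (Λ ^ (j + 1) * (G j * α j * e j)) +
          ENNReal.ofReal ((j + 1) * Λ ^ (j + 1) * E)) := by
        rw [← mul_assoc, ← ENNReal.ofReal_mul (by positivity), mul_add, ← mul_assoc,
          ← ENNReal.ofReal_mul (by positivity), ← ENNReal.ofReal_mul (by positivity), add_assoc,
          show Λ ^ (j + 1) * (G j * α j * β j) = Λ ^ (j + 1) * G j * α j * β j by ring,
          show Λ ^ (j + 1) * (G j * α j * e j) = Λ ^ (j + 1) * G j * α j * e j by ring]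
      _ ≤ ENNReal.ofReal (Λ ^ (j + 1) * (Λ * G (j + 1))) * u (j + 1) +
          (ENNReal.ofReal (Λ ^ (j + 1) * E) +
          ENNReal.ofReal ((j + 1) * Λ ^ (j + 1) * E)) := by
        refine add_le_add (mul_le_mul_left (ENNReal.ofReal_le_ofReal ?_) _)
          (add_le_add_left (ENNReal.ofReal_le_ofReal ?_) _)
        · exact mul_le_mul_of_nonneg_left (hβ j hj) hp
        · exact mul_le_mul_of_nonneg_left (he j hj) hp
      _ ≤ _ := by
        rw [← ENNReal.ofReal_add (by positivity) (by positivity), ← mul_assoc, ← pow_succ]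
        refine add_le_add_right (ENNReal.ofReal_le_ofReal ?_) _
        · push_cast
          calc Λ ^ (j + 1) * E + (j + 1) * Λ ^ (j + 1) * E
              = (j + 1 + 1) * Λ ^ (j + 1) * E := by ring
            _ ≤ (j + 1 + 1) * Λ ^ (j + 1 + 1) * E := by
              gcongr; norm_num

theorem rpow_div_le {a b R : ℝ} (ha : 1 ≤ a) (hab : a ≤ b) (hb : b ≤ R) (p : ℝ) :
    (a / b) ^ p ≤ R ^ |p| := by
  have ha0 : 0 < a := by linarith
  have hb0 : 0 < b := by linarith
  calc (a / b) ^ p ≤ (a / b) ^ (-|p|) :=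
        Real.rpow_le_rpow_of_exponent_ge (by positivity) (by rw [div_le_one hb0]; exact hab)
          (neg_abs_le p)
    _ = (b / a) ^ |p| := by rw [Real.rpow_neg (by positivity), ← Real.inv_rpow (by positivity),
          inv_div]
    _ ≤ R ^ |p| := by
        gcongr
        rw [div_le_iff₀ ha0]; nlinarith

set_option maxHeartbeats 1000000 in
open Classical in
/-- The key estimate: for a superposition of the frequency pieces of all caps that are good for the
cube of `y`, the `L²(ν)` norm gains `R^{-min(t,1)}` over the trivial bound, up to small powers
of `R`. -/
theorem eventually_lintegral_good_le (A : ℝ) (hA : 1 ≤ A) (t : ℝ) (n : ℕ) (hn : 5 ≤ n) :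
    ∀ᶠ ℓ in atTop, ∀ (σ : Measure Plane) (lam : ℝ) (f : FineCap n ℓ → Plane → ℂ),
      IsFreqData A n ℓ σ lam f → ∀ (ν : Measure Plane) [IsProbabilityMeasure ν],
      ∫⁻ y, ‖∑ θ, if IsGood ν t n ℓ 0 (cubeIndex (cubeExp n ℓ 0) y) θ then extOp σ (f θ) y
        else 0‖ₑ ^ 2 ∂ν ≤
        ENNReal.ofReal (Rpow ℓ (20 * (n + 1) * dlt n - min t 1)) *
          (∑ θ, ∫⁻ ζ, ‖f θ ζ‖ₑ ^ 2 ∂σ) + ENNReal.ofReal (Rpow ℓ (-10)) := by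
  obtain ⟨C0, hC0, H0⟩ := exists_lintegral_le_tubeSum A hA
  obtain ⟨C1, hC1, H1⟩ := exists_ballSum_le_tubeSum A hA
  obtain ⟨C2, hC2, H2⟩ := exists_ballSum_le_integral A hA
  have hδ := dlt_pos n
  have hδ1 := dlt_le_one n
  -- `X = R ^ ε` is the dilation of tubes and balls at one step. It is large enough to absorb the
  -- constants and, with `N` large, makes the tails `X ^ (-N)` negligible; but `6 (n + 1)` such
  -- dilations amount to no more than `H = R ^ (δ / 2)`.
  set p := min t 1 with hp
  have hp1 : p ≤ 1 := min_le_right _ _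
  set ε : ℝ := dlt n / (12 * (n + 1)) with hε
  have hε0 : 0 < ε := by positivity
  obtain ⟨N, hN⟩ := exists_nat_ge ((30 + 2 * |p| + 20 * n) / ε)
  rw [div_le_iff₀ hε0] at hN
  obtain ⟨D0, hD0, H0⟩ := H0 N
  obtain ⟨D1, hD1, H1⟩ := H1 N
  filter_upwards [(tendsto_Rpow hε0).eventually_ge_atTop (6 + C0 + C1 + C2),
    (tendsto_Rpow zero_lt_one).eventually_ge_atTop (n * (D0 + D1))] with ℓ hX hRD
  intro σ lam f h ν _
  set X := Rpow ℓ ε with hXdef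
  set R := Rpow ℓ 1 with hR
  set H := Rpow ℓ (dlt n / 2) with hH
  have hX6 : 6 ≤ X := by linarith
  have hX0 : 0 < X := by linarith
  have hX1 : 1 ≤ X := by linarith
  have hR1 : 1 ≤ R := one_le_Rpow ℓ zero_le_one
  have hR0 : 0 < R := by linarith
  have hR2 : (2 : ℝ) ^ ℓ = R := (Rpow_one ℓ).symm
  have hHX : X ^ (6 * (n + 1)) = H := by
    rw [hXdef, ← Rpow_mul_nat]; congr 1; push_cast; rw [hε]; field_simp; ring
  have hHR : Rpow ℓ (dlt n) = H ^ 2 := by rw [hH, ← Rpow_mul_nat]; congr 1; push_cast; ring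
  have hHR10 : Rpow ℓ (10 * dlt n) = H ^ 20 := by
    rw [hH, ← Rpow_mul_nat]; congr 1; push_cast; ring
  have hH2R : H ^ 2 ≤ R := by rw [← hHR]; exact Rpow_mono ℓ hδ1
  have hXH : ∀ k, k ≤ 6 * (n + 1) → X ^ k ≤ H := fun k hk => by
    rw [← hHX]; exact pow_le_pow_right₀ hX1 hk
  have hXH1 : X ≤ H := by simpa using hXH 1 (by omega)
  have hH6 : 6 ≤ H := hX6.trans hXH1
  have hH0 : 0 < H := by linarith
  have hH1 : 1 ≤ H := by linarith
  have hdil : ∀ j, j ≤ n → dil n ℓ j ≤ H := fun j hj => dil_le hn ℓ hj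
  have hdil2 : ∀ j, j ≤ n → (dil n ℓ j + 1) ^ 2 ≤ H ^ 4 := fun j hj => by
    have h1 := hdil j hj
    have h2 := one_le_dil n ℓ j
    have h3 : dil n ℓ j + 1 ≤ H ^ 2 := by nlinarith
    calc (dil n ℓ j + 1) ^ 2 ≤ (H ^ 2) ^ 2 := by gcongr
      _ = H ^ 4 := by ring
  -- The tubes of level `j` are dilated by `Y j`: at each level, this leaves room for the passage to
  -- balls and for the enlargements in local orthogonality and local constancy.
  set Y : ℕ → ℝ := fun j => X ^ (3 * (j + 1)) with hYdef
  have hY1 : ∀ j, 1 ≤ Y j := fun j => one_le_pow₀ hX1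
  have hYX : ∀ j, j < n → X ^ 2 * Y j ≤ H := fun j hj => by
    rw [hYdef, ← pow_add]; exact hXH _ (by omega)
  have hYd : ∀ j, j < n → dil n ℓ j + 2 * Y j ≤ Rpow ℓ (dlt n) / 2 := fun j hj => by
    rw [hHR]
    have h1 := hdil j hj.le
    have h2 := hYX j hj
    have h3 := hY1 j
    nlinarith [mul_le_mul hX6 hX6 (by norm_num) hX0.le]
  have hP : ∀ j, j < n → X * (2 * Y j + 1) ≤ H := fun j hj => by
    refine le_trans ?_ (hYX j hj)
    rw [pow_two, mul_assoc]
    have := hY1 j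
    gcongr
    nlinarith
  have hP2 : ∀ j, j < n → 2 * Y j + 1 ≤ H := fun j hj => by
    refine le_trans ?_ (hP j hj)
    nlinarith [hY1 j]
  have hYs : ∀ j, X * (2 * Y j + 1) + X ≤ Y (j + 1) := fun j => by
    have h1 := hY1 j
    have h2 : Y (j + 1) = X ^ 3 * Y j := by rw [hYdef]; ring
    rw [h2]
    have h3 : X * 36 ≤ X ^ 3 := by nlinarith [mul_le_mul hX6 hX6 (by norm_num) hX0.le]
    nlinarith
  have hY0 : X + 1 ≤ Y 0 := by
    have h2 : Y 0 = X ^ 3 := by rw [hYdef]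
    rw [h2]
    nlinarith [mul_le_mul hX6 hX6 (by norm_num) hX0.le]
  have hr0 : ∀ j, 0 < scale n ℓ j := scale_pos n ℓ
  have hside : ∀ j, side n ℓ j = scale n ℓ j / R := fun j => by rw [side, hR2]
  have hrR : ∀ j, j ≤ n → scale n ℓ j ≤ R := fun j hj => by rw [← hR2]; exact scale_le n ℓ hj
  -- `G j` is the essential factor in front of the sum over the tubes of level `j`: the gains
  -- `(r_j / r_{j+1}) ^ p` and the costs `ρ_{j+1} / ρ_{j+2}` both telescope. All else is at most
  -- `Λ = R ^ (20 δ)` per level.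
  set Λ := H ^ 40 with hΛ
  have hΛ1 : 1 ≤ Λ := one_le_pow₀ hH1
  set G : ℕ → ℝ := fun j => R * (scale n ℓ 0 / scale n ℓ j) ^ p / side n ℓ (j + 1) with hG
  set α : ℕ → ℝ := fun j => (dil n ℓ j + 1) ^ 2 * (Rpow ℓ (10 * dlt n) *
    (scale n ℓ j / scale n ℓ (j + 1)) ^ p) with hα
  set β : ℕ → ℝ := fun j => C1 * (X * (2 * Y j + 1)) ^ 2 *
    (side n ℓ (j + 1) / side n ℓ (j + 2)) with hβ
  set e : ℕ → ℝ := fun j => (dil n ℓ (j + 1) + 1) ^ 2 * 2 ^ ℓ * D1 *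
    (X * (2 * Y j + 1)) ^ 2 / X ^ N with he
  set E : ℝ := (D0 + D1) * R ^ 19 * R ^ (2 * |p|) / X ^ N with hE
  have hE0 : 0 ≤ E := by positivity
  have hs0 : ∀ j, 0 < side n ℓ j := side_pos n ℓ
  have hG0 : ∀ j, 0 ≤ G j := fun j => by
    have := hs0 (j + 1); have := hr0 0; have := hr0 j
    simp only [hG]; positivity
  have hα0 : ∀ j, 0 ≤ α j := fun j => by
    have := hr0 j; have := hr0 (j + 1); have := Rpow_pos ℓ (10 * dlt n)
    simp only [hα]; positivity
  have hGα : ∀ j, G j * α j = (dil n ℓ j + 1) ^ 2 * H ^ 20 *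
      (R * (scale n ℓ 0 / scale n ℓ (j + 1)) ^ p / side n ℓ (j + 1)) := fun j => by
    have h1 : (scale n ℓ 0 / scale n ℓ (j + 1)) ^ p =
        (scale n ℓ 0 / scale n ℓ j) ^ p * (scale n ℓ j / scale n ℓ (j + 1)) ^ p := by
      have := hr0 0; have := hr0 j; have := hr0 (j + 1)
      rw [← Real.mul_rpow (by positivity) (by positivity)]
      congr 1; field_simp
    rw [h1, ← hHR10]; simp only [hG, hα]; ring
  have hGαle : ∀ j, j < n → G j * α j ≤ R ^ 14 * R ^ |p| := fun j hj => by
    rw [hGα]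
    have h1 := hdil2 j hj.le
    have h2 := rpow_div_le (one_le_scale n ℓ 0) (scale_mono n ℓ (Nat.zero_le (j + 1)))
      (hrR (j + 1) hj) p
    have h3 : 1 ≤ scale n ℓ (j + 1) := one_le_scale n ℓ _
    have h4 : R / side n ℓ (j + 1) ≤ R * R := by
      rw [hside, div_div_eq_mul_div, div_le_iff₀ (by linarith)]
      nlinarith
    have h5 : H ^ 24 ≤ R ^ 12 := by
      calc H ^ 24 = (H ^ 2) ^ 12 := by ring
        _ ≤ _ := by gcongr
    calc _ = (dil n ℓ j + 1) ^ 2 * H ^ 20 * ((R / side n ℓ (j + 1)) *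
          (scale n ℓ 0 / scale n ℓ (j + 1)) ^ p) := by ring
      _ ≤ H ^ 4 * H ^ 20 * ((R * R) * R ^ |p|) := by
        have := hr0 0; have := hr0 (j + 1); have := hs0 (j + 1)
        gcongr
      _ = H ^ 24 * R ^ 2 * R ^ |p| := by ring
      _ ≤ R ^ 12 * R ^ 2 * R ^ |p| := by gcongr
      _ = _ := by ring
  have hRp1 : 1 ≤ R ^ |p| := Real.one_le_rpow hR1 (abs_nonneg p)
  have hRp2 : R ^ (2 * |p|) = R ^ |p| * R ^ |p| := by
    rw [two_mul, Real.rpow_add hR0]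
  have hH8 : H ^ 8 ≤ R ^ 4 := by
    calc H ^ 8 = (H ^ 2) ^ 4 := by ring
      _ ≤ _ := by gcongr
  have hele : ∀ j, j + 1 < n → e j ≤ R ^ 5 * D1 / X ^ N := fun j hj => by
    simp only [he]
    rw [hR2]
    calc _ ≤ H ^ 4 * R * D1 * H ^ 2 / X ^ N := by
          have h1 : (X * (2 * Y j + 1)) ^ 2 ≤ H ^ 2 := by
            have := hY1 j
            have := hP j (by omega)
            gcongr
          have h2 := hdil2 (j + 1) hj.le
          gcongr
      _ = H ^ 6 * R * D1 / X ^ N := by ring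
      _ ≤ H ^ 8 * R * D1 / X ^ N := by
          gcongr; norm_num
      _ ≤ R ^ 4 * R * D1 / X ^ N := by gcongr
      _ = _ := by ring
  -- The first and the last of the obligations concern the smallest cubes and the error terms; the
  -- two others are the passage from tubes of level `j` to those of level `j + 1`.
  have key := chain_estimate (L := ∫⁻ y, ‖∑ θ, if IsGood ν t n ℓ 0 (cubeIndex (cubeExp n ℓ 0) y) θ
        then extOp σ (f θ) y else 0‖ₑ ^ 2 ∂ν) (u := fun j => tubeSum ν t σ f (Y j) j) (n := n)
    (Λ := Λ) (E := E) (G := G) (α := α) (β := β) (e := e) hΛ1 hE0 hG0 hα0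
    (by
      refine (H0 n ℓ σ lam f h ν t (by omega) X (Y 0) hX1 hY0).trans ?_
      have h1 : C0 * scale n ℓ 0 * (side n ℓ 0 * side n ℓ 1)⁻¹ ≤ Λ * G 0 := by
        have h2 : C0 ≤ Λ := by
          calc C0 ≤ H := by linarith
            _ ≤ Λ := le_self_pow₀ hH1 (by norm_num)
        have h3 : C0 * scale n ℓ 0 * (side n ℓ 0 * side n ℓ 1)⁻¹ = C0 * G 0 := by
          have := hr0 0; have := hs0 1
          simp only [hG]
          rw [div_self (hr0 0).ne', Real.one_rpow, hside 0]
          field_simp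
          try ring
        rw [h3]
        exact mul_le_mul_of_nonneg_right h2 (hG0 0)
      have h2 : scale n ℓ 0 ^ 2 * D0 / X ^ N ≤ E := by
        simp only [hE]
        gcongr ?_ / _
        have h3 := hrR 0 (Nat.zero_le n)
        have := hr0 0
        calc scale n ℓ 0 ^ 2 * D0 ≤ R ^ 2 * (D0 + D1) := by gcongr; linarith
          _ ≤ R ^ 19 * (D0 + D1) := by
            gcongr; norm_num
          _ ≤ R ^ 19 * (D0 + D1) * R ^ (2 * |p|) := by
            apply le_mul_of_one_le_right (by positivity)
            exact Real.one_le_rpow hR1 (by positivity)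
          _ = _ := by ring
      gcongr)
    (by
      intro j hj
      refine (tubeSum_le_ballSum ν t σ f (by omega) (by linarith [hY1 j]) (hYd j (by omega))
        (fun τ k => h.integrable_goodPart ν t _ _ τ k)).trans ?_
      refine mul_le_mul_right ?_ _
      exact H1 n ℓ σ lam f h ν t j hj X (2 * Y j + 1) (Y (j + 1)) hX1 (by linarith [hY1 j]) (hYs j))
    (by
      intro j hj
      rw [hGα]
      have h1 : (X * (2 * Y j + 1)) ^ 2 ≤ H ^ 2 := by
        have := hY1 j
        have := hP j (by omega)
        gcongr
      have h2 := hdil2 j (by omega)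
      have h3 : C1 ≤ H := by linarith
      have := hr0 0; have := hr0 (j + 1); have := hs0 (j + 1); have := hs0 (j + 2)
      simp only [hβ, hG]
      calc _ = (dil n ℓ j + 1) ^ 2 * H ^ 20 * C1 * (X * (2 * Y j + 1)) ^ 2 *
            (R * (scale n ℓ 0 / scale n ℓ (j + 1)) ^ p / side n ℓ (j + 2)) := by
            field_simp
        _ ≤ H ^ 4 * H ^ 20 * H * H ^ 2 *
            (R * (scale n ℓ 0 / scale n ℓ (j + 1)) ^ p / side n ℓ (j + 2)) := by gcongr
        _ = H ^ 27 * (R * (scale n ℓ 0 / scale n ℓ (j + 1)) ^ p / side n ℓ (j + 2)) := by ring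
        _ ≤ _ := by
            rw [hΛ]
            gcongr; norm_num)
    (by
      intro j hj
      calc G j * α j * e j ≤ (R ^ 14 * R ^ |p|) * (R ^ 5 * D1 / X ^ N) := by
            have := hele j hj
            have := hGαle j (by omega)
            have : 0 ≤ e j := by
              simp only [he]; positivity
            gcongr
        _ = D1 * R ^ 19 * R ^ |p| / X ^ N := by ring
        _ ≤ E := by
            simp only [hE]
            rw [hRp2]
            gcongr
            · linarith
            · nlinarith)
    (n - 1) (by omega)
  obtain ⟨m, rfl⟩ : ∃ m, n = m + 1 := ⟨n - 1, by omega⟩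
  simp only [Nat.add_sub_cancel] at key
  refine key.trans ?_
  -- At the top level the balls have radius about `1`, and the local `L²` bound ends the chain.
  have hu : tubeSum ν t σ f (Y m) m ≤ ENNReal.ofReal (α m) *
      (ENNReal.ofReal (C2 * (dil (m + 1) ℓ (m + 1) + 1) ^ 2 * (2 * Y m + 1) / 2 ^ ℓ) *
        ∑ θ, ∫⁻ ζ, ‖f θ ζ‖ₑ ^ 2 ∂σ) := by
    refine (tubeSum_le_ballSum ν t σ f (by omega) (by linarith [hY1 m]) (hYd m (by omega))
      (fun τ k => h.integrable_goodPart ν t _ _ τ k)).trans ?_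
    exact mul_le_mul_right (H2 m ℓ σ lam f h ν t (2 * Y m + 1) (by linarith [hY1 m])) _
  refine add_le_add ((mul_le_mul_right hu _).trans ?_) (ENNReal.ofReal_le_ofReal ?_)
  · have := hα0 m
    have := hG0 m
    rw [← mul_assoc, ← mul_assoc, ← ENNReal.ofReal_mul (by positivity),
      ← ENNReal.ofReal_mul (by positivity)]
    refine mul_le_mul_left (ENNReal.ofReal_le_ofReal ?_) _
    rw [mul_assoc _ (G m), hGα, side_self, hR2]
    have hsn : scale (m + 1) ℓ (m + 1) = R := by
      rw [← hR2]; unfold scale; rw [scaleExp_self]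
    have h1 : (scale (m + 1) ℓ 0 / scale (m + 1) ℓ (m + 1)) ^ p ≤ H ^ 2 * Rpow ℓ (-p) := by
      rw [hsn, Real.div_rpow (hr0 0).le hR0.le, Rpow_neg, div_eq_mul_inv]
      have h3 : R ^ p = Rpow ℓ p := by rw [hR, Rpow_one]; rfl
      rw [h3]
      have := Rpow_pos ℓ p
      gcongr
      calc scale (m + 1) ℓ 0 ^ p ≤ scale (m + 1) ℓ 0 ^ (1 : ℝ) :=
            Real.rpow_le_rpow_of_exponent_le (one_le_scale _ _ _) hp1
        _ = scale (m + 1) ℓ 0 := Real.rpow_one _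
        _ ≤ H ^ 2 := by rw [← hHR]; exact scale_zero_le _ _
    have h2 : Rpow ℓ (20 * ((m + 1 : ℕ) + 1) * dlt (m + 1) - p) = Λ ^ (m + 2) * Rpow ℓ (-p) := by
      rw [hΛ, ← pow_mul, hH, ← Rpow_mul_nat, ← Rpow_add]
      congr 1; push_cast; ring
    rw [h2]
    have h4 := hdil2 m (by omega)
    have h5 := hdil2 (m + 1) le_rfl
    have h6 := hP2 m (by omega)
    have h7 : C2 ≤ H := by linarith
    have := hY1 m
    have := Rpow_pos ℓ (-p)
    have hr0' := hr0 0
    have hrn' := hr0 (m + 1)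
    calc _ = Λ ^ (m + 1) * ((dil (m + 1) ℓ m + 1) ^ 2 * H ^ 20 *
          (scale (m + 1) ℓ 0 / scale (m + 1) ℓ (m + 1)) ^ p *
          (C2 * (dil (m + 1) ℓ (m + 1) + 1) ^ 2 * (2 * Y m + 1))) := by field_simp
      _ ≤ Λ ^ (m + 1) * (H ^ 4 * H ^ 20 * (H ^ 2 * Rpow ℓ (-p)) * (H * H ^ 4 * H)) := by
        gcongr
      _ = Λ ^ (m + 1) * (H ^ 32 * Rpow ℓ (-p)) := by ring
      _ ≤ Λ ^ (m + 1) * (H ^ 40 * Rpow ℓ (-p)) := by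
        gcongr; norm_num
      _ = _ := by rw [← hΛ]; ring
  · have hXN : R ^ (30 + 2 * |p| + 20 * ((m + 1 : ℕ) : ℝ)) ≤ X ^ N := by
      have h3 : ∀ x : ℝ, R ^ x = Rpow ℓ x := fun x => by rw [hR, Rpow_one]; rfl
      rw [h3, hXdef, ← Rpow_mul_nat]
      apply Rpow_mono
      linarith
    have hΛR : Λ ^ (m + 1) ≤ R ^ (20 * (m + 1)) := by
      calc Λ ^ (m + 1) = (H ^ 2) ^ (20 * (m + 1)) := by rw [hΛ, ← pow_mul, ← pow_mul]; ring_nf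
        _ ≤ _ := by gcongr
    rw [hE]
    have h10 : Rpow ℓ (-10) = (R ^ 10)⁻¹ := by
      rw [Rpow_neg, hR, ← Rpow_mul_nat]; norm_num
    rw [h10]
    have hXN' : R ^ 30 * R ^ (2 * |p|) * R ^ (20 * (m + 1)) ≤ X ^ N := by
      refine le_trans (le_of_eq ?_) hXN
      rw [Real.rpow_add hR0, Real.rpow_add hR0]
      congr 1
      · congr 1; norm_cast
      · rw [← Real.rpow_natCast]; congr 1; push_cast; ring
    push_cast at hRD
    rw [mul_div_assoc', div_le_iff₀ (by positivity), inv_mul_eq_div, le_div_iff₀ (by positivity)]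
    calc ((m : ℝ) + 1) * Λ ^ (m + 1) * ((D0 + D1) * R ^ 19 * R ^ (2 * |p|)) * R ^ 10
        = ((m + 1) * (D0 + D1)) * Λ ^ (m + 1) * (R ^ 29 * R ^ (2 * |p|)) := by ring
      _ ≤ R * R ^ (20 * (m + 1)) * (R ^ 29 * R ^ (2 * |p|)) := by
        gcongr
      _ = R ^ 30 * R ^ (2 * |p|) * R ^ (20 * (m + 1)) := by ring
      _ ≤ _ := hXN'

/-! ### Non-stationary phase -/

/-- `f` is smooth, and its `k`-th derivative is bounded by `K k * B ^ k`: it varies at the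
scale `B⁻¹`. -/
def IsSymbol (K : ℕ → ℝ) (B : ℝ) (f : ℝ → ℂ) : Prop :=
  ContDiff ℝ ∞ f ∧ ∀ k x, ‖iteratedDeriv k f x‖ ≤ K k * B ^ k

theorem IsSymbol.nonneg {K : ℕ → ℝ} {B : ℝ} {f : ℝ → ℂ} (h : IsSymbol K B f) (hB : 0 < B) (k : ℕ) :
    0 ≤ K k :=
  nonneg_of_mul_nonneg_left ((norm_nonneg _).trans (h.2 k 0)) (by positivity)

theorem IsSymbol.mul {K K' : ℕ → ℝ} {B : ℝ} (hB : 0 < B) {f g : ℝ → ℂ} (hf : IsSymbol K B f)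
    (hg : IsSymbol K' B g) :
    IsSymbol (fun k => ∑ i ∈ Finset.range (k + 1), k.choose i * K i * K' (k - i)) B
      (fun x => f x * g x) := by
  refine ⟨hf.1.mul hg.1, fun k x => ?_⟩
  rw [← norm_iteratedFDeriv_eq_norm_iteratedDeriv, Finset.sum_mul]
  refine (norm_iteratedFDeriv_mul_le hf.1 hg.1 x (by exact_mod_cast le_top)).trans
    (Finset.sum_le_sum fun i hi => ?_)
  rw [norm_iteratedFDeriv_eq_norm_iteratedDeriv, norm_iteratedFDeriv_eq_norm_iteratedDeriv]
  have hi' : i ≤ k := by simpa [Nat.lt_succ_iff] using hi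
  have h1 := hf.2 i x
  have h2 := hg.2 (k - i) x
  have h3 := hf.nonneg hB i
  calc _ ≤ (k.choose i : ℝ) * (K i * B ^ i) * (K' (k - i) * B ^ (k - i)) := by gcongr
    _ = k.choose i * K i * K' (k - i) * (B ^ i * B ^ (k - i)) := by ring
    _ = _ := by rw [← pow_add, Nat.add_sub_cancel' hi']

theorem IsSymbol.deriv {K : ℕ → ℝ} {B : ℝ} {f : ℝ → ℂ} (hf : IsSymbol K B f) :
    IsSymbol (fun k => K (k + 1) * B) B (deriv f) := by
  refine ⟨(contDiff_infty_iff_deriv.1 hf.1).2, fun k x => ?_⟩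
  rw [← iteratedDeriv_succ']
  exact (hf.2 (k + 1) x).trans (le_of_eq (by ring))

theorem IsSymbol.const_mul {K : ℕ → ℝ} {B : ℝ} {f : ℝ → ℂ} (hf : IsSymbol K B f) (c : ℂ) :
    IsSymbol (fun k => ‖c‖ * K k) B (fun x => c * f x) := by
  refine ⟨contDiff_const.mul hf.1, fun k x => ?_⟩
  rw [iteratedDeriv_const_mul_field, norm_mul, mul_assoc]
  gcongr
  exact hf.2 k x

theorem periodic_deriv {f : ℝ → ℂ} {c : ℝ} (h : Function.Periodic f c) :
    Function.Periodic (deriv f) c := by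
  intro x
  rw [← deriv_comp_add_const]
  congr 1
  funext y
  exact h y

/-- Repeated integration by parts: an oscillating factor `E` with `E' = v E` may be integrated
against an amplitude which varies at the scale `B⁻¹`, with a gain `B / P` each time, if `v⁻¹` agrees
on the support of the amplitude with `P⁻¹ q`, where `q` varies at the scale `B⁻¹`. -/
theorem exists_integral_oscillating_le (N : ℕ) (K' : ℕ → ℝ) :
    ∀ K : ℕ → ℝ, ∃ C : ℝ, ∀ (B P : ℝ) (a q v E : ℝ → ℂ), 0 < B → 0 < P →
      IsSymbol K B a → IsSymbol K' B q → Continuous v → (∀ α, HasDerivAt E (v α * E α) α) →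
      (∀ α, ‖E α‖ ≤ 1) → Function.Periodic a (2 * Real.pi) → Function.Periodic q (2 * Real.pi) →
      Function.Periodic E (2 * Real.pi) → (∀ α, a α ≠ 0 → q α * v α = P) →
      ‖∫ α in (-Real.pi)..Real.pi, a α * E α‖ ≤ C * (B / P) ^ N := by
  induction N with
  | zero =>
    intro K
    refine ⟨K 0 * (2 * Real.pi), ?_⟩
    intro B P a q v E hB hP ha hq hv hE hE1 hap hqp hEp hsupp
    rw [pow_zero, mul_one]
    have h := intervalIntegral.norm_integral_le_of_norm_le_const (a := -Real.pi) (b := Real.pi)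
      (f := fun α => a α * E α) (C := K 0) fun α _ => by
        have h1 := ha.2 0 α
        simp only [iteratedDeriv_zero, pow_zero, mul_one] at h1
        rw [norm_mul]
        nlinarith [norm_nonneg (a α), hE1 α, norm_nonneg (E α)]
    refine h.trans (le_of_eq ?_)
    rw [sub_neg_eq_add, ← two_mul, abs_of_pos (by positivity)]
  | succ N ih =>
    intro K
    obtain ⟨C, hC⟩ := ih (fun k => ∑ i ∈ Finset.range (k + 1 + 1),
      (k + 1).choose i * K i * K' (k + 1 - i))
    refine ⟨C, ?_⟩
    intro B P a q v E hB hP ha hq hv hE hE1 hap hqp hEp hsupp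
    have haq := ha.mul hB hq
    have hP' : (P : ℂ) ≠ 0 := by exact_mod_cast hP.ne'
    have hB' : (B : ℂ) ≠ 0 := by exact_mod_cast hB.ne'
    set b : ℝ → ℂ := fun α => (B : ℂ)⁻¹ * deriv (fun x => a x * q x) α with hb
    have hdiff : ∀ α, HasDerivAt (fun x => a x * q x) (deriv (fun x => a x * q x) α) α :=
      fun α => (haq.1.differentiable (by simp) α).hasDerivAt
    have hEc : Continuous E := continuous_iff_continuousAt.2 fun α => (hE α).continuousAt
    have hbc : Continuous (deriv fun x => a x * q x) := haq.deriv.1.continuous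
    have hbs : IsSymbol (fun k => ∑ i ∈ Finset.range (k + 1 + 1),
        (k + 1).choose i * K i * K' (k + 1 - i)) B b := by
      have h := haq.deriv.const_mul (B : ℂ)⁻¹
      refine ⟨h.1, fun k x => (h.2 k x).trans (le_of_eq ?_)⟩
      rw [norm_inv, Complex.norm_real, Real.norm_of_nonneg hB.le]
      field_simp
    -- This is the integral of the derivative of the periodic function `a q E`.
    have hparts : ∫ α in (-Real.pi)..Real.pi,
        (deriv (fun x => a x * q x) α * E α + a α * q α * (v α * E α)) = 0 := by
      rw [intervalIntegral.integral_eq_sub_of_hasDerivAt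
        (f := fun x => a x * q x * E x) (fun α _ => (hdiff α).mul (hE α))]
      · have h1 : Real.pi = -Real.pi + 2 * Real.pi := by ring
        have h2 : a Real.pi = a (-Real.pi) := by conv_lhs => rw [h1, hap]
        have h3 : q Real.pi = q (-Real.pi) := by conv_lhs => rw [h1, hqp]
        have h4 : E Real.pi = E (-Real.pi) := by conv_lhs => rw [h1, hEp]
        rw [h2, h3, h4, sub_self]
      · have := ha.1.continuous
        have := hq.1.continuous
        exact Continuous.intervalIntegrable (by fun_prop) _ _
    -- As `a q v = P a`, this trades the amplitude `a` for `-(B / P) b`, where `b = B⁻¹ (a q)'` is again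
    -- a symbol at the scale `B⁻¹`.
    have hrel : ∀ α, a α * E α = -((B / P : ℂ) * (b α * E α)) +
        (P : ℂ)⁻¹ * (deriv (fun x => a x * q x) α * E α + a α * q α * (v α * E α)) := by
      intro α
      have h1 : a α * q α * v α = P * a α := by
        by_cases h : a α = 0
        · simp [h]
        · rw [mul_assoc, hsupp α h, mul_comm]
      have h2 : a α * q α * (v α * E α) = P * a α * E α := by rw [← mul_assoc, h1]
      rw [h2, hb]
      field_simp
      ring
    have hint : ∫ α in (-Real.pi)..Real.pi, a α * E α =
        -((B / P : ℂ) * ∫ α in (-Real.pi)..Real.pi, b α * E α) := by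
      have h1 : Continuous b := hbs.1.continuous
      have := ha.1.continuous
      have := hq.1.continuous
      simp_rw [hrel]
      rw [intervalIntegral.integral_add, intervalIntegral.integral_const_mul, hparts, mul_zero,
        add_zero, intervalIntegral.integral_neg, intervalIntegral.integral_const_mul]
      · exact Continuous.intervalIntegrable (by fun_prop) _ _
      · exact Continuous.intervalIntegrable (by fun_prop) _ _
    have hmain := hC B P b q v E hB hP hbs hq hv hE hE1 ?_ hqp hEp ?_
    · rw [hint, norm_neg, norm_mul, pow_succ]
      have : ‖(B / P : ℂ)‖ = B / P := by
        rw [norm_div, Complex.norm_real, Complex.norm_real, Real.norm_of_nonneg hB.le,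
          Real.norm_of_nonneg hP.le]
      rw [this]
      calc B / P * ‖∫ α in (-Real.pi)..Real.pi, b α * E α‖ ≤ B / P * (C * (B / P) ^ N) := by gcongr
        _ = _ := by ring
    · have h : Function.Periodic (fun x => a x * q x) (2 * Real.pi) := hap.mul hqp
      intro α
      simp only [hb]
      rw [periodic_deriv h α]
    · intro α hα
      have h1 : deriv (fun x => a x * q x) α ≠ 0 := right_ne_zero_of_mul hα
      -- The derivative may be nonzero where `a` vanishes, but only in the closure of the set where
      -- `a` does not, and the relation between `q` and `v` persists there.
      have h2 : α ∈ closure {x | a x ≠ 0} := by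
        have h3 : α ∈ tsupport (deriv fun x => a x * q x) := subset_tsupport _ h1
        have h4 := tsupport_deriv_subset (𝕜 := ℝ) h3
        exact closure_mono (fun x hx => left_ne_zero_of_mul hx) h4
      have h5 : IsClosed {x | q x * v x = P} :=
        isClosed_eq (hq.1.continuous.mul hv) continuous_const
      exact closure_minimal (fun x hx => hsupp x hx) h5 h2

/-- A smooth function with bounded derivatives which agrees with `1/s` for `|s| ≥ 1`. -/
theorem exists_smooth_inv :
    ∃ Θ : ℝ → ℝ, ContDiff ℝ ∞ Θ ∧ (∀ s, 1 ≤ |s| → Θ s * s = 1) ∧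
      ∃ T : ℕ → ℝ, ∀ k s, ‖iteratedFDeriv ℝ k Θ s‖ ≤ T k := by
  let χ : ContDiffBump (0 : ℝ) := ⟨1 / 4, 1 / 2, by norm_num, by norm_num⟩
  have hχ1 : ∀ s, |s| ≤ 1 / 4 → χ s = 1 := fun s hs =>
    χ.one_of_mem_closedBall (by simpa [χ] using hs)
  have hχ0 : ∀ s, 1 / 2 ≤ |s| → χ s = 0 := fun s hs =>
    χ.zero_of_le_dist (by simpa [χ] using hs)
  set Θ : ℝ → ℝ := fun s => (1 - χ s) * s⁻¹ with hΘ
  have hsm : ContDiff ℝ ∞ Θ := by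
    rw [contDiff_iff_contDiffAt]
    intro s
    by_cases hs : s = 0
    · have : Θ =ᶠ[𝓝 s] fun _ => 0 := by
        have h1 : Metric.ball (0 : ℝ) (1 / 4) ∈ 𝓝 s := by
          rw [hs]; exact Metric.ball_mem_nhds _ (by norm_num)
        filter_upwards [h1] with x hx
        simp only [Metric.mem_ball, dist_zero_right, Real.norm_eq_abs] at hx
        simp only [hΘ, hχ1 x hx.le, sub_self, zero_mul]
      exact contDiffAt_const.congr_of_eventuallyEq this
    · exact (contDiffAt_const.sub χ.contDiffAt).mul (contDiffAt_inv ℝ hs)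
  refine ⟨Θ, hsm, fun s hs => ?_, ?_⟩
  · have hs0 : s ≠ 0 := by rintro rfl; norm_num at hs
    simp only [hΘ]
    rw [hχ0 s (by linarith), sub_zero, one_mul, inv_mul_cancel₀ hs0]
  · have : ∀ k, ∃ T, ∀ s, ‖iteratedFDeriv ℝ k Θ s‖ ≤ T := by
      intro k
      obtain ⟨T, hT⟩ := (isCompact_Icc (a := (-1 : ℝ)) (b := 1)).exists_bound_of_continuousOn
        (hsm.continuous_iteratedFDeriv (m := k) (by exact_mod_cast le_top)).continuousOn
      refine ⟨max T k.factorial, fun s => ?_⟩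
      by_cases hs : |s| ≤ 1
      · exact (hT s (abs_le.1 hs)).trans (le_max_left _ _)
      · push Not at hs
        refine le_trans ?_ (le_max_right _ _)
        have h1 : Θ =ᶠ[𝓝 s] Inv.inv := by
          have h2 : {x : ℝ | 1 / 2 < |x|} ∈ 𝓝 s :=
            (isOpen_lt continuous_const continuous_abs).mem_nhds
              (by simp only [Set.mem_ofPred_eq]; linarith)
          filter_upwards [h2] with x hx
          simp only [hΘ]
          rw [hχ0 x (le_of_lt hx), sub_zero, one_mul]
        rw [norm_iteratedFDeriv_eq_norm_iteratedDeriv, h1.iteratedDeriv_eq,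
          iteratedDeriv_eq_iterate, iter_deriv_inv]
        rw [norm_mul, norm_mul, norm_pow, norm_neg, norm_one, one_pow, one_mul,
          Real.norm_natCast, norm_zpow, Real.norm_eq_abs]
        apply mul_le_of_le_one_right (by positivity)
        apply zpow_le_one_of_nonpos₀ hs.le
        omega
    choose T hT using this
    exact ⟨T, hT⟩

theorem norm_iteratedDeriv_trig_le {F : Type*} [NormedAddCommGroup F] [NormedSpace ℝ F] (i : ℕ) :
    ∀ (v w : F) (α : ℝ),
      ‖iteratedDeriv i (fun x : ℝ => Real.cos x • v + Real.sin x • w) α‖ ≤ ‖v‖ + ‖w‖ := by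
  induction i with
  | zero =>
    intro v w α
    rw [iteratedDeriv_zero]
    refine (norm_add_le _ _).trans ?_
    rw [norm_smul, norm_smul]
    gcongr
    · exact mul_le_of_le_one_left (norm_nonneg _) (Real.abs_cos_le_one _)
    · exact mul_le_of_le_one_left (norm_nonneg _) (Real.abs_sin_le_one _)
  | succ i ih =>
    intro v w α
    have h : deriv (fun x : ℝ => Real.cos x • v + Real.sin x • w) =
        fun x => Real.cos x • w + Real.sin x • (-v) := by
      funext x
      have := ((Real.hasDerivAt_cos x).smul_const v).add ((Real.hasDerivAt_sin x).smul_const w)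
      refine (HasDerivAt.deriv this).trans ?_
      rw [smul_neg, neg_smul, add_comm]
    rw [iteratedDeriv_succ', h]
    refine (ih w (-v) α).trans ?_
    rw [norm_neg, add_comm]

theorem contDiff_trig {F : Type*} [NormedAddCommGroup F] [NormedSpace ℝ F] (c v w : F) :
    ContDiff ℝ ∞ (fun x : ℝ => c + (Real.cos x • v + Real.sin x • w)) :=
  contDiff_const.add ((Real.contDiff_cos.smul contDiff_const).add
    (Real.contDiff_sin.smul contDiff_const))

/-- A function with bounded derivatives of a trigonometric curve of size `B` is a symbol. -/
theorem isSymbol_comp_trig {F : Type*} [NormedAddCommGroup F] [NormedSpace ℝ F] {K : ℕ → ℝ}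
    {g : F → ℝ} (hg : ContDiff ℝ ∞ g) (hK : ∀ k p, ‖iteratedFDeriv ℝ k g p‖ ≤ K k) (c v w : F)
    {B : ℝ} (hB : 1 ≤ B) (hvw : ‖v‖ + ‖w‖ ≤ B) :
    IsSymbol (fun k => k.factorial * ∑ i ∈ Finset.range (k + 1), |K i|) B
      (fun x => (g (c + (Real.cos x • v + Real.sin x • w)) : ℂ)) := by
  have h1 := contDiff_trig c v w
  have h2 : ContDiff ℝ ∞ (g ∘ fun x : ℝ => c + (Real.cos x • v + Real.sin x • w)) := hg.comp h1
  refine ⟨Complex.ofRealCLM.contDiff.comp h2, fun k x => ?_⟩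
  rw [← norm_iteratedFDeriv_eq_norm_iteratedDeriv]
  have h3 := Complex.ofRealCLM.norm_iteratedFDeriv_comp_left (h2.contDiffAt (x := x))
    (n := k) (by exact_mod_cast le_top)
  rw [Complex.ofRealCLM_norm, one_mul] at h3
  refine h3.trans ?_
  refine norm_iteratedFDeriv_comp_le hg h1 (by exact_mod_cast le_top) x (fun i hi => ?_)
    (fun i hi hik => ?_)
  · exact (hK i _).trans ((le_abs_self _).trans (Finset.single_le_sum (f := fun i => |K i|)
      (fun i _ => abs_nonneg _) (Finset.mem_range.2 (by omega))))
  · rw [norm_iteratedFDeriv_eq_norm_iteratedDeriv, iteratedDeriv_const_add (by omega)]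
    exact (norm_iteratedDeriv_trig_le i v w x).trans (hvw.trans (le_self_pow₀ hB (by omega)))

/-! ### Tubes that do not meet the center of the circles -/

/-- The coordinates of a vector in the frame `(a e, b e^⊥)`. -/
def frameCoord (e : Plane) (a b : ℝ) : Plane →ₗ[ℝ] Plane where
  toFun x := !₂[inner ℝ x e / a, inner ℝ x (perp e) / b]
  map_add' x y := by ext l; fin_cases l <;> simp [inner_add_left, add_div]
  map_smul' c x := by ext l; fin_cases l <;> simp [inner_smul_left, mul_div_assoc]

@[simp] theorem frameCoord_zero (e : Plane) (a b : ℝ) (x : Plane) :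
    frameCoord e a b x 0 = inner ℝ x e / a := by simp [frameCoord]

@[simp] theorem frameCoord_one (e : Plane) (a b : ℝ) (x : Plane) :
    frameCoord e a b x 1 = inner ℝ x (perp e) / b := by simp [frameCoord]

theorem frameMap_frameCoord {e : Plane} (he : ‖e‖ = 1) {a b : ℝ} (ha : a ≠ 0) (hb : b ≠ 0)
    (x : Plane) : (a * frameCoord e a b x 0) • e + (b * frameCoord e a b x 1) • perp e = x := by
  rw [frameCoord_zero, frameCoord_one, mul_div_cancel₀ _ ha, mul_div_cancel₀ _ hb,
    frameMap_inner he]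

theorem norm_le_abs_add_abs (x : Plane) : ‖x‖ ≤ |x 0| + |x 1| := by
  have h := norm_sq_eq x
  have h0 := abs_nonneg (x 0)
  have h1 := abs_nonneg (x 1)
  have h2 := sq_abs (x 0)
  have h3 := sq_abs (x 1)
  nlinarith [norm_nonneg x]

theorem norm_le_frame {e : Plane} (he : ‖e‖ = 1) (x : Plane) :
    ‖x‖ ≤ |inner ℝ x e| + |inner ℝ x (perp e)| := by
  have h := norm_sq_eq_inner he x
  have h0 := abs_nonneg (inner ℝ x e)
  have h1 := abs_nonneg (inner ℝ x (perp e))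
  have h2 := sq_abs (inner ℝ x e)
  have h3 := sq_abs (inner ℝ x (perp e))
  nlinarith [norm_nonneg x]

theorem norm_frameCoord_le {e : Plane} (he : ‖e‖ = 1) {a b : ℝ} (ha : 0 < a) (hb : 0 < b)
    (x : Plane) : ‖frameCoord e a b x‖ ≤ ‖x‖ * (a⁻¹ + b⁻¹) := by
  have hp : ‖perp e‖ = 1 := by rw [norm_perp, he]
  refine (norm_le_abs_add_abs _).trans ?_
  rw [frameCoord_zero, frameCoord_one, abs_div, abs_div, abs_of_pos ha, abs_of_pos hb, mul_add,
    div_eq_mul_inv, div_eq_mul_inv]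
  gcongr
  · exact abs_inner_le he
  · exact abs_inner_le hp

theorem contDiff_comp_frame {f : Plane → ℝ} (hf : ContDiff ℝ ∞ f) (e : Plane) (a b : ℝ) :
    ContDiff ℝ ∞ (fun q : Plane => f ((a * q 0) • e + (b * q 1) • perp e)) := by
  refine hf.comp ?_
  fun_prop

theorem circlePoint_eq (α : ℝ) :
    circlePoint α = Real.cos α • circlePoint 0 + Real.sin α • perp (circlePoint 0) := by
  ext l; fin_cases l <;> simp [circlePoint, perp]

theorem circlePoint_periodic : Function.Periodic circlePoint (2 * Real.pi) := by
  intro α; simp [circlePoint]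

set_option maxHeartbeats 1000000 in
/-- Non-stationary phase: if the center `y` of a circle is not in the double of a tube of direction
`e`, then the circular average of a wave packet of the tube is negligible. Its frequency `ξ` is almost
parallel to `e`, and the phase `r ω · ξ` is stationary in `ω` only where `ω` is parallel to `ξ`, that is
near the line through `y` in the direction `e`, which keeps away from the tube. -/
theorem eventually_norm_integral_tube_le (A : ℝ) (hA : 1 ≤ A) (K : ℕ → ℝ) {n : ℕ} (hn : 1 ≤ n)
    {ρ : ℝ} (hρ : 1 ≤ ρ) (M : ℕ) :
    ∀ᶠ ℓ in atTop, ∀ (e : Plane) (u : ℝ) (y ξ : Plane) (r : ℝ) (η : Plane → ℝ), ‖e‖ = 1 →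
      IsAdapted K e 1 (Rpow ℓ (-(1 / 2) + dlt n)) η →
      (∀ x, η x ≠ 0 → |inner ℝ (x - u • perp e) (perp e)| ≤ Rpow ℓ (-(1 / 2) + dlt n) / 2) →
      Rpow ℓ (-(1 / 2) + dlt n) < |inner ℝ (y - u • perp e) (perp e)| → 0 < r → r ≤ ρ →
      A⁻¹ * 2 ^ ℓ ≤ inner ℝ ξ e → inner ℝ ξ e ≤ A * 2 ^ ℓ →
      |inner ℝ ξ (perp e)| ≤ A * Rpow ℓ (1 / 2) →
      ‖∫ α in (-Real.pi)..Real.pi, (η (y + r • circlePoint α) : ℂ) *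
        (Real.fourierChar (inner ℝ (r • circlePoint α) ξ) : ℂ)‖ ≤ Rpow ℓ (-(M : ℝ)) := by
  obtain ⟨Θ, hΘ, hΘ1, T, hT⟩ := exists_smooth_inv
  have hδ := dlt_pos n
  have hδ2 : dlt n ≤ 1 / 2 := by
    unfold dlt
    calc (2 : ℝ)⁻¹ ^ n ≤ 2⁻¹ ^ 1 := pow_le_pow_of_le_one (by norm_num) (by norm_num) hn
      _ = 1 / 2 := by norm_num
  set Cc : ℝ := 8 * Real.pi * ρ * A ^ 2 + 4 * ρ with hCc
  have hpi := Real.pi_gt_three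
  have hpi4 := Real.pi_le_four
  have hCc1 : 1 ≤ Cc := by
    have : 0 ≤ 8 * Real.pi * ρ * A ^ 2 := by positivity
    linarith
  obtain ⟨N, hN⟩ := exists_nat_ge (((M : ℝ) + 1) / (2 * dlt n))
  rw [div_le_iff₀ (by positivity)] at hN
  obtain ⟨C, hC⟩ := exists_integral_oscillating_le N
    (fun k => ‖(-Complex.I)‖ * (k.factorial * ∑ i ∈ Finset.range (k + 1), |T i|))
    (fun k => k.factorial * ∑ i ∈ Finset.range (k + 1), |K i|)
  filter_upwards [(tendsto_Rpow hδ).eventually_ge_atTop (4 * ρ * A ^ 2),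
    (tendsto_Rpow zero_lt_one).eventually_ge_atTop (|C| * (Cc * A) ^ N)] with ℓ hℓ1 hℓ2
  intro e u y ξ r η he hη hsupp hy hr hrρ hξ1 hξ2 hξ3
  have hp : ‖perp e‖ = 1 := by rw [norm_perp, he]
  have hA0 : 0 < A := by linarith
  set w := Rpow ℓ (-(1 / 2) + dlt n) with hw
  set H := Rpow ℓ (1 / 2) with hH
  set D := Rpow ℓ (dlt n) with hD
  have hw0 : 0 < w := Rpow_pos _ _
  have hH0 : 0 < H := Rpow_pos _ _
  have hD0 : 0 < D := Rpow_pos _ _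
  have hR : (2 : ℝ) ^ ℓ = H * H := by
    rw [hH, ← Rpow_add]; norm_num [Rpow_one]
  have hwH : w * H = D := by rw [hw, hH, hD, ← Rpow_add]; congr 1; ring
  have hw1 : w ≤ 1 := by rw [← Rpow_zero ℓ]; exact Rpow_mono ℓ (by linarith)
  have hH1 : 1 ≤ H := one_le_Rpow ℓ (by norm_num)
  set P : ℝ := D * H / A with hP
  have hP0 : 0 < P := by positivity
  set B : ℝ := Cc / w with hB
  have hB1 : 1 ≤ B := by
    rw [hB, le_div_iff₀ hw0]; linarith
  have hB0 : 0 < B := by linarith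
  -- The amplitude `α ↦ η (y + r ω)` varies at the angular scale `B⁻¹`, `B` about `R ^ (1 / 2 - δ)`,
  -- because of the width `w` of the tube.
  have ha := isSymbol_comp_trig (contDiff_comp_frame hη.1 e 1 w) hη.2 (frameCoord e 1 w y)
    (frameCoord e 1 w (r • circlePoint 0)) (frameCoord e 1 w (r • perp (circlePoint 0))) hB1 (by
      have h1 := norm_frameCoord_le he one_pos hw0 (r • circlePoint 0)
      have h2 := norm_frameCoord_le he one_pos hw0 (r • perp (circlePoint 0))
      rw [norm_smul, norm_circlePoint, mul_one, Real.norm_of_nonneg hr.le] at h1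
      rw [norm_smul, norm_perp, norm_circlePoint, mul_one, Real.norm_of_nonneg hr.le] at h2
      have h3 : (1 : ℝ)⁻¹ + w⁻¹ ≤ 2 * w⁻¹ := by
        have := one_le_inv_iff₀.2 ⟨hw0, hw1⟩
        rw [inv_one]; linarith
      have h4 : r * (1⁻¹ + w⁻¹) ≤ ρ * (2 * w⁻¹) := by gcongr
      have h5 : 4 * ρ * w⁻¹ ≤ B := by
        rw [hB, div_eq_mul_inv]
        gcongr
        have : 0 ≤ 8 * Real.pi * ρ * A ^ 2 := by positivity
        linarith
      linarith)
  have haeq : ∀ α, η ((1 * (frameCoord e 1 w y + (Real.cos α • frameCoord e 1 w (r • circlePoint 0) +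
      Real.sin α • frameCoord e 1 w (r • perp (circlePoint 0)))) 0) • e +
      (w * (frameCoord e 1 w y + (Real.cos α • frameCoord e 1 w (r • circlePoint 0) +
      Real.sin α • frameCoord e 1 w (r • perp (circlePoint 0)))) 1) • perp e) =
      η (y + r • circlePoint α) := by
    intro α
    congr 1
    rw [← map_smul, ← map_smul, ← map_add, ← map_add, frameMap_frameCoord he one_ne_zero hw0.ne',
      circlePoint_eq α, smul_add, smul_comm r (Real.cos α), smul_comm r (Real.sin α)]
  simp_rw [haeq] at ha
  -- On the support of the amplitude, the derivative `U` of the phase is at least `P`, which is about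
  -- `R ^ (1 / 2 + δ)`, and `Θ (U / P) / P` stands for `1 / U`. Each integration by parts gains `B / P`,
  -- a multiple of `R ^ (-2 δ)`, and `2 δ N ≥ M + 1`.
  set U : ℝ → ℝ := fun α => 2 * Real.pi * inner ℝ (r • perp (circlePoint α)) ξ with hU
  have hUeq : ∀ α, (0 : ℝ) + (Real.cos α • (2 * Real.pi * r * ξ 1 / P) +
      Real.sin α • (-(2 * Real.pi * r * ξ 0) / P)) = U α / P := by
    intro α
    simp only [hU, inner_smul_left, inner_eq, perp_zero, perp_one, circlePoint_zero,
      circlePoint_one, smul_eq_mul]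
    simp
    ring
  have hξn : ‖ξ‖ ≤ 2 * A * (H * H) := by
    refine (norm_le_frame he ξ).trans ?_
    rw [hR] at hξ2 hξ1
    have h0 : 0 ≤ inner ℝ ξ e := le_trans (by positivity) hξ1
    rw [abs_of_nonneg h0]
    have : A * H ≤ A * (H * H) := by gcongr; nlinarith
    linarith
  have hξ0 : |ξ 0| ≤ 2 * A * (H * H) := by
    have := norm_sq_eq ξ
    exact (abs_le_of_sq_le_sq (by nlinarith [sq_nonneg (ξ 1)]) (norm_nonneg ξ)).trans hξn
  have hξ1' : |ξ 1| ≤ 2 * A * (H * H) := by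
    have := norm_sq_eq ξ
    exact (abs_le_of_sq_le_sq (by nlinarith [sq_nonneg (ξ 0)]) (norm_nonneg ξ)).trans hξn
  have hamp : ∀ z : ℝ, |z| ≤ 2 * A * (H * H) → 2 * Real.pi * r * |z| / P ≤ B / 2 := by
    intro z hz
    have h1 : 2 * Real.pi * r * |z| / P ≤ 2 * Real.pi * ρ * (2 * A * (H * H)) / P := by gcongr
    refine h1.trans ?_
    have h2 : 2 * Real.pi * ρ * (2 * A * (H * H)) / P = 4 * Real.pi * ρ * A ^ 2 / w := by
      rw [hP, ← hwH]; field_simp; ring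
    rw [h2, hB, div_div, mul_comm w 2, ← div_div]
    gcongr
    have : 0 ≤ ρ := by linarith
    rw [hCc]; linarith
  have hq := (isSymbol_comp_trig hΘ hT (0 : ℝ) (2 * Real.pi * r * ξ 1 / P)
    (-(2 * Real.pi * r * ξ 0) / P) hB1 (by
      have h1 := hamp _ hξ1'
      have h2 := hamp _ hξ0
      have hr2 : 0 ≤ 2 * Real.pi * r := by positivity
      rw [Real.norm_eq_abs, Real.norm_eq_abs, abs_div (2 * Real.pi * r * ξ 1) P,
        abs_div (-(2 * Real.pi * r * ξ 0)) P, abs_neg, abs_mul _ (ξ 1), abs_mul _ (ξ 0),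
        abs_of_pos hP0, abs_of_nonneg hr2]
      linarith)).const_mul (-Complex.I)
  simp_rw [hUeq] at hq
  have hcp := circlePoint_periodic
  have hmain := hC B P (fun α => (η (y + r • circlePoint α) : ℂ))
    (fun α => -Complex.I * (Θ (U α / P) : ℂ)) (fun α => Complex.I * (U α : ℂ))
    (fun α => (Real.fourierChar (inner ℝ (r • circlePoint α) ξ) : ℂ)) hB0 hP0 ha hq ?_ ?_ ?_ ?_ ?_
    ?_ ?_
  · refine hmain.trans ?_
    have h1 : B / P = Cc * A * (Rpow ℓ (2 * dlt n))⁻¹ := by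
      rw [two_mul, Rpow_add, ← hD, hB, hP, ← hwH]
      field_simp
    have h2 : Rpow ℓ (M + 1) ≤ Rpow ℓ (2 * dlt n) ^ N := by
      rw [← Rpow_mul_nat]; exact Rpow_mono ℓ (by linarith)
    rw [h1, mul_pow, Rpow_neg, inv_pow]
    have h3 : 0 ≤ (Rpow ℓ (2 * dlt n) ^ N)⁻¹ :=
      inv_nonneg.2 (pow_nonneg (Rpow_pos ℓ (2 * dlt n)).le N)
    calc C * ((Cc * A) ^ N * (Rpow ℓ (2 * dlt n) ^ N)⁻¹)
        ≤ |C| * ((Cc * A) ^ N * (Rpow ℓ (2 * dlt n) ^ N)⁻¹) :=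
          mul_le_mul_of_nonneg_right (le_abs_self C) (mul_nonneg (by positivity) h3)
      _ = |C| * (Cc * A) ^ N * (Rpow ℓ (2 * dlt n) ^ N)⁻¹ := by ring
      _ ≤ Rpow ℓ 1 * (Rpow ℓ (M + 1))⁻¹ := by
          have := Rpow_pos ℓ (M + 1)
          have := Rpow_pos ℓ 1
          gcongr
      _ = (Rpow ℓ M)⁻¹ := by
          have := Rpow_pos ℓ M
          have := Rpow_pos ℓ 1
          rw [Rpow_add]; field_simp
  · have h1 : Continuous fun α => inner ℝ (r • perp (circlePoint α)) ξ :=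
      ((continuous_perp.comp continuous_circlePoint).const_smul r).inner continuous_const
    exact continuous_const.mul (Complex.continuous_ofReal.comp (continuous_const.mul h1))
  · intro α
    have h1 : ∀ α, inner ℝ (r • circlePoint α) ξ =
        r * (Real.cos α * ξ 0 + Real.sin α * ξ 1) := by
      intro α; rw [inner_smul_left, inner_eq]; simp
    have h2 : HasDerivAt (fun α => inner ℝ (r • circlePoint α) ξ)
        (r * (-Real.sin α * ξ 0 + Real.cos α * ξ 1)) α := by
      simp_rw [h1]
      exact (((Real.hasDerivAt_cos α).mul_const _).add
        ((Real.hasDerivAt_sin α).mul_const _)).const_mul r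
    have h3 := (Real.hasDerivAt_fourierChar (inner ℝ (r • circlePoint α) ξ)).scomp α h2
    refine h3.congr_deriv ?_
    have h4 : U α = 2 * Real.pi * (r * (-Real.sin α * ξ 0 + Real.cos α * ξ 1)) := by
      simp only [hU, inner_smul_left, inner_eq]; simp
    rw [h4, Complex.real_smul]
    push_cast
    ring
  · intro α; exact (norm_fourierChar_coe _).le
  · intro α; simp only [hcp α]
  · intro α; simp only [hU, hcp α]
  · intro α; simp only [hcp α]
  · intro α hα
    have h1 : η (y + r • circlePoint α) ≠ 0 := by exact_mod_cast hα
    have h2 := hsupp _ h1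
    -- Transversally to the tube, `y` is further than `w` from its axis and `y + r ω` is within
    -- `w / 2` of it.
    have h3 : w / 2 ≤ r * |inner ℝ (circlePoint α) (perp e)| := by
      have h4 : inner ℝ (y + r • circlePoint α - u • perp e) (perp e) =
          inner ℝ (y - u • perp e) (perp e) + r * inner ℝ (circlePoint α) (perp e) := by
        rw [show y + r • circlePoint α - u • perp e = (y - u • perp e) + r • circlePoint α by abel,
          inner_add_left, inner_smul_left]
        simp
      rw [h4] at h2
      have h5 := abs_sub_abs_le_abs_sub (inner ℝ (y - u • perp e) (perp e))
        (-(r * inner ℝ (circlePoint α) (perp e)))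
      rw [sub_neg_eq_add, abs_neg, abs_mul, abs_of_pos hr] at h5
      linarith
    have h6 : inner ℝ (perp (circlePoint α)) e = -inner ℝ (circlePoint α) (perp e) := by
      simp only [inner_eq, perp_zero, perp_one]; ring
    have h7 : inner ℝ (perp (circlePoint α)) (perp e) = inner ℝ (circlePoint α) e := by
      simp only [inner_eq, perp_zero, perp_one]; ring
    have h8 : |inner ℝ (circlePoint α) e| ≤ 1 := by
      have := abs_inner_le (x := circlePoint α) he
      rwa [norm_circlePoint] at this
    -- The term with `ξ · e`, of size `R`, dominates the one with `ξ · e^⊥`, of size `R ^ (1 / 2)`.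
    have h9 : P ≤ |U α| := by
      have h20 : U α = -(2 * Real.pi * (r * (inner ℝ (circlePoint α) (perp e) * inner ℝ ξ e -
          inner ℝ (circlePoint α) e * inner ℝ ξ (perp e)))) := by
        simp only [hU]
        rw [inner_smul_left, inner_eq_frame he, h6, h7, conj_trivial]
        ring
      rw [h20, abs_neg, abs_mul, abs_of_pos (by positivity : 0 < 2 * Real.pi), abs_mul r,
        abs_of_pos hr]
      have h10 := abs_sub_abs_le_abs_sub (inner ℝ (circlePoint α) (perp e) * inner ℝ ξ e)
        (inner ℝ (circlePoint α) e * inner ℝ ξ (perp e))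
      rw [abs_mul, abs_mul (inner ℝ (circlePoint α) e)] at h10
      have h0 : 0 ≤ inner ℝ ξ e := le_trans (by positivity) hξ1
      rw [abs_of_nonneg h0] at h10
      have h11 : r * |inner ℝ (circlePoint α) (perp e)| * inner ℝ ξ e ≥
          w / 2 * (A⁻¹ * (H * H)) := by
        rw [hR] at hξ1
        gcongr
      have h12 : r * (|inner ℝ (circlePoint α) e| * |inner ℝ ξ (perp e)|) ≤ ρ * (1 * (A * H)) := by
        gcongr
      have h13 : w / 2 * (A⁻¹ * (H * H)) = P / 2 := by
        rw [hP, ← hwH]; field_simp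
      have h14 : ρ * (1 * (A * H)) ≤ P / 4 := by
        rw [hP, div_div, le_div_iff₀ (by positivity)]
        calc ρ * (1 * (A * H)) * (A * 4) = 4 * ρ * A ^ 2 * H := by ring
          _ ≤ D * H := by gcongr
      have h15 : P / 4 ≤ r * |inner ℝ (circlePoint α) (perp e) * inner ℝ ξ e -
          inner ℝ (circlePoint α) e * inner ℝ ξ (perp e)| := by
        have := mul_le_mul_of_nonneg_left h10 hr.le
        rw [mul_sub] at this
        nlinarith
      nlinarith
    have h16 := hΘ1 (U α / P) (by rw [abs_div, abs_of_pos hP0, le_div_iff₀ hP0, one_mul]; exact h9)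
    have h17 : ((Θ (U α / P) * (U α / P) : ℝ) : ℂ) = 1 := by rw [h16]; simp
    have hPc : (P : ℂ) ≠ 0 := by exact_mod_cast hP0.ne'
    push_cast at h17
    calc -Complex.I * (Θ (U α / P) : ℂ) * (Complex.I * U α)
        = -(Complex.I * Complex.I) * (Θ (U α / P) * (U α / P)) * P := by field_simp
      _ = P := by rw [h17, Complex.I_mul_I]; ring

/-! ### Decay of wave packets -/

theorem fourierMeasure_eq_extOp (μ : Measure Plane) (ξ : Plane) :
    fourierMeasure μ ξ = extOp μ (fun _ => 1) (-ξ) := by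
  unfold fourierMeasure extOp
  congr 1
  funext x
  rw [one_mul, inner_neg_left, real_inner_comm]

theorem continuous_fourierMeasure (μ : Measure Plane) [IsFiniteMeasure μ] :
    Continuous (fourierMeasure μ) := by
  have h : fourierMeasure μ = fun ξ => extOp μ (fun _ => 1) (-ξ) :=
    funext (fourierMeasure_eq_extOp μ)
  rw [h]
  exact (continuous_extOp (integrable_const 1)).comp continuous_neg

theorem norm_fourierMeasure_le (μ : Measure Plane) [IsProbabilityMeasure μ] (ξ : Plane) :
    ‖fourierMeasure μ ξ‖ ≤ 1 := by
  rw [fourierMeasure_eq_extOp]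
  refine (norm_extOp_le _ _ _).trans (le_of_eq ?_)
  simp

theorem ae_norm_le_of_support {μ : Measure Plane} (h : μ.support ⊆ Metric.closedBall 0 1) :
    ∀ᵐ z ∂μ, ‖z‖ ≤ 1 := by
  filter_upwards [μ.support_mem_ae] with z hz
  simpa using h hz

theorem fourierInv_mul_fourierMeasure {ψ : Plane → ℝ} (hint : Integrable fun ξ => (ψ ξ : ℂ))
    (μ : Measure Plane) [IsProbabilityMeasure μ] (x : Plane) :
    𝓕⁻ (fun ξ : Plane => (ψ ξ : ℂ) * fourierMeasure μ ξ) x =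
      ∫ z, 𝓕⁻ (fun ξ : Plane => (ψ ξ : ℂ)) (x - z) ∂μ := by
  have h1 : ∀ ξ : Plane, Real.fourierChar (inner ℝ ξ x) • ((ψ ξ : ℂ) * fourierMeasure μ ξ) =
      ∫ z, (ψ ξ : ℂ) * (Real.fourierChar (inner ℝ ξ x + -inner ℝ z ξ) : ℂ) ∂μ := by
    intro ξ
    rw [integral_const_mul]
    simp_rw [fourierChar_add_coe]
    rw [integral_const_mul, Circle.smul_def, smul_eq_mul, fourierMeasure]
    ring
  have h2 : ∀ ξ z : Plane, Real.fourierChar (inner ℝ ξ (x - z)) • (ψ ξ : ℂ) =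
      (ψ ξ : ℂ) * (Real.fourierChar (inner ℝ ξ x + -inner ℝ z ξ) : ℂ) := by
    intro ξ z
    rw [inner_sub_right, real_inner_comm ξ z, sub_eq_add_neg, Circle.smul_def, smul_eq_mul,
      mul_comm]
  simp_rw [Real.fourierInv_eq, h1, h2]
  rw [integral_integral_swap]
  have h3 : Integrable (fun p : Plane × Plane => (ψ p.1 : ℂ)) (volume.prod μ) :=
    hint.comp_fst μ
  exact integrable_mul_fourierChar h3 (by fun_prop)

/-- The Fourier transform of a function adapted to an `a × b` rectangle at the origin, `b ≤ a`,
decays rapidly at the scale `b⁻¹`. -/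
theorem exists_fourierInv_adapted_le (A : ℝ) (hA : 0 ≤ A) (K : ℕ → ℝ) (N : ℕ) :
    ∃ C : ℝ, 0 ≤ C ∧ ∀ (e : Plane) (a b : ℝ) (ψ : Plane → ℝ), ‖e‖ = 1 → 0 < b → b ≤ a →
      IsAdapted K e a b ψ →
      (∀ ξ, ψ ξ ≠ 0 → |inner ℝ ξ e| ≤ A * a ∧ |inner ℝ ξ (perp e)| ≤ A * b) → ∀ v : Plane,
      (b * ‖v‖) ^ N * ‖𝓕⁻ (fun ξ : Plane => (ψ ξ : ℂ)) v‖ ≤ C * (a * b) := by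
  refine ⟨2 ^ N * ∑ p ∈ Finset.range (N + 1), |K p| * (4 * (2 * A) ^ 2), by positivity, ?_⟩
  intro e a b ψ he hb hba hψ hsupp v
  have ha : 0 < a := hb.trans_le hba
  set g : Plane → ℂ := fun q => (ψ ((a * q 0) • e + (b * q 1) • perp e) : ℂ) with hg
  have hgr : ContDiff ℝ ∞ (fun q : Plane => ψ ((a * q 0) • e + (b * q 1) • perp e)) :=
    contDiff_comp_frame hψ.1 e a b
  have hgs : ContDiff ℝ ∞ g := Complex.ofRealCLM.contDiff.comp hgr
  have hgK : ∀ p q, ‖iteratedFDeriv ℝ p g q‖ ≤ |K p| := fun p q => by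
    have h := Complex.ofRealCLM.norm_iteratedFDeriv_comp_left (hgr.contDiffAt (x := q))
      (n := p) (by exact_mod_cast le_top)
    rw [Complex.ofRealCLM_norm, one_mul] at h
    exact h.trans ((hψ.2 p q).trans (le_abs_self _))
  have hgsupp : tsupport g ⊆ Metric.closedBall 0 (2 * A) := by
    refine closure_minimal (fun q hq => ?_) Metric.isClosed_closedBall
    have h1 : ψ (frameMap e a b q) ≠ 0 := by
      intro h; apply hq; simp only [hg]; rw [← frameMap_apply, h]; simp
    obtain ⟨h2, h3⟩ := hsupp _ h1
    rw [inner_frameMap_self he, abs_mul, abs_of_pos ha, mul_comm A] at h2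
    rw [inner_frameMap_perp he, abs_mul, abs_of_pos hb, mul_comm A] at h3
    have h4 := le_of_mul_le_mul_left h2 ha
    have h5 := le_of_mul_le_mul_left h3 hb
    rw [mem_closedBall_zero_iff]
    linarith [norm_le_abs_add_abs q]
  have hgc : HasCompactSupport g :=
    (isCompact_closedBall (0 : Plane) (2 * A)).of_isClosed_subset (isClosed_tsupport g) hgsupp
  have hpk : ∀ (k p : ℕ), Continuous fun q => ‖q‖ ^ k * ‖iteratedFDeriv ℝ p g q‖ := fun k p =>
    (continuous_norm.pow k).mul (hgs.continuous_iteratedFDeriv (by exact_mod_cast le_top)).norm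
  have hint : ∀ k p : ℕ, Integrable (fun q => ‖q‖ ^ k * ‖iteratedFDeriv ℝ p g q‖) := fun k p =>
    (hpk k p).integrable_of_hasCompactSupport ((hgc.iteratedFDeriv p).norm.mul_left)
  set v' : Plane := !₂[a * inner ℝ e v, b * inner ℝ (perp e) v] with hv'
  have hv'n : b * ‖v‖ ≤ ‖v'‖ := by
    have h1 := norm_sq_eq v'
    have h2 := norm_sq_eq_inner he v
    have h3 : v' 0 = a * inner ℝ v e := by rw [real_inner_comm]; simp [hv']
    have h4 : v' 1 = b * inner ℝ v (perp e) := by rw [real_inner_comm]; simp [hv']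
    refine abs_le_of_sq_le_sq' ?_ (norm_nonneg _) |>.2
    rw [h1, h3, h4, mul_pow, h2, mul_pow, mul_pow]
    have : b ^ 2 ≤ a ^ 2 := by gcongr
    nlinarith [sq_nonneg (inner ℝ v e)]
  have hF : 𝓕⁻ (fun ξ : Plane => (ψ ξ : ℂ)) v = ((a * b : ℝ) : ℂ) * 𝓕 g (-v') := by
    have h1 := integral_frameMap he ha hb
      (fun ξ => (Real.fourierChar (inner ℝ ξ v) : ℂ) * (ψ ξ : ℂ))
    have h2 : ∫ q, (Real.fourierChar (inner ℝ (frameMap e a b q) v) : ℂ) *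
        (ψ (frameMap e a b q) : ℂ) = 𝓕 g (-v') := by
      rw [Real.fourier_eq]
      congr 1
      funext q
      rw [Circle.smul_def, smul_eq_mul]
      simp only [hg, frameMap_apply]
      congr 3
      have h3 : inner ℝ q v' = q 0 * (a * inner ℝ e v) + q 1 * (b * inner ℝ (perp e) v) := by
        rw [inner_eq q v']; simp [hv']
      rw [← frameMap_apply, inner_frameMap, inner_neg_right, neg_neg, h3]
      ring
    rw [← h2, h1, Real.fourierInv_eq]
    simp_rw [Circle.smul_def, smul_eq_mul]
    rw [Complex.real_smul, ← mul_assoc, ← Complex.ofReal_mul, mul_inv_cancel₀ (by positivity)]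
    simp
  have hmain := Real.pow_mul_norm_iteratedFDeriv_fourier_le (f := g) (K := 0) (N := N)
    (hgs.of_le (by exact_mod_cast le_top)) (fun k p _ _ => hint k p) (k := 0) (n := N) le_rfl le_rfl
    (-v')
  rw [norm_iteratedFDeriv_zero, norm_neg, pow_zero, one_mul] at hmain
  have hsum : ∑ p ∈ Finset.range (0 + 1) ×ˢ Finset.range (N + 1),
      ∫ q, ‖q‖ ^ p.1 * ‖iteratedFDeriv ℝ p.2 g q‖ ≤
      ∑ p ∈ Finset.range (N + 1), |K p| * (4 * (2 * A) ^ 2) := by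
    rw [Finset.sum_product, zero_add, Finset.sum_range_one]
    refine Finset.sum_le_sum fun p _ => ?_
    simp only [pow_zero, one_mul]
    have h1 : ∀ q, q ∉ Metric.closedBall (0 : Plane) (2 * A) → ‖iteratedFDeriv ℝ p g q‖ = 0 := by
      intro q hq
      rw [norm_eq_zero]
      by_contra h
      exact hq (hgsupp (support_iteratedFDeriv_subset p h))
    rw [← setIntegral_eq_integral_of_forall_compl_eq_zero h1]
    have h2 := norm_setIntegral_le_of_norm_le_const (μ := volume)
      (s := Metric.closedBall (0 : Plane) (2 * A)) (f := fun q => ‖iteratedFDeriv ℝ p g q‖)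
      (C := |K p|) (isCompact_closedBall _ _).measure_lt_top fun q _ => by
        rw [norm_norm]; exact hgK p q
    refine (le_abs_self _).trans (h2.trans ?_)
    gcongr
    rw [measureReal_def]
    exact ENNReal.toReal_le_of_le_ofReal (by positivity) (volume_closedBall_le 0 (by positivity))
  rw [hF, norm_mul, Complex.norm_real, Real.norm_of_nonneg (by positivity)]
  calc (b * ‖v‖) ^ N * (a * b * ‖𝓕 g (-v')‖) ≤ ‖v'‖ ^ N * (a * b * ‖𝓕 g (-v')‖) := by gcongr
    _ = a * b * (‖v'‖ ^ N * ‖𝓕 g (-v')‖) := by ring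
    _ ≤ a * b * ((2 * ((0 : ℕ) : ℝ) + 2) ^ N *
        ∑ p ∈ Finset.range (N + 1), |K p| * (4 * (2 * A) ^ 2)) := by
      refine mul_le_mul_of_nonneg_left (hmain.trans ?_) (by positivity)
      gcongr
    _ = _ := by rw [Nat.cast_zero]; ring

/-- Boundedly overlapping intervals of length `w` in a bounded region: there are `O(1/w)` many. -/
theorem card_le_of_overlap {A w : ℝ} (hA : 0 ≤ A) (hw : 0 < w) (hw1 : w ≤ 1) (F : Finset ℝ)
    (hF : ∀ u ∈ F, |u| ≤ A) (hov : ∀ v : ℝ, (Set.ncard {u : ℝ | u ∈ F ∧ |v - u| ≤ w / 2} : ℝ) ≤ A) :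
    (F.card : ℝ) ≤ A * (2 * A + 2) / w := by
  classical
  rw [le_div_iff₀ hw]
  have hInd : ∀ v : ℝ, ∑ u ∈ F, (Set.Icc (u - w / 2) (u + w / 2)).indicator (1 : ℝ → ℝ≥0∞) v ≤
      (Set.Icc (-A - 1) (A + 1)).indicator (fun _ => ENNReal.ofReal A) v := by
    intro v
    have hset : {u : ℝ | u ∈ F ∧ |v - u| ≤ w / 2} =
        ((F.filter fun u => v ∈ Set.Icc (u - w / 2) (u + w / 2) : Finset ℝ) : Set ℝ) := by
      ext u
      simp only [Set.mem_ofPred_eq, Finset.coe_filter, Set.mem_Icc, abs_le]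
      constructor
      · rintro ⟨h1, h2, h3⟩; exact ⟨h1, by linarith, by linarith⟩
      · rintro ⟨h1, h2, h3⟩; exact ⟨h1, by linarith, by linarith⟩
    have hsum : ∑ u ∈ F, (Set.Icc (u - w / 2) (u + w / 2)).indicator (1 : ℝ → ℝ≥0∞) v =
        ((F.filter fun u => v ∈ Set.Icc (u - w / 2) (u + w / 2)).card : ℝ≥0∞) := by
      simp only [Set.indicator_apply, Pi.one_apply, Finset.sum_boole]
    by_cases hv : v ∈ Set.Icc (-A - 1) (A + 1)
    · rw [Set.indicator_of_mem hv, hsum, ← ENNReal.ofReal_natCast]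
      apply ENNReal.ofReal_le_ofReal
      have := hov v
      rwa [hset, Set.ncard_coe_finset] at this
    · rw [Set.indicator_of_notMem hv, hsum, nonpos_iff_eq_zero, Nat.cast_eq_zero,
        Finset.card_eq_zero, Finset.filter_eq_empty_iff]
      intro u hu hvu
      have h1 := abs_le.1 (hF u hu)
      exact hv ⟨by linarith [hvu.1, h1.1], by linarith [hvu.2, h1.2]⟩
  have h := lintegral_mono (μ := volume) hInd
  rw [lintegral_finsetSum _ (fun u _ => (measurable_one.indicator measurableSet_Icc)),
    lintegral_indicator_const measurableSet_Icc, Real.volume_Icc] at h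
  simp_rw [lintegral_indicator_one measurableSet_Icc, Real.volume_Icc] at h
  have h2 : ∀ u : ℝ, u + w / 2 - (u - w / 2) = w := fun u => by ring
  simp_rw [h2] at h
  rw [Finset.sum_const, nsmul_eq_mul, ← ENNReal.ofReal_natCast, ← ENNReal.ofReal_mul (by positivity),
    ← ENNReal.ofReal_mul hA, ENNReal.ofReal_le_ofReal_iff (by nlinarith)] at h
  calc (F.card : ℝ) * w ≤ _ := h
    _ = _ := by ring

/-! ### Circular averages of the good part -/

theorem tendsto_add_left_atTop (m : ℕ) : Tendsto (fun i => m + i) atTop atTop :=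
  tendsto_atTop_mono (fun i => Nat.le_add_left i m) tendsto_id

theorem fourierInv_eq_extOp (f : Plane → ℂ) : 𝓕⁻ f = extOp volume f := by
  funext x
  rw [Real.fourierInv_eq, extOp]
  congr 1
  funext v
  rw [Circle.smul_def, smul_eq_mul, mul_comm, real_inner_comm]

theorem IsAdapted.abs_le {K : ℕ → ℝ} {e : Plane} (he : ‖e‖ = 1) {a b : ℝ} (ha : a ≠ 0) (hb : b ≠ 0)
    {f : Plane → ℝ} (hf : IsAdapted K e a b f) (x : Plane) : |f x| ≤ K 0 := by
  have h := hf.2 0 (frameCoord e a b x)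
  rwa [norm_iteratedFDeriv_zero, frameMap_frameCoord he ha hb, Real.norm_eq_abs] at h

namespace WavePackets

variable {m₀ n : ℕ} (W : WavePackets m₀ n)

theorem norm_fineDir {i : ℕ} (θ : FineCap n (m₀ + i)) : ‖fineDir θ‖ = 1 := norm_capDir _ _

theorem sum_ψ_le_one {i : ℕ} (hi : 1 ≤ i) (ξ : Plane) : ∑ θ, W.ψ i θ ξ ≤ 1 := by
  obtain ⟨j, rfl⟩ : ∃ j, i = j + 1 := ⟨i - 1, by omega⟩
  have h := le_hasSum (W.ψ_sum ξ) j fun k _ =>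
    Finset.sum_nonneg fun θ _ => W.ψ_nonneg (k + 1) (by omega) θ ξ
  linarith [W.ψ₀_nonneg ξ]

theorem ψ_le_one {i : ℕ} (hi : 1 ≤ i) (θ : FineCap n (m₀ + i)) (ξ : Plane) : W.ψ i θ ξ ≤ 1 :=
  (Finset.single_le_sum (f := fun θ => W.ψ i θ ξ) (fun θ _ => W.ψ_nonneg i hi θ ξ)
    (Finset.mem_univ θ)).trans (W.sum_ψ_le_one hi ξ)

theorem continuous_ψ {i : ℕ} (hi : 1 ≤ i) (θ : FineCap n (m₀ + i)) : Continuous (W.ψ i θ) :=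
  (W.ψ_adapted i hi θ).1.continuous

theorem norm_le_of_ψ_ne_zero {i : ℕ} (hi : 1 ≤ i) {θ : FineCap n (m₀ + i)} {ξ : Plane}
    (h : W.ψ i θ ξ ≠ 0) : ‖ξ‖ ≤ 2 * W.A * 2 ^ (m₀ + i) := by
  obtain ⟨h1, h2, h3⟩ := W.ψ_support i hi θ h
  have hA := W.one_le_A
  refine (norm_le_frame (norm_fineDir θ) ξ).trans ?_
  have h0 : 0 ≤ inner ℝ ξ (fineDir θ) := le_trans (by positivity) h1
  rw [abs_of_nonneg h0]
  have : Rpow (m₀ + i) (1 / 2) ≤ 2 ^ (m₀ + i) := by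
    rw [← Rpow_one]; exact Rpow_mono _ (by norm_num)
  have : W.A * Rpow (m₀ + i) (1 / 2) ≤ W.A * 2 ^ (m₀ + i) := by gcongr
  linarith

theorem hasCompactSupport_ψ {i : ℕ} (hi : 1 ≤ i) (θ : FineCap n (m₀ + i)) :
    HasCompactSupport (W.ψ i θ) :=
  HasCompactSupport.of_support_subset_isCompact
    (isCompact_closedBall (0 : Plane) (2 * W.A * 2 ^ (m₀ + i))) fun ξ hξ => by
      rw [mem_closedBall_zero_iff]; exact W.norm_le_of_ψ_ne_zero hi hξ

/-- The frequency localization `ψ_{i,θ} μ̂`. -/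
def freq (μ : Measure Plane) (i : ℕ) (θ : FineCap n (m₀ + i)) (ξ : Plane) : ℂ :=
  (W.ψ i θ ξ : ℂ) * fourierMeasure μ ξ

/-- The part `(ψ_{i,θ} μ̂)^∨` of `μ` with frequencies in the rectangle of `θ`. -/
def packet (μ : Measure Plane) (i : ℕ) (θ : FineCap n (m₀ + i)) : Plane → ℂ :=
  extOp volume (W.freq μ i θ)

variable (μ : Measure Plane)

theorem hasCompactSupport_freq {i : ℕ} (hi : 1 ≤ i) (θ : FineCap n (m₀ + i)) :
    HasCompactSupport (W.freq μ i θ) :=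
  ((W.hasCompactSupport_ψ hi θ).comp_left Complex.ofReal_zero).mul_right

theorem norm_freq_ne_zero_le {i : ℕ} (hi : 1 ≤ i) {θ : FineCap n (m₀ + i)} {ξ : Plane}
    (h : W.freq μ i θ ξ ≠ 0) : ‖ξ‖ ≤ 2 * W.A * 2 ^ (m₀ + i) := by
  apply W.norm_le_of_ψ_ne_zero hi (θ := θ)
  intro h0; apply h; simp [freq, h0]

theorem M_eq (i : ℕ) (θ : FineCap n (m₀ + i)) (u : ℝ) (x : Plane) :
    W.M μ i θ u x = (W.η i θ u x : ℂ) * W.packet μ i θ x := by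
  rw [M, fourierInv_eq_extOp]; rfl

variable [IsProbabilityMeasure μ]

theorem norm_freq_le {i : ℕ} (hi : 1 ≤ i) (θ : FineCap n (m₀ + i)) (ξ : Plane) :
    ‖W.freq μ i θ ξ‖ ≤ W.ψ i θ ξ := by
  rw [freq, norm_mul, Complex.norm_real, Real.norm_of_nonneg (W.ψ_nonneg i hi θ ξ)]
  exact mul_le_of_le_one_right (W.ψ_nonneg i hi θ ξ) (norm_fourierMeasure_le μ ξ)

theorem continuous_freq {i : ℕ} (hi : 1 ≤ i) (θ : FineCap n (m₀ + i)) :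
    Continuous (W.freq μ i θ) :=
  (Complex.continuous_ofReal.comp (W.continuous_ψ hi θ)).mul (continuous_fourierMeasure μ)

theorem integrable_freq {i : ℕ} (hi : 1 ≤ i) (θ : FineCap n (m₀ + i)) :
    Integrable (W.freq μ i θ) :=
  (W.continuous_freq μ hi θ).integrable_of_hasCompactSupport (W.hasCompactSupport_freq μ hi θ)

theorem continuous_packet {i : ℕ} (hi : 1 ≤ i) (θ : FineCap n (m₀ + i)) :
    Continuous (W.packet μ i θ) :=
  continuous_extOp (W.integrable_freq μ hi θ)

theorem integral_norm_freq_le {i : ℕ} (hi : 1 ≤ i) (θ : FineCap n (m₀ + i)) :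
    ∫ ξ, ‖W.freq μ i θ ξ‖ ≤ 4 * (2 * W.A * 2 ^ (m₀ + i)) ^ 2 := by
  have hA := W.one_le_A
  set s := Metric.closedBall (0 : Plane) (2 * W.A * 2 ^ (m₀ + i))
  have h1 : ∀ ξ, ξ ∉ s → ‖W.freq μ i θ ξ‖ = 0 := by
    intro ξ hξ
    rw [norm_eq_zero]
    by_contra h
    exact hξ (by rw [mem_closedBall_zero_iff]; exact W.norm_freq_ne_zero_le μ hi h)
  rw [← setIntegral_eq_integral_of_forall_compl_eq_zero h1]
  have h2 := norm_setIntegral_le_of_norm_le_const (μ := volume) (s := s)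
    (f := fun ξ => ‖W.freq μ i θ ξ‖) (C := 1) (isCompact_closedBall _ _).measure_lt_top
    fun ξ _ => by
      rw [norm_norm]; exact (W.norm_freq_le μ hi θ ξ).trans (W.ψ_le_one hi θ ξ)
  refine (le_abs_self _).trans (h2.trans ?_)
  rw [one_mul, measureReal_def]
  exact ENNReal.toReal_le_of_le_ofReal (by positivity) (volume_closedBall_le 0 (by positivity))

/-- Outside of the ball of radius `2` the pieces of `μ` are negligible. -/
theorem eventually_norm_packet_le (hμ : ∀ᵐ z ∂μ, ‖z‖ ≤ 1) (M : ℕ) :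
    ∀ᶠ i in atTop, ∀ (θ : FineCap n (m₀ + i)) (x : Plane), 2 ≤ ‖x‖ →
      ‖W.packet μ i θ x‖ ≤ Rpow (m₀ + i) (-(M : ℝ)) := by
  obtain ⟨C, hC, h⟩ := exists_fourierInv_adapted_le W.A (zero_le_one.trans W.one_le_A) W.K
    (2 * (M + 3))
  filter_upwards [eventually_ge_atTop 1, (tendsto_add_left_atTop m₀).eventually
    ((tendsto_Rpow zero_lt_one).eventually_ge_atTop C)] with i hi hCR θ x hx
  set H := Rpow (m₀ + i) (1 / 2) with hH
  have hH1 : 1 ≤ H := one_le_Rpow (m₀ + i) (by norm_num)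
  have hR : (2 : ℝ) ^ (m₀ + i) = H ^ 2 := by
    rw [hH, ← Rpow_mul_nat, ← Rpow_one]; congr 1; norm_num
  have hRC : Rpow (m₀ + i) 1 = H ^ 2 := by rw [Rpow_one, hR]
  rw [hRC] at hCR
  have h1 : ∀ v : Plane, 1 ≤ ‖v‖ → ‖𝓕⁻ (fun ξ : Plane => (W.ψ i θ ξ : ℂ)) v‖ ≤
      Rpow (m₀ + i) (-(M : ℝ)) := by
    intro v hv
    have h2 := h (fineDir θ) (2 ^ (m₀ + i)) H (W.ψ i θ) (norm_fineDir θ) (by positivity)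
      (by rw [hR]; nlinarith) (W.ψ_adapted i hi θ) (fun ξ hξ => by
        obtain ⟨h3, h4, h5⟩ := W.ψ_support i hi θ hξ
        have hA := W.one_le_A
        rw [abs_of_nonneg (le_trans (by positivity) h3)]
        exact ⟨h4, h5⟩) v
    have h6 : H ^ (2 * (M + 3)) ≤ (H * ‖v‖) ^ (2 * (M + 3)) := by
      gcongr; nlinarith
    have hM : Rpow (m₀ + i) (M : ℝ) = H ^ (2 * M) := by
      rw [hH, ← Rpow_mul_nat]; congr 1; push_cast; ring
    rw [Rpow_neg, hM, ← one_div, le_div_iff₀ (by positivity)]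
    have h7 : H ^ (2 * (M + 3)) * ‖𝓕⁻ (fun ξ : Plane => (W.ψ i θ ξ : ℂ)) v‖ ≤ H ^ 6 := by
      calc _ ≤ (H * ‖v‖) ^ (2 * (M + 3)) * ‖𝓕⁻ (fun ξ : Plane => (W.ψ i θ ξ : ℂ)) v‖ := by gcongr
        _ ≤ C * (2 ^ (m₀ + i) * H) := h2
        _ ≤ H ^ 2 * (H ^ 2 * H) := by rw [hR]; gcongr
        _ = H ^ 5 := by ring
        _ ≤ H ^ 6 := pow_le_pow_right₀ hH1 (by norm_num)
    have h8 : H ^ (2 * (M + 3)) = H ^ 6 * H ^ (2 * M) := by ring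
    rw [h8, mul_assoc] at h7
    have h9 : 0 < H ^ 6 := by positivity
    have h10 := le_of_mul_le_mul_left (h7.trans (mul_one _).ge) h9
    linarith
  have h2 : W.packet μ i θ x = ∫ z, 𝓕⁻ (fun ξ : Plane => (W.ψ i θ ξ : ℂ)) (x - z) ∂μ := by
    have hint : Integrable fun ξ => (W.ψ i θ ξ : ℂ) :=
      ((W.continuous_ψ hi θ).integrable_of_hasCompactSupport (W.hasCompactSupport_ψ hi θ)).ofReal
    rw [← fourierInv_mul_fourierMeasure hint,
      fourierInv_eq_extOp]
    rfl
  rw [h2]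
  refine (norm_integral_le_of_norm_le_const (C := Rpow (m₀ + i) (-(M : ℝ))) ?_).trans (by simp)
  filter_upwards [hμ] with z hz
  apply h1
  have := norm_sub_norm_le x z
  linarith

theorem card_tubes_le (hn : 1 ≤ n) {i : ℕ} (hi : 1 ≤ i) (θ : FineCap n (m₀ + i)) :
    ((W.tubes i θ).card : ℝ) ≤ W.A * (2 * W.A + 2) * 2 ^ (m₀ + i) := by
  have hA := W.one_le_A
  set w := Rpow (m₀ + i) (-(1 / 2) + dlt n) with hw
  have hδ := dlt_pos n
  have hδ2 : dlt n ≤ 1 / 2 := by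
    unfold dlt
    calc (2 : ℝ)⁻¹ ^ n ≤ 2⁻¹ ^ 1 := pow_le_pow_of_le_one (by norm_num) (by norm_num) hn
      _ = 1 / 2 := by norm_num
  have hw0 : 0 < w := Rpow_pos _ _
  have hw1 : w ≤ 1 := by rw [← Rpow_zero (m₀ + i)]; exact Rpow_mono _ (by linarith)
  have hwR : w⁻¹ ≤ 2 ^ (m₀ + i) := by
    rw [hw, ← Rpow_neg, ← Rpow_one]; exact Rpow_mono _ (by linarith)
  have h := card_le_of_overlap (A := W.A) (w := w) (by linarith) hw0 hw1 (W.tubes i θ)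
    (W.tubes_bounded i hi θ) (fun v => by
      have h1 := W.tubes_overlap i hi θ (v • perp (fineDir θ))
      have h2 : {u : ℝ | u ∈ W.tubes i θ ∧ |v - u| ≤ w / 2} =
          {u : ℝ | u ∈ W.tubes i θ ∧ v • perp (fineDir θ) ∈ tube (u • perp (fineDir θ)) (fineDir θ)
            (Rpow (m₀ + i) (-(1 / 2) + dlt n)) W.len} := by
        ext u
        have h3 : inner ℝ (perp (fineDir θ)) (fineDir θ) = 0 := by
          rw [real_inner_comm, inner_perp_self]
        have h4 : inner ℝ (perp (fineDir θ)) (perp (fineDir θ)) = 1 := by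
          rw [real_inner_self_eq_norm_sq, norm_perp, norm_fineDir]; norm_num
        have h5 : 0 ≤ W.len / 2 := by linarith [W.four_lt_len]
        simp only [Set.mem_ofPred_eq, tube, ← sub_smul, inner_smul_left, conj_trivial, h3, h4,
          mul_zero, abs_zero, mul_one, h5, true_and, hw]
      rw [h2]; exact h1)
  calc _ ≤ _ := h
    _ = W.A * (2 * W.A + 2) * w⁻¹ := by rw [div_eq_mul_inv]
    _ ≤ _ := by gcongr

theorem continuous_η {i : ℕ} (hi : 1 ≤ i) {θ : FineCap n (m₀ + i)} {u : ℝ}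
    (hu : u ∈ W.tubes i θ) : Continuous (W.η i θ u) :=
  (W.η_adapted i hi θ u hu).1.continuous

/-- The circular average of a wave packet, as a superposition over its frequencies. -/
theorem integral_circle_mul_packet {i : ℕ} (hi : 1 ≤ i) (θ : FineCap n (m₀ + i)) {η : Plane → ℝ}
    (hη : Continuous η) (y : Plane) (r : ℝ) :
    ∫ α in (-Real.pi)..Real.pi, (η (y + r • circlePoint α) : ℂ) *
        W.packet μ i θ (y + r • circlePoint α) =
      ∫ ξ, (W.freq μ i θ ξ * (Real.fourierChar (inner ℝ y ξ) : ℂ)) *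
        ∫ α in (-Real.pi)..Real.pi, (η (y + r • circlePoint α) : ℂ) *
          (Real.fourierChar (inner ℝ (r • circlePoint α) ξ) : ℂ) := by
  have hpi : -Real.pi ≤ Real.pi := by linarith [Real.pi_pos]
  have hcp := continuous_circlePoint
  simp_rw [intervalIntegral.integral_of_le hpi, packet, extOp, ← integral_const_mul]
  rw [integral_integral_swap]
  · congr 1
    funext ξ
    congr 1
    funext α
    rw [inner_add_left, fourierChar_add_coe]
    ring
  · have h1 : Integrable (fun α => (η (y + r • circlePoint α) : ℂ))
        (volume.restrict (Set.Ioc (-Real.pi) Real.pi)) := by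
      have : Continuous fun α => (η (y + r • circlePoint α) : ℂ) := by fun_prop
      exact (this.integrableOn_Icc (a := -Real.pi) (b := Real.pi)).mono_set Set.Ioc_subset_Icc_self
    have h2 := h1.mul_prod (W.integrable_freq μ hi θ)
    have h3 := integrable_mul_fourierChar h2
      (g := fun p : ℝ × Plane => inner ℝ (y + r • circlePoint p.1) p.2)
      (by apply Continuous.aestronglyMeasurable; fun_prop)
    refine h3.congr (Eventually.of_forall fun p => ?_)
    simp only [Function.uncurry]
    ring

end WavePackets

namespace WavePackets

variable {m₀ n : ℕ} (W : WavePackets m₀ n) (μ : Measure Plane) [IsProbabilityMeasure μ]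

theorem eventually_const_le (c : ℝ) : ∀ᶠ i : ℕ in atTop, c ≤ (2 : ℝ) ^ (m₀ + i) := by
  have h := (tendsto_add_left_atTop m₀).eventually
    ((tendsto_Rpow zero_lt_one).eventually_ge_atTop c)
  simpa only [Rpow_one] using h

theorem card_fineCap_le (hn : 1 ≤ n) (i : ℕ) :
    ((Finset.univ : Finset (FineCap n (m₀ + i))).card : ℝ) ≤ 2 ^ (m₀ + i) := by
  rw [Finset.card_univ, Fintype.card_fin]
  push_cast
  exact scale_le n (m₀ + i) (by omega)

/-- The tubes that do not contain `y` in their double contribute a negligible amount to the circular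
averages around `y`. -/
theorem eventually_norm_integral_circle_tube_le (hn : 1 ≤ n) {ρ : ℝ} (hρ : 1 ≤ ρ) (M : ℕ) :
    ∀ᶠ i in atTop, ∀ (θ : FineCap n (m₀ + i)) (u : ℝ), u ∈ W.tubes i θ → ∀ (y : Plane) (r : ℝ),
      0 < r → r ≤ ρ → Rpow (m₀ + i) (-(1 / 2) + dlt n) <
        |inner ℝ (y - u • perp (fineDir θ)) (perp (fineDir θ))| →
      ‖∫ α in (-Real.pi)..Real.pi, W.M μ i θ u (y + r • circlePoint α)‖ ≤
        16 * W.A ^ 2 * (2 ^ (m₀ + i)) ^ 2 * Rpow (m₀ + i) (-(M : ℝ)) := by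
  filter_upwards [eventually_ge_atTop 1, (tendsto_add_left_atTop m₀).eventually
    (eventually_norm_integral_tube_le W.A W.one_le_A W.K hn hρ M)] with i hi hmain
  intro θ u hu y r hr hrρ hy
  simp_rw [M_eq]
  rw [W.integral_circle_mul_packet μ hi θ (W.continuous_η hi hu)]
  have h1 : ∀ ξ, ‖(W.freq μ i θ ξ * (Real.fourierChar (inner ℝ y ξ) : ℂ)) *
      ∫ α in (-Real.pi)..Real.pi, (W.η i θ u (y + r • circlePoint α) : ℂ) *
        (Real.fourierChar (inner ℝ (r • circlePoint α) ξ) : ℂ)‖ ≤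
      ‖W.freq μ i θ ξ‖ * Rpow (m₀ + i) (-(M : ℝ)) := by
    intro ξ
    rw [norm_mul, norm_mul, norm_fourierChar_coe, mul_one]
    by_cases hξ : W.ψ i θ ξ = 0
    · simp [freq, hξ]
    · obtain ⟨h2, h3, h4⟩ := W.ψ_support i hi θ hξ
      gcongr
      exact hmain (fineDir θ) u y ξ r (W.η i θ u) (norm_fineDir θ) (W.η_adapted i hi θ u hu)
        (fun x hx => (W.η_support i hi θ u hu hx).2) hy hr hrρ h2 h3 h4
  refine (norm_integral_le_of_norm_le ((W.integrable_freq μ hi θ).norm.mul_const _)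
    (Eventually.of_forall h1)).trans ?_
  rw [integral_mul_const]
  have := Rpow_pos (m₀ + i) (-(M : ℝ))
  refine mul_le_mul_of_nonneg_right ((W.integral_norm_freq_le μ hi θ).trans (le_of_eq ?_)) this.le
  ring

open Classical in
/-- The circular averages of the good part around `y` are, up to a negligible error, those of the
sum of the full frequency pieces over the caps that are good for the cube of `y`. -/
theorem eventually_norm_integral_circle_goodAt_sub_le (hn : 1 ≤ n) (hμ : ∀ᵐ z ∂μ, ‖z‖ ≤ 1)
    (ν : Measure Plane) (t : ℝ) {ρ : ℝ} (hρ : 1 ≤ ρ) :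
    ∀ᶠ i in atTop, ∀ (y : Plane) (r : ℝ), ‖y‖ ≤ 1 → 0 < r → r ≤ ρ →
      ‖(∫ α in (-Real.pi)..Real.pi, W.goodAt μ ν t i (cubeIndex (cubeExp n (m₀ + i) 0) y)
          (y + r • circlePoint α)) -
        ∑ θ, if IsGood ν t n (m₀ + i) 0 (cubeIndex (cubeExp n (m₀ + i) 0) y) θ then
          ∫ α in (-Real.pi)..Real.pi, W.packet μ i θ (y + r • circlePoint α) else 0‖ ≤
        Rpow (m₀ + i) (-5) := by
  have hA := W.one_le_A
  set C₁ : ℝ := W.A * (2 * W.A + 2) with hC₁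
  have hC₁0 : 0 ≤ C₁ := by positivity
  set C₂ : ℝ := 2 * Real.pi * (C₁ * |W.K 0| + 1) + C₁ * (16 * W.A ^ 2) with hC₂
  have hpi := Real.pi_pos
  have hC₂0 : 0 ≤ C₂ := by positivity
  filter_upwards [eventually_ge_atTop 1, W.eventually_norm_integral_circle_tube_le μ hn hρ 10,
    W.eventually_norm_packet_le μ hμ 10, eventually_const_le (m₀ := m₀) C₂,
    eventually_const_le (m₀ := m₀) 1] with i hi htube hpacket hCR hR1
  intro y r hy hr hrρ
  set k := cubeIndex (cubeExp n (m₀ + i) 0) y with hk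
  set R : ℝ := 2 ^ (m₀ + i) with hR
  have hR0 : 0 < R := by positivity
  have hRp : ∀ m : ℕ, Rpow (m₀ + i) (-(m : ℝ)) = (R ^ m)⁻¹ := fun m => by
    rw [Rpow_neg]; unfold Rpow; rw [Real.rpow_natCast]
  have h10 := hRp 10
  have h5 := hRp 5
  push_cast at h10 h5 htube hpacket
  rw [h10] at htube hpacket
  rw [h5]
  have hcp := continuous_circlePoint
  have hpc : ∀ θ : FineCap n (m₀ + i), Continuous fun α =>
      W.packet μ i θ (y + r • circlePoint α) := fun θ =>
    (W.continuous_packet μ hi θ).comp (by fun_prop)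
  have hMc : ∀ θ : FineCap n (m₀ + i), ∀ u ∈ W.tubes i θ, Continuous fun α =>
      W.M μ i θ u (y + r • circlePoint α) := fun θ u hu => by
    simp_rw [M_eq]
    exact (Complex.continuous_ofReal.comp ((W.continuous_η hi hu).comp (by fun_prop))).mul (hpc θ)
  have hsum : ∫ α in (-Real.pi)..Real.pi, W.goodAt μ ν t i k (y + r • circlePoint α) =
      ∑ θ, ∑ u ∈ (W.tubes i θ).filter (fun u => ¬ W.IsRemoved ν t i k θ u),
        ∫ α in (-Real.pi)..Real.pi, W.M μ i θ u (y + r • circlePoint α) := by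
    unfold goodAt
    rw [intervalIntegral.integral_finsetSum]
    · refine Finset.sum_congr rfl fun θ _ => ?_
      rw [intervalIntegral.integral_finsetSum]
      intro u hu
      exact (hMc θ u (Finset.mem_filter.1 hu).1).intervalIntegrable _ _
    · intro θ _
      apply Continuous.intervalIntegrable
      exact continuous_finsetSum _ fun u hu => hMc θ u (Finset.mem_filter.1 hu).1
  rw [hsum, ← Finset.sum_sub_distrib]
  have hterm : ∀ θ : FineCap n (m₀ + i),
      ‖(∑ u ∈ (W.tubes i θ).filter (fun u => ¬ W.IsRemoved ν t i k θ u),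
        ∫ α in (-Real.pi)..Real.pi, W.M μ i θ u (y + r • circlePoint α)) -
        if IsGood ν t n (m₀ + i) 0 k θ then
          ∫ α in (-Real.pi)..Real.pi, W.packet μ i θ (y + r • circlePoint α) else 0‖ ≤
      C₂ * R ^ 3 * (R ^ 10)⁻¹ := by
    intro θ
    have hcard := W.card_tubes_le hn hi θ
    rw [← hC₁, ← hR] at hcard
    by_cases hg : IsGood ν t n (m₀ + i) 0 k θ
    · rw [if_pos hg]
      -- A good cap: all its tubes are kept, and they resolve the unit on the ball of radius `2`,
      -- outside of which the packet is negligible.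
      have hnr : ∀ u, ¬ W.IsRemoved ν t i k θ u := by
        rintro u ⟨j, hj, -, hb⟩
        exact (isGood_zero_iff ν t n (m₀ + i) k θ).1 hg ⟨j, hj, hb⟩
      rw [Finset.filter_true_of_mem fun u _ => hnr u,
        ← intervalIntegral.integral_finsetSum
          (fun u hu => (hMc θ u hu).intervalIntegrable _ _),
        ← intervalIntegral.integral_sub
          ((continuous_finsetSum _ fun u hu => hMc θ u hu).intervalIntegrable _ _)
          ((hpc θ).intervalIntegrable _ _)]
      refine (intervalIntegral.norm_integral_le_of_norm_le_const
        (C := (C₁ * |W.K 0| + 1) * R * (R ^ 10)⁻¹) fun α _ => ?_).trans ?_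
      · simp_rw [M_eq]
        rw [← Finset.sum_mul, ← sub_one_mul, norm_mul]
        set x := y + r • circlePoint α
        by_cases hx : ‖x‖ ≤ 2
        · have h1 := W.η_sum i hi θ x (by rwa [mem_closedBall_zero_iff])
          have h2 : (∑ u ∈ W.tubes i θ, (W.η i θ u x : ℂ)) - 1 = 0 := by
            rw [← Complex.ofReal_sum, h1]; simp
          rw [h2, norm_zero, zero_mul]
          positivity
        · push Not at hx
          have h1 : ‖(∑ u ∈ W.tubes i θ, (W.η i θ u x : ℂ)) - 1‖ ≤ (C₁ * |W.K 0| + 1) * R := by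
            refine (norm_sub_le _ _).trans ?_
            rw [norm_one, add_mul, one_mul]
            refine add_le_add ((norm_sum_le _ _).trans ?_) hR1
            calc ∑ u ∈ W.tubes i θ, ‖(W.η i θ u x : ℂ)‖ ≤ ∑ u ∈ W.tubes i θ, |W.K 0| := by
                  refine Finset.sum_le_sum fun u hu => ?_
                  rw [Complex.norm_real, Real.norm_eq_abs]
                  exact ((W.η_adapted i hi θ u hu).abs_le (norm_fineDir θ) one_ne_zero
                    (Rpow_pos _ _).ne' x).trans (le_abs_self _)
              _ = (W.tubes i θ).card * |W.K 0| := by rw [Finset.sum_const, nsmul_eq_mul]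
              _ ≤ C₁ * R * |W.K 0| := by gcongr
              _ = _ := by ring
          exact mul_le_mul h1 (hpacket θ x hx.le) (norm_nonneg _) (by positivity)
      · rw [sub_neg_eq_add, ← two_mul, abs_of_pos (by positivity : 0 < 2 * Real.pi)]
        have h2 : 2 * Real.pi * (C₁ * |W.K 0| + 1) ≤ C₂ := by
          rw [hC₂]; have : 0 ≤ C₁ * (16 * W.A ^ 2) := by positivity
          linarith
        calc (C₁ * |W.K 0| + 1) * R * (R ^ 10)⁻¹ * (2 * Real.pi)
            = 2 * Real.pi * (C₁ * |W.K 0| + 1) * R * (R ^ 10)⁻¹ := by ring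
          _ ≤ C₂ * R ^ 3 * (R ^ 10)⁻¹ := by
            gcongr
            exact le_self_pow₀ hR1 (by norm_num)
    · rw [if_neg hg, sub_zero]
      -- A bad cap: the tubes kept do not meet the cube of `y` with their doubles, and non-stationary
      -- phase applies to each of them.
      have hb : ∃ j, j < n ∧ InBadCap ν t n (m₀ + i) j k θ := by
        by_contra h
        exact hg ((isGood_zero_iff ν t n (m₀ + i) k θ).2 h)
      obtain ⟨j, hj, hb⟩ := hb
      refine (norm_sum_le _ _).trans ?_
      calc ∑ u ∈ (W.tubes i θ).filter (fun u => ¬ W.IsRemoved ν t i k θ u),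
            ‖∫ α in (-Real.pi)..Real.pi, W.M μ i θ u (y + r • circlePoint α)‖
          ≤ ∑ u ∈ (W.tubes i θ).filter (fun u => ¬ W.IsRemoved ν t i k θ u),
            16 * W.A ^ 2 * R ^ 2 * (R ^ 10)⁻¹ := by
            refine Finset.sum_le_sum fun u hu => ?_
            obtain ⟨hu1, hu2⟩ := Finset.mem_filter.1 hu
            refine (htube θ u hu1 y r hr hrρ ?_)
            by_contra hlt
            push Not at hlt
            refine hu2 ⟨j, hj, ⟨y, ⟨?_, ?_⟩, mem_dilatedCube_cubeIndex _ y⟩, hb⟩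
            · rw [inner_sub_left, inner_smul_left, real_inner_comm _ (perp (fineDir θ)),
                inner_perp_self, mul_zero, sub_zero, mul_div_cancel_left₀ _ (two_ne_zero' ℝ)]
              have := abs_inner_le (x := y) (norm_fineDir θ)
              linarith [W.four_lt_len]
            · rw [mul_div_cancel_left₀ _ (two_ne_zero' ℝ)]
              exact hlt
        _ ≤ C₁ * R * (16 * W.A ^ 2 * R ^ 2 * (R ^ 10)⁻¹) := by
            rw [Finset.sum_const, nsmul_eq_mul]
            gcongr
            refine le_trans ?_ hcard
            exact_mod_cast Finset.card_filter_le _ _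
        _ = C₁ * (16 * W.A ^ 2) * R ^ 3 * (R ^ 10)⁻¹ := by ring
        _ ≤ C₂ * R ^ 3 * (R ^ 10)⁻¹ := by
            gcongr
            rw [hC₂]
            have : 0 ≤ 2 * Real.pi * (C₁ * |W.K 0| + 1) := by positivity
            linarith
  calc _ ≤ ∑ θ : FineCap n (m₀ + i), C₂ * R ^ 3 * (R ^ 10)⁻¹ :=
        (norm_sum_le _ _).trans (Finset.sum_le_sum fun θ _ => hterm θ)
    _ ≤ R * (C₂ * R ^ 3 * (R ^ 10)⁻¹) := by
        rw [Finset.sum_const, nsmul_eq_mul]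
        gcongr
        exact card_fineCap_le hn i
    _ ≤ R * (R * R ^ 3 * (R ^ 10)⁻¹) := by gcongr
    _ = (R ^ 5)⁻¹ := by field_simp

end WavePackets

/-! ### Energies and Fourier transforms -/

theorem exists_exp_neg_sq_le {s : ℝ} (hs : 0 < s) :
    ∃ C : ℝ, 0 < C ∧ ∀ u : ℝ, 0 < u → Real.exp (-Real.pi * u ^ 2) ≤ C * u ^ (-s) := by
  obtain ⟨m, hm⟩ := exists_nat_ge s
  refine ⟨m.factorial + 1, by positivity, fun u hu => ?_⟩
  have hpi := Real.pi_gt_three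
  have hus : 0 < u ^ s := by positivity
  rw [Real.rpow_neg hu.le, ← div_eq_mul_inv, le_div_iff₀ hus, neg_mul, Real.exp_neg,
    inv_mul_le_iff₀ (Real.exp_pos _)]
  have hexp : Real.exp (u ^ 2) ≤ Real.exp (Real.pi * u ^ 2) := by
    apply Real.exp_le_exp.2; nlinarith [sq_nonneg u]
  have hexp1 : 1 ≤ Real.exp (u ^ 2) := Real.one_le_exp (sq_nonneg u)
  rcases le_total u 1 with h1 | h1
  · have : u ^ s ≤ 1 := Real.rpow_le_one hu.le h1 hs.le
    nlinarith [show (0 : ℝ) ≤ m.factorial by positivity]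
  · have h2 : u ^ s ≤ (u ^ 2) ^ m := by
      rw [← pow_mul, ← Real.rpow_natCast]
      apply Real.rpow_le_rpow_of_exponent_le h1
      push_cast
      have : (0 : ℝ) ≤ m := by positivity
      linarith
    have h3 := Real.pow_div_factorial_le_exp (u ^ 2) (sq_nonneg u) m
    rw [div_le_iff₀ (by positivity)] at h3
    have h4 : (0 : ℝ) < m.factorial := by positivity
    nlinarith

/-- The mass of `|μ̂|²` in a ball is controlled by the energy of `μ`. -/
theorem exists_lintegral_fourierMeasure_le {s : ℝ} (hs : 0 < s) :
    ∃ C : ℝ, 0 < C ∧ ∀ (μ : Measure Plane) [IsProbabilityMeasure μ] (r : ℝ), 0 < r →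
      ∫⁻ ξ in Metric.closedBall (0 : Plane) r, ‖fourierMeasure μ ξ‖ₑ ^ 2 ≤
        ENNReal.ofReal (C * r ^ (2 - s)) * energy s μ := by
  obtain ⟨C, hC, hexp⟩ := exists_exp_neg_sq_le hs
  refine ⟨Real.exp Real.pi * C, by positivity, ?_⟩
  intro μ _ r hr
  have hpi := Real.pi_pos
  -- The Gaussian at the scale `r` is bounded below on the ball, and its inverse Fourier transform is
  -- positive and dominated by a multiple of `r ^ (2 - s) |v| ^ (-s)`.
  set G : Plane → ℝ := fun ξ => Real.exp (-(Real.pi / r ^ 2) * ‖ξ‖ ^ 2) with hG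
  have hGc : Continuous G := by fun_prop
  have hb : 0 < Real.pi / r ^ 2 := by positivity
  have hGcomplex : ∀ ξ, (G ξ : ℂ) = Complex.exp (-((Real.pi / r ^ 2 : ℝ) : ℂ) * ‖ξ‖ ^ 2) := by
    intro ξ; simp only [hG]; push_cast; rfl
  have hGi : Integrable (fun ξ => (G ξ : ℂ)) := by
    simp_rw [hGcomplex]
    have := GaussianFourier.integrable_cexp_neg_mul_sq_norm_add (V := Plane)
      (b := ((Real.pi / r ^ 2 : ℝ) : ℂ)) (by rw [Complex.ofReal_re]; exact hb) 0 0
    simpa using this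
  have hF : ∀ v : Plane, 𝓕⁻ (fun ξ => (G ξ : ℂ)) v =
      ((r ^ 2 * Real.exp (-Real.pi * (r * ‖v‖) ^ 2) : ℝ) : ℂ) := by
    intro v
    rw [Real.fourierInv_eq_fourier_neg]
    simp_rw [hGcomplex]
    rw [fourier_gaussian_innerProductSpace (by rw [Complex.ofReal_re]; exact hb)]
    have h1 : (Real.pi / ((Real.pi / r ^ 2 : ℝ) : ℂ)) = ((r ^ 2 : ℝ) : ℂ) := by
      have : (Real.pi : ℂ) ≠ 0 := by exact_mod_cast hpi.ne'
      push_cast; field_simp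
    rw [h1]
    have h2 : ((Module.finrank ℝ Plane : ℂ) / 2) = 1 := by simp
    rw [h2, Complex.cpow_one]
    have h3 : (-(Real.pi : ℂ) ^ 2 * ‖-v‖ ^ 2 / ((Real.pi / r ^ 2 : ℝ) : ℂ)) =
        ((-Real.pi * (r * ‖v‖) ^ 2 : ℝ) : ℂ) := by
      have : (Real.pi : ℂ) ≠ 0 := by exact_mod_cast hpi.ne'
      have : (r : ℂ) ≠ 0 := by exact_mod_cast hr.ne'
      rw [norm_neg]; push_cast; field_simp
    rw [h3]
    push_cast; rfl
  have hμc := continuous_fourierMeasure μ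
  have hint : Integrable (fun ξ => (G ξ : ℂ) * fourierMeasure μ ξ) :=
    hGi.mul_bdd (c := 1) hμc.aestronglyMeasurable
      (Eventually.of_forall (norm_fourierMeasure_le μ))
  have hconj : ∀ ξ, ∫ x, (Real.fourierChar (inner ℝ ξ x) : ℂ) ∂μ =
      (starRingEnd ℂ) (fourierMeasure μ ξ) := by
    intro ξ
    rw [fourierMeasure, ← integral_conj]
    congr 1
    funext x
    rw [AddChar.map_neg_eq_inv, Circle.coe_inv_eq_conj, Complex.conj_conj, real_inner_comm]
  -- Fubini's theorem: `∬ Ǧ (x - z) dμ (z) dμ (x) = ∫ G |μ̂|²`.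
  have hdouble : ∫ x, ∫ z, 𝓕⁻ (fun ξ => (G ξ : ℂ)) (x - z) ∂μ ∂μ =
      ((∫ ξ, G ξ * ‖fourierMeasure μ ξ‖ ^ 2 : ℝ) : ℂ) := by
    simp_rw [← fourierInv_mul_fourierMeasure hGi μ, Real.fourierInv_eq]
    rw [integral_integral_swap]
    · rw [← integral_complex_ofReal]
      congr 1
      funext ξ
      simp_rw [Circle.smul_def, smul_eq_mul]
      rw [integral_mul_const, hconj]
      push_cast
      rw [← Complex.mul_conj']
      ring
    · have h1 : Integrable (fun p : Plane × Plane =>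
          (G p.2 : ℂ) * fourierMeasure μ p.2) (μ.prod volume) := hint.comp_snd μ
      refine (integrable_mul_fourierChar h1 (g := fun p => inner ℝ p.2 p.1) (by fun_prop)).congr
        (Eventually.of_forall fun p => ?_)
      simp only [Function.uncurry]
      rw [Circle.smul_def, smul_eq_mul, mul_comm]
  have hreal : Integrable (fun ξ => G ξ * ‖fourierMeasure μ ξ‖ ^ 2) := by
    refine (hGi.re.mul_bdd (c := 1) (g := fun ξ => ‖fourierMeasure μ ξ‖ ^ 2)
      (by fun_prop) (Eventually.of_forall fun ξ => ?_)).congr (Eventually.of_forall fun ξ => ?_)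
    · rw [Real.norm_of_nonneg (by positivity)]
      exact pow_le_one₀ (norm_nonneg _) (norm_fourierMeasure_le μ ξ)
    · simp
  calc ∫⁻ ξ in Metric.closedBall (0 : Plane) r, ‖fourierMeasure μ ξ‖ₑ ^ 2
      ≤ ∫⁻ ξ in Metric.closedBall (0 : Plane) r, ENNReal.ofReal (Real.exp Real.pi) *
          ENNReal.ofReal (G ξ * ‖fourierMeasure μ ξ‖ ^ 2) := by
        refine setLIntegral_mono' Metric.isClosed_closedBall.measurableSet fun ξ hξ => ?_
        rw [mem_closedBall_zero_iff] at hξ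
        rw [← ofReal_norm, ← ENNReal.ofReal_pow (norm_nonneg _), ← ENNReal.ofReal_mul (by positivity)]
        apply ENNReal.ofReal_le_ofReal
        rw [← mul_assoc]
        apply le_mul_of_one_le_left (by positivity)
        simp only [hG]
        rw [← Real.exp_add]
        apply Real.one_le_exp
        have h1 : ‖ξ‖ ^ 2 ≤ r ^ 2 := by gcongr
        have h2 : Real.pi / r ^ 2 * ‖ξ‖ ^ 2 ≤ Real.pi := by
          rw [div_mul_eq_mul_div, div_le_iff₀ (by positivity)]; gcongr
        linarith
    _ ≤ ENNReal.ofReal (Real.exp Real.pi) *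
          ∫⁻ ξ, ENNReal.ofReal (G ξ * ‖fourierMeasure μ ξ‖ ^ 2) := by
        rw [← lintegral_const_mul' _ _ ENNReal.ofReal_ne_top]
        exact setLIntegral_le_lintegral _ _
    _ = ENNReal.ofReal (Real.exp Real.pi) *
          ‖∫ x, ∫ z, 𝓕⁻ (fun ξ => (G ξ : ℂ)) (x - z) ∂μ ∂μ‖ₑ := by
        have h0 : 0 ≤ ∫ ξ, G ξ * ‖fourierMeasure μ ξ‖ ^ 2 :=
          integral_nonneg fun ξ => by positivity
        rw [hdouble, ← ofReal_norm, Complex.norm_real, Real.norm_of_nonneg h0,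
          ofReal_integral_eq_lintegral_ofReal hreal (Eventually.of_forall fun ξ => by positivity)]
    _ ≤ ENNReal.ofReal (Real.exp Real.pi) *
          ∫⁻ x, ∫⁻ z, ‖𝓕⁻ (fun ξ => (G ξ : ℂ)) (x - z)‖ₑ ∂μ ∂μ := by
        gcongr
        exact (enorm_integral_le_lintegral_enorm _).trans
          (lintegral_mono fun x => enorm_integral_le_lintegral_enorm _)
    _ ≤ ENNReal.ofReal (Real.exp Real.pi) *
          ∫⁻ x, ∫⁻ z, ENNReal.ofReal (C * r ^ (2 - s)) * (edist x z) ^ (-s) ∂μ ∂μ := by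
        gcongr with x z
        rw [hF, ← ofReal_norm, Complex.norm_real, Real.norm_of_nonneg (by positivity)]
        by_cases hxz : x = z
          -- On the diagonal the kernel of the energy is infinite.
        · rw [hxz, edist_self, ENNReal.zero_rpow_of_neg (by linarith), ENNReal.mul_top]
          · exact le_top
          · simp only [ne_eq, ENNReal.ofReal_eq_zero, not_le]; positivity
        · have h1 : 0 < ‖x - z‖ := norm_pos_iff.2 (sub_ne_zero.2 hxz)
          rw [edist_dist, dist_eq_norm, ENNReal.ofReal_rpow_of_pos h1,
            ← ENNReal.ofReal_mul (by positivity)]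
          apply ENNReal.ofReal_le_ofReal
          calc r ^ 2 * Real.exp (-Real.pi * (r * ‖x - z‖) ^ 2)
              ≤ r ^ 2 * (C * (r * ‖x - z‖) ^ (-s)) := by
                gcongr; exact hexp _ (by positivity)
            _ = C * (r ^ (2 : ℝ) * r ^ (-s)) * ‖x - z‖ ^ (-s) := by
                rw [Real.mul_rpow hr.le h1.le, Real.rpow_two]; ring
            _ = _ := by rw [← Real.rpow_add hr]; rfl
    _ = _ := by
        have h1 : ∀ x, ∫⁻ z, ENNReal.ofReal (C * r ^ (2 - s)) * (edist x z) ^ (-s) ∂μ =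
            ENNReal.ofReal (C * r ^ (2 - s)) * ∫⁻ z, (edist x z) ^ (-s) ∂μ := fun x =>
          lintegral_const_mul' _ _ ENNReal.ofReal_ne_top
        simp_rw [h1]
        rw [lintegral_const_mul' _ _ ENNReal.ofReal_ne_top, ← mul_assoc,
          ← ENNReal.ofReal_mul (by positivity), energy, mul_assoc]

/-! ### Circular averages and restriction to circles in frequency space -/

/-- The arc length measure, of total mass `2π`, on the circle around the origin through `ξ`. -/
def rotMeasure (ξ : Plane) : Measure Plane :=
  Measure.map (fun α => rot α ξ) (volume.restrict (Set.Ioc (-Real.pi) Real.pi))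

@[fun_prop]
theorem continuous_rot_comp {X : Type*} [TopologicalSpace X] {f : X → ℝ} {g : X → Plane}
    (hf : Continuous f) (hg : Continuous g) : Continuous fun x => rot (f x) (g x) := by
  have h := continuous_rot.comp (hf.prodMk hg)
  exact h

theorem continuous_rot_left (ξ : Plane) : Continuous fun α => rot α ξ :=
  continuous_rot_comp continuous_id continuous_const

theorem extOp_rotMeasure {f : Plane → ℂ} (hf : Measurable f) (ξ y : Plane) :
    extOp (rotMeasure ξ) f y = ∫ α in (-Real.pi)..Real.pi,
      f (rot α ξ) * (Real.fourierChar (inner ℝ y (rot α ξ)) : ℂ) := by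
  rw [extOp, rotMeasure, integral_map (continuous_rot_left ξ).aemeasurable,
    intervalIntegral.integral_of_le (by linarith [Real.pi_pos])]
  have h : Continuous fun ζ : Plane => (Real.fourierChar (inner ℝ y ζ) : ℂ) :=
    continuous_fourierChar_coe.comp (by fun_prop)
  exact (hf.mul h.measurable).aestronglyMeasurable

theorem lintegral_rotMeasure {f : Plane → ℝ≥0∞} (hf : Measurable f) (ξ : Plane) :
    ∫⁻ ζ, f ζ ∂(rotMeasure ξ) = ∫⁻ α in Set.Ioc (-Real.pi) Real.pi, f (rot α ξ) :=
  lintegral_map hf (continuous_rot_left ξ).measurable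

theorem rotMeasure_univ (ξ : Plane) : rotMeasure ξ Set.univ = ENNReal.ofReal (2 * Real.pi) := by
  rw [rotMeasure, Measure.map_apply (continuous_rot_left ξ).measurable MeasurableSet.univ,
    Set.preimage_univ, Measure.restrict_apply_univ, Real.volume_Ioc]
  congr 1; ring

theorem norm_rot_sub_rot (α β : ℝ) (ξ : Plane) :
    ‖rot α ξ - rot β ξ‖ = 2 * |Real.sin ((α - β) / 2)| * ‖ξ‖ := by
  rw [← norm_circlePoint_sub, ← sq_eq_sq₀ (norm_nonneg _) (by positivity), norm_sq_eq, mul_pow,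
    norm_sq_eq, norm_sq_eq]
  simp only [PiLp.sub_apply, rot_zero', rot_one', circlePoint_zero, circlePoint_one]
  ring

theorem inner_rot_rot (α : ℝ) (x y : Plane) : inner ℝ (rot α x) (rot α y) = inner ℝ x y := by
  simp only [inner_eq, rot_zero', rot_one']
  linear_combination (x 0 * y 0 + x 1 * y 1) * Real.cos_sq_add_sin_sq α

/-- Arc length is one-dimensional: rotations of `ξ` that are within `2 s` of each other differ by an
angle of at most `π s / ‖ξ‖`, up to a full turn. -/
theorem rotMeasure_closedBall_le {ξ : Plane} (hξ : ξ ≠ 0) (η : Plane) {s : ℝ} (hs : 0 < s) :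
    rotMeasure ξ (Metric.closedBall η s) ≤ ENNReal.ofReal (6 * Real.pi * s / ‖ξ‖) := by
  have hpi := Real.pi_pos
  have hn : 0 < ‖ξ‖ := norm_pos_iff.2 hξ
  rw [rotMeasure, Measure.map_apply (continuous_rot_left ξ).measurable
    Metric.isClosed_closedBall.measurableSet, Measure.restrict_apply
    ((continuous_rot_left ξ).measurable Metric.isClosed_closedBall.measurableSet)]
  set S := (fun α => rot α ξ) ⁻¹' Metric.closedBall η s ∩ Set.Ioc (-Real.pi) Real.pi with hS
  rcases S.eq_empty_or_nonempty with h | ⟨β, hβ1, hβ2⟩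
  · rw [h]; simp
  · set q := s / ‖ξ‖ with hq
    have hq0 : 0 < q := by positivity
    -- Differences of angles range over `(-2π, 2π)`, so there are three intervals.
    have hsub : S ⊆ Set.Icc (β - Real.pi * q) (β + Real.pi * q) ∪
        (Set.Icc (β + 2 * Real.pi - Real.pi * q) (β + 2 * Real.pi + Real.pi * q) ∪
        Set.Icc (β - 2 * Real.pi - Real.pi * q) (β - 2 * Real.pi + Real.pi * q)) := by
      rintro α ⟨hα1, hα2⟩
      have h1 : ‖rot α ξ - rot β ξ‖ ≤ 2 * s := by
        rw [← dist_eq_norm]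
        have h2 : dist (rot α ξ) η ≤ s := hα1
        have h3 : dist (rot β ξ) η ≤ s := hβ1
        linarith [dist_triangle_right (rot α ξ) (rot β ξ) η]
      rw [norm_rot_sub_rot] at h1
      have h2 : |Real.sin ((α - β) / 2)| ≤ q := by
        rw [hq, le_div_iff₀ hn]; linarith
      have h3 : |(α - β) / (2 * Real.pi)| < 1 := by
        rw [abs_div, abs_of_pos (by positivity : 0 < 2 * Real.pi), div_lt_one (by positivity), abs_lt]
        constructor <;> linarith [hα2.1, hα2.2, hβ2.1, hβ2.2]
      have h4 := two_mul_min_le_abs_sin h3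
      rw [show Real.pi * ((α - β) / (2 * Real.pi)) = (α - β) / 2 by field_simp] at h4
      have h5 : α - β = 2 * Real.pi * ((α - β) / (2 * Real.pi)) := by field_simp
      set x := (α - β) / (2 * Real.pi)
      rcases min_le_iff.1 (le_refl (min |x| (1 - |x|))) with h | h
      · left
        have h6 : |x| ≤ q / 2 := by linarith
        rw [abs_le] at h6
        constructor <;> nlinarith [h6.1, h6.2]
      · right
        have h6 : 1 - q / 2 ≤ |x| := by linarith
        rcases abs_cases x with ⟨h7, h8⟩ | ⟨h7, h8⟩
        · left
          rw [h7] at h6 h3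
          constructor <;> nlinarith
        · right
          rw [h7] at h6 h3
          constructor <;> nlinarith
    refine (measure_mono hsub).trans ((measure_union_le _ _).trans
      ((add_le_add_right (measure_union_le _ _) _).trans ?_))
    simp only [Real.volume_Icc]
    rw [← ENNReal.ofReal_add (by nlinarith) (by nlinarith),
      ← ENNReal.ofReal_add (by nlinarith) (by nlinarith)]
    apply ENNReal.ofReal_le_ofReal
    rw [mul_div_assoc, ← hq]
    linarith

theorem continuous_extOp_rotMeasure {b : Plane → ℂ} (hb : Continuous b) :
    Continuous fun p : Plane × Plane => extOp (rotMeasure p.1) b p.2 := by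
  simp_rw [extOp_rotMeasure hb.measurable]
  apply intervalIntegral.continuous_parametric_intervalIntegral_of_continuous'
  have h : Continuous fun p : (Plane × Plane) × ℝ => rot p.2 p.1.1 :=
    continuous_rot_comp continuous_snd (continuous_fst.comp continuous_fst)
  exact (hb.comp h).mul (continuous_fourierChar_coe.comp (by fun_prop))

/-- Averages over circles centered at `y` of a function with Fourier transform `b`: by Plancherel's
identity for the average over rotations around `y`, their `L²` norm over all radii is expressed
through the restrictions of `b` to circles around the origin. -/
theorem lintegral_circle_average {b : Plane → ℂ} (hb : Continuous b) (hbc : HasCompactSupport b)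
    (y : Plane) :
    ENNReal.ofReal (2 * Real.pi) * ∫⁻ r in Set.Ioi (0 : ℝ), ENNReal.ofReal r *
      ‖∫ α in (-Real.pi)..Real.pi, extOp volume b (y + r • circlePoint α)‖ₑ ^ 2 =
      ∫⁻ ξ, ‖extOp (rotMeasure ξ) b y‖ₑ ^ 2 := by
  have hpi := Real.pi_pos
  have hpi' : -Real.pi ≤ Real.pi := by linarith
  have hbi : Integrable b := hb.integrable_of_hasCompactSupport hbc
  have hcp := continuous_circlePoint
  set g : Plane → ℂ := fun ξ => extOp (rotMeasure ξ) b y with hg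
  have hgc : Continuous g :=
    (continuous_extOp_rotMeasure hb).comp (by fun_prop : Continuous fun ξ : Plane => (ξ, y))
  obtain ⟨ρ, hρ⟩ := hbc.isBounded.subset_closedBall (0 : Plane)
  have hgs : HasCompactSupport g := by
    refine HasCompactSupport.of_support_subset_isCompact (isCompact_closedBall (0 : Plane) ρ)
      fun ξ hξ => ?_
    rw [mem_closedBall_zero_iff]
    by_contra hlt
    apply hξ
    simp only [hg]
    rw [extOp_rotMeasure hb.measurable]
    have : ∀ α, b (rot α ξ) = 0 := fun α => by
      by_contra h
      have := hρ (subset_tsupport b h)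
      rw [mem_closedBall_zero_iff, norm_rot] at this
      exact hlt this
    simp [this]
  have hBc : Continuous (extOp volume b) := continuous_extOp hbi
  have hinv : ∀ x, 𝓕⁻ g x = ∫ α in (-Real.pi)..Real.pi, extOp volume b (y + rot α x) := by
    intro x
    rw [fourierInv_eq_extOp, extOp]
    simp only [hg]
    simp_rw [extOp_rotMeasure hb.measurable, intervalIntegral.integral_of_le hpi',
      ← integral_mul_const]
    rw [integral_integral_swap]
    · congr 1
      funext α
      have h1 := (measurePreserving_rot α).integral_comp (measurableEmbedding_rot α)
        (fun ζ => b ζ * (Real.fourierChar (inner ℝ (y + rot α x) ζ) : ℂ))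
      rw [extOp, ← h1]
      congr 1
      funext ξ
      rw [inner_add_left, inner_rot_rot, fourierChar_add_coe]
      ring
    · have hr : Continuous fun p : Plane × ℝ => rot p.2 p.1 :=
        continuous_rot_comp continuous_snd continuous_fst
      have h1 : Integrable (fun p : Plane × ℝ => b (rot p.2 p.1))
          (volume.prod (volume.restrict (Set.Ioc (-Real.pi) Real.pi))) := by
        have hc : Continuous fun p : Plane × ℝ => b (rot p.2 p.1) := hb.comp hr
        rw [integrable_prod_iff' hc.aestronglyMeasurable]
        refine ⟨Eventually.of_forall fun α => ?_, ?_⟩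
        · exact ((measurePreserving_rot α).integrable_comp_emb (measurableEmbedding_rot α)).2 hbi
        · have h2 : ∀ α, ∫ ξ, ‖b (rot α ξ)‖ = ∫ ξ, ‖b ξ‖ := fun α =>
            (measurePreserving_rot α).integral_comp (measurableEmbedding_rot α) (fun ξ => ‖b ξ‖)
          simp_rw [h2]
          exact integrable_const _
      have h2 := integrable_mul_fourierChar h1
        (g := fun p : Plane × ℝ => inner ℝ y (rot p.2 p.1) + inner ℝ x p.1)
        (by apply Continuous.aestronglyMeasurable; fun_prop)
      refine h2.congr (Eventually.of_forall fun p => ?_)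
      simp only [Function.uncurry]
      rw [fourierChar_add_coe]; ring
  have hinvc : ∀ (r β : ℝ), 𝓕⁻ g (r • circlePoint β) =
      ∫ α in (-Real.pi)..Real.pi, extOp volume b (y + r • circlePoint α) := by
    intro r β
    rw [hinv]
    simp_rw [rot_smul_circlePoint]
    rw [intervalIntegral.integral_comp_add_right
      (fun α => extOp volume b (y + r • circlePoint α)) β]
    have hper : Function.Periodic (fun α => extOp volume b (y + r • circlePoint α))
        (2 * Real.pi) := fun α => by simp only [circlePoint_periodic α]
    have h1 := hper.intervalIntegral_add_eq (-Real.pi + β) (-Real.pi)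
    rw [show -Real.pi + β + 2 * Real.pi = Real.pi + β by ring,
      show -Real.pi + 2 * Real.pi = Real.pi by ring] at h1
    exact h1
  have hmeas : Measurable fun r : ℝ => ENNReal.ofReal r *
      ‖∫ α in (-Real.pi)..Real.pi, extOp volume b (y + r • circlePoint α)‖ₑ ^ 2 := by
    have : Continuous fun r : ℝ =>
        ∫ α in (-Real.pi)..Real.pi, extOp volume b (y + r • circlePoint α) := by
      apply intervalIntegral.continuous_parametric_intervalIntegral_of_continuous'
      exact hBc.comp (by fun_prop)
    exact ENNReal.measurable_ofReal.mul (this.measurable.enorm.pow_const 2)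
  rw [← lintegral_enorm_sq_fourierInv (hgc.integrable_of_hasCompactSupport hgs)
    (hgc.memLp_of_hasCompactSupport hgs), lintegral_polar]
  simp_rw [hinvc]
  rw [Measure.volume_eq_prod, setLIntegral_prod (fun p : ℝ × ℝ => ENNReal.ofReal p.1 *
    ‖∫ α in (-Real.pi)..Real.pi, extOp volume b (y + p.1 • circlePoint α)‖ₑ ^ 2)
    (hmeas.comp measurable_fst).aemeasurable]
  simp_rw [setLIntegral_const]
  rw [lintegral_mul_const _ hmeas, Real.volume_Ioo, mul_comm]
  congr 2
  ring

/-! ### The mean square of the circular averages -/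

theorem scale_pred_le {n : ℕ} (hn : 1 ≤ n) (ℓ : ℕ) : scale n ℓ (n - 1) ≤ Rpow ℓ (1 / 2) := by
  obtain ⟨m, rfl⟩ : ∃ m, n = m + 1 := ⟨n - 1, by omega⟩
  unfold scale scaleExp Rpow
  rw [← Real.rpow_natCast, ← Real.rpow_natCast, ← Real.rpow_mul (by norm_num)]
  apply Real.rpow_le_rpow_of_exponent_le (by norm_num)
  refine Nat.cast_div_le.trans (le_of_eq ?_)
  push_cast
  rw [pow_succ]
  field_simp

/-- A vector in the rectangle of `e` of length about `H ^ 2` and width about `H` is within a multiple of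
`H` of the vector of the same length in the direction `e`. -/
theorem norm_sub_smul_le {e ζ : Plane} (he : ‖e‖ = 1) {A H : ℝ} (hA : 1 ≤ A) (hH : 1 ≤ H)
    (h1 : A⁻¹ * H ^ 2 ≤ inner ℝ ζ e) (h2 : |inner ℝ ζ (perp e)| ≤ A * H) :
    ‖ζ - ‖ζ‖ • e‖ ≤ 2 * A ^ 3 * H := by
  have h := norm_sq_eq_inner he ζ
  have hA0 : 0 < A := by linarith
  have hH0 : 0 < H := by linarith
  have h0 : 0 < inner ℝ ζ e := lt_of_lt_of_le (by positivity) h1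
  have h3 : inner ℝ ζ e ≤ ‖ζ‖ := (le_abs_self _).trans (abs_inner_le he)
  have h4 : ‖ζ‖ - inner ℝ ζ e ≤ A ^ 3 := by
    have h5 : (‖ζ‖ - inner ℝ ζ e) * (‖ζ‖ + inner ℝ ζ e) ≤ (A * H) ^ 2 := by
      calc (‖ζ‖ - inner ℝ ζ e) * (‖ζ‖ + inner ℝ ζ e) = inner ℝ ζ (perp e) ^ 2 := by linarith
        _ ≤ (A * H) ^ 2 := by rw [← sq_abs]; gcongr
    have h6 : A⁻¹ * H ^ 2 ≤ ‖ζ‖ + inner ℝ ζ e := by linarith [norm_nonneg ζ]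
    have h7 : (‖ζ‖ - inner ℝ ζ e) * (A⁻¹ * H ^ 2) ≤ (A * H) ^ 2 :=
      le_trans (mul_le_mul_of_nonneg_left h6 (by linarith)) h5
    have h8 : (A * H) ^ 2 = A ^ 3 * (A⁻¹ * H ^ 2) := by field_simp
    rw [h8] at h7
    exact le_of_mul_le_mul_right h7 (by positivity)
  have h9 : inner ℝ (ζ - ‖ζ‖ • e) e = inner ℝ ζ e - ‖ζ‖ := by
    rw [inner_sub_left, inner_smul_left, real_inner_self_eq_norm_sq, he]; simp
  have h10 : inner ℝ (ζ - ‖ζ‖ • e) (perp e) = inner ℝ ζ (perp e) := by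
    rw [inner_sub_left, inner_smul_left, inner_perp_self]; simp
  refine (norm_le_frame he _).trans ?_
  rw [h9, h10, abs_sub_comm, abs_of_nonneg (by linarith)]
  have h11 : A ^ 3 ≤ A ^ 3 * H := le_mul_of_one_le_right (by positivity) hH
  have h12 : A * H ≤ A ^ 3 * H := by gcongr; exact le_self_pow₀ hA (by norm_num)
  linarith

namespace WavePackets

variable {m₀ n : ℕ} (W : WavePackets m₀ n) (μ : Measure Plane)

theorem lt_norm_of_freq_ne_zero {i : ℕ} (hi : 1 ≤ i) {θ : FineCap n (m₀ + i)} {ξ : Plane}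
    (h : W.freq μ i θ ξ ≠ 0) : W.A⁻¹ * 2 ^ (m₀ + i) ≤ ‖ξ‖ := by
  have h0 : W.ψ i θ ξ ≠ 0 := by intro h0; apply h; simp [freq, h0]
  exact (W.ψ_support i hi θ h0).1.trans
    ((le_abs_self _).trans (abs_inner_le (norm_fineDir θ)))

theorem sum_enorm_freq_sq_le {i : ℕ} (hi : 1 ≤ i) (ξ : Plane) :
    ∑ θ, ‖W.freq μ i θ ξ‖ₑ ^ 2 ≤ ‖fourierMeasure μ ξ‖ₑ ^ 2 := by
  have h1 : ∀ θ, ‖W.freq μ i θ ξ‖ₑ ^ 2 ≤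
      ENNReal.ofReal (W.ψ i θ ξ) * ‖fourierMeasure μ ξ‖ₑ ^ 2 := by
    intro θ
    have h0 := W.ψ_nonneg i hi θ ξ
    rw [freq, enorm_mul, mul_pow]
    gcongr
    rw [← ofReal_norm, Complex.norm_real, Real.norm_of_nonneg h0, ← ENNReal.ofReal_pow h0]
    apply ENNReal.ofReal_le_ofReal
    nlinarith [W.ψ_le_one hi θ ξ]
  refine (Finset.sum_le_sum fun θ _ => h1 θ).trans ?_
  rw [← Finset.sum_mul, ← ENNReal.ofReal_sum_of_nonneg fun θ _ => W.ψ_nonneg i hi θ ξ]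
  exact mul_le_of_le_one_left (zero_le) (ENNReal.ofReal_le_one.2 (W.sum_ψ_le_one hi ξ))

open Classical in
/-- The sum of the frequency pieces over the good caps for the cube of index `k`. -/
def goodFreq (ν : Measure Plane) (t : ℝ) (i : ℕ) (k : Fin 2 → ℤ) (ξ : Plane) : ℂ :=
  ∑ θ, if IsGood ν t n (m₀ + i) 0 k θ then W.freq μ i θ ξ else 0

theorem hasCompactSupport_goodFreq {i : ℕ} (hi : 1 ≤ i) (ν : Measure Plane) (t : ℝ)
    (k : Fin 2 → ℤ) : HasCompactSupport (W.goodFreq μ ν t i k) := by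
  refine HasCompactSupport.of_support_subset_isCompact
    (isCompact_closedBall (0 : Plane) (2 * W.A * 2 ^ (m₀ + i))) fun ξ hξ => ?_
  obtain ⟨θ, -, hθ⟩ := Finset.exists_ne_zero_of_sum_ne_zero hξ
  rw [mem_closedBall_zero_iff]
  apply W.norm_freq_ne_zero_le μ hi (θ := θ)
  intro h0; apply hθ; simp [h0]

open Classical in
theorem extOp_goodFreq {σ : Measure Plane} {i : ℕ} (hσ : ∀ θ, Integrable (W.freq μ i θ) σ)
    (ν : Measure Plane) (t : ℝ) (k : Fin 2 → ℤ) (y : Plane) :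
    extOp σ (W.goodFreq μ ν t i k) y =
      ∑ θ, if IsGood ν t n (m₀ + i) 0 k θ then extOp σ (W.freq μ i θ) y else 0 := by
  unfold goodFreq
  rw [extOp_finset_sum]
  · refine Finset.sum_congr rfl fun θ _ => ?_
    split_ifs
    · rfl
    · exact extOp_zero σ y
  · intro θ _
    split_ifs
    · exact hσ θ
    · exact integrable_zero _ _ _

variable [IsProbabilityMeasure μ]

/-- On each circle in the relevant annulus of frequency space, the pieces `ψ_{i,θ} μ̂` are
admissible for the multiscale estimate. -/
theorem isFreqData (hn : 1 ≤ n) {i : ℕ} (hi : 1 ≤ i) {ξ : Plane}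
    (h1 : W.A⁻¹ * 2 ^ (m₀ + i) ≤ ‖ξ‖) (h2 : ‖ξ‖ ≤ 2 * W.A * 2 ^ (m₀ + i)) :
    IsFreqData (24 * W.A ^ 3) n (m₀ + i) (rotMeasure ξ) ‖ξ‖
      (fun θ => {ζ : Plane | ‖ζ‖ = ‖ξ‖}.indicator (W.freq μ i θ)) := by
  have hA := W.one_le_A
  have hA0 : 0 < W.A := by linarith
  have hA3 : W.A ≤ W.A ^ 3 := le_self_pow₀ hA (by norm_num)
  have hpi := Real.pi_le_four
  have hpi0 := Real.pi_pos
  have hR : (0 : ℝ) < 2 ^ (m₀ + i) := by positivity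
  have hξ : 0 < ‖ξ‖ := lt_of_lt_of_le (by positivity) h1
  have hH : (2 : ℝ) ^ (m₀ + i) = Rpow (m₀ + i) (1 / 2) ^ 2 := by
    rw [← Rpow_mul_nat, ← Rpow_one]; congr 1; norm_num
  refine ⟨?_, ?_, ?_, ?_, ?_, ?_, ?_, ?_⟩
  · rw [rotMeasure_univ]
    apply ENNReal.ofReal_le_ofReal
    linarith
  · refine le_trans ?_ h1
    gcongr
    linarith
  · refine h2.trans ?_
    gcongr
    linarith
  · intro η s hs
    refine (rotMeasure_closedBall_le (norm_pos_iff.1 hξ) η hs).trans ?_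
    apply ENNReal.ofReal_le_ofReal
    -- The constant: `6 π A ≤ 24 A ≤ 24 A ^ 3`.
    calc 6 * Real.pi * s / ‖ξ‖ ≤ 6 * Real.pi * s / (W.A⁻¹ * 2 ^ (m₀ + i)) := by gcongr
      _ = 6 * Real.pi * W.A * s / 2 ^ (m₀ + i) := by field_simp
      _ ≤ _ := by gcongr; nlinarith
  · intro θ
    exact (W.continuous_freq μ hi θ).measurable.indicator
      (measurableSet_eq_fun measurable_norm measurable_const)
  · intro ζ
    calc ∑ θ, ‖{ζ : Plane | ‖ζ‖ = ‖ξ‖}.indicator (W.freq μ i θ) ζ‖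
        ≤ ∑ θ, W.ψ i θ ζ := by
          refine Finset.sum_le_sum fun θ _ => ?_
          exact (norm_indicator_le_norm_self _ _).trans (W.norm_freq_le μ hi θ ζ)
      _ ≤ 1 := W.sum_ψ_le_one hi ζ
  · intro θ ζ h
    exact Set.mem_of_indicator_ne_zero (s := {ζ : Plane | ‖ζ‖ = ‖ξ‖}) h
  · intro θ ζ h
    have h3 : ‖ζ‖ = ‖ξ‖ := Set.mem_of_indicator_ne_zero (s := {ζ : Plane | ‖ζ‖ = ‖ξ‖}) h
    have h4 : W.freq μ i θ ζ ≠ 0 := by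
      intro h0; apply h; rw [Set.indicator_apply, h0]; simp
    have h5 : W.ψ i θ ζ ≠ 0 := by intro h0; apply h4; simp [freq, h0]
    obtain ⟨h6, h7, h8⟩ := W.ψ_support i hi θ h5
    rw [hH] at h6
    have h9 := norm_sub_smul_le (norm_fineDir θ) hA (one_le_Rpow (m₀ + i) (by norm_num)) h6 h8
    rw [h3] at h9
    refine h9.trans ?_
    have h10 : Rpow (m₀ + i) (1 / 2) ≤ (side n (m₀ + i) (n - 1))⁻¹ := by
      rw [side, inv_div, le_div_iff₀ (scale_pos _ _ _), hH, pow_two]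
      have := Rpow_pos (m₀ + i) (1 / 2)
      gcongr
      exact scale_pred_le hn _
    have := Rpow_pos (m₀ + i) (1 / 2)
    gcongr
    linarith

theorem continuous_goodFreq {i : ℕ} (hi : 1 ≤ i) (ν : Measure Plane) (t : ℝ) (k : Fin 2 → ℤ) :
    Continuous (W.goodFreq μ ν t i k) := by
  refine continuous_finsetSum _ fun θ _ => ?_
  split_ifs
  · exact W.continuous_freq μ hi θ
  · exact continuous_const

instance (ξ : Plane) : IsFiniteMeasure (rotMeasure ξ) :=
  ⟨by rw [rotMeasure_univ]; exact ENNReal.ofReal_lt_top⟩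

theorem integrable_freq_rotMeasure {i : ℕ} (hi : 1 ≤ i) (ξ : Plane) (θ : FineCap n (m₀ + i)) :
    Integrable (W.freq μ i θ) (rotMeasure ξ) :=
  Integrable.of_bound (W.continuous_freq μ hi θ).aestronglyMeasurable 1
    (Eventually.of_forall fun ζ => (W.norm_freq_le μ hi θ ζ).trans (W.ψ_le_one hi θ ζ))

/-- The multiscale estimate for the restrictions of `μ̂` to circles. -/
theorem eventually_lintegral_extOp_goodFreq_le (hn : 5 ≤ n) (t : ℝ) :
    ∀ᶠ i in atTop, ∀ (ν : Measure Plane) [IsProbabilityMeasure ν] (ξ : Plane),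
      ∫⁻ y, ‖extOp (rotMeasure ξ) (W.goodFreq μ ν t i (cubeIndex (cubeExp n (m₀ + i) 0) y)) y‖ₑ ^ 2
        ∂ν ≤
      (Metric.closedBall (0 : Plane) (2 * W.A * 2 ^ (m₀ + i))).indicator (fun ξ =>
        ENNReal.ofReal (Rpow (m₀ + i) (20 * (n + 1) * dlt n - min t 1)) *
          (∫⁻ α in Set.Ioc (-Real.pi) Real.pi, ‖fourierMeasure μ (rot α ξ)‖ₑ ^ 2) +
        ENNReal.ofReal (Rpow (m₀ + i) (-10))) ξ := by
  classical
  have hA := W.one_le_A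
  have hA24 : 1 ≤ 24 * W.A ^ 3 := by
    have : 1 ≤ W.A ^ 3 := one_le_pow₀ hA
    linarith
  filter_upwards [eventually_ge_atTop 1, (tendsto_add_left_atTop m₀).eventually
    (eventually_lintegral_good_le (24 * W.A ^ 3) hA24 t n hn)] with i hi hmain
  intro ν _ ξ
  have hext : ∀ θ y, extOp (rotMeasure ξ) ({ζ : Plane | ‖ζ‖ = ‖ξ‖}.indicator (W.freq μ i θ)) y =
      extOp (rotMeasure ξ) (W.freq μ i θ) y := by
    intro θ y
    have hm := (W.continuous_freq μ hi θ).measurable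
    rw [extOp_rotMeasure hm, extOp_rotMeasure (hm.indicator
      (measurableSet_eq_fun measurable_norm measurable_const))]
    congr 1
    funext α
    rw [Set.indicator_of_mem (by simp : rot α ξ ∈ {ζ : Plane | ‖ζ‖ = ‖ξ‖})]
  by_cases hξ : W.A⁻¹ * 2 ^ (m₀ + i) ≤ ‖ξ‖ ∧ ‖ξ‖ ≤ 2 * W.A * 2 ^ (m₀ + i)
  · rw [Set.indicator_of_mem (by rw [mem_closedBall_zero_iff]; exact hξ.2)]
    have h1 := hmain (rotMeasure ξ) ‖ξ‖ _ (W.isFreqData μ (by omega) hi hξ.1 hξ.2) ν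
    simp_rw [hext] at h1
    simp_rw [W.extOp_goodFreq μ (W.integrable_freq_rotMeasure μ hi ξ)]
    refine h1.trans ?_
    gcongr
    have hm : ∀ θ, Measurable fun ζ =>
        ‖({ζ : Plane | ‖ζ‖ = ‖ξ‖}.indicator (W.freq μ i θ)) ζ‖ₑ ^ 2 := fun θ =>
      (((W.continuous_freq μ hi θ).measurable.indicator
        (measurableSet_eq_fun measurable_norm measurable_const)).enorm).pow_const 2
    simp_rw [lintegral_rotMeasure (hm _)]
    have hm' : ∀ θ, Measurable fun α =>
        ‖({ζ : Plane | ‖ζ‖ = ‖ξ‖}.indicator (W.freq μ i θ)) (rot α ξ)‖ₑ ^ 2 := fun θ =>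
      (hm θ).comp (continuous_rot_left ξ).measurable
    rw [← lintegral_finsetSum _ fun θ _ => hm' θ]
    refine lintegral_mono fun α => ?_
    refine le_trans (Finset.sum_le_sum fun θ _ => ?_) (W.sum_enorm_freq_sq_le μ hi (rot α ξ))
    gcongr
    exact enorm_indicator_le_enorm_self _ _
  · have h0 : ∀ y, extOp (rotMeasure ξ)
        (W.goodFreq μ ν t i (cubeIndex (cubeExp n (m₀ + i) 0) y)) y = 0 := by
      intro y
      rw [W.extOp_goodFreq μ (W.integrable_freq_rotMeasure μ hi ξ)]
      refine Finset.sum_eq_zero fun θ _ => ?_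
      split_ifs
      · rw [extOp_rotMeasure (W.continuous_freq μ hi θ).measurable]
        have : ∀ α, W.freq μ i θ (rot α ξ) = 0 := by
          intro α
          by_contra h
          have h1 := W.lt_norm_of_freq_ne_zero μ hi h
          have h2 := W.norm_freq_ne_zero_le μ hi h
          rw [norm_rot] at h1 h2
          exact hξ ⟨h1, h2⟩
        simp [this]
      · rfl
    simp [h0]

/-- The mean square of the circular averages of the good frequency pieces. -/
theorem exists_lintegral_circle_good_le (hn : 5 ≤ n) (t : ℝ) {s : ℝ} (hs : 0 < s) :
    ∃ C : ℝ, 0 ≤ C ∧ ∀ᶠ i in atTop, ∀ (ν : Measure Plane) [IsProbabilityMeasure ν],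
      ∫⁻ y, (∫⁻ r in Set.Ioi (0 : ℝ), ENNReal.ofReal r * ‖∫ α in (-Real.pi)..Real.pi,
        extOp volume (W.goodFreq μ ν t i (cubeIndex (cubeExp n (m₀ + i) 0) y))
          (y + r • circlePoint α)‖ₑ ^ 2) ∂ν ≤
      ENNReal.ofReal (C * Rpow (m₀ + i) (20 * (n + 1) * dlt n - min t 1 + 2 - s)) * energy s μ +
        ENNReal.ofReal (C * Rpow (m₀ + i) (-8)) := by
  classical
  obtain ⟨C₀, hC₀, henergy⟩ := exists_lintegral_fourierMeasure_le hs
  have hA := W.one_le_A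
  have hpi := Real.pi_gt_three
  refine ⟨2 * Real.pi * (C₀ * (2 * W.A) ^ (2 - s)) + 4 * (2 * W.A) ^ 2, by positivity, ?_⟩
  filter_upwards [eventually_ge_atTop 1, W.eventually_lintegral_extOp_goodFreq_le μ hn t]
    with i hi hmain ν _
  set k : Plane → Fin 2 → ℤ := cubeIndex (cubeExp n (m₀ + i) 0) with hk
  have hkm : Measurable k := measurable_cubeIndex _
  have hmeas : Measurable fun p : Plane × Plane =>
      ‖extOp (rotMeasure p.2) (W.goodFreq μ ν t i (k p.1)) p.1‖ₑ ^ 2 := by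
    have h1 : Measurable fun q : (Fin 2 → ℤ) × (Plane × Plane) =>
        extOp (rotMeasure q.2.2) (W.goodFreq μ ν t i q.1) q.2.1 := by
      refine measurable_from_prod_countable_right fun k' => ?_
      exact ((continuous_extOp_rotMeasure (W.continuous_goodFreq μ hi ν t k')).comp
        continuous_swap).measurable
    have h2 : Measurable fun p : Plane × Plane => (k p.1, p) :=
      (hkm.comp measurable_fst).prodMk measurable_id
    exact (h1.comp h2).enorm.pow_const 2
  set R : ℝ := 2 ^ (m₀ + i) with hR
  set a := ENNReal.ofReal (Rpow (m₀ + i) (20 * (n + 1) * dlt n - min t 1)) with ha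
  set Q := Metric.closedBall (0 : Plane) (2 * W.A * R) with hQ
  have hQm : MeasurableSet Q := Metric.isClosed_closedBall.measurableSet
  have hμm : Measurable fun ξ => ‖fourierMeasure μ ξ‖ₑ ^ 2 :=
    (continuous_fourierMeasure μ).measurable.enorm.pow_const 2
  have hμrm : Measurable fun p : Plane × ℝ => ‖fourierMeasure μ (rot p.2 p.1)‖ₑ ^ 2 :=
    hμm.comp (continuous_rot_comp continuous_snd continuous_fst).measurable
  have hrotint : ∫⁻ ξ in Q, ∫⁻ α in Set.Ioc (-Real.pi) Real.pi,
      ‖fourierMeasure μ (rot α ξ)‖ₑ ^ 2 =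
      ENNReal.ofReal (2 * Real.pi) * ∫⁻ ξ in Q, ‖fourierMeasure μ ξ‖ₑ ^ 2 := by
    rw [lintegral_lintegral_swap hμrm.aemeasurable]
    have h1 : ∀ α, ∫⁻ ξ in Q, ‖fourierMeasure μ (rot α ξ)‖ₑ ^ 2 =
        ∫⁻ ξ in Q, ‖fourierMeasure μ ξ‖ₑ ^ 2 := by
      intro α
      have h2 : rot α ⁻¹' Q = Q := by
        ext ξ; simp [hQ]
      have h3 := (measurePreserving_rot α).setLIntegral_comp_preimage_emb
        (measurableEmbedding_rot α) (fun ξ => ‖fourierMeasure μ ξ‖ₑ ^ 2) Q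
      rwa [h2] at h3
    simp_rw [h1]
    rw [setLIntegral_const, Real.volume_Ioc, mul_comm]
    congr 2; ring
  calc _ ≤ ∫⁻ y, (∫⁻ ξ, ‖extOp (rotMeasure ξ) (W.goodFreq μ ν t i (k y)) y‖ₑ ^ 2) ∂ν := by
        refine lintegral_mono fun y => ?_
        rw [← lintegral_circle_average (W.continuous_goodFreq μ hi ν t _)
          (W.hasCompactSupport_goodFreq μ hi ν t _)]
        refine le_mul_of_one_le_left zero_le ?_
        rw [ENNReal.one_le_ofReal]; linarith
    _ = ∫⁻ ξ, (∫⁻ y, ‖extOp (rotMeasure ξ) (W.goodFreq μ ν t i (k y)) y‖ₑ ^ 2 ∂ν) :=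
        lintegral_lintegral_swap hmeas.aemeasurable
    _ ≤ ∫⁻ ξ, Q.indicator (fun ξ => a * (∫⁻ α in Set.Ioc (-Real.pi) Real.pi,
          ‖fourierMeasure μ (rot α ξ)‖ₑ ^ 2) + ENNReal.ofReal (Rpow (m₀ + i) (-10))) ξ :=
        lintegral_mono fun ξ => hmain ν ξ
    _ = a * (ENNReal.ofReal (2 * Real.pi) * ∫⁻ ξ in Q, ‖fourierMeasure μ ξ‖ₑ ^ 2) +
          ENNReal.ofReal (Rpow (m₀ + i) (-10)) * volume Q := by
        rw [lintegral_indicator hQm, lintegral_add_right _ measurable_const,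
          lintegral_const_mul _ hμrm.lintegral_prod_right', hrotint, setLIntegral_const]
    _ ≤ a * (ENNReal.ofReal (2 * Real.pi) *
          (ENNReal.ofReal (C₀ * (2 * W.A * R) ^ (2 - s)) * energy s μ)) +
          ENNReal.ofReal (Rpow (m₀ + i) (-10)) * ENNReal.ofReal (4 * (2 * W.A * R) ^ 2) := by
        gcongr
        · exact henergy μ _ (by positivity)
        · exact volume_closedBall_le 0 (by positivity)
    _ ≤ _ := by
        have hRp := Rpow_pos (m₀ + i)
        have h1 : (2 * W.A * R) ^ (2 - s) = (2 * W.A) ^ (2 - s) * Rpow (m₀ + i) (2 - s) := by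
          rw [Real.mul_rpow (by positivity) (by positivity)]; rfl
        have h2 : Rpow (m₀ + i) (-10) * R ^ 2 = Rpow (m₀ + i) (-8) := by
          rw [hR, ← Rpow_one, ← Rpow_mul_nat, ← Rpow_add]; norm_num
        rw [← mul_assoc, ← mul_assoc, ha, ← ENNReal.ofReal_mul (hRp _).le,
          ← ENNReal.ofReal_mul (mul_nonneg (hRp _).le (by positivity)),
          ← ENNReal.ofReal_mul (hRp _).le]
        refine add_le_add (mul_le_mul_left (ENNReal.ofReal_le_ofReal ?_) _)
          (ENNReal.ofReal_le_ofReal ?_)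
        · rw [h1, add_sub_assoc (20 * (n + 1) * dlt n - min t 1), Rpow_add]
          have h3 := hRp (20 * (n + 1) * dlt n - min t 1)
          have h4 := hRp (2 - s)
          calc _ = 2 * Real.pi * (C₀ * (2 * W.A) ^ (2 - s)) *
                (Rpow (m₀ + i) (20 * (n + 1) * dlt n - min t 1) * Rpow (m₀ + i) (2 - s)) := by ring
            _ ≤ _ := by
              gcongr
              have : 0 ≤ 4 * (2 * W.A) ^ 2 := by positivity
              linarith
        · have h3 := hRp (-8)
          calc Rpow (m₀ + i) (-10) * (4 * (2 * W.A * R) ^ 2) =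
                4 * (2 * W.A) ^ 2 * (Rpow (m₀ + i) (-10) * R ^ 2) := by ring
            _ = 4 * (2 * W.A) ^ 2 * Rpow (m₀ + i) (-8) := by rw [h2]
            _ ≤ _ := by
              gcongr
              have : 0 ≤ 2 * Real.pi * (C₀ * (2 * W.A) ^ (2 - s)) := by positivity
              linarith

end WavePackets

/-! ### Pushforwards under the distance to a point -/

/-- The density `r ↦ r ∫ F(y + r ω) dω`, for `r > 0`, of the pushforward of `F` under
`x ↦ |x - y|`. -/
def radialDensity (F : Plane → ℂ) (y : Plane) (r : ℝ) : ℂ :=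
  if 0 < r then (r : ℂ) * ∫ α in (-Real.pi)..Real.pi, F (y + r • circlePoint α) else 0

theorem continuous_integral_circle {F : Plane → ℂ} (hF : Continuous F) :
    Continuous fun p : Plane × ℝ => ∫ α in (-Real.pi)..Real.pi, F (p.1 + p.2 • circlePoint α) := by
  have hcp := continuous_circlePoint
  exact intervalIntegral.continuous_parametric_intervalIntegral_of_continuous' (by fun_prop) _ _

theorem measurable_radialDensity {F : Plane → ℂ} (hF : Continuous F) :
    Measurable fun p : Plane × ℝ => radialDensity F p.1 p.2 := by
  have h := (continuous_integral_circle hF).measurable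
  exact Measurable.ite (measurableSet_lt measurable_const measurable_snd)
    ((Complex.measurable_ofReal.comp measurable_snd).mul h) measurable_const

theorem norm_radialDensity_le {F : Plane → ℂ} {y : Plane} {r B : ℝ} (hr : 0 ≤ r)
    (h : ∀ α, ‖F (y + r • circlePoint α)‖ ≤ B) :
    ‖radialDensity F y r‖ ≤ 2 * Real.pi * B * r := by
  have hB : 0 ≤ B := (norm_nonneg _).trans (h 0)
  have hpi := Real.pi_pos
  unfold radialDensity
  split_ifs
  · rw [norm_mul, Complex.norm_real, Real.norm_of_nonneg hr]
    have h1 := intervalIntegral.norm_integral_le_of_norm_le_const (a := -Real.pi) (b := Real.pi)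
      (f := fun α => F (y + r • circlePoint α)) (C := B) fun α _ => h α
    rw [sub_neg_eq_add, abs_of_pos (by linarith)] at h1
    calc _ ≤ r * (B * (Real.pi + Real.pi)) := by gcongr
      _ = _ := by ring
  · rw [norm_zero]; positivity

theorem norm_smul_circlePoint_le {y : Plane} (hy : ‖y‖ ≤ 1) {r : ℝ} (hr : 0 ≤ r) (α : ℝ) :
    r ≤ ‖y + r • circlePoint α‖ + 1 := by
  have h : ‖r • circlePoint α‖ = r := by
    rw [norm_smul, norm_circlePoint, mul_one, Real.norm_of_nonneg hr]
  calc r = ‖(y + r • circlePoint α) - y‖ := by rw [add_sub_cancel_left, h]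
    _ ≤ ‖y + r • circlePoint α‖ + ‖y‖ := norm_sub_le _ _
    _ ≤ _ := by gcongr

/-- `radialDensity F y` is the density of the pushforward of `F` under `x ↦ |x - y|`. -/
theorem integral_comp_dist_mul {F : Plane → ℂ} (hFc : Continuous F) (hF : Integrable F)
    (φ : 𝓢(ℝ, ℂ)) (y : Plane) :
    ∫ x, φ (dist x y) * F x = ∫ r, φ r * radialDensity F y r := by
  have hcp := continuous_circlePoint
  have hφ := φ.continuous
  have hpi : -Real.pi ≤ Real.pi := by linarith [Real.pi_pos]
  set G : Plane → ℂ := fun x => φ ‖x‖ * F (y + x) with hG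
  have hGc : Continuous G := by fun_prop
  have hGi : Integrable G := by
    obtain ⟨C, -, hC⟩ := φ.decay 0 0
    refine (hF.comp_add_left y).bdd_mul (c := C) (by fun_prop) (Eventually.of_forall fun x => ?_)
    simpa using hC ‖x‖
  have hH : IntegrableOn (fun p : ℝ × ℝ => p.1 • G (p.1 • circlePoint p.2))
      (Set.Ioi (0 : ℝ) ×ˢ Set.Ioo (-Real.pi) Real.pi) := by
    refine ⟨by apply Continuous.aestronglyMeasurable; fun_prop, ?_⟩
    rw [hasFiniteIntegral_iff_enorm]
    refine lt_of_eq_of_lt ?_ hGi.2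
    rw [lintegral_polar]
    refine setLIntegral_congr_fun (measurableSet_Ioi.prod measurableSet_Ioo) fun p hp => ?_
    rw [enorm_smul, Real.enorm_eq_ofReal (le_of_lt hp.1)]
  calc ∫ x, φ (dist x y) * F x = ∫ x, G x := by
        rw [← integral_add_left_eq_self (fun x => φ (dist x y) * F x) y]
        simp [hG, dist_eq_norm]
    _ = ∫ r in Set.Ioi (0 : ℝ), ∫ α in Set.Ioo (-Real.pi) Real.pi,
          r • G (r • circlePoint α) := by
        rw [integral_polar]
        rw [Measure.volume_eq_prod] at hH ⊢
        exact setIntegral_prod _ hH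
    _ = ∫ r in Set.Ioi (0 : ℝ), φ r * radialDensity F y r := by
        refine setIntegral_congr_fun measurableSet_Ioi fun r hr => ?_
        have hr' : (0 : ℝ) < r := hr
        simp only [radialDensity, if_pos hr', hG, norm_smul, norm_circlePoint, mul_one,
          Real.norm_of_nonneg hr'.le]
        rw [intervalIntegral.integral_of_le hpi, integral_Ioc_eq_integral_Ioo,
          ← integral_const_mul, ← integral_const_mul]
        congr 1
        funext α
        rw [Complex.real_smul]
        ring
    _ = ∫ r, φ r * radialDensity F y r := by
        refine setIntegral_eq_integral_of_forall_compl_eq_zero fun r hr => ?_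
        have : ¬ 0 < r := hr
        simp [radialDensity, this]

/-- Functions whose `L²` norms decay geometrically are absolutely summable in `L²`. -/
theorem lintegral_sq_tsum_lt_top {α : Type*} [MeasurableSpace α] {m : Measure α}
    {h : ℕ → α → ℝ≥0∞} (hm : ∀ i, Measurable (h i)) (hfin : ∀ i, ∫⁻ x, h i x ^ 2 ∂m < ⊤)
    {K : ℝ≥0∞} (hK : K ≠ ⊤) {q : ℝ} (hq0 : 0 < q) (hq1 : q < 1)
    (hdec : ∀ᶠ i in atTop, ∫⁻ x, h i x ^ 2 ∂m ≤ K * ENNReal.ofReal (q ^ i)) :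
    ∫⁻ x, (∑' i, h i x) ^ 2 ∂m < ⊤ := by
  set p : ℝ := √q with hp
  have hp0 : 0 < p := Real.sqrt_pos.2 hq0
  have hp1 : p < 1 := by rw [hp, Real.sqrt_lt' one_pos]; simpa using hq1
  have hpq : q = p * p := (Real.mul_self_sqrt hq0.le).symm
  -- The Cauchy–Schwarz inequality with the weights `p ^ i`, `p = √q`, costs `p ^ (-i)` in the `i`-th
  -- term, which leaves the factor `q ^ i / p ^ i = p ^ i`.
  set w : ℕ → ℝ≥0∞ := fun i => ENNReal.ofReal (p ^ i) with hw
  have hw0 : ∀ i, w i ≠ 0 := fun i => by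
    rw [hw]; simp only [ne_eq, ENNReal.ofReal_eq_zero, not_le]; positivity
  have hwt : ∀ i, w i ≠ ⊤ := fun i => ENNReal.ofReal_ne_top
  have hwsum : ∑' i, w i ≠ ⊤ := by
    rw [hw, ← ENNReal.ofReal_tsum_of_nonneg (fun i => by positivity)
      (summable_geometric_of_lt_one hp0.le hp1)]
    exact ENNReal.ofReal_ne_top
  have hCS : ∀ x, (∑' i, h i x) ^ 2 ≤ (∑' i, w i) * ∑' i, (w i)⁻¹ * h i x ^ 2 := by
    intro x
    have h1 := sq_lintegral_mul_le (μ := Measure.count) (w := w) (g := fun i => (w i)⁻¹ * h i x)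
      (Measurable.of_discrete).aemeasurable (Measurable.of_discrete).aemeasurable
    simp only [lintegral_count] at h1
    convert h1 using 4 with i i
    · rw [← mul_assoc, ENNReal.mul_inv_cancel (hw0 i) (hwt i), one_mul]
    · rw [mul_pow, ← mul_assoc, pow_two (w i)⁻¹, ← mul_assoc,
        ENNReal.mul_inv_cancel (hw0 i) (hwt i), one_mul]
  refine (lintegral_mono hCS).trans_lt ?_
  rw [lintegral_const_mul' _ _ hwsum, lintegral_tsum fun i =>
    (((hm i).pow_const 2).const_mul _).aemeasurable]
  refine ENNReal.mul_lt_top hwsum.lt_top ?_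
  have hpull : ∀ i, ∫⁻ x, (w i)⁻¹ * h i x ^ 2 ∂m = (w i)⁻¹ * ∫⁻ x, h i x ^ 2 ∂m := fun i =>
    lintegral_const_mul _ ((hm i).pow_const 2)
  simp_rw [hpull]
  obtain ⟨N, hN⟩ := eventually_atTop.1 hdec
  rw [← ENNReal.summable.sum_add_tsum_nat_add' (k := N)]
  refine ENNReal.add_lt_top.2 ⟨ENNReal.sum_lt_top.2 fun i _ =>
    ENNReal.mul_lt_top (ENNReal.inv_lt_top.2 (pos_iff_ne_zero.2 (hw0 i))) (hfin i), ?_⟩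
  have h2 : ∀ i, (w (i + N))⁻¹ * ∫⁻ x, h (i + N) x ^ 2 ∂m ≤ K * w i := by
    intro i
    calc _ ≤ (w (i + N))⁻¹ * (K * ENNReal.ofReal (q ^ (i + N))) := by
          gcongr; exact hN _ (by omega)
      _ = (w (i + N))⁻¹ * w (i + N) * (K * w (i + N)) := by
          rw [hpq, mul_pow, ENNReal.ofReal_mul (by positivity)]
          simp only [hw]; ring
      _ = K * w (i + N) := by rw [ENNReal.inv_mul_cancel (hw0 _) (hwt _), one_mul]
      _ ≤ K * w i := by
          refine mul_le_mul_right (ENNReal.ofReal_le_ofReal ?_) K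
          exact pow_le_pow_of_le_one hp0.le hp1.le (by omega)
  refine (ENNReal.tsum_le_tsum h2).trans_lt ?_
  rw [ENNReal.tsum_mul_left]
  exact ENNReal.mul_lt_top hK.lt_top hwsum.lt_top

/-! ### The pushforward of the good part, scale by scale -/

theorem dlt_le_half {n : ℕ} (hn : 1 ≤ n) : dlt n ≤ 1 / 2 := by
  unfold dlt
  calc (2 : ℝ)⁻¹ ^ n ≤ 2⁻¹ ^ 1 := pow_le_pow_of_le_one (by norm_num) (by norm_num) hn
    _ = 1 / 2 := by norm_num

theorem enorm_sq_le_of_norm_sub_le {z w : ℂ} {ε : ℝ} (h : ‖z - w‖ ≤ ε) :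
    ‖z‖ₑ ^ 2 ≤ 2 * ‖w‖ₑ ^ 2 + ENNReal.ofReal (2 * ε ^ 2) := by
  have h1 : ‖z‖ ≤ ‖w‖ + ε := by
    have := norm_sub_norm_le z w
    linarith
  rw [← ofReal_norm, ← ofReal_norm, ← ENNReal.ofReal_pow (norm_nonneg _),
    ← ENNReal.ofReal_pow (norm_nonneg _), ← ENNReal.ofReal_ofNat 2,
    ← ENNReal.ofReal_mul (by norm_num), ← ENNReal.ofReal_add (by positivity) (by positivity)]
  apply ENNReal.ofReal_le_ofReal
  nlinarith [norm_nonneg z, norm_nonneg w, sq_nonneg (‖w‖ - ε)]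

/-- The good part at a scale depends on `y` only through the index of a cube, of which there are
countably many; this gives the joint measurability. -/
theorem measurable_apply_of_countable {k : Plane → Fin 2 → ℤ} (hk : Measurable k)
    {f : (Fin 2 → ℤ) → Plane × ℝ → ℂ} (hf : ∀ k, Measurable (f k)) :
    Measurable fun p : Plane × ℝ => f (k p.1) p := by
  have h1 : Measurable fun q : (Fin 2 → ℤ) × (Plane × ℝ) => f q.1 q.2 :=
    measurable_from_prod_countable_right hf
  exact h1.comp ((hk.comp measurable_fst).prodMk measurable_id)

namespace WavePackets

variable {m₀ n : ℕ} (W : WavePackets m₀ n) (μ ν : Measure Plane) (t : ℝ)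

theorem norm_le_of_η_ne_zero (hn : 1 ≤ n) {i : ℕ} (hi : 1 ≤ i) {θ : FineCap n (m₀ + i)} {u : ℝ}
    (hu : u ∈ W.tubes i θ) {x : Plane} (hx : W.η i θ u x ≠ 0) : ‖x‖ ≤ W.A + W.len + 1 := by
  obtain ⟨h1, h2⟩ := W.η_support i hi θ u hu hx
  have he := norm_fineDir (m₀ := m₀) θ
  have h3 : Rpow (m₀ + i) (-(1 / 2) + dlt n) ≤ 1 := by
    exact (Rpow_mono _ (by linarith [dlt_le_half hn])).trans_eq (Rpow_zero (m₀ + i))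
  have h4 := norm_le_frame he (x - u • perp (fineDir θ))
  have h5 : ‖u • perp (fineDir θ)‖ ≤ W.A := by
    rw [norm_smul, norm_perp, he, mul_one]
    exact W.tubes_bounded i hi θ u hu
  have h6 : ‖x‖ ≤ ‖x - u • perp (fineDir θ)‖ + ‖u • perp (fineDir θ)‖ := by
    simpa using norm_add_le (x - u • perp (fineDir θ)) (u • perp (fineDir θ))
  linarith [W.four_lt_len]

theorem goodAt_eq_zero (hn : 1 ≤ n) {i : ℕ} (hi : 1 ≤ i) (k : Fin 2 → ℤ) {x : Plane}
    (hx : W.A + W.len + 1 < ‖x‖) : W.goodAt μ ν t i k x = 0 := by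
  classical
  refine Finset.sum_eq_zero fun θ _ => Finset.sum_eq_zero fun u hu => ?_
  have h : W.η i θ u x = 0 := by
    by_contra h
    exact absurd (W.norm_le_of_η_ne_zero hn hi (Finset.mem_filter.1 hu).1 h) (not_le.2 hx)
  rw [M, h, Complex.ofReal_zero, zero_mul]

/-- The contribution of the scale `i` to the density of `d^y_*(μ_{good,y})`. -/
def goodDensity (i : ℕ) (y : Plane) (r : ℝ) : ℂ :=
  radialDensity (W.goodAt μ ν t i (cubeIndex (cubeExp n (m₀ + i) 0) y)) y r

theorem goodDensity_eq_zero (hn : 1 ≤ n) {i : ℕ} (hi : 1 ≤ i) {y : Plane} (hy : ‖y‖ ≤ 1) {r : ℝ}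
    (hr : W.A + W.len + 2 < r) : W.goodDensity μ ν t i y r = 0 := by
  have h0 : 0 < r := by linarith [W.one_le_A, W.four_lt_len]
  have h : ∀ α, W.goodAt μ ν t i (cubeIndex (cubeExp n (m₀ + i) 0) y) (y + r • circlePoint α) = 0 :=
    fun α => W.goodAt_eq_zero μ ν t hn hi _ (by linarith [norm_smul_circlePoint_le hy h0.le α])
  simp [goodDensity, radialDensity, h]

theorem exists_norm_goodAt_le {i : ℕ} (hi : 1 ≤ i) :
    ∃ B : ℝ, ∀ k x, ‖W.goodAt μ ν t i k x‖ ≤ B := by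
  classical
  have hM : ∀ θ, ∀ u ∈ W.tubes i θ, ∀ x, ‖W.M μ i θ u x‖ ≤ W.K 0 * ∫ ξ, ‖W.freq μ i θ ξ‖ := by
    intro θ u hu x
    have hη := (W.η_adapted i hi θ u hu).abs_le (norm_fineDir θ) one_ne_zero (Rpow_pos _ _).ne' x
    rw [M_eq, norm_mul, Complex.norm_real]
    exact mul_le_mul hη (norm_extOp_le _ _ _) (norm_nonneg _) ((abs_nonneg _).trans hη)
  refine ⟨∑ θ, ∑ u ∈ W.tubes i θ, W.K 0 * ∫ ξ, ‖W.freq μ i θ ξ‖, fun k x => ?_⟩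
  refine (norm_sum_le _ _).trans (Finset.sum_le_sum fun θ _ => ?_)
  refine (norm_sum_le _ _).trans ?_
  refine (Finset.sum_le_sum fun u hu => hM θ u (Finset.mem_filter.1 hu).1 x).trans ?_
  exact Finset.sum_le_sum_of_subset_of_nonneg (Finset.filter_subset _ _) fun u hu _ =>
    (norm_nonneg _).trans (hM θ u hu x)

theorem lintegral_goodDensity_sq_lt_top [IsProbabilityMeasure ν] (hν : ∀ᵐ y ∂ν, ‖y‖ ≤ 1)
    (hn : 1 ≤ n) {i : ℕ} (hi : 1 ≤ i) :
    ∫⁻ y, (∫⁻ r, ‖W.goodDensity μ ν t i y r‖ₑ ^ 2) ∂ν < ⊤ := by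
  obtain ⟨B, hB⟩ := W.exists_norm_goodAt_le μ ν t hi
  set ρ : ℝ := W.A + W.len + 2
  have hρ : 0 < ρ := by linarith [W.one_le_A, W.four_lt_len]
  have hB0 : 0 ≤ B := (norm_nonneg _).trans (hB 0 0)
  have hpi := Real.pi_pos
  set c : ℝ≥0∞ := ENNReal.ofReal (2 * Real.pi * B * ρ) ^ 2
  have h : ∀ᵐ y ∂ν, ∫⁻ r, ‖W.goodDensity μ ν t i y r‖ₑ ^ 2 ≤ c * ENNReal.ofReal ρ := by
    filter_upwards [hν] with y hy
    calc _ ≤ ∫⁻ r, (Set.Ioc 0 ρ).indicator (fun _ => c) r := by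
          refine lintegral_mono fun r => ?_
          by_cases hr : r ∈ Set.Ioc 0 ρ
          · rw [Set.indicator_of_mem hr, ← ofReal_norm]
            refine pow_le_pow_left₀ zero_le (ENNReal.ofReal_le_ofReal ?_) 2
            refine (norm_radialDensity_le hr.1.le fun α => hB _ _).trans ?_
            gcongr
            exact hr.2
          · rw [Set.indicator_of_notMem hr]
            have h0 : W.goodDensity μ ν t i y r = 0 := by
              by_cases h1 : 0 < r
              · exact W.goodDensity_eq_zero μ ν t hn hi hy (not_le.1 fun h => hr ⟨h1, h⟩)
              · simp [goodDensity, radialDensity, h1]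
            simp [h0]
      _ = _ := by
          rw [lintegral_indicator measurableSet_Ioc, setLIntegral_const, Real.volume_Ioc, sub_zero]
  refine (lintegral_mono_ae h).trans_lt ?_
  rw [lintegral_const, measure_univ, mul_one]
  exact ENNReal.mul_lt_top (ENNReal.pow_lt_top ENNReal.ofReal_lt_top) ENNReal.ofReal_lt_top

variable [IsProbabilityMeasure μ]

theorem continuous_goodAt {i : ℕ} (hi : 1 ≤ i) (k : Fin 2 → ℤ) :
    Continuous (W.goodAt μ ν t i k) := by
  classical
  refine continuous_finsetSum _ fun θ _ => continuous_finsetSum _ fun u hu => ?_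
  have hM : W.M μ i θ u = fun x => (W.η i θ u x : ℂ) * W.packet μ i θ x :=
    funext (W.M_eq μ i θ u)
  refine Continuous.congr ?_ fun x => (congrFun hM x).symm
  exact (Complex.continuous_ofReal.comp (W.continuous_η hi (Finset.mem_filter.1 hu).1)).mul
    (W.continuous_packet μ hi θ)

theorem integrable_goodAt (hn : 1 ≤ n) {i : ℕ} (hi : 1 ≤ i) (k : Fin 2 → ℤ) :
    Integrable (W.goodAt μ ν t i k) :=
  (W.continuous_goodAt μ ν t hi k).integrable_of_hasCompactSupport
    (HasCompactSupport.intro (isCompact_closedBall (0 : Plane) (W.A + W.len + 1)) fun x hx =>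
      W.goodAt_eq_zero μ ν t hn hi k (by simpa using hx))

theorem measurable_goodDensity {i : ℕ} (hi : 1 ≤ i) :
    Measurable fun p : Plane × ℝ => W.goodDensity μ ν t i p.1 p.2 := by
  have h := measurable_apply_of_countable (measurable_cubeIndex (cubeExp n (m₀ + i) 0))
    (f := fun k p => radialDensity (W.goodAt μ ν t i k) p.1 p.2)
    fun k => measurable_radialDensity (W.continuous_goodAt μ ν t hi k)
  exact h

open Classical in
theorem integral_circle_goodFreq {i : ℕ} (hi : 1 ≤ i) (k : Fin 2 → ℤ) (y : Plane) (r : ℝ) :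
    ∫ α in (-Real.pi)..Real.pi, extOp volume (W.goodFreq μ ν t i k) (y + r • circlePoint α) =
      ∑ θ, if IsGood ν t n (m₀ + i) 0 k θ then
        ∫ α in (-Real.pi)..Real.pi, W.packet μ i θ (y + r • circlePoint α) else 0 := by
  have hcp := continuous_circlePoint
  simp_rw [W.extOp_goodFreq μ (W.integrable_freq μ hi)]
  rw [intervalIntegral.integral_finsetSum]
  · refine Finset.sum_congr rfl fun θ _ => ?_
    split_ifs
    · rfl
    · simp
  · intro θ _
    split_ifs
    · exact ((W.continuous_packet μ hi θ).comp (by fun_prop)).intervalIntegrable _ _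
    · exact intervalIntegrable_const

/-- The mean square of the pushforward densities decays geometrically as soon as
`20 (n + 1) δ < min (t, 1) + s - 2`. -/
theorem exists_lintegral_goodDensity_sq_le [IsProbabilityMeasure ν] (hμ : ∀ᵐ z ∂μ, ‖z‖ ≤ 1)
    (hν : ∀ᵐ y ∂ν, ‖y‖ ≤ 1) (hn : 5 ≤ n) {s : ℝ} (hs : 0 < s) (hμs : energy s μ < ⊤)
    (hgain : 20 * (n + 1) * dlt n - min t 1 + 2 - s < 0) :
    ∃ K : ℝ≥0∞, K ≠ ⊤ ∧ ∃ q : ℝ, 0 < q ∧ q < 1 ∧ ∀ᶠ i in atTop,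
      ∫⁻ y, (∫⁻ r, ‖W.goodDensity μ ν t i y r‖ₑ ^ 2) ∂ν ≤ K * ENNReal.ofReal (q ^ i) := by
  classical
  obtain ⟨C, hC, hmain⟩ := W.exists_lintegral_circle_good_le μ hn t hs
  set ρ : ℝ := W.A + W.len + 2
  have hρ : 1 ≤ ρ := by linarith [W.one_le_A, W.four_lt_len]
  set e : ℝ := max (20 * (n + 1) * dlt n - min t 1 + 2 - s) (-8) with he
  have he0 : e < 0 := max_lt hgain (by norm_num)
  have hRe : ∀ i, Rpow (m₀ + i) e ≤ ((2 : ℝ) ^ e) ^ i := by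
    intro i
    rw [Rpow, ← Real.rpow_natCast, ← Real.rpow_natCast, ← Real.rpow_mul (by norm_num),
      ← Real.rpow_mul (by norm_num)]
    apply Real.rpow_le_rpow_of_exponent_le (by norm_num)
    push_cast
    have : (0 : ℝ) ≤ m₀ := by positivity
    nlinarith
  refine ⟨ENNReal.ofReal (2 * ρ) * (ENNReal.ofReal C * energy s μ + ENNReal.ofReal C) +
    ENNReal.ofReal (2 * ρ ^ 3), ?_, (2 : ℝ) ^ e, by positivity,
    Real.rpow_lt_one_of_one_lt_of_neg (by norm_num) he0, ?_⟩
  · have h1 : energy s μ ≠ ⊤ := hμs.ne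
    finiteness
  filter_upwards [eventually_ge_atTop 1, hmain,
    W.eventually_norm_integral_circle_goodAt_sub_le μ (by omega) hμ ν t hρ] with i hi hmain herr
  -- The density of the good part is `r (m y r + O (R ^ (-5)))`, and one of the two factors `r` in its
  -- square is bounded by `ρ`, as the tubes lie in a bounded region.
  set m : Plane → ℝ → ℂ := fun y r => ∫ α in (-Real.pi)..Real.pi,
    extOp volume (W.goodFreq μ ν t i (cubeIndex (cubeExp n (m₀ + i) 0) y)) (y + r • circlePoint α)
    with hm
  have hpt : ∀ y r, ‖y‖ ≤ 1 → 0 < r → r ≤ ρ → ‖W.goodDensity μ ν t i y r‖ₑ ^ 2 ≤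
      ENNReal.ofReal (2 * ρ) * (ENNReal.ofReal r * ‖m y r‖ₑ ^ 2) +
        ENNReal.ofReal (2 * ρ ^ 2 * Rpow (m₀ + i) (-10)) := by
    intro y r hy hr hrρ
    have h1 := herr y r hy hr hrρ
    rw [← W.integral_circle_goodFreq μ ν t hi] at h1
    have h2 := enorm_sq_le_of_norm_sub_le h1
    rw [← Rpow_mul_nat] at h2
    rw [goodDensity, radialDensity, if_pos hr, enorm_mul, mul_pow, ← ofReal_norm (r : ℂ),
      Complex.norm_real, Real.norm_of_nonneg hr.le]
    refine (mul_le_mul_right h2 _).trans ?_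
    rw [mul_add]
    refine add_le_add ?_ ?_
    · rw [pow_two, ENNReal.ofReal_mul (by norm_num), ENNReal.ofReal_ofNat]
      calc _ = 2 * ENNReal.ofReal r * (ENNReal.ofReal r * ‖m y r‖ₑ ^ 2) := by ring
        _ ≤ _ := by gcongr
    · rw [← ENNReal.ofReal_pow hr.le, ← ENNReal.ofReal_mul (by positivity)]
      apply ENNReal.ofReal_le_ofReal
      have h3 : Rpow (m₀ + i) (-5 * (2 : ℕ)) = Rpow (m₀ + i) (-10) := by norm_num
      have h4 := Rpow_pos (m₀ + i) (-10)
      rw [h3]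
      calc r ^ 2 * (2 * Rpow (m₀ + i) (-10)) = 2 * r ^ 2 * Rpow (m₀ + i) (-10) := by ring
        _ ≤ _ := by gcongr
  have hint : ∀ᵐ y ∂ν, ∫⁻ r, ‖W.goodDensity μ ν t i y r‖ₑ ^ 2 ≤
      ENNReal.ofReal (2 * ρ) * (∫⁻ r in Set.Ioi (0 : ℝ), ENNReal.ofReal r * ‖m y r‖ₑ ^ 2) +
        ENNReal.ofReal (2 * ρ ^ 2 * Rpow (m₀ + i) (-10)) * ENNReal.ofReal ρ := by
    filter_upwards [hν] with y hy
    have hsupp : ∀ r, r ∉ Set.Ioc 0 ρ → ‖W.goodDensity μ ν t i y r‖ₑ ^ 2 = 0 := by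
      intro r hr
      have h0 : W.goodDensity μ ν t i y r = 0 := by
        by_cases h1 : 0 < r
        · exact W.goodDensity_eq_zero μ ν t (by omega) hi hy (not_le.1 fun h => hr ⟨h1, h⟩)
        · simp [goodDensity, radialDensity, h1]
      simp [h0]
    calc ∫⁻ r, ‖W.goodDensity μ ν t i y r‖ₑ ^ 2
        = ∫⁻ r in Set.Ioc 0 ρ, ‖W.goodDensity μ ν t i y r‖ₑ ^ 2 := by
          rw [← lintegral_indicator measurableSet_Ioc]
          congr 1
          funext r
          by_cases hr : r ∈ Set.Ioc 0 ρ
          · rw [Set.indicator_of_mem hr]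
          · rw [Set.indicator_of_notMem hr, hsupp r hr]
      _ ≤ ∫⁻ r in Set.Ioc 0 ρ, (ENNReal.ofReal (2 * ρ) * (ENNReal.ofReal r * ‖m y r‖ₑ ^ 2) +
            ENNReal.ofReal (2 * ρ ^ 2 * Rpow (m₀ + i) (-10))) :=
          setLIntegral_mono' measurableSet_Ioc fun r hr => hpt y r hy hr.1 hr.2
      _ = ENNReal.ofReal (2 * ρ) * (∫⁻ r in Set.Ioc 0 ρ, ENNReal.ofReal r * ‖m y r‖ₑ ^ 2) +
            ENNReal.ofReal (2 * ρ ^ 2 * Rpow (m₀ + i) (-10)) * ENNReal.ofReal ρ := by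
          rw [lintegral_add_right _ measurable_const, lintegral_const_mul' _ _ ENNReal.ofReal_ne_top,
            setLIntegral_const, Real.volume_Ioc, sub_zero]
      _ ≤ _ := by
          refine add_le_add_left (mul_le_mul_right ?_ _) _
          exact lintegral_mono_set Set.Ioc_subset_Ioi_self
  refine (lintegral_mono_ae hint).trans ?_
  rw [lintegral_add_right _ measurable_const, lintegral_const_mul' _ _ ENNReal.ofReal_ne_top,
    lintegral_const, measure_univ, mul_one]
  have hx : ∀ x ≤ e, ENNReal.ofReal (Rpow (m₀ + i) x) ≤ ENNReal.ofReal (((2 : ℝ) ^ e) ^ i) :=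
    fun x hx => ENNReal.ofReal_le_ofReal ((Rpow_mono _ hx).trans (hRe i))
  set Q := ENNReal.ofReal (((2 : ℝ) ^ e) ^ i)
  calc _ ≤ ENNReal.ofReal (2 * ρ) * (ENNReal.ofReal C * Q * energy s μ + ENNReal.ofReal C * Q) +
        ENNReal.ofReal (2 * ρ ^ 2) * Q * ENNReal.ofReal ρ := by
        refine add_le_add (mul_le_mul_right ((hmain ν).trans ?_) _) (mul_le_mul_left ?_ _)
        · refine add_le_add (mul_le_mul_left ?_ _) ?_
          · rw [ENNReal.ofReal_mul hC]
            exact mul_le_mul_right (hx _ (le_max_left _ _)) _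
          · rw [ENNReal.ofReal_mul hC]
            exact mul_le_mul_right (hx _ (le_max_right _ _)) _
        · rw [ENNReal.ofReal_mul (by positivity)]
          exact mul_le_mul_right (hx _ ((by norm_num : (-10 : ℝ) ≤ -8).trans (le_max_right _ _))) _
    _ = _ := by
        have h1 : ENNReal.ofReal (2 * ρ ^ 3) = ENNReal.ofReal (2 * ρ ^ 2) * ENNReal.ofReal ρ := by
          rw [← ENNReal.ofReal_mul (by positivity)]; congr 1; ring
        rw [h1]
        ring

end WavePackets

/-! ### Summation over the scales -/

section Series

variable {ν : Measure Plane} {h₀ : Plane → ℝ → ℂ} {h : ℕ → Plane → ℝ → ℂ}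

/-- Square summability of densities with a common bounded support yields the convergence of the
series against all test functions. -/
theorem ae_tendsto_integral_series [IsProbabilityMeasure ν]
    (hm₀ : Measurable fun p : Plane × ℝ => h₀ p.1 p.2)
    (hm : ∀ i, Measurable fun p : Plane × ℝ => h i p.1 p.2) {C : ℝ}
    (hC : ∀ᵐ y ∂ν, ∀ r, ‖h₀ y r‖ ≤ C * (1 + r ^ 2)⁻¹) {ρ : ℝ}
    (hsupp : ∀ᵐ y ∂ν, ∀ i r, r ∉ Set.Ioc 0 ρ → h i y r = 0)
    (hS2 : ∫⁻ y, (∫⁻ r, (∑' i, ‖h i y r‖ₑ) ^ 2) ∂ν < ⊤) :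
    ∀ᵐ y ∂ν, ∀ φ : 𝓢(ℝ, ℂ), Tendsto (fun N => (∫ r, φ r * h₀ y r) +
      ∑ i ∈ Finset.range N, ∫ r, φ r * h i y r) atTop
      (𝓝 (∫ r, φ r * (h₀ y r + ∑' i, h i y r))) := by
  set S : Plane → ℝ → ℝ≥0∞ := fun y r => ∑' i, ‖h i y r‖ₑ with hS
  have hSm : Measurable fun p : Plane × ℝ => S p.1 p.2 := Measurable.tsum fun i => (hm i).enorm
  have hSy : ∀ y, Measurable (S y) := fun y => hSm.comp measurable_prodMk_left
  have hhy : ∀ i y, Measurable (h i y) := fun i y => (hm i).comp measurable_prodMk_left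
  filter_upwards [hC, hsupp, ae_lt_top (hSm.pow_const 2).lintegral_prod_right' hS2.ne]
    with y hCy hy hSy2
  -- On a bounded set `S ≤ 1 + S ^ 2` passes from `L²` to `L¹`.
  have hS1 : ∫⁻ r, S y r < ⊤ := by
    calc ∫⁻ r, S y r ≤ ∫⁻ r, ((Set.Ioc 0 ρ).indicator (fun _ => 1) r + S y r ^ 2) := by
          refine lintegral_mono fun r => ?_
          by_cases hr : r ∈ Set.Ioc 0 ρ
          · rw [Set.indicator_of_mem hr]
            rcases le_total (S y r) 1 with h1 | h1
            · exact h1.trans le_self_add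
            · exact (le_self_pow h1 two_ne_zero).trans le_add_self
          · have h0 : ∀ i, h i y r = 0 :=
              fun i => hy i r hr
            simp [hS, h0]
      _ = ENNReal.ofReal ρ + ∫⁻ r, S y r ^ 2 := by
          rw [lintegral_add_right _ ((hSy y).pow_const 2), lintegral_indicator measurableSet_Ioc,
            setLIntegral_const, Real.volume_Ioc, sub_zero, one_mul]
      _ < ⊤ := ENNReal.add_lt_top.2 ⟨ENNReal.ofReal_lt_top, hSy2⟩
  intro φ
  obtain ⟨B, hB0, hB⟩ := φ.decay 0 0
  have hB' : ∀ r, ‖φ r‖ ≤ B := fun r => by simpa using hB r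
  have hφ := φ.continuous
  have hsum : ∑' i, ∫⁻ r, ‖h i y r‖ₑ < ⊤ := by
    rwa [← lintegral_tsum fun i => (hhy i y).enorm.aemeasurable]
  have hint : ∀ i, Integrable (h i y) := fun i =>
    ⟨(hhy i y).aestronglyMeasurable, (ENNReal.le_tsum i).trans_lt hsum⟩
  have hint₀ : Integrable (h₀ y) :=
    (integrable_inv_one_add_sq.const_mul C).mono' (hm₀.comp measurable_prodMk_left).aestronglyMeasurable
      (Eventually.of_forall fun r => hCy r)
  have hφint : ∀ {f : ℝ → ℂ}, Integrable f → Integrable fun r => φ r * f r := fun hf =>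
    hf.bdd_mul (c := B) hφ.aestronglyMeasurable (Eventually.of_forall hB')
  have hφsum : ∑' i, ∫⁻ r, ‖φ r * h i y r‖ₑ < ⊤ := by
    refine lt_of_le_of_lt (ENNReal.tsum_le_tsum fun i => ?_)
      (b := ∑' i, ENNReal.ofReal B * ∫⁻ r, ‖h i y r‖ₑ) ?_
    · rw [← lintegral_const_mul _ (hhy i y).enorm]
      refine lintegral_mono fun r => ?_
      rw [enorm_mul, ← ofReal_norm (φ r)]
      gcongr
      exact hB' r
    · rw [ENNReal.tsum_mul_left]
      exact ENNReal.mul_lt_top ENNReal.ofReal_lt_top hsum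
  have hhas : HasSum (fun i => ∫ r, φ r * h i y r) (∫ r, ∑' i, φ r * h i y r) := by
    refine hasSum_integral_of_summable_integral_norm (fun i => hφint (hint i)) ?_
    simp_rw [fun i => integral_norm_eq_lintegral_enorm (hφint (hint i)).1]
    exact ENNReal.summable_toReal hφsum.ne
  have htint : Integrable fun r => ∑' i, φ r * h i y r := by
    refine ⟨(Measurable.tsum fun i => hφ.measurable.mul (hhy i y)).aestronglyMeasurable, ?_⟩
    refine (lintegral_mono fun r => enorm_tsum_le_tsum_enorm).trans_lt ?_
    have hme : ∀ i, Measurable fun r => ‖φ r * h i y r‖ₑ := fun i =>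
      (hφ.measurable.mul (hhy i y)).enorm
    rwa [lintegral_tsum fun i => (hme i).aemeasurable]
  have hlim : ∫ r, φ r * (h₀ y r + ∑' i, h i y r) =
      (∫ r, φ r * h₀ y r) + ∫ r, ∑' i, φ r * h i y r := by
    rw [← integral_add (hφint hint₀) htint]
    congr 1
    funext r
    rw [mul_add, tsum_mul_left]
  rw [hlim]
  exact tendsto_const_nhds.add hhas.tendsto_sum_nat

theorem lintegral_eLpNorm_series_lt_top [IsProbabilityMeasure ν]
    (hm : ∀ i, Measurable fun p : Plane × ℝ => h i p.1 p.2) {C : ℝ}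
    (hC : ∀ᵐ y ∂ν, ∀ r, ‖h₀ y r‖ ≤ C * (1 + r ^ 2)⁻¹)
    (hS2 : ∫⁻ y, (∫⁻ r, (∑' i, ‖h i y r‖ₑ) ^ 2) ∂ν < ⊤) :
    ∫⁻ y, (eLpNorm (fun r => h₀ y r + ∑' i, h i y r) 2 volume) ^ 2 ∂ν < ⊤ := by
  set S : Plane → ℝ → ℝ≥0∞ := fun y r => ∑' i, ‖h i y r‖ₑ with hS
  have hSm : Measurable fun p : Plane × ℝ => S p.1 p.2 := Measurable.tsum fun i => (hm i).enorm
  have hSy : ∀ y, Measurable (S y) := fun y => hSm.comp measurable_prodMk_left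
  have hinv : ∫⁻ r : ℝ, ENNReal.ofReal ((1 + r ^ 2)⁻¹) ≠ ⊤ :=
    (integrable_inv_one_add_sq.lintegral_lt_top).ne
  have hpt : ∀ y r, ‖h₀ y r‖ ≤ C * (1 + r ^ 2)⁻¹ → ‖h₀ y r + ∑' i, h i y r‖ₑ ^ 2 ≤
      2 * (ENNReal.ofReal (C ^ 2) * ENNReal.ofReal ((1 + r ^ 2)⁻¹)) + 2 * S y r ^ 2 := by
    intro y r hy
    have h1 : ‖h₀ y r‖ₑ ^ 2 ≤ ENNReal.ofReal (C ^ 2) * ENNReal.ofReal ((1 + r ^ 2)⁻¹) := by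
      rw [← ofReal_norm, ← ENNReal.ofReal_pow (norm_nonneg _), ← ENNReal.ofReal_mul (by positivity)]
      apply ENNReal.ofReal_le_ofReal
      have h2 : (1 + r ^ 2)⁻¹ ≤ 1 := inv_le_one_of_one_le₀ (by nlinarith [sq_nonneg r])
      calc ‖h₀ y r‖ ^ 2 ≤ (C * (1 + r ^ 2)⁻¹) ^ 2 := by gcongr
        _ = C ^ 2 * ((1 + r ^ 2)⁻¹ * (1 + r ^ 2)⁻¹) := by ring
        _ ≤ C ^ 2 * (1 * (1 + r ^ 2)⁻¹) := by gcongr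
        _ = _ := by ring
    calc _ ≤ (‖h₀ y r‖ₑ + S y r) ^ 2 := by
          gcongr
          exact (enorm_add_le _ _).trans (add_le_add_right enorm_tsum_le_tsum_enorm _)
      _ ≤ 2 * ‖h₀ y r‖ₑ ^ 2 + 2 * S y r ^ 2 := by
          have := ENNReal.rpow_add_le_mul_rpow_add_rpow ‖h₀ y r‖ₑ (S y r) (p := 2) (by norm_num)
          rw [← mul_add]
          norm_num at this
          exact this
      _ ≤ _ := by gcongr
  have hbd : ∀ᵐ y ∂ν, (eLpNorm (fun r => h₀ y r + ∑' i, h i y r) 2 volume) ^ 2 ≤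
      2 * (ENNReal.ofReal (C ^ 2) * ∫⁻ r : ℝ, ENNReal.ofReal ((1 + r ^ 2)⁻¹)) +
        2 * ∫⁻ r, S y r ^ 2 := by
    filter_upwards [hC] with y hCy
    have h1 := eLpNorm_nnreal_pow_eq_lintegral (μ := (volume : Measure ℝ)) (p := 2) two_ne_zero
      (f := fun r => h₀ y r + ∑' i, h i y r)
    norm_num at h1
    rw [h1, ← lintegral_const_mul' _ _ ENNReal.ofReal_ne_top,
      ← lintegral_const_mul' _ _ ENNReal.ofNat_ne_top,
      ← lintegral_const_mul' _ _ ENNReal.ofNat_ne_top,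
      ← lintegral_add_right _ (((hSy y).pow_const 2).const_mul 2)]
    exact lintegral_mono fun r => hpt y r (hCy r)
  refine (lintegral_mono_ae hbd).trans_lt ?_
  rw [lintegral_add_left measurable_const, lintegral_const, measure_univ, mul_one,
    lintegral_const_mul' _ _ ENNReal.ofNat_ne_top]
  have := hS2.ne
  finiteness

end Series

namespace WavePackets

variable {m₀ n : ℕ} (W : WavePackets m₀ n) (μ ν : Measure Plane) (t : ℝ)

theorem hasCompactSupport_ψ₀ : HasCompactSupport W.ψ₀ :=
  HasCompactSupport.of_support_subset_isCompact (isCompact_closedBall _ _) W.ψ₀_support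

variable [IsProbabilityMeasure μ]

theorem continuous_M₀ : Continuous (W.M₀ μ) := by
  rw [M₀, fourierInv_eq_extOp]
  have hψ : HasCompactSupport fun ξ => (W.ψ₀ ξ : ℂ) :=
    W.hasCompactSupport_ψ₀.comp_left Complex.ofReal_zero
  refine continuous_extOp (Continuous.integrable_of_hasCompactSupport ?_ hψ.mul_right)
  exact (Complex.continuous_ofReal.comp W.ψ₀_smooth.continuous).mul (continuous_fourierMeasure μ)

/-- `M₀ μ` is the convolution of `μ`, a measure on the unit ball, with a Schwartz function. -/
theorem exists_norm_M₀_le (hμ : ∀ᵐ z ∂μ, ‖z‖ ≤ 1) :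
    ∃ C : ℝ, 0 ≤ C ∧ ∀ x, ‖W.M₀ μ x‖ ≤ C * ((1 + ‖x‖) ^ 4)⁻¹ := by
  have h1 : HasCompactSupport (Complex.ofRealCLM ∘ W.ψ₀) :=
    W.hasCompactSupport_ψ₀.comp_left rfl
  have h2 : ContDiff ℝ ∞ (Complex.ofRealCLM ∘ W.ψ₀) :=
    Complex.ofRealCLM.contDiff.comp W.ψ₀_smooth
  set Ψ : 𝓢(Plane, ℂ) := h1.toSchwartzMap h2
  have hΨ : (Ψ : Plane → ℂ) = fun ξ => (W.ψ₀ ξ : ℂ) := rfl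
  set C : ℝ := 2 ^ 4 * (Finset.Iic (4, 0)).sup (fun m => SchwartzMap.seminorm ℝ m.1 m.2)
    (𝓕⁻ Ψ : 𝓢(Plane, ℂ))
  have hC : ∀ x, (1 + ‖x‖) ^ 4 * ‖(𝓕⁻ Ψ : 𝓢(Plane, ℂ)) x‖ ≤ C := by
    intro x
    have h := SchwartzMap.one_add_le_sup_seminorm_apply (𝕜 := ℝ) (m := (4, 0)) (k := 4) (n := 0)
      le_rfl le_rfl (𝓕⁻ Ψ : 𝓢(Plane, ℂ)) x
    rwa [norm_iteratedFDeriv_zero] at h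
  have hC0 : 0 ≤ C := le_trans (by positivity) (hC 0)
  refine ⟨16 * C, by positivity, fun x => ?_⟩
  have hint : Integrable fun ξ => (W.ψ₀ ξ : ℂ) := hΨ ▸ Ψ.integrable
  rw [M₀, fourierInv_mul_fourierMeasure hint, ← hΨ, ← SchwartzMap.fourierInv_coe]
  have h3 : ∀ᵐ z ∂μ, ‖(𝓕⁻ Ψ : 𝓢(Plane, ℂ)) (x - z)‖ ≤ 16 * C * ((1 + ‖x‖) ^ 4)⁻¹ := by
    filter_upwards [hμ] with z hz
    have h4 : 1 + ‖x‖ ≤ 2 * (1 + ‖x - z‖) := by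
      have : ‖x‖ ≤ ‖x - z‖ + ‖z‖ := by simpa using norm_add_le (x - z) z
      linarith [norm_nonneg (x - z)]
    rw [← div_eq_mul_inv, le_div_iff₀ (by positivity), mul_comm]
    calc (1 + ‖x‖) ^ 4 * ‖(𝓕⁻ Ψ : 𝓢(Plane, ℂ)) (x - z)‖
        ≤ (2 * (1 + ‖x - z‖)) ^ 4 * ‖(𝓕⁻ Ψ : 𝓢(Plane, ℂ)) (x - z)‖ := by gcongr
      _ = 16 * ((1 + ‖x - z‖) ^ 4 * ‖(𝓕⁻ Ψ : 𝓢(Plane, ℂ)) (x - z)‖) := by ring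
      _ ≤ 16 * C := by gcongr; exact hC _
  simpa using norm_integral_le_of_norm_le_const h3

theorem integrable_M₀ (hμ : ∀ᵐ z ∂μ, ‖z‖ ≤ 1) : Integrable (W.M₀ μ) := by
  obtain ⟨C, -, hC⟩ := W.exists_norm_M₀_le μ hμ
  have h := (integrable_one_add_norm (E := Plane) (μ := volume) (r := 4) (by
    simp; norm_num)).const_mul C
  refine h.mono' (W.continuous_M₀ μ).aestronglyMeasurable (Eventually.of_forall fun x => ?_)
  refine (hC x).trans_eq ?_
  rw [Real.rpow_neg (by positivity)]
  norm_cast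

/-- The density of `d^y_* (M₀ μ)` decays, uniformly in the unit ball. -/
theorem exists_norm_radialDensity_M₀_le (hμ : ∀ᵐ z ∂μ, ‖z‖ ≤ 1) :
    ∃ C : ℝ, 0 ≤ C ∧ ∀ y r, ‖y‖ ≤ 1 → ‖radialDensity (W.M₀ μ) y r‖ ≤ C * (1 + r ^ 2)⁻¹ := by
  obtain ⟨C, hC0, hC⟩ := W.exists_norm_M₀_le μ hμ
  have hpi := Real.pi_pos
  refine ⟨2 * Real.pi * (16 * C), by positivity, fun y r hy => ?_⟩
  rcases le_or_gt r 0 with hr | hr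
  · rw [radialDensity, if_neg (not_lt.2 hr), norm_zero]; positivity
  have h1 : ∀ α, ‖W.M₀ μ (y + r • circlePoint α)‖ ≤ 16 * C * ((1 + r) ^ 4)⁻¹ := by
    intro α
    have h2 : 1 + r ≤ 2 * (1 + ‖y + r • circlePoint α‖) := by
      linarith [norm_smul_circlePoint_le hy hr.le α, norm_nonneg (y + r • circlePoint α)]
    refine (hC _).trans ?_
    rw [← div_eq_mul_inv, ← div_eq_mul_inv, div_le_div_iff₀ (by positivity) (by positivity)]
    calc C * (1 + r) ^ 4 ≤ C * (2 * (1 + ‖y + r • circlePoint α‖)) ^ 4 := by gcongr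
      _ = _ := by ring
  refine (norm_radialDensity_le hr.le h1).trans ?_
  have h3 : ((1 + r) ^ 4)⁻¹ * r ≤ (1 + r ^ 2)⁻¹ := by
    rw [← div_eq_inv_mul, div_le_iff₀ (by positivity), ← div_eq_inv_mul,
      le_div_iff₀ (by positivity)]
    nlinarith [pow_pos hr 2, pow_pos hr 3, pow_pos hr 4]
  calc _ = 2 * Real.pi * (16 * C) * (((1 + r) ^ 4)⁻¹ * r) := by ring
    _ ≤ _ := by gcongr

theorem goodPartialSum_integral (hμ : ∀ᵐ z ∂μ, ‖z‖ ≤ 1) (hn : 1 ≤ n) (φ : 𝓢(ℝ, ℂ)) (N : ℕ)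
    (y : Plane) :
    ∫ x, φ (dist x y) * W.goodPartialSum μ ν t N y x =
      (∫ r, φ r * radialDensity (W.M₀ μ) y r) +
        ∑ i ∈ Finset.range N, ∫ r, φ r * W.goodDensity μ ν t (i + 1) y r := by
  have hbdd : ∀ {F : Plane → ℂ}, Integrable F → Integrable fun x => φ (dist x y) * F x := by
    intro F hF
    have hφ := φ.continuous
    obtain ⟨C, -, hC⟩ := φ.decay 0 0
    refine hF.bdd_mul (c := C) (by fun_prop) (Eventually.of_forall fun x => ?_)
    simpa using hC (dist x y)
  have hi : ∀ i, 1 ≤ i + 1 := fun i => by omega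
  have hgi := fun i => hbdd (W.integrable_goodAt μ ν t hn (hi i)
    (cubeIndex (cubeExp n (m₀ + (i + 1)) 0) y))
  have hsum : ∀ x, W.goodPartialSum μ ν t N y x = W.M₀ μ x + ∑ i ∈ Finset.range N,
      W.goodAt μ ν t (i + 1) (cubeIndex (cubeExp n (m₀ + (i + 1)) 0) y) x := by
    intro x
    rw [goodPartialSum, Finset.range_eq_Ico, Finset.sum_Ico_add' (fun i =>
      W.goodAt μ ν t i (cubeIndex (cubeExp n (m₀ + i) 0) y) x) 0 N 1]
    rfl
  simp_rw [hsum, mul_add, Finset.mul_sum]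
  rw [integral_add (hbdd (W.integrable_M₀ μ hμ)) (integrable_finsetSum _ fun i _ => hgi i),
    integral_finsetSum _ fun i _ => hgi i,
    integral_comp_dist_mul (W.continuous_M₀ μ) (W.integrable_M₀ μ hμ)]
  congr 1
  refine Finset.sum_congr rfl fun i _ => ?_
  exact integral_comp_dist_mul (W.continuous_goodAt μ ν t (hi i) _)
    (W.integrable_goodAt μ ν t hn (hi i) _) φ y

theorem lintegral_tsum_goodDensity_sq_lt_top [IsProbabilityMeasure ν] (hμ : ∀ᵐ z ∂μ, ‖z‖ ≤ 1)
    (hν : ∀ᵐ y ∂ν, ‖y‖ ≤ 1) (hn : 5 ≤ n) {s : ℝ} (hs : 0 < s) (hμs : energy s μ < ⊤)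
    (hgain : 20 * (n + 1) * dlt n - min t 1 + 2 - s < 0) :
    ∫⁻ y, (∫⁻ r, (∑' i, ‖W.goodDensity μ ν t (i + 1) y r‖ₑ) ^ 2) ∂ν < ⊤ := by
  have hi : ∀ i, 1 ≤ i + 1 := fun i => by omega
  have hm := fun i => W.measurable_goodDensity μ ν t (hi i)
  obtain ⟨K, hK, q, hq0, hq1, hdec⟩ :=
    W.exists_lintegral_goodDensity_sq_le μ ν t hμ hν hn hs hμs hgain
  have hprod : ∀ i, ∫⁻ p : Plane × ℝ, ‖W.goodDensity μ ν t (i + 1) p.1 p.2‖ₑ ^ 2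
      ∂(ν.prod volume) = ∫⁻ y, (∫⁻ r, ‖W.goodDensity μ ν t (i + 1) y r‖ₑ ^ 2) ∂ν := fun i =>
    lintegral_prod _ ((hm i).enorm.pow_const 2).aemeasurable
  have key := lintegral_sq_tsum_lt_top (m := ν.prod volume)
    (h := fun i (p : Plane × ℝ) => ‖W.goodDensity μ ν t (i + 1) p.1 p.2‖ₑ)
    (fun i => (hm i).enorm) (fun i => by
      rw [hprod]; exact W.lintegral_goodDensity_sq_lt_top μ ν t hν (by omega) (hi i))
    hK hq0 hq1 (by
      filter_upwards [(tendsto_add_atTop_nat 1).eventually hdec] with i h1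
      rw [hprod]
      refine h1.trans (mul_le_mul_right (ENNReal.ofReal_le_ofReal ?_) K)
      exact pow_le_pow_of_le_one hq0.le hq1.le (by omega))
  have hSm : Measurable fun p : Plane × ℝ =>
      (∑' i, ‖W.goodDensity μ ν t (i + 1) p.1 p.2‖ₑ) ^ 2 :=
    (Measurable.tsum fun i => (hm i).enorm).pow_const 2
  rwa [lintegral_prod _ hSm.aemeasurable] at key

/-- The pushforward of the good part is square integrable as soon as
`20 (n + 1) δ < min (t, 1) + s - 2`. -/
theorem exists_pushforward_density [IsProbabilityMeasure ν] (hμ : ∀ᵐ z ∂μ, ‖z‖ ≤ 1)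
    (hν : ∀ᵐ y ∂ν, ‖y‖ ≤ 1) (hn : 5 ≤ n) {s : ℝ} (hs : 0 < s) (hμs : energy s μ < ⊤)
    (hgain : 20 * (n + 1) * dlt n - min t 1 + 2 - s < 0) :
    ∃ g : Plane → ℝ → ℂ, Measurable (Function.uncurry g) ∧
      (∀ᵐ y ∂ν, IsPushforwardDensity (fun N => W.goodPartialSum μ ν t N y) y (g y)) ∧
      ∫⁻ y, (eLpNorm (g y) 2 volume) ^ 2 ∂ν < ⊤ := by
  have hi : ∀ i, 1 ≤ i + 1 := fun i => by omega
  have hn1 : 1 ≤ n := by omega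
  obtain ⟨C, -, hC⟩ := W.exists_norm_radialDensity_M₀_le μ hμ
  have hm₀ := measurable_radialDensity (W.continuous_M₀ μ)
  have hm := fun i => W.measurable_goodDensity μ ν t (hi i)
  have hC' : ∀ᵐ y ∂ν, ∀ r, ‖radialDensity (W.M₀ μ) y r‖ ≤ C * (1 + r ^ 2)⁻¹ := by
    filter_upwards [hν] with y hy r using hC y r hy
  have hsupp : ∀ᵐ y ∂ν, ∀ i r, r ∉ Set.Ioc 0 (W.A + W.len + 2) →
      W.goodDensity μ ν t (i + 1) y r = 0 := by
    filter_upwards [hν] with y hy i r hr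
    by_cases h1 : 0 < r
    · exact W.goodDensity_eq_zero μ ν t hn1 (hi i) hy (not_le.1 fun h => hr ⟨h1, h⟩)
    · rw [goodDensity, radialDensity, if_neg h1]
  have hS2 := W.lintegral_tsum_goodDensity_sq_lt_top μ ν t hμ hν hn hs hμs hgain
  refine ⟨fun y r => radialDensity (W.M₀ μ) y r + ∑' i, W.goodDensity μ ν t (i + 1) y r,
    hm₀.add (Measurable.tsum hm), ?_, lintegral_eLpNorm_series_lt_top hm hC' hS2⟩
  filter_upwards [ae_tendsto_integral_series hm₀ hm hC' hsupp hS2] with y hy φ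
  refine (hy φ).congr fun N => ?_
  exact (W.goodPartialSum_integral μ ν t hμ hn1 φ N y).symm

end WavePackets

theorem tendsto_mul_dlt : Tendsto (fun n : ℕ => 20 * ((n : ℝ) + 1) * dlt n) atTop (𝓝 0) := by
  have h1 := tendsto_self_mul_const_pow_of_lt_one (r := (2 : ℝ)⁻¹) (by norm_num) (by norm_num)
  have h2 := tendsto_pow_atTop_nhds_zero_of_lt_one (r := (2 : ℝ)⁻¹) (by norm_num) (by norm_num)
  have h3 := (h1.add h2).const_mul 20
  simp only [add_zero, mul_zero] at h3
  refine h3.congr fun n => ?_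
  unfold dlt; ring

end PinnedDistance

end

open PinnedDistance
theorem proposition4p1 (s t : ℝ) (hs : 1 < s) (ht : 2 - s < t) :
    ∃ δ₀ : ℝ, 0 < δ₀ ∧ ∀ n : ℕ, dlt n ≤ δ₀ →
      ∀ (m₀ : ℕ) (W : WavePackets m₀ n) (μ ν : Measure Plane)
        [IsProbabilityMeasure μ] [IsProbabilityMeasure ν],
        μ.support ⊆ Metric.closedBall 0 1 → ν.support ⊆ Metric.closedBall 0 1 →
        Disjoint μ.support ν.support →
        energy s μ < ⊤ →
        IsFrostman t ν →
        upperMinkowskiDim ν.support < ((t + dlt n ^ 2 : ℝ) : EReal) →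
        ∃ g : Plane → ℝ → ℂ, Measurable (Function.uncurry g) ∧
          (∀ᵐ y ∂ν, IsPushforwardDensity (fun N => W.goodPartialSum μ ν t N y) y (g y)) ∧
          ∫⁻ y, (eLpNorm (g y) 2 volume) ^ 2 ∂ν < ⊤ := by
  have hgap : 0 < min t 1 + s - 2 := by
    rcases min_cases t 1 with ⟨h, -⟩ | ⟨h, -⟩ <;> rw [h] <;> linarith
  obtain ⟨N, hN⟩ := eventually_atTop.1
    ((tendsto_mul_dlt.eventually_lt_const hgap).and (eventually_ge_atTop 5))
  refine ⟨dlt N, dlt_pos N, fun n hn m₀ W μ ν _ _ hμ hν _ hμs _ _ => ?_⟩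
  have hNn : N ≤ n := (pow_le_pow_iff_right_of_lt_one₀ (by norm_num) (by norm_num)).1 hn
  obtain ⟨h1, h2⟩ := hN n hNn
  exact W.exists_pushforward_density μ ν t (ae_norm_le_of_support hμ) (ae_norm_le_of_support hν)
    h2 (by linarith) hμs (by linarith)
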